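/- **Setting.** Let $d\ge 3$. Let $e,\omega:\mathbb R^d\to[0,\infty)$ be even functions of class $C^{2d}$ with $|\nabla^\ell e(k)|\le C_1(1+\langle k\rangle^{2-\ell})$ and $|\nabla^\ell\omega(k)|\le C_2(1+\langle k\rangle^{2-\ell})$ for $0\le\ell\le 2d$, where $\langle k\rangle=(k^2+1)^{1/2}$. Put $\Phi_\pm(p,k)=e(k+p)\pm\omega(k)$ and assume that $\Phi_\pm(p,k)\to\infty$ as $k\to\infty$ and $0<C_3\le \mathrm{Hess}_k\Phi_\pm(p,k)\le C_4$ for all $p,k$. Let $\beta>0$, $\mu\in\mathbb R$ with $\inf_k\omega(k)-\mu\beta^{-1}\ge C_6>0$, and let $Q\in C^{2d}(\mathbb R^d)$ be real and even with $|\nabla^\ell Q(k)|\le C_7\langle k\rangle^{-2d-12}$ for $0\le \ell\le 2d$. Put $\mathcal N(k)=\frac{e^{-\beta\omega(k)+\mu}}{1-e^{-\beta\omega(k)+\mu}}$ and $M(k,\sigma)=|Q(k)|^2\big(\mathcal N(k)+\frac{\sigma+1}2\big)$, $\sigma=\pm1$. Let $\lambda\in\mathbb R$ and $t\ge 0$.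 The momentum lattice of the box of size $L$ is $\Lambda_L^*=(\sqrt{2\pi}L^{-1}\mathbb Z)^d$. Momentum integrals $\int dk$ mean $L^{-d}\sum_{k\in\Lambda_L^*}$ in the box, with $\delta(k)=L^d\mathbf 1(k=0)$, and $(2\pi)^{-d/2}$ times Lebesgue integration in infinite volume. The notation $\int_0^{t*}[ds_j]_0^N$ is integration over $s_0,\dots,s_N\ge0$ with $\sum_j s_j=t$. For $n\le N$ with $N-n$ even, $\mathcal M(n,N)$ is the set of $m=(m_0,\dots,m_n)$, $m_j\ge0$ integers, with $n+2\sum_jm_j=N$. Put $\mu(j)=j+2\sum_{i<j}m_i$, $I=\{\mu(1),\dots,\mu(n)\}$, $I_j=\{\mu(j)+1,\mu(j)+3,\dots,\mu(j)+2m_j-1\}$, $I_j^c=\{\mu(j),\mu(j)+2,\dots,\mu(j)+2m_j\}$, $J=\bigcup_j I_j$. **Pairings.** For $m,\tilde m\in\mathcal M(n,N)$ and a permutation $\pi$ of $\{1,\dots,n\}$ let $$C_{m,\tilde m,\pi}(t)=\lambda^{2N}\sum_{\sigma\in\{\pm1\}^n}\int \hat\gamma_e(p_n,p_n)\,dp_n\int\prod_{j=1}^nM(k_j,\sigma_j)\,dk_j\;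 A_m(p_n,k,\sigma)\,\overline{A_{\tilde m}(p_n,k\circ\pi^{-1},\sigma\circ\pi^{-1})},$$ $$A_m(p_n,k,\sigma)=\int_0^{t*}[ds_b]_0^N\prod_{j=0}^n\Big[\prod_{b\in I_j^c}e^{-is_b[e(p_j)+\Omega_j]}\prod_{b\in I_j}\Theta(s_b,p_j,\Omega_j)\Big],$$ $$p_j=p_n+\sum_{\ell>j}k_\ell,\quad \Omega_j=\sum_{\ell>j}\sigma_\ell\omega(k_\ell),\quad \Theta(s,p,\Omega)=\sum_{\sigma=\pm1}\int e^{-is[\Phi_\sigma(p,k)+\Omega]}M(k,\sigma)\,dk .$$ In infinite volume $\hat\gamma_e(p,p)\,dp$ stands for any probability measure on $\mathbb R^d$. In the box it is the momentum distribution of a density matrix $\gamma_e=\gamma_{e,L}$ (positive, trace one) on $L^2_{per}$, which may depend on $L$ in any way. **Expanded operator.** In the box let $c_k^\dagger,c_k$ be the creation and annihilation operators on the bosonic Fock space over $L^2_{per}$, with $[c_k,c_{k'}^\dagger]=\delta(k-k')$, let $b_k=c_k^\dagger-c_{-k}$, let $H_0=e(p)+\int\omega(k)c_k^\dagger c_k\,dk$,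 and let $$\mathcal E^0_{n,N}(t)=\sum_{m\in\mathcal M(n,N)}\lambda^N\int^{(m)}dk_1\cdots dk_N\int_0^{t*}[ds_j]_0^N\,e^{-is_0H_0}\prod_{j=1}^N\big(Q(k_j)\,b_{k_j}\,e^{-is_jH_0}\big),$$ where each factor $b_{k}$ also shifts the electron momentum by $k$, and $\int^{(m)}$ is restricted to $k_b+k_{b+1}=0$ for all $b\in J$ and $k_b+k_{b'}\ne0$ for all $b\neq b'$ in $I$. Let $\Gamma_0=\gamma_e\otimes\gamma_{ph}$ with the Gibbs state $\gamma_{ph}=Z^{-1}\exp\int[-\beta\omega(k)+\mu]c_k^\dagger c_k\,dk$. **Claim.** For every $0\le a<1$ there is a constant $C_a>0$, depending only on $a$, $d$, $\beta$ and the constants $C_1,C_2,C_3,C_4,C_6,C_7$, such that for all $e,\omega,Q,\mu,\lambda,t$ as above and all $n\le N$ with $N-n$ even, with $M:=(n+N)/2$: 1. For all $m,\tilde m\in\mathcal M(n,N)$ and every permutation $\pi$, $$|C_{m,\tilde m,\pi}(t)|\le\frac{(C_a\lambda^2t)^N}{[M!]^a}$$ for the infinite-volume value, and the same bound holds for $\limsup_{L\to\infty}|C_{m,\tilde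 m,\pi}(t)|$ of the values in the boxes. 2. The trace below is given by an absolutely convergent expansion over the occupation-number basis, and $$\limsup_{L\to\infty}\mathrm{Tr}\Big(\mathcal E^0_{n,N}(t)\,\Gamma_0\,[\mathcal E^0_{n,N}(t)]^*\Big)\le n!\,\frac{(C_a\lambda^2t)^N}{[M!]^a}.$$ This holds for the Gibbs state on the full Fock space whenever $Z<\infty$ for all large $L$. Without that condition (for example for constant $\omega$) it holds when, at each $L$, the trace is understood as the $\limsup$ along increasing finite sets $A\subset\Lambda_L^*$, $A\uparrow\Lambda_L^*$, of the traces with the Gibbs state of the phonon modes in $A$ (vacuum in the other modes). -/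

import Mathlib

open MeasureTheory Filter

noncomputable section

namespace Polaron

/-- Momentum space `ℝ^d`. -/
abbrev Mom (d : ℕ) := EuclideanSpace ℝ (Fin d)

/-- Labels of the points of the dual lattice `Λ* = (√(2π) L⁻¹ ℤ)^d`. -/
abbrev Mode (d : ℕ) := Fin d → ℤ

/-- The lattice momentum `√(2π) L⁻¹ m`. -/
def mom {d : ℕ} (L : ℝ) (m : Mode d) : Mom d :=
  WithLp.toLp 2 fun i => Real.sqrt (2 * Real.pi) / L * (m i : ℝ)

/-- `⟨k⟩ = (k² + 1)^{1/2}`. -/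
def bracket {d : ℕ} (k : Mom d) : ℝ := Real.sqrt (‖k‖ ^ 2 + 1)

/-- The data of the electron-phonon model: electron dispersion relation `e`, phonon dispersion
relation `ω`, form factor `Q`, inverse temperature `β`, chemical potential `chem`. -/
structure Model (d : ℕ) where
  e : Mom d → ℝ
  ω : Mom d → ℝ
  Q : Mom d → ℝ
  β : ℝ
  chem : ℝ

variable {d : ℕ}

/-- `Φ_σ(p, k) = e(k + p) + σ ω(k)`, `σ = ±1`. -/
def Model.Phi (S : Model d) (σ : ℤˣ) (p k : Mom d) : ℝ :=
  S.e (k + p) + ((σ : ℤ) : ℝ) * S.ω k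

/-- Standing assumptions on the dispersion relations, the form factor and the temperature, with
their quantifying constants. -/
structure Model.Admissible (S : Model d) (C₁ C₂ C₃ C₄ C₆ C₇ : ℝ) : Prop where
  e_nonneg : ∀ k, 0 ≤ S.e k
  ω_nonneg : ∀ k, 0 ≤ S.ω k
  e_even : ∀ k, S.e (-k) = S.e k
  ω_even : ∀ k, S.ω (-k) = S.ω k
  e_smooth : ContDiff ℝ (2 * d : ℕ) S.e
  ω_smooth : ContDiff ℝ (2 * d : ℕ) S.ω
  e_bound : ∀ l : ℕ, l ≤ 2 * d → ∀ k,
    ‖iteratedFDeriv ℝ l S.e k‖ ≤ C₁ * (1 + bracket k ^ (2 - (l : ℤ)))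
  ω_bound : ∀ l : ℕ, l ≤ 2 * d → ∀ k,
    ‖iteratedFDeriv ℝ l S.ω k‖ ≤ C₂ * (1 + bracket k ^ (2 - (l : ℤ)))
  Phi_tendsto : ∀ (σ : ℤˣ) (p : Mom d), Tendsto (S.Phi σ p) (cocompact (Mom d)) atTop
  C₃_pos : 0 < C₃
  hess_lower : ∀ (σ : ℤˣ) (p k v : Mom d),
    C₃ * ‖v‖ ^ 2 ≤ iteratedFDeriv ℝ 2 (S.Phi σ p) k ![v, v]
  hess_upper : ∀ (σ : ℤˣ) (p k v : Mom d),
    iteratedFDeriv ℝ 2 (S.Phi σ p) k ![v, v] ≤ C₄ * ‖v‖ ^ 2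
  β_pos : 0 < S.β
  C₆_pos : 0 < C₆
  gap : ∀ k, C₆ ≤ S.ω k - S.chem * S.β⁻¹
  Q_even : ∀ k, S.Q (-k) = S.Q k
  Q_smooth : ContDiff ℝ (2 * d : ℕ) S.Q
  Q_decay : ∀ l : ℕ, l ≤ 2 * d → ∀ k,
    ‖iteratedFDeriv ℝ l S.Q k‖ ≤ C₇ * bracket k ^ (-(2 * (d : ℤ)) - 12)

/-- Expected occupation number `𝒩(k)` of the mode `k` in the Gibbs state. -/
def Model.occ (S : Model d) (k : Mom d) : ℝ :=
  Real.exp (-S.β * S.ω k + S.chem) / (1 - Real.exp (-S.β * S.ω k + S.chem))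

/-- `M(k, σ) = |Q(k)|² (𝒩(k) + (σ + 1)/2)`. -/
def Model.M (S : Model d) (k : Mom d) (σ : ℤˣ) : ℝ :=
  S.Q k ^ 2 * (S.occ k + (((σ : ℤ) : ℝ) + 1) / 2)

/-! ### Collision histories -/

/-- The set `ℳ(n, N)` of the tuples `(m_0, …, m_n)` of nonnegative integers with
`n + 2 (m_0 + ⋯ + m_n) = N` (the condition forces `m_j ≤ N`). -/
def patterns (n N : ℕ) : Finset (Fin (n + 1) → ℕ) :=
  (Fintype.piFinset fun _ => Finset.range (N + 1)).filter fun m => n + 2 * ∑ j, m j = N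

/-- `μ(j) = j + 2 (m_0 + ⋯ + m_{j-1})`. -/
def muIdx {n : ℕ} (m : Fin (n + 1) → ℕ) (j : ℕ) : ℕ :=
  j + 2 * ∑ i with (i : Fin (n + 1)).val < j, m i

/-- `I_j = {μ(j) + 1, μ(j) + 3, …, μ(j) + 2 m_j - 1}`. -/
def setI {n : ℕ} (m : Fin (n + 1) → ℕ) (j : Fin (n + 1)) : Finset ℕ :=
  (Finset.range (m j)).image fun i => muIdx m j + 2 * i + 1

/-- `I_j^c = {μ(j), μ(j) + 2, …, μ(j) + 2 m_j}`. -/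
def setIc {n : ℕ} (m : Fin (n + 1) → ℕ) (j : Fin (n + 1)) : Finset ℕ :=
  (Finset.range (m j + 1)).image fun i => muIdx m j + 2 * i

/-- `I = {μ(1), …, μ(n)}`, the indices of the external phonons. -/
def extIdx {n : ℕ} (m : Fin (n + 1) → ℕ) : Finset ℕ :=
  Finset.univ.image fun j : Fin n => muIdx m (j.val + 1)

/-- `J = ⋃_j I_j`. -/
def intIdx {n : ℕ} (m : Fin (n + 1) → ℕ) : Finset ℕ :=
  Finset.univ.biUnion (setI m)

/-- The constraint `∫_0^{t*} [ds_j]_0^N`: Lebesgue integral over `s_1, …, s_N ≥ 0` with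
`s_0 = t - (s_1 + ⋯ + s_N) ≥ 0`. -/
def timeInt (t : ℝ) (N : ℕ) (F : (Fin (N + 1) → ℝ) → ℂ) : ℂ :=
  ∫ u in {u : Fin N → ℝ | (∀ j, 0 ≤ u j) ∧ ∑ j, u j ≤ t},
    F (Fin.cons (t - ∑ j, u j) u : Fin (N + 1) → ℝ)

/-! ### The values of the pairing graphs -/

/-- The momentum measure `dk` of the box of size `L`: `∫ F dk = L⁻ᵈ ∑_{k ∈ Λ*} F(k)`. -/
def latticeMeasure (d : ℕ) (L : ℝ) : Measure (Mom d) :=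
  ENNReal.ofReal ((L ^ d)⁻¹) • Measure.sum fun m : Mode d => Measure.dirac (mom L m)

/-- The momentum measure `dk` in infinite volume: Lebesgue measure divided by `(2π)^{d/2}`. -/
def fullMeasure (d : ℕ) : Measure (Mom d) :=
  ENNReal.ofReal (((2 * Real.pi) ^ ((d : ℝ) / 2))⁻¹) • volume

/-- `Θ(s, p, Ω) = ∑_σ ∫ exp(-i s [Φ_σ(p, k) + Ω]) M(k, σ) dk`, for the momentum measure `κ`. -/
def Model.Theta (S : Model d) (κ : Measure (Mom d)) (s : ℝ) (p : Mom d) (Ω : ℝ) : ℂ :=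
  ∑ σ : ℤˣ, ∫ k, Complex.exp (-Complex.I * ((s * (S.Phi σ p k + Ω) : ℝ) : ℂ)) *
    (S.M k σ : ℂ) ∂κ

/-- `p_j = p_n + k_{j+1} + ⋯ + k_n`; the phonon `k_{ℓ+1}` has label `ℓ : Fin n`. -/
def elMom {n : ℕ} (p : Mom d) (k : Fin n → Mom d) (j : Fin (n + 1)) : Mom d :=
  p + ∑ l with j.val ≤ (l : Fin n).val, k l

/-- `Ω_j = σ_{j+1} ω(k_{j+1}) + ⋯ + σ_n ω(k_n)`. -/
def Model.Omega {n : ℕ} (S : Model d) (k : Fin n → Mom d) (σ : Fin n → ℤˣ)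
    (j : Fin (n + 1)) : ℝ :=
  ∑ l with j.val ≤ (l : Fin n).val, (((σ l : ℤˣ) : ℤ) : ℝ) * S.ω (k l)

/-- One of the two time integrals in `Y`:
`∫_0^{t*} [ds_b]_0^N ∏_j (∏_{b ∈ I_j^c} exp(-i s_b [e(p_j) + Ω_j]) ∏_{b ∈ I_j} Θ(s_b, p_j, Ω_j))`. -/
def Model.halfY {n : ℕ} (S : Model d) (κ : Measure (Mom d)) (t : ℝ) (N : ℕ)
    (m : Fin (n + 1) → ℕ) (p : Mom d) (k : Fin n → Mom d) (σ : Fin n → ℤˣ) : ℂ :=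
  timeInt t N fun s => ∏ j : Fin (n + 1),
    ((∏ b : Fin (N + 1) with b.val ∈ setIc m j,
        Complex.exp (-Complex.I * ((s b * (S.e (elMom p k j) + S.Omega k σ j) : ℝ) : ℂ))) *
      ∏ b : Fin (N + 1) with b.val ∈ setI m j,
        S.Theta κ (s b) (elMom p k j) (S.Omega k σ j))

/-- `Y_{m,m̃,π}` on the support of the delta functions: `p̃_n = p_n`, `k̃_{π(j)} = k_j`, and the
signs of the tilde variables are `σ ∘ π⁻¹`. The tilde factor is the complex conjugate of the same
expression in the tilde variables. -/
def Model.Y {n : ℕ} (S : Model d) (κ : Measure (Mom d)) (t : ℝ) (N : ℕ)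
    (m mt : Fin (n + 1) → ℕ) (π : Equiv.Perm (Fin n)) (p : Mom d) (k : Fin n → Mom d)
    (σ : Fin n → ℤˣ) : ℂ :=
  S.halfY κ t N m p k σ *
    (starRingEnd ℂ) (S.halfY κ t N mt p (fun l => k (π.symm l)) (fun l => σ (π.symm l)))

/-- `C_{m,m̃,π}(t)`, for the phonon momentum measure `κ = dk` and the electron momentum
distribution `ρ(dp) = γ̂_e(p, p) dp`; the delta functions have been integrated out. -/
def Model.C {n : ℕ} (S : Model d) (κ ρ : Measure (Mom d)) (lam t : ℝ) (N : ℕ)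
    (m mt : Fin (n + 1) → ℕ) (π : Equiv.Perm (Fin n)) : ℂ :=
  (lam : ℂ) ^ (2 * N) * ∑ σ : Fin n → ℤˣ, ∫ p, ∫ k : Fin n → Mom d,
    ((∏ j, S.M (k j) (σ j) : ℝ) : ℂ) * S.Y κ t N m mt π p k σ
      ∂(Measure.pi fun _ => κ) ∂ρ

/-! ### Electron density matrices -/

/-- The electron state space `L²_per(Λ)` in momentum representation. -/
abbrev ElSpace (d : ℕ) := lp (fun _ : Mode d => ℂ) 2

/-- Matrix element of an electron operator between normalised plane waves. With the normalised
sums `∫ dp = L⁻ᵈ ∑_p` the kernel of the operator is `γ̂(p, q) = Lᵈ elMat γ p q`. -/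
def elMat (γ : ElSpace d →L[ℂ] ElSpace d) (p q : Mode d) : ℂ :=
  inner ℂ (lp.single 2 p (1 : ℂ) : ElSpace d) (γ (lp.single 2 q (1 : ℂ)))

/-- Density matrix: a positive operator of trace one. -/
def IsDensity (γ : ElSpace d →L[ℂ] ElSpace d) : Prop :=
  γ.IsPositive ∧ HasSum (fun p => elMat γ p p) 1

/-- The electron momentum distribution `γ̂_e(p, p) dp` in the box of size `L`. -/
def momDist (L : ℝ) (γ : ElSpace d →L[ℂ] ElSpace d) : Measure (Mom d) :=
  Measure.sum fun m : Mode d => ENNReal.ofReal (elMat γ m m).re • Measure.dirac (mom L m)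

/-! ### The electron-phonon system in the box of size `L` -/

/-- Occupation numbers: these label the orthonormal basis of the bosonic Fock space over
`L²_per(Λ)` whose elements are the normalised symmetrised products of plane waves. -/
abbrev Config (d : ℕ) := Mode d →₀ ℕ

/-- Labels of the orthonormal basis `|p⟩ ⊗ |ν⟩` of the total Hilbert space. -/
abbrev Label (d : ℕ) := Mode d × Config d

/-- Coefficient functions of the vectors of the total space in the basis `|p⟩ ⊗ |ν⟩`. -/
abbrev Wave (d : ℕ) := Label d → ℂ

/-- Annihilation operator `c_k`. It is `L^{d/2}` times the one of the normalised mode, so that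
`[c_k, c_{k'}^†] = δ(k - k')` with the lattice delta function, which is `Lᵈ` at the origin. -/
def annih (L : ℝ) (k : Mode d) (Ψ : Wave d) : Wave d := fun x =>
  ((L ^ ((d : ℝ) / 2) * Real.sqrt ((x.2 k : ℝ) + 1) : ℝ) : ℂ) * Ψ (x.1, x.2 + Finsupp.single k 1)

/-- Creation operator `c_k^†` (the coefficient vanishes when the mode `k` is empty). -/
def creat (L : ℝ) (k : Mode d) (Ψ : Wave d) : Wave d := fun x =>
  ((L ^ ((d : ℝ) / 2) * Real.sqrt (x.2 k : ℝ) : ℝ) : ℂ) * Ψ (x.1, x.2 - Finsupp.single k 1)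

/-- `b_k = c_k^† - c_{-k}`. -/
def bOp (L : ℝ) (k : Mode d) (Ψ : Wave d) : Wave d := fun x =>
  creat L k Ψ x - annih L (-k) Ψ x

/-- `Q(k) b_k` together with the change `p ↦ p + k` of the electron momentum (the labelling
`p_{j-1} = p_j + k_j`; the opposite sign amounts to the relabelling `k ↦ -k` of the phonon modes,
under which `Q` and `ω` are invariant). -/
def Model.vertex (S : Model d) (L : ℝ) (k : Mode d) (Ψ : Wave d) : Wave d := fun x =>
  (S.Q (mom L k) : ℂ) * bOp L k Ψ (x.1 - k, x.2)

/-- Phonon energy `∑_k ω(k) ν_k`. -/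
def Model.phEnergy (S : Model d) (L : ℝ) (ν : Config d) : ℝ :=
  ν.sum fun k c => S.ω (mom L k) * (c : ℝ)

/-- Free evolution `exp(-i s H_0)`, `H_0 = H_e + H_ph`. -/
def Model.free (S : Model d) (L s : ℝ) (Ψ : Wave d) : Wave d := fun x =>
  Complex.exp (-Complex.I * ((s * (S.e (mom L x.1) + S.phEnergy L x.2) : ℝ) : ℂ)) * Ψ x

/-- `exp(-i s_0 H_0) ∏_{j=1}^N (Q(k_j) b_{k_j} exp(-i s_j H_0))`. -/
def Model.chain (S : Model d) (L : ℝ) :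
    (N : ℕ) → (Fin N → Mode d) → (Fin (N + 1) → ℝ) → Wave d → Wave d
  | 0, _, s, Ψ => S.free L (s 0) Ψ
  | N + 1, k, s, Ψ =>
      S.free L (s 0) (S.vertex L (k 0) (S.chain L N (Fin.tail k) (Fin.tail s) Ψ))

/-- `ℬ(t, k, N)`. -/
def Model.B (S : Model d) (L lam t : ℝ) (N : ℕ) (k : Fin N → Mode d) (Ψ : Wave d) : Wave d :=
  fun x => (lam : ℂ) ^ N * timeInt t N fun s => S.chain L N k s Ψ x

/-- The restriction in `∫^{(m)} dk`: `k_b + k_{b+1} = 0` for all `b ∈ J(m)`, and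
`k_b + k_{b'} ≠ 0` for all `b ≠ b'` in `I(m)`. The phonon `k_{b+1}` has label `b : Fin N`. -/
def Allowed {n N : ℕ} (m : Fin (n + 1) → ℕ) (k : Fin N → Mode d) : Prop :=
  (∀ b c : Fin N, b.val + 1 ∈ intIdx m → c.val = b.val + 1 → k b + k c = 0) ∧
  (∀ b c : Fin N, b ≠ c → b.val + 1 ∈ extIdx m → c.val + 1 ∈ extIdx m → k b + k c ≠ 0)

open Classical in
/-- The fully expanded operator without genuine recollisions
`ℰ⁰_{n,N}(t) = ∑_{m ∈ ℳ(n,N)} ∫^{(m)} dk ℬ(t, k, N)`. -/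
def Model.E0 (S : Model d) (L lam t : ℝ) (n N : ℕ) (Ψ : Wave d) : Wave d := fun x =>
  ∑ m ∈ patterns n N, (((L ^ d)⁻¹ ^ N : ℝ) : ℂ) *
    ∑' k : Fin N → Mode d, if Allowed m k then S.B L lam t N k Ψ x else 0

open Classical in
/-- Matrix elements `⟨x| ℰ⁰_{n,N}(t) |y⟩`. -/
def Model.E0Mat (S : Model d) (L lam t : ℝ) (n N : ℕ) (x y : Label d) : ℂ :=
  S.E0 L lam t n N (fun z => if z = y then 1 else 0) x

open Classical in
/-- Eigenvalue of `exp(-β H_ph + chem ∫ N_k dk)` at `|ν⟩`, with the phonons confined to the set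
`A` of modes (`A = Set.univ` is the full Fock space). -/
def Model.boltz (S : Model d) (L : ℝ) (A : Set (Mode d)) (ν : Config d) : ℝ :=
  if (ν.support : Set (Mode d)) ⊆ A then
    Real.exp (ν.sum fun k c => (-S.β * S.ω (mom L k) + S.chem) * (c : ℝ))
  else 0

/-- Eigenvalue of the Gibbs state `γ_ph` of the modes in `A` at `|ν⟩`. -/
def Model.gibbs (S : Model d) (L : ℝ) (A : Set (Mode d)) (ν : Config d) : ℝ :=
  S.boltz L A ν / ∑' ν', S.boltz L A ν'

open Classical in
/-- Matrix elements of `Γ_0 = γ_e ⊗ γ_ph`. -/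
def Model.Gamma0 (S : Model d) (L : ℝ) (A : Set (Mode d)) (γ : ElSpace d →L[ℂ] ElSpace d)
    (y z : Label d) : ℂ :=
  elMat γ y.1 z.1 * if y.2 = z.2 then (S.gibbs L A y.2 : ℂ) else 0

/-- The terms `E_{xy} Γ_{yz} \overline{E_{xz}}` of `Tr(E Γ_0 E*)`, `E = ℰ⁰_{n,N}(t)`. -/
def Model.trTerm (S : Model d) (L : ℝ) (A : Set (Mode d)) (γ : ElSpace d →L[ℂ] ElSpace d)
    (lam t : ℝ) (n N : ℕ) (w : Label d × Label d × Label d) : ℂ :=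
  S.E0Mat L lam t n N w.1 w.2.1 * S.Gamma0 L A γ w.2.1 w.2.2 *
    (starRingEnd ℂ) (S.E0Mat L lam t n N w.1 w.2.2)

/-- `Tr_{e+ph}(ℰ⁰_{n,N}(t) Γ_0 [ℰ⁰_{n,N}(t)]*)`. -/
def Model.tr (S : Model d) (L : ℝ) (A : Set (Mode d)) (γ : ElSpace d →L[ℂ] ElSpace d)
    (lam t : ℝ) (n N : ℕ) : ℝ :=
  (∑' w, S.trTerm L A γ lam t n N w).re

/-- The right-hand side `(C λ² t)^N / [M!]^a`, `M = (n + N)/2`. -/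
def aprioriBound (C a lam t : ℝ) (n N : ℕ) : ℝ :=
  (C * lam ^ 2 * t) ^ N / (((n + N) / 2).factorial : ℝ) ^ a

end Polaron

end

/-! Each vertex of a collision history is paid for by a dispersive bound that is integrable in time
and uniform in the electron momentum. Since every external phonon and every recollision still
carries one ordered time integration, a history gains the factorial of `M = n + r`, where `r` is the
number of immediate recollisions and `N = n + 2 r`.

Dispersive bound. The sum `∫ exp(-iτΦ) M dk` is squared and rearranged by the difference `h` of the
two momenta (`norm_tsum_sq_le`). The phase becomes `Φ(x+h) - Φ(x)`, and convexity makes its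
derivative in the direction of `h` at least `C₃ |h|`. Three integrations by parts along `h` give the
factor `(1+|τ||h|)^{-3}` (`exists_pairOsc_integral_bound`). Integrating over `h` in dimension at
least three leaves `(1+|τ|)^{-5/2}` (`exists_singular_integral_bound`), so the sum itself is
`O((1+|τ|)^{-5/4})`, which is integrable in `τ`. The argument runs on the lattice, where comparing
sums with integrals costs an error that is negligible for bounded times and large boxes. The
infinite-volume bound is the limit of the lattice bounds (`exists_dispersive`).

Pairings. An amplitude is an iterated convolution in time along its pattern (`Pat.timeInt_patProd`).
Cauchy-Schwarz between the two halves of a pairing reduces everything to the mean square of one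
amplitude over the external phonons, so the permutation plays no role (`norm_C_le`). This mean
square obeys a recursion. Integrating out the outermost external phonon and applying the Schur test
bounds it by a time integral of the mean square of the shorter pattern (`lintegral_vertex_le`). A
recollision costs one further factor `t` (`enorm_recollision_le`). After `n + r` steps this gives
`t^N / M!` (`avg_le`), which is stronger than the claim because `M! ≥ [M!]^a`.

Trace. In the occupation-number basis the operator is a sum over words of emissions and absorptions.
Total momentum is conserved and `Γ_0` is diagonal in the occupation numbers, so only the diagonal of
the electron state enters (`trace_le`). Words with an accidental coincidence of momentum classes are
degenerate. A degenerate word and a partner with the same net occupation change use at most `N - 1`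
classes between them (`Degenerate.card_classes`), so against the prefactor `L^{-dN}` their
contribution is `O(L^{-d})`. In the remaining words each event sees the initial occupation numbers,
and the matrix element factorises (`Pat.pathWeight_expand`). At most `n!` external words produce a
given transition (`exists_finset_of_net`), which is the source of `n!` after Cauchy-Schwarz.
Independence of the modes in the Gibbs state then replaces the random weights by their means, again
up to coincidences of order `L^{-d}` (`tsum_gib_coefSum_le`). What is left is the lattice mean
square of the pairing part (`avg_eq_wordAvg`). Cauchy-Schwarz over the patterns and the split into
good and bad words only cost a constant to the power `N`. For phonons confined to a finite set of
modes the mean weights converge dominatedly to the full ones. -/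

noncomputable section

namespace Polaron

/-! ### Calculus of weighted bounds on directional derivatives. -/

variable {E : Type*} [NormedAddCommGroup E] [NormedSpace ℝ E]

theorem hasLineDerivAt_mul {f g : E → ℝ} {f' g' : ℝ} {x u : E} (hf : HasLineDerivAt ℝ f f' x u)
    (hg : HasLineDerivAt ℝ g g' x u) :
    HasLineDerivAt ℝ (fun y => f y * g y) (f' * g x + f x * g') x u := by
  have := HasDerivAt.mul (show HasDerivAt (fun t : ℝ => f (x + t • u)) f' 0 from hf)
    (show HasDerivAt (fun t : ℝ => g (x + t • u)) g' 0 from hg)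
  simpa [HasLineDerivAt] using! this

theorem hasLineDerivAt_add {f g : E → ℝ} {f' g' : ℝ} {x u : E} (hf : HasLineDerivAt ℝ f f' x u)
    (hg : HasLineDerivAt ℝ g g' x u) :
    HasLineDerivAt ℝ (fun y => f y + g y) (f' + g') x u :=
  HasDerivAt.add (show HasDerivAt (fun t : ℝ => f (x + t • u)) f' 0 from hf)
    (show HasDerivAt (fun t : ℝ => g (x + t • u)) g' 0 from hg)

theorem hasLineDerivAt_comp {f : E → ℝ} {f' F' : ℝ} {F : ℝ → ℝ} {x u : E}
    (hf : HasLineDerivAt ℝ f f' x u) (hF : HasDerivAt F F' (f x)) :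
    HasLineDerivAt ℝ (fun y => F (f y)) (F' * f') x u := by
  have h1 : HasDerivAt (fun t : ℝ => f (x + t • u)) f' 0 := hf
  exact HasDerivAt.comp (0 : ℝ) (h₂ := F) (by simpa using hF) h1

theorem hasLineDerivAt_comp_add {f : E → ℝ} {f' : ℝ} {x u : E} (h : E)
    (hf : HasLineDerivAt ℝ f f' (x + h) u) :
    HasLineDerivAt ℝ (fun y => f (y + h)) f' x u := by
  have h1 : HasDerivAt (fun t : ℝ => f (x + h + t • u)) f' 0 := hf
  have : (fun t : ℝ => f (x + h + t • u)) = fun t : ℝ => f (x + t • u + h) := by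
    funext t; congr 1; abel
  rw [this] at h1
  exact h1

/-- `f` is continuous and `f`, as well as its first `j` derivatives in the direction `u`, are
bounded by `K * w`. -/
def DerivBound (u : E) (w : E → ℝ) : ℕ → ℝ → (E → ℝ) → Prop
  | 0, K, f => Continuous f ∧ ∀ x, |f x| ≤ K * w x
  | j + 1, K, f => (Continuous f ∧ ∀ x, |f x| ≤ K * w x) ∧
      ∃ f' : E → ℝ, (∀ x, HasLineDerivAt ℝ f (f' x) x u) ∧ DerivBound u w j K f'

namespace DerivBound

variable {u : E} {w w₁ w₂ : E → ℝ} {j : ℕ} {K K₁ K₂ : ℝ} {f g : E → ℝ}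

theorem base (h : DerivBound u w j K f) : Continuous f ∧ ∀ x, |f x| ≤ K * w x := by
  cases j with
  | zero => exact h
  | succ j => exact h.1

theorem mono (h : DerivBound u w₁ j K₁ f) (hK : ∀ x, K₁ * w₁ x ≤ K₂ * w₂ x) :
    DerivBound u w₂ j K₂ f := by
  induction j generalizing f with
  | zero => exact ⟨h.1, fun x => (h.2 x).trans (hK x)⟩
  | succ j ih =>
    obtain ⟨h0, f', hf', h1⟩ := h
    exact ⟨⟨h0.1, fun x => (h0.2 x).trans (hK x)⟩, f', hf', ih h1⟩

theorem of_succ (h : DerivBound u w (j + 1) K f) : DerivBound u w j K f := by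
  induction j generalizing f with
  | zero => exact h.1
  | succ j ih =>
    obtain ⟨h0, f', hf', h1⟩ := h
    exact ⟨h0, f', hf', ih h1⟩

theorem add (hf : DerivBound u w j K₁ f) (hg : DerivBound u w j K₂ g) :
    DerivBound u w j (K₁ + K₂) (fun x => f x + g x) := by
  have key : ∀ {f g : E → ℝ}, (Continuous f ∧ ∀ x, |f x| ≤ K₁ * w x) →
      (Continuous g ∧ ∀ x, |g x| ≤ K₂ * w x) →
      (Continuous (fun x => f x + g x) ∧ ∀ x, |f x + g x| ≤ (K₁ + K₂) * w x) := by
    intro f g hf hg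
    refine ⟨hf.1.add hg.1, fun x => ?_⟩
    calc |f x + g x| ≤ |f x| + |g x| := abs_add_le _ _
      _ ≤ K₁ * w x + K₂ * w x := add_le_add (hf.2 x) (hg.2 x)
      _ = _ := by ring
  induction j generalizing f g with
  | zero => exact key hf hg
  | succ j ih =>
    obtain ⟨h0, f', hf', h1⟩ := hf
    obtain ⟨k0, g', hg', k1⟩ := hg
    exact ⟨key h0 k0, _, fun x => hasLineDerivAt_add (hf' x) (hg' x), ih h1 k1⟩

/-- The Leibniz rule doubles the number of terms with every derivative, which accounts for the
factor `2 ^ j`. Keeping separate weights lets the decay of one factor absorb the growth of the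
other. -/
theorem mul (hf : DerivBound u w₁ j K₁ f) (hg : DerivBound u w₂ j K₂ g) :
    DerivBound u (fun x => w₁ x * w₂ x) j (2 ^ j * (K₁ * K₂)) (fun x => f x * g x) := by
  have key : ∀ {f g : E → ℝ}, (Continuous f ∧ ∀ x, |f x| ≤ K₁ * w₁ x) →
      (Continuous g ∧ ∀ x, |g x| ≤ K₂ * w₂ x) →
      (Continuous (fun x => f x * g x) ∧ ∀ x, |f x * g x| ≤ (K₁ * K₂) * (w₁ x * w₂ x)) := by
    intro f g hf hg
    refine ⟨hf.1.mul hg.1, fun x => ?_⟩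
    calc |f x * g x| = |f x| * |g x| := abs_mul _ _
      _ ≤ (K₁ * w₁ x) * (K₂ * w₂ x) :=
        mul_le_mul (hf.2 x) (hg.2 x) (abs_nonneg _) ((abs_nonneg _).trans (hf.2 x))
      _ = _ := by ring
  induction j generalizing f g with
  | zero =>
    have := key hf hg
    rw [pow_zero, one_mul]
    exact this
  | succ j ih =>
    obtain ⟨h0, f', hf', h1⟩ := id hf
    obtain ⟨k0, g', hg', k1⟩ := id hg
    have hnn : ∀ x, 0 ≤ (K₁ * K₂) * (w₁ x * w₂ x) := fun x =>
      (abs_nonneg _).trans ((key h0 k0).2 x)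
    refine ⟨⟨(key h0 k0).1, fun x => ((key h0 k0).2 x).trans ?_⟩, _,
      fun x => hasLineDerivAt_mul (hf' x) (hg' x), ?_⟩
    · have : (1 : ℝ) ≤ 2 ^ (j + 1) := one_le_pow₀ (by norm_num)
      nlinarith [hnn x]
    · have := add (ih h1 (of_succ hg)) (ih (of_succ hf) k1)
      refine this.mono fun x => le_of_eq ?_
      ring

theorem comp_add (hf : DerivBound u w j K f) (h : E) :
    DerivBound u (fun x => w (x + h)) j K (fun x => f (x + h)) := by
  induction j generalizing f with
  | zero => exact ⟨hf.1.comp (continuous_add_const h), fun x => hf.2 _⟩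
  | succ j ih =>
    obtain ⟨h0, f', hf', h1⟩ := hf
    exact ⟨⟨h0.1.comp (continuous_add_const h), fun x => h0.2 _⟩, _,
      fun x => hasLineDerivAt_comp_add h (hf' _), ih h1⟩

theorem const (u : E) (j : ℕ) (c : ℝ) : DerivBound u (fun _ => 1) j |c| (fun _ => c) := by
  have key : Continuous (fun _ : E => c) ∧ ∀ x : E, |c| ≤ |c| * 1 :=
    ⟨continuous_const, fun x => by simp⟩
  -- The derivatives vanish, but have to be bounded with the same constant `|c|` as the function
  -- itself.
  have zero : ∀ i, DerivBound u (fun _ => 1) i |c| (fun _ => 0) := by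
    intro i
    induction i with
    | zero => exact ⟨continuous_const, fun x => by simp⟩
    | succ i ih => exact ⟨⟨continuous_const, fun x => by simp⟩, fun _ => 0,
        fun x => by simpa [HasLineDerivAt] using hasDerivAt_const (0 : ℝ) (0 : ℝ), ih⟩
  cases j with
  | zero => exact key
  | succ j => exact ⟨key, fun _ => 0,
      fun x => by simpa [HasLineDerivAt] using hasDerivAt_const (0 : ℝ) c, zero j⟩

theorem const_mul (hf : DerivBound u w j K f) (c : ℝ) :
    DerivBound u w j (|c| * K) (fun x => c * f x) := by
  induction j generalizing f with
  | zero =>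
    refine ⟨continuous_const.mul hf.1, fun x => ?_⟩
    rw [abs_mul, mul_assoc]; exact mul_le_mul_of_nonneg_left (hf.2 x) (abs_nonneg _)
  | succ j ih =>
    obtain ⟨h0, f', hf', h1⟩ := hf
    refine ⟨⟨continuous_const.mul h0.1, fun x => ?_⟩, _, fun x => ?_, ih h1⟩
    · rw [abs_mul, mul_assoc]; exact mul_le_mul_of_nonneg_left (h0.2 x) (abs_nonneg _)
    · exact HasDerivAt.const_mul c (hf' x)

theorem _root_.Polaron.hasLineDerivAt_iteratedFDeriv {n : ℕ} (hf : ContDiff ℝ n f) {i : ℕ}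
    (hi : i < n) (x u : E) :
    HasLineDerivAt ℝ (fun x => iteratedFDeriv ℝ i f x (fun _ => u))
      (iteratedFDeriv ℝ (i + 1) f x (fun _ => u)) x u := by
  have hd : DifferentiableAt ℝ (iteratedFDeriv ℝ i f) x :=
    (hf.differentiable_iteratedFDeriv (m := i) (by exact_mod_cast hi)) x
  exact ((ContinuousMultilinearMap.apply ℝ (fun _ : Fin i => E) ℝ
    (fun _ => u)).hasFDerivAt.comp x hd.hasFDerivAt).hasLineDerivAt u

/-- Directional derivatives of a function with bounded iterated Fréchet derivatives. -/
theorem of_iteratedFDeriv_aux {n : ℕ} (hf : ContDiff ℝ n f) (hu : ‖u‖ = 1) (i j : ℕ)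
    (hij : i + j ≤ n)
    (hb : ∀ l, i ≤ l → l ≤ i + j → ∀ x, ‖iteratedFDeriv ℝ l f x‖ ≤ K * w x) :
    DerivBound u w j K (fun x => iteratedFDeriv ℝ i f x (fun _ => u)) := by
  have key : ∀ i ≤ n, (∀ x, ‖iteratedFDeriv ℝ i f x‖ ≤ K * w x) →
      Continuous (fun x => iteratedFDeriv ℝ i f x (fun _ => u)) ∧
        ∀ x, |iteratedFDeriv ℝ i f x (fun _ => u)| ≤ K * w x := by
    intro i hi hb
    constructor
    · have := hf.continuous_iteratedFDeriv (m := i) (by exact_mod_cast hi)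
      exact (ContinuousMultilinearMap.apply ℝ (fun _ : Fin i => E) ℝ (fun _ => u)).continuous.comp
        this
    · intro x
      refine ((iteratedFDeriv ℝ i f x).le_opNorm _).trans ?_
      simpa [hu] using hb x
  induction j generalizing i with
  | zero => exact key i (by omega) (hb i le_rfl (by omega))
  | succ j ih =>
    refine ⟨key i (by omega) (hb i le_rfl (by omega)),
      fun x => iteratedFDeriv ℝ (i + 1) f x (fun _ => u),
      fun x => hasLineDerivAt_iteratedFDeriv hf (by omega) x u,
      ih (i + 1) (by omega) fun l hl hl' => hb l (by omega) (by omega)⟩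

theorem of_iteratedFDeriv {n : ℕ} (hf : ContDiff ℝ n f) (hu : ‖u‖ = 1) (hj : j ≤ n)
    (hb : ∀ l, l ≤ j → ∀ x, ‖iteratedFDeriv ℝ l f x‖ ≤ K * w x) : DerivBound u w j K f := by
  have := of_iteratedFDeriv_aux (w := w) (K := K) hf hu 0 j (by omega)
    (fun l _ hl => hb l (by omega))
  simpa using this

/-- The reciprocal of a function bounded below. -/
theorem inv_exists (c K : ℝ) (hc : 0 < c) (hK : 0 ≤ K) (j : ℕ) : ∃ B : ℝ, 0 ≤ B ∧
    ∀ (u : E) (V V' : E → ℝ), Continuous V → (∀ x, c ≤ V x) →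
      (∀ x, HasLineDerivAt ℝ V (V' x) x u) →
      DerivBound u (fun _ => 1) (j - 1) K V' → DerivBound u (fun _ => 1) j B fun x => (V x)⁻¹ := by
  have key : ∀ B : ℝ, c⁻¹ ≤ B → ∀ V : E → ℝ, Continuous V → (∀ x, c ≤ V x) →
      (Continuous (fun x => (V x)⁻¹) ∧ ∀ x, |(V x)⁻¹| ≤ B * 1) := by
    intro B hB V hV hc'
    refine ⟨hV.inv₀ fun x => (hc.trans_le (hc' x)).ne', fun x => ?_⟩
    have h1 := hc.trans_le (hc' x)
    rw [abs_of_pos (inv_pos.mpr h1), mul_one]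
    exact (inv_anti₀ hc (hc' x)).trans hB
  induction j with
  | zero => exact ⟨c⁻¹, by positivity, fun u V V' hV hc' hd hb => key _ le_rfl V hV hc'⟩
  | succ j ih =>
    obtain ⟨B, hB0, hB⟩ := ih
    -- From `(1/V)' = -V' · (1/V) · (1/V)`: two applications of the product rule at order `j` give
    -- the two factors `2 ^ j`, and `c⁻¹` bounds the function itself.
    refine ⟨c⁻¹ + 2 ^ j * (K * (2 ^ j * (B * B))), by positivity,
      fun u V V' hV hc' hd hb => ?_⟩
    have hb' : DerivBound u (fun _ => 1) j K V' := hb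
    have hj : DerivBound u (fun _ => 1) j B fun x => (V x)⁻¹ := by
      apply hB u V V' hV hc' hd
      cases j with
      | zero => exact hb'
      | succ j => exact hb'.of_succ
    have hpos : 0 ≤ 2 ^ j * (K * (2 ^ j * (B * B))) := by positivity
    refine ⟨key _ (by linarith) V hV hc', fun x => (-1) * (V' x * ((V x)⁻¹ * (V x)⁻¹)),
      fun x => ?_, ?_⟩
    · have h1 := hc.trans_le (hc' x)
      have := hasLineDerivAt_comp (hd x) (hasDerivAt_inv h1.ne')
      convert! this using 1
      field_simp
    · refine ((hb'.mul (hj.mul hj)).const_mul (-1)).mono fun x => ?_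
      have : (0 : ℝ) < c⁻¹ := inv_pos.mpr hc
      simp only [abs_neg, abs_one, mul_one, one_mul]
      linarith

end DerivBound

end Polaron
end


/-! ### Oscillatory integrals and difference quotients. -/

noncomputable section

set_option linter.unusedSectionVars false

namespace Polaron

section Oscillatory

variable {E : Type*} [NormedAddCommGroup E] [NormedSpace ℝ E] 

theorem hasLineDerivAt_cexp {ψ : E → ℝ} {ψ' : ℝ} {x u : E} (τ : ℝ)
    (h : HasLineDerivAt ℝ ψ ψ' x u) :
    HasLineDerivAt ℝ (fun y => Complex.exp (-Complex.I * ((τ * ψ y : ℝ) : ℂ)))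
      (-Complex.I * ((τ * ψ' : ℝ) : ℂ) * Complex.exp (-Complex.I * ((τ * ψ x : ℝ) : ℂ))) x u := by
  have h1 : HasDerivAt (fun t : ℝ => τ * ψ (x + t • u)) (τ * ψ') 0 :=
    HasDerivAt.const_mul τ h
  have h2 := ((h1.ofReal_comp).const_mul (-Complex.I)).cexp
  simp only [zero_smul, add_zero] at h2
  rw [mul_comm] at h2
  exact h2

theorem norm_cexp_I (x : ℝ) : ‖Complex.exp (-Complex.I * (x : ℂ))‖ = 1 := by
  have : -Complex.I * (x : ℂ) = ((-x : ℝ) : ℂ) * Complex.I := by push_cast; ring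
  rw [this, Complex.norm_exp_ofReal_mul_I]

variable [MeasurableSpace E] [BorelSpace E] [FiniteDimensional ℝ E]
  {μ : Measure E} [μ.IsAddHaarMeasure] {u : E} {w : E → ℝ}

theorem DerivBound.integrable {j : ℕ} {K : ℝ} {a : E → ℝ} (ha : DerivBound u w j K a)
    (hw : Integrable w μ) : Integrable a μ := by
  refine (hw.const_mul K).mono' ha.base.1.aestronglyMeasurable ?_
  exact Eventually.of_forall fun x => by simpa using ha.base.2 x

theorem integrable_cexp_mul {ψ : E → ℝ} {a : E → ℝ} (hψ : Continuous ψ) (ha : Integrable a μ)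
    (τ : ℝ) :
    Integrable (fun x => Complex.exp (-Complex.I * ((τ * ψ x : ℝ) : ℂ)) * (a x : ℂ)) μ := by
  refine ha.ofReal.bdd_mul (c := 1) (Continuous.aestronglyMeasurable (by fun_prop)) ?_
  exact Eventually.of_forall fun x => (norm_cexp_I _).le

theorem norm_integral_cexp_mul_le {ψ : E → ℝ} {a : E → ℝ} {K : ℝ}
    (ha : ∀ x, |a x| ≤ K * w x) (hw : Integrable w μ) (τ : ℝ) :
    ‖∫ x, Complex.exp (-Complex.I * ((τ * ψ x : ℝ) : ℂ)) * (a x : ℂ) ∂μ‖ ≤ K * ∫ x, w x ∂μ := by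
  rw [← integral_const_mul]
  refine norm_integral_le_of_norm_le (hw.const_mul K) (Eventually.of_forall fun x => ?_)
  rw [norm_mul, norm_cexp_I, one_mul, Complex.norm_real]
  exact ha x

/-- One integration by parts in an oscillatory integral, in the direction `u`. -/
theorem oscillatory_step {j : ℕ} {K B H τ : ℝ} {ψ V a : E → ℝ}
    (hψ : Continuous ψ) (hV : ∀ x, V x ≠ 0) (hH : 0 < H) (hτ : τ ≠ 0)
    (hψV : ∀ x, HasLineDerivAt ℝ ψ (H * V x) x u)
    (ha : DerivBound u w (j + 1) K a) (hb : DerivBound u (fun _ => 1) (j + 1) B fun x => (V x)⁻¹)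
    (hw : Integrable w μ) :
    ∃ a' : E → ℝ, DerivBound u w j (2 ^ (j + 1) * (K * B)) a' ∧
      ‖∫ x, Complex.exp (-Complex.I * ((τ * ψ x : ℝ) : ℂ)) * (a x : ℂ) ∂μ‖ ≤
        (|τ| * H)⁻¹ * ‖∫ x, Complex.exp (-Complex.I * ((τ * ψ x : ℝ) : ℂ)) * (a' x : ℂ) ∂μ‖ := by
  have hab : DerivBound u w (j + 1) (2 ^ (j + 1) * (K * B)) fun x => a x * (V x)⁻¹ :=
    (ha.mul hb).mono fun x => by simp
  obtain ⟨h0, a', ha', h1⟩ := id hab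
  refine ⟨a', h1, ?_⟩
  have hint := ha.integrable hw
  -- Differentiating the exponential and multiplying by `a / V` reproduces the original integrand
  -- times `-iτH`. Moving the derivative onto `a / V` therefore gains `(|τ| H)⁻¹`.
  have hF : ∀ x, -Complex.I * ((τ * (H * V x) : ℝ) : ℂ) *
      Complex.exp (-Complex.I * ((τ * ψ x : ℝ) : ℂ)) * ((a x * (V x)⁻¹ : ℝ) : ℂ) =
      (-Complex.I * ((τ * H : ℝ) : ℂ)) *
        (Complex.exp (-Complex.I * ((τ * ψ x : ℝ) : ℂ)) * (a x : ℂ)) := by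
    intro x
    have : (V x : ℂ) ≠ 0 := by exact_mod_cast hV x
    push_cast
    field_simp
  have key := integral_bilinear_hasLineDerivAt_right_eq_neg_left_of_integrable (μ := μ) (v := u)
    (f := fun x => Complex.exp (-Complex.I * ((τ * ψ x : ℝ) : ℂ)))
    (f' := fun x => -Complex.I * ((τ * (H * V x) : ℝ) : ℂ) *
      Complex.exp (-Complex.I * ((τ * ψ x : ℝ) : ℂ)))
    (g := fun x => ((a x * (V x)⁻¹ : ℝ) : ℂ)) (g' := fun x => ((a' x : ℝ) : ℂ))
    (B := ContinuousLinearMap.mul ℝ ℂ) ?_ ?_ ?_ ?_ ?_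
  · simp only [ContinuousLinearMap.mul_apply'] at key
    simp_rw [hF] at key
    rw [integral_const_mul] at key
    rw [key, norm_neg, norm_mul, norm_mul, norm_neg, Complex.norm_I, one_mul, Complex.norm_real,
      Real.norm_eq_abs, abs_mul, abs_of_pos hH, ← mul_assoc, inv_mul_cancel₀, one_mul]
    positivity
  · simp only [ContinuousLinearMap.mul_apply']
    simp_rw [hF]
    exact (integrable_cexp_mul hψ hint τ).const_mul _
  · exact integrable_cexp_mul hψ (h1.integrable hw) τ
  · exact integrable_cexp_mul hψ (hab.integrable hw) τ
  · exact fun x _ => hasLineDerivAt_cexp τ (hψV x)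
  · intro x _
    exact (ha' x).ofReal_comp

/-- The constant is `64 = 2³ · 2² · 2`, from the product rule at orders three, two and one. Three
steps are enough because only a decay of order `5/2` is kept after integration over the differences.
-/
theorem oscillatory_three {K B H τ : ℝ} {ψ V a : E → ℝ}
    (hψ : Continuous ψ) (hV : ∀ x, V x ≠ 0) (hH : 0 < H) (hτ : τ ≠ 0)
    (hψV : ∀ x, HasLineDerivAt ℝ ψ (H * V x) x u)
    (ha : DerivBound u w 3 K a) (hb : DerivBound u (fun _ => 1) 3 B fun x => (V x)⁻¹)
    (hw : Integrable w μ) :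
    ‖∫ x, Complex.exp (-Complex.I * ((τ * ψ x : ℝ) : ℂ)) * (a x : ℂ) ∂μ‖ ≤
      ((|τ| * H)⁻¹) ^ 3 * (64 * K * B ^ 3 * ∫ x, w x ∂μ) := by
  obtain ⟨a₁, h₁, e₁⟩ := oscillatory_step hψ hV hH hτ hψV ha hb hw
  obtain ⟨a₂, h₂, e₂⟩ := oscillatory_step hψ hV hH hτ hψV h₁ hb.of_succ hw
  obtain ⟨a₃, h₃, e₃⟩ := oscillatory_step hψ hV hH hτ hψV h₂ hb.of_succ.of_succ hw
  have e₄ := norm_integral_cexp_mul_le (ψ := ψ) h₃.base.2 hw τ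
  have hpos : 0 ≤ (|τ| * H)⁻¹ := by positivity
  calc _ ≤ _ := e₁
    _ ≤ (|τ| * H)⁻¹ * ((|τ| * H)⁻¹ * ((|τ| * H)⁻¹ * _)) := by
      refine mul_le_mul_of_nonneg_left (e₂.trans ?_) hpos
      refine mul_le_mul_of_nonneg_left (e₃.trans ?_) hpos
      exact mul_le_mul_of_nonneg_left e₄ hpos
    _ = _ := by ring

end Oscillatory

section DiffQuot

variable {E : Type*} [NormedAddCommGroup E] [NormedSpace ℝ E]

/-- The mean value theorem on the segment from `x` to `x + h`. The distance from `y` to `x` is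
recorded so that weights at the two points can be compared. -/
theorem exists_lineDeriv_eq_slope {g g' : E → ℝ} {h : E} (hh : h ≠ 0)
    (hg : ∀ x, HasLineDerivAt ℝ g (g' x) x (‖h‖⁻¹ • h)) (x : E) :
    ∃ y, ‖y - x‖ ≤ ‖h‖ ∧ ‖h‖⁻¹ * (g (x + h) - g x) = g' y := by
  have hn : 0 < ‖h‖ := norm_pos_iff.mpr hh
  have hd : ∀ t : ℝ, HasDerivAt (fun t : ℝ => g (x + t • (‖h‖⁻¹ • h)))
      (g' (x + t • (‖h‖⁻¹ • h))) t := by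
    intro t
    have h1 : HasDerivAt (fun s : ℝ => g (x + t • (‖h‖⁻¹ • h) + s • (‖h‖⁻¹ • h)))
      (g' (x + t • (‖h‖⁻¹ • h))) (t - t) := by simpa using! hg (x + t • (‖h‖⁻¹ • h))
    have h2 := h1.comp_sub_const t t
    convert! h2 using 1
    funext s
    congr 1
    module
  obtain ⟨c, hc', hc⟩ := exists_hasDerivAt_eq_slope (fun t : ℝ => g (x + t • (‖h‖⁻¹ • h)))
    _ hn (fun t _ => (hd t).continuousAt.continuousWithinAt) (fun t _ => hd t)
  refine ⟨x + c • (‖h‖⁻¹ • h), ?_, ?_⟩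
  · simp [norm_smul, hn.ne', abs_of_pos hc'.1, hc'.2.le]
  rw [hc]
  simp [smul_smul, hn.ne']
  field_simp

/-- By the mean value theorem, applied to each derivative in turn, difference quotients obey the
bounds of the derivative with a constant independent of the size of `h`. This keeps the integrations
by parts uniform as `h` tends to zero. -/
theorem DerivBound.diffQuot {j : ℕ} {K : ℝ} {g g' : E → ℝ} {h : E} (hh : h ≠ 0)
    (hgc : Continuous g) (hg : ∀ x, HasLineDerivAt ℝ g (g' x) x (‖h‖⁻¹ • h))
    (hb : DerivBound (‖h‖⁻¹ • h) (fun _ => 1) j K g') :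
    DerivBound (‖h‖⁻¹ • h) (fun _ => 1) j K fun x => ‖h‖⁻¹ * (g (x + h) - g x) := by
  have key : ∀ {g g' : E → ℝ}, Continuous g →
      (∀ x, HasLineDerivAt ℝ g (g' x) x (‖h‖⁻¹ • h)) →
      (∀ x, |g' x| ≤ K * 1) → Continuous (fun x => ‖h‖⁻¹ * (g (x + h) - g x)) ∧
        ∀ x, |‖h‖⁻¹ * (g (x + h) - g x)| ≤ K * 1 := by
    intro g g' hc hg hK
    refine ⟨by fun_prop, fun x => ?_⟩
    obtain ⟨y, -, hy⟩ := exists_lineDeriv_eq_slope hh hg x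
    rw [hy]; exact hK y
  induction j generalizing g g' with
  | zero => exact key hgc hg hb.2
  | succ j ih =>
    obtain ⟨h0, g'', hg'', h1⟩ := hb
    refine ⟨key hgc hg h0.2, _, fun x => ?_, ih h0.1 hg'' h1⟩
    have h1 : HasDerivAt (fun t : ℝ => g (x + t • (‖h‖⁻¹ • h) + h)) (g' (x + h)) 0 :=
      hasLineDerivAt_comp_add h (hg (x + h))
    exact HasDerivAt.const_mul _ (HasDerivAt.sub h1 (hg x))

end DiffQuot

end Polaron
end


/-! ### Weights, and regularity of the form factor and the phases. -/

noncomputable section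

set_option linter.unusedSectionVars false

namespace Polaron

variable {d : ℕ}

/-- The weight `1 + |k|`. -/
def jap (k : Mom d) : ℝ := 1 + ‖k‖

theorem one_le_jap (k : Mom d) : 1 ≤ jap k := by simp [jap]

theorem jap_pos (k : Mom d) : 0 < jap k := zero_lt_one.trans_le (one_le_jap k)

theorem continuous_jap : Continuous (jap (d := d)) := by unfold jap; fun_prop

/-- The decay of the amplitudes. -/
def decay (k : Mom d) : ℝ := (jap k ^ (d + 3))⁻¹

theorem decay_pos (k : Mom d) : 0 < decay k := inv_pos.mpr (pow_pos (jap_pos k) _)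

theorem decay_le_one (k : Mom d) : decay k ≤ 1 :=
  inv_le_one_of_one_le₀ (one_le_pow₀ (one_le_jap k))

theorem continuous_decay : Continuous (decay (d := d)) :=
  (continuous_jap.pow _).inv₀ fun k => (pow_pos (jap_pos k) _).ne'

theorem integrable_jap_inv_pow {r : ℕ} (hr : d < r) :
    Integrable (fun k : Mom d => (jap k ^ r)⁻¹) := by
  have := integrable_one_add_norm (E := Mom d) (μ := volume) (r := r)
    (by simpa using! hr)
  refine this.congr (Eventually.of_forall fun k => ?_)
  have h0 := jap_pos k
  simp only [jap] at h0 ⊢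
  rw [Real.rpow_neg h0.le, Real.rpow_natCast]

theorem integrable_decay : Integrable (decay (d := d)) := integrable_jap_inv_pow (by omega)

theorem bracket_le_jap (k : Mom d) : bracket k ≤ jap k := by
  unfold bracket jap
  rw [Real.sqrt_le_left (by positivity)]
  nlinarith [norm_nonneg k]

theorem jap_le_two_bracket (k : Mom d) : jap k ≤ 2 * bracket k := by
  have h : jap k / 2 ≤ bracket k := by
    unfold bracket jap
    apply Real.le_sqrt_of_sq_le
    nlinarith [norm_nonneg k, sq_nonneg (‖k‖ - 1)]
  linarith

theorem one_le_bracket (k : Mom d) : 1 ≤ bracket k := by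
  unfold bracket
  rw [Real.one_le_sqrt]
  nlinarith [norm_nonneg k]

theorem bracket_zpow_le_one (k : Mom d) {m : ℤ} (hm : m ≤ 0) : bracket k ^ m ≤ 1 :=
  zpow_le_one_of_nonpos₀ (one_le_bracket k) hm

namespace Model.Admissible

variable {S : Model d} {C₁ C₂ C₃ C₄ C₆ C₇ : ℝ}

theorem gap' (hS : S.Admissible C₁ C₂ C₃ C₄ C₆ C₇) (k : Mom d) :
    -S.β * S.ω k + S.chem ≤ -(S.β * C₆) := by
  have h1 := hS.gap k
  have h2 := hS.β_pos
  have h3 : S.β * (S.ω k - S.chem * S.β⁻¹) = S.β * S.ω k - S.chem := by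
    field_simp
  nlinarith [mul_le_mul_of_nonneg_left h1 h2.le]

theorem exp_le (hS : S.Admissible C₁ C₂ C₃ C₄ C₆ C₇) (k : Mom d) :
    Real.exp (-S.β * S.ω k + S.chem) ≤ Real.exp (-(S.β * C₆)) := Real.exp_le_exp.mpr (hS.gap' k)

theorem exp_gap_lt_one (hS : S.Admissible C₁ C₂ C₃ C₄ C₆ C₇) : Real.exp (-(S.β * C₆)) < 1 := by
  have := mul_pos hS.β_pos hS.C₆_pos
  rw [Real.exp_lt_one_iff]; linarith

theorem occ_nonneg (hS : S.Admissible C₁ C₂ C₃ C₄ C₆ C₇) (k : Mom d) : 0 ≤ S.occ k := by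
  have h1 := hS.exp_le k
  have h2 := hS.exp_gap_lt_one
  exact div_nonneg (Real.exp_pos _).le (by linarith)

theorem occ_le (hS : S.Admissible C₁ C₂ C₃ C₄ C₆ C₇) (k : Mom d) :
    S.occ k ≤ (1 - Real.exp (-(S.β * C₆)))⁻¹ := by
  have h1 := hS.exp_le k
  have h2 := hS.exp_gap_lt_one
  unfold Model.occ
  rw [div_le_iff₀ (by linarith), inv_mul_eq_div, le_div_iff₀ (by linarith)]
  have := Real.exp_pos (-(S.β * C₆))
  nlinarith

theorem M_nonneg (hS : S.Admissible C₁ C₂ C₃ C₄ C₆ C₇) (k : Mom d) (σ : ℤˣ) : 0 ≤ S.M k σ := by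
  have := hS.occ_nonneg k
  unfold Model.M
  rcases Int.units_eq_one_or σ with rfl | rfl <;> simp <;> positivity

theorem continuous_occ (hS : S.Admissible C₁ C₂ C₃ C₄ C₆ C₇) : Continuous S.occ := by
  have := hS.ω_smooth.continuous
  unfold Model.occ
  refine Continuous.div (by fun_prop) (by fun_prop) fun k => ?_
  have h1 := hS.exp_le k
  have h2 := hS.exp_gap_lt_one
  linarith

theorem continuous_M (hS : S.Admissible C₁ C₂ C₃ C₄ C₆ C₇) (σ : ℤˣ) :
    Continuous fun k => S.M k σ := by
  have h1 := hS.continuous_occ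
  have h2 := hS.Q_smooth.continuous
  unfold Model.M
  fun_prop

/-- The Bose function solves `n' = -n (1 + n)` in its exponent. Derivatives of `occ` are thus
polynomials in `occ` and derivatives of `ω`, and the bound on `occ` itself can be bootstrapped. -/
theorem hasLineDerivAt_occ (hS : S.Admissible C₁ C₂ C₃ C₄ C₆ C₇) {x u : Mom d} {ω' : ℝ}
    (h : HasLineDerivAt ℝ S.ω ω' x u) :
    HasLineDerivAt ℝ S.occ (-S.β * (ω' * (S.occ x * (1 + S.occ x)))) x u := by
  have h1 := hS.exp_le x
  have h2 := hS.exp_gap_lt_one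
  have hne : 1 - Real.exp (-S.β * S.ω x + S.chem) ≠ 0 := by linarith
  have hy : HasDerivAt (fun y => Real.exp (-S.β * y + S.chem))
      (Real.exp (-S.β * S.ω x + S.chem) * (-S.β)) (S.ω x) := by
    have := (((hasDerivAt_id (S.ω x)).const_mul (-S.β)).add_const S.chem).exp
    simpa using! this
  have hF := hy.div (hy.const_sub 1) hne
  have := hasLineDerivAt_comp h hF
  convert! this using 1
  unfold Model.occ
  generalize Real.exp (-S.β * S.ω x + S.chem) = y at hne
  field_simp
  ring

theorem lineDeriv_ω (hd : 3 ≤ d) (hS : S.Admissible C₁ C₂ C₃ C₄ C₆ C₇) {u : Mom d}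
    (hu : ‖u‖ = 1) :
    (∀ x, HasLineDerivAt ℝ S.ω (iteratedFDeriv ℝ 1 S.ω x fun _ => u) x u) ∧
      DerivBound u jap 2 (2 * |C₂|) fun x => iteratedFDeriv ℝ 1 S.ω x fun _ => u := by
  constructor
  · intro x
    simpa using hasLineDerivAt_iteratedFDeriv hS.ω_smooth (i := 0) (by omega) x u
  · refine DerivBound.of_iteratedFDeriv_aux hS.ω_smooth hu 1 2 (by omega) fun l hl hl' x => ?_
    refine (hS.ω_bound l (by omega) x).trans ?_
    have h1 : bracket x ^ (2 - (l : ℤ)) ≤ bracket x := by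
      have := zpow_le_zpow_right₀ (one_le_bracket x) (show (2 - (l : ℤ)) ≤ 1 by omega)
      simpa using this
    have h2 := bracket_le_jap x
    have h3 := one_le_jap x
    have h4 : 0 ≤ bracket x ^ (2 - (l : ℤ)) :=
      zpow_nonneg (zero_le_one.trans (one_le_bracket x)) _
    calc C₂ * (1 + bracket x ^ (2 - (l : ℤ))) ≤ |C₂| * (1 + bracket x ^ (2 - (l : ℤ))) :=
          mul_le_mul_of_nonneg_right (le_abs_self _) (by linarith)
      _ ≤ |C₂| * (2 * jap x) := mul_le_mul_of_nonneg_left (by linarith) (abs_nonneg _)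
      _ = _ := by ring

/-- Induction through `occ' = -β ω' occ (1 + occ)`. Since `ω'` grows linearly, the weight exponents
satisfy `e₀ = 0` and `e_{j+1} = 2 e_j + 1`, hence `2 ^ j - 1`. This crude growth is later absorbed
by `Q`. The constant is chosen before the model and depends only on the listed quantities. -/
theorem exists_derivBound_occ (hd : 3 ≤ d) (β C₂ C₆ : ℝ) (j : ℕ) (hj : j ≤ 3) :
    ∃ B : ℝ, 0 ≤ B ∧ ∀ (S : Model d) (C₁ C₃ C₄ C₇ : ℝ), S.β = β →
      S.Admissible C₁ C₂ C₃ C₄ C₆ C₇ → ∀ u : Mom d, ‖u‖ = 1 →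
        DerivBound u (fun k => jap k ^ (2 ^ j - 1)) j B S.occ := by
  have hbase : ∀ (B : ℝ) (e : ℕ), |(1 - Real.exp (-(β * C₆)))⁻¹| ≤ B →
      ∀ (S : Model d) (C₁ C₃ C₄ C₇ : ℝ), S.β = β →
      S.Admissible C₁ C₂ C₃ C₄ C₆ C₇ → Continuous S.occ ∧ ∀ x, |S.occ x| ≤ B * jap x ^ e := by
    intro B e hB S C₁ C₃ C₄ C₇ hβ hS
    refine ⟨hS.continuous_occ, fun x => ?_⟩
    rw [abs_of_nonneg (hS.occ_nonneg x)]
    have h1 := hS.occ_le x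
    rw [hβ] at h1
    have h2 : 1 ≤ jap x ^ e := one_le_pow₀ (one_le_jap x)
    have h3 := le_abs_self (1 - Real.exp (-(β * C₆)))⁻¹
    have h4 := abs_nonneg (1 - Real.exp (-(β * C₆)))⁻¹
    nlinarith
  induction j with
  | zero => exact ⟨|(1 - Real.exp (-(β * C₆)))⁻¹|, abs_nonneg _,
      fun S C₁ C₃ C₄ C₇ hβ hS u hu => hbase _ 0 le_rfl S C₁ C₃ C₄ C₇ hβ hS⟩
  | succ j ih =>
    obtain ⟨B, hB0, hB⟩ := ih (by omega)
    refine ⟨|(1 - Real.exp (-(β * C₆)))⁻¹| +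
      |β| * (2 ^ j * (2 * |C₂| * (2 ^ j * (B * (1 + B))))), by positivity, ?_⟩
    intro S C₁ C₃ C₄ C₇ hβ hS u hu
    have ho := hB S C₁ C₃ C₄ C₇ hβ hS u hu
    obtain ⟨hω, hω'⟩ := hS.lineDeriv_ω hd hu
    have hω'' : DerivBound u jap j (2 * |C₂|) fun x => iteratedFDeriv ℝ 1 S.ω x fun _ => u := by
      have : j = 0 ∨ j = 1 ∨ j = 2 := by omega
      rcases this with rfl | rfl | rfl
      · exact hω'.of_succ.of_succ
      · exact hω'.of_succ
      · exact hω'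
    have hpos : 0 ≤ |β| * (2 ^ j * (2 * |C₂| * (2 ^ j * (B * (1 + B))))) := by positivity
    refine ⟨hbase _ _ (by linarith) S C₁ C₃ C₄ C₇ hβ hS, _,
      fun x => hS.hasLineDerivAt_occ (hω x), ?_⟩
    have h1 : DerivBound u (fun k => jap k ^ (2 ^ j - 1)) j (1 + B) fun x => 1 + S.occ x := by
      refine DerivBound.add ((DerivBound.const u j 1).mono fun x => ?_) ho
      rw [abs_one, one_mul, one_mul]
      exact one_le_pow₀ (one_le_jap x)
    refine ((hω''.mul (ho.mul h1)).const_mul (-S.β)).mono fun x => ?_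
    rw [abs_neg, hβ]
    have e1 : jap x * (jap x ^ (2 ^ j - 1) * jap x ^ (2 ^ j - 1)) = jap x ^ (2 ^ (j + 1) - 1) := by
      rw [← pow_add, ← pow_succ']
      congr 1
      have := Nat.one_le_two_pow (n := j)
      rw [pow_succ]; omega
    rw [e1]
    exact mul_le_mul_of_nonneg_right (by linarith [abs_nonneg (1 - Real.exp (-(β * C₆)))⁻¹])
      (pow_nonneg (jap_pos x).le _)

theorem derivBound_Q (hd : 3 ≤ d) (hS : S.Admissible C₁ C₂ C₃ C₄ C₆ C₇) {u : Mom d}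
    (hu : ‖u‖ = 1) :
    DerivBound u (fun k => (jap k ^ (2 * d + 12))⁻¹) 3 (|C₇| * 2 ^ (2 * d + 12)) S.Q := by
  refine DerivBound.of_iteratedFDeriv hS.Q_smooth hu (by omega) fun l hl x => ?_
  refine (hS.Q_decay l (by omega) x).trans ?_
  have e : (-(2 * (d : ℤ)) - 12) = -((2 * d + 12 : ℕ) : ℤ) := by push_cast; ring
  rw [e, zpow_neg, zpow_natCast]
  have h1 := one_le_bracket x
  have h2 : jap x ^ (2 * d + 12) ≤ 2 ^ (2 * d + 12) * bracket x ^ (2 * d + 12) := by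
    rw [← mul_pow]; exact pow_le_pow_left₀ (jap_pos x).le (jap_le_two_bracket x) _
  have h3 : (bracket x ^ (2 * d + 12))⁻¹ ≤ 2 ^ (2 * d + 12) * (jap x ^ (2 * d + 12))⁻¹ := by
    rw [inv_eq_one_div, ← div_eq_mul_inv, div_le_div_iff₀ (by positivity) (pow_pos (jap_pos x) _),
      one_mul]
    exact h2
  calc C₇ * (bracket x ^ (2 * d + 12))⁻¹ ≤ |C₇| * (bracket x ^ (2 * d + 12))⁻¹ :=
        mul_le_mul_of_nonneg_right (le_abs_self _) (by positivity)
    _ ≤ |C₇| * (2 ^ (2 * d + 12) * (jap x ^ (2 * d + 12))⁻¹) :=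
        mul_le_mul_of_nonneg_left h3 (abs_nonneg _)
    _ = _ := by ring

/-- Two factors `Q` supply decay of order `4 d + 24`, while `occ` with up to three derivatives grows
at most to the seventh power. The difference leaves more than the order `d + 3` required by `decay`.
-/
theorem exists_derivBound_M (hd : 3 ≤ d) (β C₂ C₆ C₇ : ℝ) :
    ∃ K : ℝ, 0 ≤ K ∧ ∀ (S : Model d) (C₁ C₃ C₄ : ℝ), S.β = β →
      S.Admissible C₁ C₂ C₃ C₄ C₆ C₇ → ∀ (σ : ℤˣ) (u : Mom d), ‖u‖ = 1 →
        DerivBound u decay 3 K fun k => S.M k σ := by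
  obtain ⟨B, hB0, hB⟩ := exists_derivBound_occ hd β C₂ C₆ 3 le_rfl
  set q := |C₇| * 2 ^ (2 * d + 12)
  refine ⟨2 ^ 3 * ((2 ^ 3 * (q * q)) * (B + 1)), by positivity, ?_⟩
  intro S C₁ C₃ C₄ hβ hS σ u hu
  have hQ := hS.derivBound_Q hd hu
  have ho := hB S C₁ C₃ C₄ C₇ hβ hS u hu
  have hc : DerivBound u (fun k => jap k ^ (2 ^ 3 - 1)) 3 1
      fun _ => (((σ : ℤ) : ℝ) + 1) / 2 := by
    refine (DerivBound.const u 3 _).mono fun x => ?_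
    have h1 : 1 ≤ jap x ^ 7 := one_le_pow₀ (one_le_jap x)
    rcases Int.units_eq_one_or σ with rfl | rfl <;> norm_num
    · exact h1
    · linarith
  have h := (hQ.mul hQ).mul (ho.add hc)
  have e : (fun x => S.Q x * S.Q x * (S.occ x + (((σ : ℤ) : ℝ) + 1) / 2)) =
      fun k => S.M k σ := by
    funext x; unfold Model.M; ring
  rw [e] at h
  refine h.mono fun x => mul_le_mul_of_nonneg_left ?_ (by positivity)
  have h0 := jap_pos x
  unfold decay
  rw [← mul_inv, ← pow_add, inv_mul_eq_div, div_le_iff₀ (by positivity), inv_mul_eq_div,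
    le_div_iff₀ (by positivity), ← pow_add]
  exact pow_le_pow_right₀ (one_le_jap x) (by omega)

/-- Bound on the second and higher derivatives of `Φ`. -/
theorem Phi_bound (hS : S.Admissible C₁ C₂ C₃ C₄ C₆ C₇) (σ : ℤˣ) (p : Mom d) :
    ContDiff ℝ (2 * d : ℕ) (S.Phi σ p) ∧ ∀ l, 2 ≤ l → l ≤ 2 * d → ∀ x,
      ‖iteratedFDeriv ℝ l (S.Phi σ p) x‖ ≤ 2 * |C₁| + 2 * |C₂| := by
  have h1 : ContDiff ℝ (2 * d : ℕ) (fun k => S.e (k + p)) :=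
    hS.e_smooth.comp (contDiff_id.add contDiff_const)
  have h2 : ContDiff ℝ (2 * d : ℕ) (fun k => (((σ : ℤ) : ℝ)) • S.ω k) :=
    hS.ω_smooth.const_smul _
  have e : S.Phi σ p = (fun k => S.e (k + p)) + fun k => (((σ : ℤ) : ℝ)) • S.ω k := by
    funext k; simp [Model.Phi]
  refine ⟨by rw [e]; exact h1.add h2, fun l hl hl' x => ?_⟩
  have hl'' : (l : WithTop ℕ∞) ≤ (2 * d : ℕ) := by exact_mod_cast hl'
  rw [e, iteratedFDeriv_add (h1.of_le hl'') (h2.of_le hl'')]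
  -- From the second derivative on the exponent `2 - l` is nonpositive, so the growth of the
  -- dispersion relations no longer appears.
  have b : ∀ y : Mom d, ∀ C : ℝ, C * (1 + bracket y ^ (2 - (l : ℤ))) ≤ 2 * |C| := by
    intro y C
    have h3 := bracket_zpow_le_one y (m := 2 - (l : ℤ)) (by omega)
    have h4 : 0 ≤ bracket y ^ (2 - (l : ℤ)) :=
      zpow_nonneg (zero_le_one.trans (one_le_bracket y)) _
    nlinarith [le_abs_self C, abs_nonneg C]
  refine (norm_add_le _ _).trans (add_le_add ?_ ?_)
  · rw [iteratedFDeriv_comp_add_right]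
    exact (hS.e_bound l hl' _).trans (b _ _)
  · rw [iteratedFDeriv_const_smul_apply' (hS.ω_smooth.of_le hl'').contDiffAt, norm_smul]
    have : ‖(((σ : ℤ) : ℝ))‖ = 1 := by
      rcases Int.units_eq_one_or σ with rfl | rfl <;> simp
    rw [this, one_mul]
    exact (hS.ω_bound l hl' _).trans (b _ _)

end Model.Admissible

end Polaron
end


/-! ### The differenced phases. -/

noncomputable section

set_option linter.unusedSectionVars false

namespace Polaron

variable {d : ℕ}

theorem jap_le_two_mul {x z : Mom d} (h : ‖z - x‖ ≤ 1) : jap x ≤ 2 * jap z := by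
  have : x = z - (z - x) := by abel
  have h1 : ‖x‖ ≤ ‖z‖ + ‖z - x‖ := by
    conv_lhs => rw [this]
    exact norm_sub_le _ _
  unfold jap
  linarith [norm_nonneg z]

theorem jap_inv_pow_le {x z : Mom d} (r : ℕ) (h : ‖z - x‖ ≤ 1) :
    (jap z ^ r)⁻¹ ≤ 2 ^ r * (jap x ^ r)⁻¹ := by
  rw [inv_eq_one_div, ← div_eq_mul_inv,
    div_le_div_iff₀ (pow_pos (jap_pos z) _) (pow_pos (jap_pos x) _), one_mul, ← mul_pow]
  exact pow_le_pow_left₀ (jap_pos x).le (jap_le_two_mul h) _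

theorem decay_le {x z : Mom d} (h : ‖z - x‖ ≤ 1) : decay z ≤ 2 ^ (d + 3) * decay x :=
  jap_inv_pow_le _ h

theorem norm_cexp_sub_cexp_le (a b : ℝ) :
    ‖Complex.exp (-Complex.I * (a : ℂ)) - Complex.exp (-Complex.I * (b : ℂ))‖ ≤ |a - b| := by
  have : Complex.exp (-Complex.I * (a : ℂ)) - Complex.exp (-Complex.I * (b : ℂ)) =
      Complex.exp (-Complex.I * (b : ℂ)) *
        (Complex.exp (Complex.I * ((-(a - b) : ℝ) : ℂ)) - 1) := by
    rw [mul_sub, ← Complex.exp_add, mul_one]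
    congr 2
    push_cast; ring
  rw [this, norm_mul, norm_cexp_I, one_mul]
  refine (Real.norm_exp_I_mul_ofReal_sub_one_le).trans ?_
  simp [abs_sub_comm b a]

theorem norm_osc_sub_le (a b c e : ℝ) :
    ‖Complex.exp (-Complex.I * (a : ℂ)) * (c : ℂ) - Complex.exp (-Complex.I * (b : ℂ)) * (e : ℂ)‖ ≤
      |a - b| * |c| + |c - e| := by
  have : Complex.exp (-Complex.I * (a : ℂ)) * (c : ℂ) -
      Complex.exp (-Complex.I * (b : ℂ)) * (e : ℂ) =
      (Complex.exp (-Complex.I * (a : ℂ)) - Complex.exp (-Complex.I * (b : ℂ))) * (c : ℂ) +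
        Complex.exp (-Complex.I * (b : ℂ)) * ((c - e : ℝ) : ℂ) := by push_cast; ring
  rw [this]
  refine (norm_add_le _ _).trans (add_le_add ?_ ?_)
  · rw [norm_mul, Complex.norm_real]
    exact mul_le_mul_of_nonneg_right (norm_cexp_sub_cexp_le a b) (abs_nonneg _)
  · rw [norm_mul, norm_cexp_I, one_mul, Complex.norm_real]
    exact le_rfl

theorem abs_sub_le_of_derivBound {K : ℝ} {f : Mom d → ℝ} (hK : 0 ≤ K)
    (hf : ∀ u : Mom d, ‖u‖ = 1 → DerivBound u decay 1 K f) {x y : Mom d} (h : ‖y - x‖ ≤ 1) :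
    |f y - f x| ≤ ‖y - x‖ * (K * (2 ^ (d + 3) * decay x)) := by
  rcases eq_or_ne (y - x) 0 with h0 | h0
  · have : y = x := sub_eq_zero.mp h0
    subst this; simp
  have hn : 0 < ‖y - x‖ := norm_pos_iff.mpr h0
  obtain ⟨-, f', hf', h1⟩ := hf (‖y - x‖⁻¹ • (y - x)) (by
    rw [norm_smul, norm_inv, norm_norm, inv_mul_cancel₀ hn.ne'])
  obtain ⟨z, hz, hz'⟩ := exists_lineDeriv_eq_slope h0 hf' x
  rw [add_sub_cancel] at hz'
  have h2 : f y - f x = ‖y - x‖ * f' z := by rw [← hz']; field_simp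
  rw [h2, abs_mul, abs_norm]
  refine mul_le_mul_of_nonneg_left ((h1.base.2 z).trans ?_) hn.le
  exact mul_le_mul_of_nonneg_left (decay_le (hz.trans h)) hK

namespace Model.Admissible

variable {S : Model d} {C₁ C₂ C₃ C₄ C₆ C₇ : ℝ}

theorem fderiv_Phi_lipschitz (hd : 3 ≤ d) (hS : S.Admissible C₁ C₂ C₃ C₄ C₆ C₇) (σ : ℤˣ)
    (p x y : Mom d) :
    ‖fderiv ℝ (S.Phi σ p) y - fderiv ℝ (S.Phi σ p) x‖ ≤ (2 * |C₁| + 2 * |C₂|) * ‖y - x‖ := by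
  obtain ⟨hc, hb⟩ := hS.Phi_bound σ p
  have hc2 : ContDiff ℝ (1 + 1) (S.Phi σ p) := by
    refine hc.of_le ?_
    rw [one_add_one_eq_two]
    exact_mod_cast (by omega : 2 ≤ 2 * d)
  have hdf : Differentiable ℝ (fderiv ℝ (S.Phi σ p)) :=
    ((contDiff_succ_iff_fderiv.mp hc2).2.2).differentiable (by norm_num)
  refine Convex.norm_image_sub_le_of_norm_fderiv_le (𝕜 := ℝ) (s := Set.univ)
    (fun z _ => hdf z) (fun z _ => ?_) convex_univ trivial trivial
  have h1 := hb 2 le_rfl (by omega) z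
  rw [← norm_fderiv_iteratedFDeriv] at h1
  have h2 : ‖fderiv ℝ (fderiv ℝ (S.Phi σ p)) z‖ = ‖iteratedFDeriv ℝ 2 (S.Phi σ p) z‖ := by
    rw [← norm_iteratedFDeriv_fderiv, ← norm_iteratedFDeriv_one]
  rw [h2, ← norm_fderiv_iteratedFDeriv]
  exact h1

theorem differentiable_Phi (hd : 3 ≤ d) (hS : S.Admissible C₁ C₂ C₃ C₄ C₆ C₇) (σ : ℤˣ)
    (p : Mom d) : Differentiable ℝ (S.Phi σ p) :=
  (hS.Phi_bound σ p).1.differentiable (by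
    have : (2 * d : ℕ) ≠ 0 := by omega
    exact_mod_cast this)

/-- The gradient of the differenced phase is a difference of gradients of `Φ`, hence bounded by the
Hessian bound times `‖h‖`. Differencing removes the growth of `∇Φ` and the dependence on `p`. -/
theorem Phi_diff_lipschitz (hd : 3 ≤ d) (hS : S.Admissible C₁ C₂ C₃ C₄ C₆ C₇) (σ : ℤˣ)
    (p h x y : Mom d) :
    |(S.Phi σ p (y + h) - S.Phi σ p y) - (S.Phi σ p (x + h) - S.Phi σ p x)| ≤
      (2 * |C₁| + 2 * |C₂|) * ‖h‖ * ‖y - x‖ := by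
  have hΦ := hS.differentiable_Phi hd σ p
  have hd1 : ∀ z, HasFDerivAt (fun z => S.Phi σ p (z + h) - S.Phi σ p z)
      (fderiv ℝ (S.Phi σ p) (z + h) - fderiv ℝ (S.Phi σ p) z) z := by
    intro z
    refine HasFDerivAt.sub ?_ (hΦ z).hasFDerivAt
    have := (hΦ (z + h)).hasFDerivAt
    exact (hasFDerivAt_comp_add_right h).mpr this
  refine Convex.norm_image_sub_le_of_norm_hasFDerivWithin_le (𝕜 := ℝ) (s := Set.univ)
    (f := fun z => S.Phi σ p (z + h) - S.Phi σ p z)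
    (fun z _ => (hd1 z).hasFDerivWithinAt) (fun z _ => ?_) convex_univ trivial trivial
  simpa using hS.fderiv_Phi_lipschitz hd σ p z (z + h)

/-- Here `K` may depend on `p`, because the gradient at the origin does. The lemma only serves to
show that lattice sums converge for fixed `p`; the uniform estimate works with differenced phases.
-/
theorem Phi_lipschitz (hd : 3 ≤ d) (hS : S.Admissible C₁ C₂ C₃ C₄ C₆ C₇) (σ : ℤˣ)
    (p : Mom d) : ∃ K : ℝ, 0 ≤ K ∧ ∀ x y : Mom d, ‖y - x‖ ≤ 1 →
      |S.Phi σ p y - S.Phi σ p x| ≤ K * jap x * ‖y - x‖ := by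
  have hΦ := hS.differentiable_Phi hd σ p
  refine ⟨‖fderiv ℝ (S.Phi σ p) 0‖ + 2 * (2 * |C₁| + 2 * |C₂|), by positivity, ?_⟩
  intro x y hxy
  refine Convex.norm_image_sub_le_of_norm_fderiv_le (𝕜 := ℝ) (s := Metric.closedBall x 1)
    (fun z _ => hΦ z) (fun z hz => ?_) (convex_closedBall x 1) (by simp)
    (by simpa [dist_eq_norm] using hxy)
  have h1 := hS.fderiv_Phi_lipschitz hd σ p 0 z
  rw [sub_zero] at h1
  have h2 : ‖fderiv ℝ (S.Phi σ p) z‖ ≤ ‖fderiv ℝ (S.Phi σ p) 0‖ +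
      ‖fderiv ℝ (S.Phi σ p) z - fderiv ℝ (S.Phi σ p) 0‖ := by
    simpa using norm_add_le (fderiv ℝ (S.Phi σ p) 0)
      (fderiv ℝ (S.Phi σ p) z - fderiv ℝ (S.Phi σ p) 0)
  have h3 : ‖z‖ ≤ 2 * jap x := by
    have hz' : ‖z - x‖ ≤ 1 := by simpa [dist_eq_norm] using hz
    have := jap_le_two_mul (x := z) (z := x) (by rw [norm_sub_rev]; exact hz')
    have h5 : ‖z‖ ≤ jap z := by simp [jap]
    linarith
  have h4 := one_le_jap x
  have h5 : 0 ≤ 2 * |C₁| + 2 * |C₂| := by positivity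
  nlinarith [norm_nonneg (fderiv ℝ (S.Phi σ p) 0), mul_le_mul_of_nonneg_left h3 h5]

end Model.Admissible

/-- The phase and the amplitude obtained from differencing an oscillatory sum. -/
def Model.pairOsc (S : Model d) (σ : ℤˣ) (p h : Mom d) (τ : ℝ) (x : Mom d) : ℂ :=
  Complex.exp (-Complex.I * ((τ * (S.Phi σ p (x + h) - S.Phi σ p x) : ℝ) : ℂ)) *
    ((S.M (x + h) σ * S.M x σ : ℝ) : ℂ)

/-- For `y ≤ 1` the trivial bound is used and for `y ≥ 1` the one with the gain `y^{-3}`; in either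
case `(1 + y)³` costs a factor eight. -/
theorem one_add_pow_three_bound {A B y : ℝ} (hy : 0 ≤ y) (hB : 0 ≤ B) (h1 : A ≤ B)
    (h2 : 0 < y → A ≤ (y⁻¹) ^ 3 * B) : A ≤ ((1 + y) ^ 3)⁻¹ * (8 * B) := by
  rw [inv_mul_eq_div, le_div_iff₀ (by positivity)]
  rcases le_total y 1 with hy1 | hy1
  · have : (1 + y) ^ 3 ≤ 8 := by
      calc (1 + y) ^ 3 ≤ 2 ^ 3 := pow_le_pow_left₀ (by linarith) (by linarith) 3
        _ = 8 := by norm_num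
    rcases le_total A 0 with hA | hA
    · have : 0 ≤ (1 + y) ^ 3 := by positivity
      nlinarith
    · nlinarith
  · have hy0 : 0 < y := by linarith
    have h3 : (1 + y) ^ 3 ≤ 8 * y ^ 3 := by
      calc (1 + y) ^ 3 ≤ (2 * y) ^ 3 := pow_le_pow_left₀ (by linarith) (by linarith) 3
        _ = 8 * y ^ 3 := by ring
    calc A * (1 + y) ^ 3 ≤ ((y⁻¹) ^ 3 * B) * (1 + y) ^ 3 :=
          mul_le_mul_of_nonneg_right (h2 hy0) (by positivity)
      _ ≤ ((y⁻¹) ^ 3 * B) * (8 * y ^ 3) := mul_le_mul_of_nonneg_left h3 (by positivity)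
      _ = 8 * B := by field_simp

/-- Integral estimate for the differenced phases, uniform in the momentum `p`. -/
theorem exists_pairOsc_integral_bound (hd : 3 ≤ d) (C₁ C₂ C₃ C₄ C₆ C₇ β : ℝ) :
    ∃ K : ℝ, 0 ≤ K ∧ ∀ S : Model d, S.β = β → S.Admissible C₁ C₂ C₃ C₄ C₆ C₇ →
      ∀ (σ : ℤˣ) (p h : Mom d) (τ : ℝ), ‖∫ x, S.pairOsc σ p h τ x‖ ≤
        ((1 + |τ| * ‖h‖) ^ 3)⁻¹ * (K * ∫ x, decay (x + h) * decay (d := d) x) := by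
  -- The constants are arbitrary real numbers; for nonpositive `C₃` there is no admissible model and
  -- any constant will do.
  by_cases hC₃ : 0 < C₃
  swap
  · exact ⟨0, le_rfl, fun S _ hS => absurd hS.C₃_pos hC₃⟩
  obtain ⟨K, hK0, hK⟩ := Model.Admissible.exists_derivBound_M hd β C₂ C₆ C₇
  obtain ⟨B, hB0, hB⟩ := DerivBound.inv_exists (E := Mom d) C₃ (2 * |C₁| + 2 * |C₂|) hC₃
    (by positivity) 3
  -- The maximum covers both the trivial bound (constant one) and three integrations by parts.
  set R := max 1 (64 * B ^ 3)
  refine ⟨8 * (R * (2 ^ 3 * (K * K))), by positivity, fun S hβ hS σ p h τ => ?_⟩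
  have hw : Integrable (fun x : Mom d => decay (x + h) * decay x) := by
    refine (integrable_decay (d := d)).bdd_mul (c := 1)
      ((continuous_decay.comp (continuous_add_const h)).aestronglyMeasurable)
      (Eventually.of_forall fun x => ?_)
    rw [Real.norm_eq_abs, abs_of_pos (decay_pos _)]
    exact decay_le_one _
  have ha : ∀ u : Mom d, ‖u‖ = 1 → DerivBound u (fun x => decay (x + h) * decay x) 3
      (2 ^ 3 * (K * K)) fun x => S.M (x + h) σ * S.M x σ := fun u hu =>
    ((hK S C₁ C₃ C₄ hβ hS σ u hu).comp_add h).mul (hK S C₁ C₃ C₄ hβ hS σ u hu)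
  have hI : 0 ≤ ∫ x, decay (x + h) * decay (d := d) x :=
    integral_nonneg fun x => (mul_pos (decay_pos _) (decay_pos _)).le
  have hR1 : 1 ≤ R := le_max_left _ _
  have hR2 : 64 * B ^ 3 ≤ R := le_max_right _ _
  have hΦc := (hS.Phi_bound σ p).1
  have hψ : Continuous fun x => S.Phi σ p (x + h) - S.Phi σ p x := by
    have := hΦc.continuous; fun_prop
  have e : 8 * (R * (2 ^ 3 * (K * K))) * ∫ x, decay (x + h) * decay (d := d) x =
      8 * (R * ((2 ^ 3 * (K * K)) * ∫ x, decay (x + h) * decay (d := d) x)) := by ring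
  rw [e]
  have hKI : 0 ≤ (2 ^ 3 * (K * K)) * ∫ x, decay (x + h) * decay (d := d) x := by positivity
  refine one_add_pow_three_bound (by positivity) (by positivity) ?_ ?_
  -- The sup bound on the amplitude is read off from its derivative bound in an arbitrary unit
  -- direction.
  · have : Nontrivial (Mom d) := by
      have : Nonempty (Fin d) := ⟨⟨0, by omega⟩⟩
      infer_instance
    obtain ⟨u, hu⟩ := exists_norm_eq (Mom d) (zero_le_one (α := ℝ))
    have h1 := norm_integral_cexp_mul_le (ψ := fun x => S.Phi σ p (x + h) - S.Phi σ p x)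
      (ha u hu).base.2 hw τ
    refine h1.trans ?_
    nlinarith
  · intro hpos
    have hτ : τ ≠ 0 := by rintro rfl; simp at hpos
    have hh : h ≠ 0 := by rintro rfl; simp at hpos
    have hn : 0 < ‖h‖ := norm_pos_iff.mpr hh
    -- All integrations by parts run in the direction of `h`, where convexity gives a definite sign.
    set u := ‖h‖⁻¹ • h with hu_def
    have hu : ‖u‖ = 1 := by
      rw [hu_def, norm_smul, norm_inv, norm_norm, inv_mul_cancel₀ hn.ne']
    set g : ℕ → Mom d → ℝ := fun i x => iteratedFDeriv ℝ i (S.Phi σ p) x fun _ => u with hg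
    have hgd : ∀ i, i ≤ 4 → ∀ x, HasLineDerivAt ℝ (g i) (g (i + 1) x) x u := fun i hi x =>
      hasLineDerivAt_iteratedFDeriv hΦc (by omega) x u
    -- Directional derivatives up to order five enter: two of the phase to bound the quotient `V`,
    -- and three more for the integrations by parts. Order five is available because `d ≥ 3`.
    have hgb : ∀ i j, 2 ≤ i → i + j ≤ 5 →
        DerivBound u (fun _ => 1) j (2 * |C₁| + 2 * |C₂|) (g i) := fun i j hi hij =>
      DerivBound.of_iteratedFDeriv_aux hΦc hu i j (by omega) fun l hl hl' x => by
        rw [mul_one]; exact (hS.Phi_bound σ p).2 l (by omega) (by omega) x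
    have hg1 : Continuous (g 1) := by
      have := hΦc.continuous_iteratedFDeriv (m := 1) (by exact_mod_cast (by omega : 1 ≤ 2 * d))
      exact (ContinuousMultilinearMap.apply ℝ (fun _ : Fin 1 => Mom d) ℝ
        (fun _ => u)).continuous.comp this
    -- The lower Hessian bound enters here. The difference quotient of the first derivative is a
    -- second derivative along `u` at an intermediate point, so the differenced phase has no
    -- critical point for `h ≠ 0`.
    have hVlow : ∀ x, C₃ ≤ ‖h‖⁻¹ * (g 1 (x + h) - g 1 x) := by
      intro x
      obtain ⟨y, -, hy⟩ := exists_lineDeriv_eq_slope hh (hgd 1 (by norm_num)) x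
      rw [hy]
      have := hS.hess_lower σ p y u
      rw [hu] at this
      have e2 : (![u, u] : Fin 2 → Mom d) = fun _ => u := by
        funext i; fin_cases i <;> rfl
      rw [e2] at this
      simpa using this
    have hVc : Continuous fun x => ‖h‖⁻¹ * (g 1 (x + h) - g 1 x) := by fun_prop
    have hVd : ∀ x, HasLineDerivAt ℝ (fun x => ‖h‖⁻¹ * (g 1 (x + h) - g 1 x))
        (‖h‖⁻¹ * (g 2 (x + h) - g 2 x)) x u := by
      intro x
      have h1 : HasDerivAt (fun t : ℝ => g 1 (x + t • u + h)) (g 2 (x + h)) 0 :=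
        hasLineDerivAt_comp_add h (hgd 1 (by norm_num) (x + h))
      exact HasDerivAt.const_mul _ (HasDerivAt.sub h1 (hgd 1 (by norm_num) x))
    have hb := hB u _ _ hVc hVlow hVd
      (DerivBound.diffQuot hh (hgb 2 2 le_rfl (by norm_num)).base.1 (hgd 2 (by norm_num))
        (hgb 3 2 (by norm_num) (by norm_num)))
    have hψV : ∀ x, HasLineDerivAt ℝ (fun x => S.Phi σ p (x + h) - S.Phi σ p x)
        (‖h‖ * (‖h‖⁻¹ * (g 1 (x + h) - g 1 x))) x u := by
      intro x
      rw [mul_inv_cancel_left₀ hn.ne']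
      have h0 : ∀ x, HasLineDerivAt ℝ (S.Phi σ p) (g 1 x) x u := fun x => by
        simpa [hg] using hgd 0 (by norm_num) x
      have h1 : HasDerivAt (fun t : ℝ => S.Phi σ p (x + t • u + h)) (g 1 (x + h)) 0 :=
        hasLineDerivAt_comp_add h (h0 (x + h))
      exact HasDerivAt.sub h1 (h0 x)
    have h1 := oscillatory_three hψ (fun x => (hC₃.trans_le (hVlow x)).ne') hn hτ hψV
      (ha u hu) hb hw
    refine h1.trans (mul_le_mul_of_nonneg_left ?_ (by positivity))
    calc _ = 64 * B ^ 3 * ((2 ^ 3 * (K * K)) * ∫ x, decay (x + h) * decay (d := d) x) := by ring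
      _ ≤ _ := mul_le_mul_of_nonneg_right hR2 hKI

/-- Prepares the comparison of lattice sums of the differenced amplitude with integrals. The phase
contributes `|τ| ‖h‖`, the form factors contribute a constant, and both decay factors survive a
displacement of length at most one. -/
theorem exists_pairOsc_lipschitz (hd : 3 ≤ d) (C₁ C₂ C₃ C₄ C₆ C₇ β : ℝ) :
    ∃ K : ℝ, 0 ≤ K ∧ ∀ S : Model d, S.β = β → S.Admissible C₁ C₂ C₃ C₄ C₆ C₇ →
      ∀ (σ : ℤˣ) (p h : Mom d) (τ : ℝ) (x y : Mom d), ‖y - x‖ ≤ 1 →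
        ‖S.pairOsc σ p h τ y - S.pairOsc σ p h τ x‖ ≤
        ‖y - x‖ * ((1 + |τ| * ‖h‖) * (K * (decay (x + h) * decay x))) := by
  obtain ⟨K, hK0, hK⟩ := Model.Admissible.exists_derivBound_M hd β C₂ C₆ C₇
  set A := 2 * |C₁| + 2 * |C₂|
  set c : ℝ := 2 ^ (d + 3)
  refine ⟨A * ((K * c) * (K * c)) + 2 * ((K * c) * (K * c)), by positivity, ?_⟩
  intro S hβ hS σ p h τ x y hxy
  have hc : 1 ≤ c := one_le_pow₀ (by norm_num)
  have hM : ∀ u : Mom d, ‖u‖ = 1 → DerivBound u decay 1 K fun k => S.M k σ := fun u hu =>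
    (hK S C₁ C₃ C₄ hβ hS σ u hu).of_succ.of_succ
  have : Nontrivial (Mom d) := by
    have : Nonempty (Fin d) := ⟨⟨0, by omega⟩⟩
    infer_instance
  obtain ⟨u, hu⟩ := exists_norm_eq (Mom d) (zero_le_one (α := ℝ))
  have hMb := (hM u hu).base.2
  have hshift : y + h - (x + h) = y - x := by abel
  have l1 := abs_sub_le_of_derivBound hK0 hM hxy
  have l2 := abs_sub_le_of_derivBound hK0 hM (x := x + h) (y := y + h) (by rwa [hshift])
  rw [hshift] at l2
  have b1 : |S.M y σ| ≤ K * c * decay x := (hMb y).trans (by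
    rw [mul_assoc]; exact mul_le_mul_of_nonneg_left (decay_le hxy) hK0)
  have b2 : |S.M (y + h) σ| ≤ K * c * decay (x + h) := (hMb _).trans (by
    rw [mul_assoc]; exact mul_le_mul_of_nonneg_left (decay_le (by rwa [hshift])) hK0)
  have b3 : |S.M (x + h) σ| ≤ K * c * decay (x + h) := (hMb _).trans (by
    rw [mul_assoc]
    refine mul_le_mul_of_nonneg_left ?_ hK0
    nlinarith [decay_pos (x + h)])
  have d1 := decay_pos x
  have d2 := decay_pos (x + h)
  set D := (K * c) * (K * c) * (decay (x + h) * decay x) with hD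
  have hD0 : 0 ≤ D := by positivity
  have p1 : |S.M (y + h) σ * S.M y σ| ≤ D := by
    rw [abs_mul]
    calc _ ≤ (K * c * decay (x + h)) * (K * c * decay x) :=
          mul_le_mul b2 b1 (abs_nonneg _) (by positivity)
      _ = D := by rw [hD]; ring
  have p2 : |S.M (y + h) σ * S.M y σ - S.M (x + h) σ * S.M x σ| ≤ ‖y - x‖ * (2 * D) := by
    have e : S.M (y + h) σ * S.M y σ - S.M (x + h) σ * S.M x σ =
      (S.M (y + h) σ - S.M (x + h) σ) * S.M y σ + S.M (x + h) σ * (S.M y σ - S.M x σ) := by ring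
    rw [e]
    refine (abs_add_le _ _).trans ?_
    rw [abs_mul, abs_mul]
    have q1 := mul_le_mul l2 b1 (abs_nonneg _) (by positivity)
    have q2 := mul_le_mul b3 l1 (abs_nonneg _) (by positivity)
    refine (add_le_add q1 q2).trans (le_of_eq ?_)
    rw [hD]; ring
  have p3 : |τ * (S.Phi σ p (y + h) - S.Phi σ p y) - τ * (S.Phi σ p (x + h) - S.Phi σ p x)| ≤
      |τ| * (A * ‖h‖ * ‖y - x‖) := by
    rw [← mul_sub, abs_mul]
    exact mul_le_mul_of_nonneg_left (hS.Phi_diff_lipschitz hd σ p h x y) (abs_nonneg _)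
  refine (norm_osc_sub_le _ _ _ _).trans ?_
  refine (add_le_add (mul_le_mul p3 p1 (abs_nonneg _) (by positivity)) p2).trans ?_
  have e : ‖y - x‖ * ((1 + |τ| * ‖h‖) * ((A * ((K * c) * (K * c)) + 2 * ((K * c) * (K * c))) *
      (decay (x + h) * decay x))) = ‖y - x‖ * ((1 + |τ| * ‖h‖) * ((A + 2) * D)) := by
    rw [hD]; ring
  rw [e]
  have hA : 0 ≤ A := by positivity
  have r1 : 0 ≤ ‖y - x‖ * (A * D) := by positivity
  have r2 : 0 ≤ ‖y - x‖ * (|τ| * ‖h‖ * (2 * D)) := by positivity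
  nlinarith

end Polaron
end


/-! ### Rounding to the dual lattice and comparison of sums with integrals. -/

noncomputable section

set_option linter.unusedSectionVars false

namespace Polaron

variable {d : ℕ}

/-- The spacing of the dual lattice. -/
def spacing (L : ℝ) : ℝ := Real.sqrt (2 * Real.pi) / L

theorem spacing_pos {L : ℝ} (hL : 0 < L) : 0 < spacing L :=
  div_pos (Real.sqrt_pos.mpr (by positivity)) hL

/-- The label of the lattice cell containing a momentum. -/
def cellIndex (L : ℝ) (x : Mom d) : Mode d := fun i => ⌊x i / spacing L⌋

/-- Rounding to the dual lattice. -/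
def roundMom (L : ℝ) (x : Mom d) : Mom d := mom L (cellIndex L x)

theorem measurable_cellIndex (L : ℝ) : Measurable (cellIndex (d := d) L) := by
  refine measurable_pi_iff.mpr fun i => Int.measurable_floor.comp ?_
  fun_prop

theorem measurable_mom (L : ℝ) : Measurable (mom (d := d) L) := measurable_of_countable _

theorem measurable_roundMom (L : ℝ) : Measurable (roundMom (d := d) L) :=
  (measurable_mom L).comp (measurable_cellIndex L)

theorem mom_add (L : ℝ) (a b : Mode d) : mom L (a + b) = mom L a + mom L b := by
  ext i; simp [mom]; ring

theorem mom_neg (L : ℝ) (a : Mode d) : mom L (-a) = -mom L a := by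
  ext i; simp [mom]

theorem mom_zero (L : ℝ) : mom L (0 : Mode d) = 0 := by
  ext i; simp [mom]

theorem norm_roundMom_sub_le {L : ℝ} (hL : 0 < L) (x : Mom d) :
    ‖roundMom L x - x‖ ≤ d * spacing L := by
  have hs := spacing_pos hL
  have hi : ∀ i, ‖(roundMom L x - x) i‖ ≤ spacing L := by
    intro i
    have e : (roundMom L x - x) i = spacing L * (⌊x i / spacing L⌋ : ℝ) - x i := by
      simp [roundMom, mom, cellIndex, spacing]
    rw [e, Real.norm_eq_abs, abs_le]
    have h1 := Int.floor_le (x i / spacing L)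
    have h2 := Int.lt_floor_add_one (x i / spacing L)
    rw [le_div_iff₀ hs] at h1
    rw [div_lt_iff₀ hs] at h2
    constructor <;> linarith
  rw [EuclideanSpace.norm_eq]
  apply Real.sqrt_le_left (by positivity) |>.mpr
  calc ∑ i, ‖(roundMom L x - x) i‖ ^ 2 ≤ ∑ _i : Fin d, spacing L ^ 2 :=
        Finset.sum_le_sum fun i _ => pow_le_pow_left₀ (norm_nonneg _) (hi i) 2
    _ = d * spacing L ^ 2 := by simp
    -- Using `d` in place of the sharp `√d` keeps square roots out of later conditions.
    _ ≤ (d * spacing L) ^ 2 := by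
        rw [mul_pow]
        refine mul_le_mul_of_nonneg_right ?_ (by positivity)
        rcases Nat.eq_zero_or_pos d with rfl | h
        · simp
        · have : (1 : ℝ) ≤ d := by exact_mod_cast h
          nlinarith

theorem map_cellIndex {L : ℝ} (hL : 0 < L) :
    (volume : Measure (Mom d)).map (cellIndex L) = ENNReal.ofReal (spacing L ^ d) •
      (Measure.count : Measure (Mode d)) := by
  have hs := spacing_pos hL
  refine Measure.ext_of_singleton fun m => ?_
  rw [Measure.map_apply (measurable_cellIndex L) (MeasurableSet.singleton m), Measure.smul_apply,
    Measure.count_singleton, smul_eq_mul, mul_one]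
  have e : cellIndex (d := d) L ⁻¹' {m} = (WithLp.ofLp : Mom d → (Fin d → ℝ)) ⁻¹'
      (Set.univ.pi fun i => Set.Ico (spacing L * m i) (spacing L * m i + spacing L)) := by
    ext x
    simp only [Set.mem_preimage, Set.mem_singleton_iff, cellIndex, funext_iff, Int.floor_eq_iff,
      Set.mem_univ_pi, Set.mem_Ico, le_div_iff₀ hs, div_lt_iff₀ hs]
    refine forall_congr' fun i => ?_
    rw [mul_comm (m i : ℝ), add_mul, one_mul, mul_comm (m i : ℝ)]
  rw [e, (PiLp.volume_preserving_ofLp (Fin d)).measure_preimage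
    (MeasurableSet.univ_pi fun i => measurableSet_Ico).nullMeasurableSet, Real.volume_pi_Ico]
  simp [ENNReal.ofReal_pow hs.le]

theorem latticeMeasure_eq_count {L : ℝ} : latticeMeasure d L =
    ENNReal.ofReal ((L ^ d)⁻¹) • (Measure.count : Measure (Mode d)).map (mom L) := by
  rw [latticeMeasure, Measure.count, Measure.map_sum (measurable_mom L).aemeasurable]
  congr 2
  funext m
  exact (Measure.map_dirac' (measurable_mom L) m).symm

/-- The normalisation of the continuum measure is matched to the volume of a lattice cell, so that
rounding transports one momentum measure exactly to the other. -/
theorem spacing_const {L : ℝ} (hL : 0 < L) :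
    ((2 * Real.pi) ^ ((d : ℝ) / 2))⁻¹ * spacing L ^ d = (L ^ d)⁻¹ := by
  have h : (0 : ℝ) < 2 * Real.pi := by positivity
  have : Real.sqrt (2 * Real.pi) ^ d = (2 * Real.pi) ^ ((d : ℝ) / 2) := by
    rw [Real.sqrt_eq_rpow, ← Real.rpow_natCast, ← Real.rpow_mul h.le]
    congr 1; ring
  rw [spacing, div_pow, this]
  have := Real.rpow_pos_of_pos h ((d : ℝ) / 2)
  field_simp

/-- The lattice measure is the image of the continuum measure under rounding. -/
theorem latticeMeasure_eq_map {L : ℝ} (hL : 0 < L) :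
    latticeMeasure d L = (fullMeasure d).map (roundMom L) := by
  have e : roundMom (d := d) L = mom L ∘ cellIndex L := rfl
  rw [latticeMeasure_eq_count, fullMeasure, Measure.map_smul, e,
    ← Measure.map_map (measurable_mom L) (measurable_cellIndex L), map_cellIndex hL,
    Measure.map_smul, smul_smul, ← ENNReal.ofReal_mul (by positivity), spacing_const hL]

theorem fullMeasure_const_pos : 0 < ((2 * Real.pi) ^ ((d : ℝ) / 2))⁻¹ :=
  inv_pos.mpr (Real.rpow_pos_of_pos (by positivity) _)

theorem fullMeasure_const_le : ((2 * Real.pi) ^ ((d : ℝ) / 2))⁻¹ ≤ 1 := by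
  refine inv_le_one_of_one_le₀ (Real.one_le_rpow ?_ (by positivity))
  nlinarith [Real.pi_gt_three]

theorem integrable_fullMeasure_iff {F : Type*} [NormedAddCommGroup F] {f : Mom d → F} :
    Integrable f (fullMeasure d) ↔ Integrable f := by
  unfold fullMeasure
  refine integrable_smul_measure ?_ ENNReal.ofReal_ne_top
  rw [ne_eq, ENNReal.ofReal_eq_zero, not_le]
  exact fullMeasure_const_pos

theorem integral_fullMeasure {F : Type*} [NormedAddCommGroup F] [NormedSpace ℝ F] (f : Mom d → F) :
    ∫ x, f x ∂(fullMeasure d) = ((2 * Real.pi) ^ ((d : ℝ) / 2))⁻¹ • ∫ x, f x := by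
  rw [fullMeasure, integral_smul_measure, ENNReal.toReal_ofReal fullMeasure_const_pos.le]

theorem integral_latticeMeasure {L : ℝ} (hL : 0 < L) {F : Type*} [NormedAddCommGroup F]
    [NormedSpace ℝ F] {f : Mom d → F} (hf : StronglyMeasurable f) :
    ∫ x, f x ∂(latticeMeasure d L) = ∫ x, f (roundMom L x) ∂(fullMeasure d) := by
  rw [latticeMeasure_eq_map hL, integral_map (measurable_roundMom L).aemeasurable
    hf.aestronglyMeasurable]

theorem integrable_latticeMeasure_iff {L : ℝ} (hL : 0 < L) {F : Type*} [NormedAddCommGroup F]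
    {f : Mom d → F} (hf : StronglyMeasurable f) :
    Integrable f (latticeMeasure d L) ↔ Integrable (fun x => f (roundMom L x)) := by
  rw [latticeMeasure_eq_map hL, integrable_map_measure hf.aestronglyMeasurable
    (measurable_roundMom L).aemeasurable]
  exact integrable_fullMeasure_iff

theorem integrable_latticeMeasure_iff_summable {L : ℝ} (hL : 0 < L) {F : Type*}
    [NormedAddCommGroup F] {f : Mom d → F} (hf : StronglyMeasurable f) :
    Integrable f (latticeMeasure d L) ↔ Summable fun m => ‖f (mom L m)‖ := by
  rw [latticeMeasure_eq_count, integrable_smul_measure ?_ ENNReal.ofReal_ne_top,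
    integrable_map_measure hf.aestronglyMeasurable (measurable_mom L).aemeasurable,
    integrable_count_iff]
  · rfl
  · rw [ne_eq, ENNReal.ofReal_eq_zero, not_le]
    positivity

theorem integral_latticeMeasure_eq_tsum {L : ℝ} (hL : 0 < L) {F : Type*} [NormedAddCommGroup F]
    [NormedSpace ℝ F] [CompleteSpace F] {f : Mom d → F} (hf : StronglyMeasurable f)
    (hi : Integrable f (latticeMeasure d L)) :
    ∫ x, f x ∂(latticeMeasure d L) = (L ^ d)⁻¹ • ∑' m, f (mom L m) := by
  have hs := (integrable_latticeMeasure_iff_summable hL hf).mp hi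
  rw [latticeMeasure_eq_count, integral_smul_measure,
    integral_map (measurable_mom L).aemeasurable hf.aestronglyMeasurable,
    ENNReal.toReal_ofReal (by positivity), integral_countable (integrable_count_iff.mpr hs)]
  simp [Measure.real]

/-- A lattice sum is the integral of the rounded function, and in a large box rounding moves a point
by at most one. Any majorant that tolerates such displacements therefore controls all lattice sums
at once. -/
theorem integral_roundMom_le {L : ℝ} (hL : 0 < L) (hL' : d * spacing L ≤ 1) {φ ψ : Mom d → ℝ}
    (hφ : Continuous φ) (h0 : ∀ x, 0 ≤ φ x) (hψ : Integrable ψ)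
    (h : ∀ x y, ‖y - x‖ ≤ 1 → φ y ≤ ψ x) :
    Integrable φ (latticeMeasure d L) ∧ ∫ x, φ x ∂(latticeMeasure d L) ≤ ∫ x, ψ x := by
  have hle : ∀ x, φ (roundMom L x) ≤ ψ x := fun x => h _ _ ((norm_roundMom_sub_le hL x).trans hL')
  have hi : Integrable (fun x => φ (roundMom L x)) := by
    refine hψ.mono' (hφ.measurable.comp (measurable_roundMom L)).aestronglyMeasurable ?_
    refine Eventually.of_forall fun x => ?_
    rw [Real.norm_eq_abs, abs_of_nonneg (h0 _)]
    exact hle x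
  refine ⟨(integrable_latticeMeasure_iff hL hφ.stronglyMeasurable).mpr hi, ?_⟩
  rw [integral_latticeMeasure hL hφ.stronglyMeasurable, integral_fullMeasure, smul_eq_mul]
  have h1 : 0 ≤ ∫ x, φ (roundMom L x) := integral_nonneg fun x => h0 _
  calc _ ≤ 1 * ∫ x, φ (roundMom L x) := mul_le_mul_of_nonneg_right fullMeasure_const_le h1
    _ ≤ _ := by rw [one_mul]; exact integral_mono hi hψ hle

/-- Comparison of lattice sums with integrals. -/
theorem norm_integral_lattice_sub_le {L : ℝ} (hL : 0 < L) (hL' : d * spacing L ≤ 1)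
    {g : Mom d → ℂ} {G : Mom d → ℝ} (hg : Continuous g) (hgi : Integrable g)
    (hG : Integrable G) (hG0 : ∀ x, 0 ≤ G x)
    (h : ∀ x y, ‖y - x‖ ≤ 1 → ‖g y - g x‖ ≤ ‖y - x‖ * G x) :
    Integrable g (latticeMeasure d L) ∧
    ‖∫ x, g x ∂(latticeMeasure d L) - ∫ x, g x ∂(fullMeasure d)‖ ≤
      d * spacing L * ∫ x, G x := by
  have hs := spacing_pos hL
  have hle : ∀ x, ‖g (roundMom L x) - g x‖ ≤ d * spacing L * G x := fun x =>
    (h _ _ ((norm_roundMom_sub_le hL x).trans hL')).trans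
      (mul_le_mul_of_nonneg_right (norm_roundMom_sub_le hL x) (hG0 x))
  have hm : StronglyMeasurable fun x => g (roundMom L x) :=
    (hg.measurable.comp (measurable_roundMom L)).stronglyMeasurable
  have hd : Integrable (fun x => g (roundMom L x) - g x) :=
    (hG.const_mul (d * spacing L)).mono' (hm.sub hg.stronglyMeasurable).aestronglyMeasurable
      (Eventually.of_forall hle)
  have hi : Integrable (fun x => g (roundMom L x)) := (hd.add hgi).congr (Eventually.of_forall fun x => by simp)
  refine ⟨(integrable_latticeMeasure_iff hL hg.stronglyMeasurable).mpr hi, ?_⟩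
  rw [integral_latticeMeasure hL hg.stronglyMeasurable, integral_fullMeasure, integral_fullMeasure,
    ← smul_sub, ← integral_sub hi hgi, norm_smul, Real.norm_eq_abs,
    abs_of_pos fullMeasure_const_pos]
  calc _ ≤ 1 * ‖∫ x, (g (roundMom L x) - g x)‖ :=
        mul_le_mul_of_nonneg_right fullMeasure_const_le (norm_nonneg _)
    _ ≤ ∫ x, d * spacing L * G x := by
        rw [one_mul]
        exact norm_integral_le_of_norm_le (hG.const_mul _) (Eventually.of_forall hle)
    _ = _ := integral_const_mul _ _

theorem tendsto_spacing : Tendsto spacing atTop (nhds 0) :=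
  tendsto_const_nhds.div_atTop tendsto_id

/-- Differencing of an exponential sum: the double sum in the square is reindexed by `(m + h, m)`
and the triangle inequality is applied to the sum over `h` only. Oscillation in `m` at fixed `h` is
retained. -/
theorem norm_tsum_sq_le {G : Type*} [AddCommGroup G] {a : G → ℂ} (ha : Summable fun m => ‖a m‖) :
    ‖∑' m, a m‖ ^ 2 ≤ ∑' h, ‖∑' m, a (m + h) * (starRingEnd ℂ) (a m)‖ ∧
      Summable fun h => ‖∑' m, a (m + h) * (starRingEnd ℂ) (a m)‖ := by
  set b : G → ℂ := fun m => (starRingEnd ℂ) (a m) with hb_def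
  have hb : Summable fun m => ‖b m‖ := by
    simpa only [hb_def, RCLike.norm_conj] using ha
  change _ ≤ ∑' h, ‖∑' m, a (m + h) * b m‖ ∧ Summable fun h => ‖∑' m, a (m + h) * b m‖
  have hs : Summable fun q : G × G => a q.1 * b q.2 := summable_mul_of_summable_norm ha hb
  let e : G × G ≃ G × G := 
    { toFun := fun q => (q.2 + q.1, q.2)
      invFun := fun q => (q.1 - q.2, q.2)
      left_inv := fun q => by simp
      right_inv := fun q => by simp }
  have hs' : Summable fun q : G × G => a (q.2 + q.1) * b q.2 := e.summable_iff.mpr hs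
  have hsn : Summable fun h => ‖∑' m, a (m + h) * b m‖ := by
    refine Summable.of_nonneg_of_le (fun _ => norm_nonneg _) (fun h => ?_) hs'.norm.prod
    exact norm_tsum_le_tsum_norm (hs'.norm.prod_factor h)
  refine ⟨?_, hsn⟩
  have e2 : ∑' q : G × G, a (q.2 + q.1) * b q.2 = ∑' q : G × G, a q.1 * b q.2 :=
    e.tsum_eq (fun q : G × G => a q.1 * b q.2)
  have e3 : ∑' m, b m = (starRingEnd ℂ) (∑' m, a m) := (Complex.conj_tsum a).symm
  have e1 : ‖∑' m, a m‖ ^ 2 = ‖∑' h, ∑' m, a (m + h) * b m‖ := by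
    rw [← hs'.tsum_prod, e2, ← tsum_mul_tsum_of_summable_norm ha hb, e3, norm_mul,
      RCLike.norm_conj, sq]
  rw [e1]
  exact norm_tsum_le_tsum_norm hsn

end Polaron
end


/-! ### The dispersive estimate. -/

noncomputable section

set_option linter.unusedSectionVars false

namespace Polaron

variable {d : ℕ}

theorem nontrivial_mom (hd : 3 ≤ d) : Nontrivial (Mom d) := by
  have : Nonempty (Fin d) := ⟨⟨0, by omega⟩⟩
  infer_instance

theorem integrable_decay_mul (h : Mom d) : Integrable fun x : Mom d => decay (x + h) * decay x := by
  refine (integrable_decay (d := d)).bdd_mul (c := 1)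
    ((continuous_decay.comp (continuous_add_const h)).aestronglyMeasurable)
    (Eventually.of_forall fun x => ?_)
  rw [Real.norm_eq_abs, abs_of_pos (decay_pos _)]
  exact decay_le_one _

/-- At least one of `x` and `x + h` carries half of the weight of `h`. Pulling that factor out
leaves an integrable one, so the overlap of two decaying amplitudes decays in their distance. -/
theorem integral_decay_mul_le (h : Mom d) :
    ∫ x, decay (x + h) * decay (d := d) x ≤
      2 ^ (d + 4) * (∫ x, decay (d := d) x) * decay h := by
  have hle : ∀ x : Mom d, decay (x + h) * decay x ≤
      2 ^ (d + 3) * decay h * (decay x + decay (x + h)) := by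
    intro x
    have half : ∀ y : Mom d, jap h ≤ 2 * jap y → decay y ≤ 2 ^ (d + 3) * decay h := by
      intro y hy
      unfold decay
      rw [inv_eq_one_div, ← div_eq_mul_inv, div_le_div_iff₀ (pow_pos (jap_pos y) _)
        (pow_pos (jap_pos h) _), one_mul, ← mul_pow]
      exact pow_le_pow_left₀ (jap_pos h).le hy _
    have hsum : jap h ≤ jap (x + h) + jap x := by
      have : ‖h‖ ≤ ‖x + h‖ + ‖x‖ := by
        have := norm_sub_le (x + h) x
        simpa using this
      unfold jap; linarith
    have d0 := decay_pos x
    have d1 := decay_pos (x + h)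
    have d2 := decay_pos h
    have c : (0 : ℝ) < 2 ^ (d + 3) := by positivity
    rcases le_total (jap (x + h)) (jap x) with hc | hc
    · have := half x (by linarith)
      nlinarith [mul_pos (mul_pos c d2) d0]
    · have := half (x + h) (by linarith)
      nlinarith [mul_pos (mul_pos c d2) d1]
  have hi := integrable_decay (d := d)
  have hi' : Integrable fun x : Mom d => decay (x + h) := hi.comp_add_right h
  calc _ ≤ ∫ x, 2 ^ (d + 3) * decay h * (decay x + decay (x + h)) :=
        integral_mono (integrable_decay_mul h) ((hi.add hi').const_mul _) hle
    _ = _ := by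
      rw [integral_const_mul, integral_add hi hi', integral_add_right_eq_self (fun x => decay x) h]
      ring

/-- The cube is weakened to the power `5/2`, because `‖x‖^{-5/2}` is integrable at the origin in
every dimension `d ≥ 3`, whereas `‖x‖^{-3}` is not for `d = 3`. The exponent is still large enough:
its half `5/4` exceeds one and is integrable in time. -/
theorem exists_singular_integral_bound (hd : 3 ≤ d) : ∃ C : ℝ, 0 ≤ C ∧ ∀ τ : ℝ, 0 ≤ τ →
    Integrable (fun x : Mom d => ((1 + τ * ‖x‖) ^ 3)⁻¹ * decay x) ∧
    ∫ x : Mom d, ((1 + τ * ‖x‖) ^ 3)⁻¹ * decay x ≤ C * (1 + τ) ^ (-(5 / 2) : ℝ) := by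
  have := nontrivial_mom hd
  have hsing : Integrable (fun x : Mom d => (Metric.ball (0 : Mom d) 1).indicator
      (fun x => ‖x‖ ^ (-(5 / 2) : ℝ)) x) := by
    rw [integrable_indicator_iff Metric.isOpen_ball.measurableSet]
    refine (integrableOn_fun_norm_addHaar (E := Mom d) volume
      (f := fun y => y ^ (-(5 / 2) : ℝ))).mpr ?_
    have h1 : IntegrableOn (fun y : ℝ => y ^ ((d : ℝ) - 1 - 5 / 2)) (Set.Ioo 0 1) := by
      refine (intervalIntegral.integrableOn_Ioo_rpow_iff one_pos).mpr ?_
      have : (3 : ℝ) ≤ d := by exact_mod_cast hd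
      linarith
    refine h1.congr_fun (fun y hy => ?_) measurableSet_Ioo
    have hdim : Module.finrank ℝ (Mom d) = d := by simp
    simp only [smul_eq_mul, hdim]
    rw [← Real.rpow_natCast, ← Real.rpow_add hy.1]
    congr 1
    rw [Nat.cast_sub (by omega)]; push_cast; ring
  have hdec := integrable_decay (d := d)
  refine ⟨∫ x : Mom d, (decay x + (Metric.ball (0 : Mom d) 1).indicator
      (fun x => ‖x‖ ^ (-(5 / 2) : ℝ)) x), ?_, fun τ hτ => ?_⟩
  · refine integral_nonneg fun x => add_nonneg (decay_pos x).le ?_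
    exact Set.indicator_nonneg (fun y _ => Real.rpow_nonneg (norm_nonneg _) _) _
  have hint : Integrable (fun x : Mom d => ((1 + τ * ‖x‖) ^ 3)⁻¹ * decay x) := by
    refine hdec.bdd_mul (c := 1) ?_ (Eventually.of_forall fun x => ?_)
    · refine Continuous.aestronglyMeasurable ?_
      refine Continuous.inv₀ (by fun_prop) fun x => ?_
      positivity
    · have : (1 : ℝ) ≤ (1 + τ * ‖x‖) ^ 3 :=
        one_le_pow₀ (by nlinarith [mul_nonneg hτ (norm_nonneg x)])
      rw [Real.norm_eq_abs, abs_of_nonneg (by positivity)]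
      exact inv_le_one_of_one_le₀ this
  refine ⟨hint, ?_⟩
  rw [mul_comm, ← integral_const_mul]
  have hae : ∀ᵐ x : Mom d, x ≠ 0 := by
    have : (volume : Measure (Mom d)) {0} = 0 := measure_singleton 0
    exact (measure_eq_zero_iff_ae_notMem.mp this).mono fun x hx => by simpa using hx
  refine integral_mono_ae hint ((hdec.add hsing).const_mul _) ?_
  filter_upwards [hae] with x hx
  have hx0 : 0 < ‖x‖ := norm_pos_iff.mpr hx
  have h1τ : 0 < 1 + τ := by linarith
  have h2 : 0 < 1 + τ * ‖x‖ := by positivity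
  have hA : ((1 + τ * ‖x‖) ^ 3)⁻¹ ≤ (1 + τ * ‖x‖) ^ (-(5 / 2) : ℝ) := by
    rw [← Real.rpow_natCast, ← Real.rpow_neg h2.le]
    refine Real.rpow_le_rpow_of_exponent_le ?_ (by norm_num)
    nlinarith [mul_nonneg hτ hx0.le]
  have hdp := decay_pos x
  have hpw : 0 < (1 + τ) ^ (-(5 / 2) : ℝ) := Real.rpow_pos_of_pos h1τ _
  have hpx : 0 ≤ ‖x‖ ^ (-(5 / 2) : ℝ) := Real.rpow_nonneg hx0.le _
  show ((1 + τ * ‖x‖) ^ 3)⁻¹ * decay x ≤ (1 + τ) ^ (-(5 / 2) : ℝ) * (decay x + _)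
  rcases lt_or_ge ‖x‖ 1 with h | h
  · rw [Set.indicator_of_mem (by simpa using h)]
    -- Inside the unit ball `1 + τ‖x‖ ≥ (1 + τ)‖x‖`, which separates the time decay from an
    -- integrable singularity.
    have hB : (1 + τ * ‖x‖) ^ (-(5 / 2) : ℝ) ≤ (1 + τ) ^ (-(5 / 2) : ℝ) * ‖x‖ ^ (-(5 / 2) : ℝ) := by
      rw [← Real.mul_rpow h1τ.le hx0.le]
      exact Real.rpow_le_rpow_of_nonpos (by positivity) (by nlinarith) (by norm_num)
    calc _ ≤ ((1 + τ) ^ (-(5 / 2) : ℝ) * ‖x‖ ^ (-(5 / 2) : ℝ)) * 1 :=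
          mul_le_mul (hA.trans hB) (decay_le_one x) hdp.le (by positivity)
      _ ≤ _ := by nlinarith [mul_pos hpw hdp]
  · have hB : (1 + τ * ‖x‖) ^ (-(5 / 2) : ℝ) ≤ (1 + τ) ^ (-(5 / 2) : ℝ) :=
      Real.rpow_le_rpow_of_nonpos (by positivity) (by nlinarith) (by norm_num)
    rw [Set.indicator_of_notMem (by simpa using h), add_zero]
    exact mul_le_mul_of_nonneg_right (hA.trans hB) hdp.le

/-- The oscillatory amplitude whose integral is estimated by the dispersive bound. -/
def Model.osc (S : Model d) (σ : ℤˣ) (p : Mom d) (τ : ℝ) (k : Mom d) : ℂ :=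
  Complex.exp (-Complex.I * ((τ * S.Phi σ p k : ℝ) : ℂ)) * (S.M k σ : ℂ)

theorem Model.osc_mul_conj (S : Model d) (σ : ℤˣ) (p h x : Mom d) (τ : ℝ) :
    S.osc σ p τ (x + h) * (starRingEnd ℂ) (S.osc σ p τ x) = S.pairOsc σ p h τ x := by
  unfold Model.osc Model.pairOsc
  rw [map_mul, Complex.conj_ofReal, ← Complex.exp_conj]
  have : (starRingEnd ℂ) (-Complex.I * ((τ * S.Phi σ p x : ℝ) : ℂ)) =
      Complex.I * ((τ * S.Phi σ p x : ℝ) : ℂ) := by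
    rw [map_mul, map_neg, Complex.conj_I, Complex.conj_ofReal, neg_neg]
  rw [this, mul_mul_mul_comm, ← Complex.exp_add]
  push_cast
  ring_nf

theorem Model.Admissible.continuous_osc {S : Model d} {C₁ C₂ C₃ C₄ C₆ C₇ : ℝ}
    (hS : S.Admissible C₁ C₂ C₃ C₄ C₆ C₇) (σ : ℤˣ) (p : Mom d) (τ : ℝ) :
    Continuous (S.osc σ p τ) := by
  have h1 := (hS.Phi_bound σ p).1.continuous
  have h2 := hS.continuous_M σ
  unfold Model.osc
  fun_prop

theorem Model.Admissible.continuous_pairOsc {S : Model d} {C₁ C₂ C₃ C₄ C₆ C₇ : ℝ}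
    (hS : S.Admissible C₁ C₂ C₃ C₄ C₆ C₇) (σ : ℤˣ) (p h : Mom d) (τ : ℝ) :
    Continuous (S.pairOsc σ p h τ) := by
  have h1 := (hS.Phi_bound σ p).1.continuous
  have h2 := hS.continuous_M σ
  unfold Model.pairOsc
  fun_prop

theorem exists_M_le_decay (hd : 3 ≤ d) (β C₂ C₆ C₇ : ℝ) :
    ∃ K : ℝ, 0 ≤ K ∧ ∀ (S : Model d) (C₁ C₃ C₄ : ℝ), S.β = β →
      S.Admissible C₁ C₂ C₃ C₄ C₆ C₇ → ∀ (σ : ℤˣ) k, S.M k σ ≤ K * decay k := by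
  obtain ⟨K, hK0, hK⟩ := Model.Admissible.exists_derivBound_M hd β C₂ C₆ C₇
  have := nontrivial_mom hd
  obtain ⟨u, hu⟩ := exists_norm_eq (Mom d) (zero_le_one (α := ℝ))
  exact ⟨K, hK0, fun S C₁ C₃ C₄ hβ hS σ k =>
    (le_abs_self _).trans ((hK S C₁ C₃ C₄ hβ hS σ u hu).base.2 k)⟩

theorem Model.Admissible.integrable_M (hd : 3 ≤ d) {S : Model d} {C₁ C₂ C₃ C₄ C₆ C₇ : ℝ}
    (hS : S.Admissible C₁ C₂ C₃ C₄ C₆ C₇) (σ : ℤˣ) : Integrable fun k => S.M k σ := by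
  obtain ⟨K, hK0, hK⟩ := exists_M_le_decay hd S.β C₂ C₆ C₇
  refine (integrable_decay.const_mul K).mono' (hS.continuous_M σ).aestronglyMeasurable
    (Eventually.of_forall fun k => ?_)
  rw [Real.norm_eq_abs, abs_of_nonneg (hS.M_nonneg k σ)]
  exact hK S C₁ C₃ C₄ rfl hS σ k

/-- Square of the oscillatory lattice sums. -/
theorem exists_osc_lattice_sq (hd : 3 ≤ d) (C₁ C₂ C₃ C₄ C₆ C₇ β : ℝ) :
    ∃ K : ℝ, 0 ≤ K ∧ ∀ S : Model d, S.β = β → S.Admissible C₁ C₂ C₃ C₄ C₆ C₇ →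
      ∀ (σ : ℤˣ) (p : Mom d) (τ L : ℝ), 0 < L → d * spacing L ≤ 1 → |τ| * (d * spacing L) ≤ 1 →
        ‖∫ k, S.osc σ p τ k ∂(latticeMeasure d L)‖ ^ 2 ≤
          K * ((1 + |τ|) ^ (-(5 / 2) : ℝ) + d * spacing L * (1 + |τ|)) := by
  obtain ⟨K₁, hK₁, b₁⟩ := exists_pairOsc_integral_bound hd C₁ C₂ C₃ C₄ C₆ C₇ β
  obtain ⟨K₂, hK₂, b₂⟩ := exists_pairOsc_lipschitz hd C₁ C₂ C₃ C₄ C₆ C₇ β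
  obtain ⟨K₃, hK₃, b₃⟩ := exists_singular_integral_bound hd
  obtain ⟨K₀, hK₀, b₀⟩ := exists_M_le_decay hd β C₂ C₆ C₇
  set I := ∫ x, decay (d := d) x with hI_def
  have hI : 0 ≤ I := integral_nonneg fun x => (decay_pos x).le
  set c : ℝ := 2 ^ (d + 3) with hc_def
  set W : ℝ := 2 ^ (d + 4) * I with hW_def
  set R := ∫ x : Mom d, (jap x ^ (d + 2))⁻¹ with hR_def
  have hR : 0 ≤ R := integral_nonneg fun x => (inv_pos.mpr (pow_pos (jap_pos x) _)).le
  refine ⟨K₁ * W * (8 * c * K₃) + K₂ * W * (c * R), by positivity, ?_⟩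
  intro S hβ hS σ p τ L hL hL1 hL2
  have hs := spacing_pos hL
  have hosc := hS.continuous_osc σ p τ
  have hdecL : Integrable (decay (d := d)) (latticeMeasure d L) :=
    (integral_roundMom_le hL hL1 continuous_decay (fun x => (decay_pos x).le)
      (integrable_decay.const_mul c) (fun x y h => decay_le h)).1
  have hoscL : Integrable (S.osc σ p τ) (latticeMeasure d L) := by
    refine (hdecL.const_mul K₀).mono' hosc.aestronglyMeasurable (Eventually.of_forall fun k => ?_)
    unfold Model.osc
    rw [norm_mul, norm_cexp_I, one_mul, Complex.norm_real, Real.norm_eq_abs,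
      abs_of_nonneg (hS.M_nonneg k σ)]
    exact b₀ S C₁ C₃ C₄ hβ hS σ k
  -- the pair integrals on the lattice
  have hpair : ∀ h : Mom d, Integrable (S.pairOsc σ p h τ) (latticeMeasure d L) ∧
      ‖∫ x, S.pairOsc σ p h τ x ∂(latticeMeasure d L)‖ ≤
        K₁ * W * (((1 + |τ| * ‖h‖) ^ 3)⁻¹ * decay h) +
          d * spacing L * (1 + |τ|) * (K₂ * W * (jap h ^ (d + 2))⁻¹) := by
    intro h
    have hdm := integrable_decay_mul h
    have hcont := hS.continuous_pairOsc σ p h τ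
    have hpi : Integrable (S.pairOsc σ p h τ) := by
      refine (hdm.const_mul (K₀ * K₀)).mono' hcont.aestronglyMeasurable
        (Eventually.of_forall fun x => ?_)
      unfold Model.pairOsc
      have q1 := b₀ S C₁ C₃ C₄ hβ hS σ x
      have q2 := b₀ S C₁ C₃ C₄ hβ hS σ (x + h)
      have q3 := hS.M_nonneg x σ
      have q4 := hS.M_nonneg (x + h) σ
      rw [norm_mul, norm_cexp_I, one_mul, Complex.norm_real, Real.norm_eq_abs,
        abs_of_nonneg (mul_nonneg q4 q3)]
      calc _ ≤ (K₀ * decay (x + h)) * (K₀ * decay x) := mul_le_mul q2 q1 q3 (q4.trans q2)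
        _ = _ := by ring
    have hcmp := norm_integral_lattice_sub_le hL hL1 hcont hpi
      (G := fun x => (1 + |τ| * ‖h‖) * (K₂ * (decay (x + h) * decay x)))
      ((hdm.const_mul K₂).const_mul _)
      (fun x => by have := decay_pos x; have := decay_pos (x + h); positivity)
      (fun x y hxy => b₂ S hβ hS σ p h τ x y hxy)
    refine ⟨hcmp.1, ?_⟩
    have hconv := integral_decay_mul_le h
    rw [← hI_def, ← hW_def] at hconv
    have h1 := b₁ S hβ hS σ p h τ
    have h2 : ‖∫ x, S.pairOsc σ p h τ x ∂(fullMeasure d)‖ ≤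
        K₁ * W * (((1 + |τ| * ‖h‖) ^ 3)⁻¹ * decay h) := by
      rw [integral_fullMeasure, norm_smul, Real.norm_eq_abs, abs_of_pos fullMeasure_const_pos]
      calc _ ≤ 1 * ‖∫ x, S.pairOsc σ p h τ x‖ :=
            mul_le_mul_of_nonneg_right fullMeasure_const_le (norm_nonneg _)
        _ ≤ ((1 + |τ| * ‖h‖) ^ 3)⁻¹ * (K₁ * (W * decay h)) := by
            rw [one_mul]
            refine h1.trans (mul_le_mul_of_nonneg_left ?_ (by positivity))
            exact mul_le_mul_of_nonneg_left hconv hK₁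
        _ = _ := by ring
    have h3 : d * spacing L * ∫ x, (1 + |τ| * ‖h‖) * (K₂ * (decay (x + h) * decay x)) ≤
        d * spacing L * (1 + |τ|) * (K₂ * W * (jap h ^ (d + 2))⁻¹) := by
      rw [integral_const_mul, integral_const_mul]
      -- The Lipschitz factor `1 + |τ| ‖h‖` uses up one power of the weight in `h`. The remaining
      -- power `d + 2` is still summable over the differences.
      have e1 : decay h = (jap h)⁻¹ * (jap h ^ (d + 2))⁻¹ := by
        unfold decay; rw [← mul_inv, ← pow_succ']
      have e2 : 1 + |τ| * ‖h‖ ≤ (1 + |τ|) * jap h := by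
        unfold jap; nlinarith [abs_nonneg τ, norm_nonneg h]
      have jp := jap_pos h
      calc _ ≤ d * spacing L * (((1 + |τ|) * jap h) * (K₂ * (W * decay h))) := by
            refine mul_le_mul_of_nonneg_left ?_ (by positivity)
            refine mul_le_mul e2 (mul_le_mul_of_nonneg_left hconv hK₂) ?_ (by positivity)
            refine mul_nonneg hK₂ (integral_nonneg fun x => ?_)
            exact (mul_pos (decay_pos _) (decay_pos _)).le
        _ = _ := by rw [e1]; field_simp
    calc _ = ‖∫ x, S.pairOsc σ p h τ x ∂(fullMeasure d) +
          (∫ x, S.pairOsc σ p h τ x ∂(latticeMeasure d L) -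
            ∫ x, S.pairOsc σ p h τ x ∂(fullMeasure d))‖ := by rw [add_sub_cancel]
      _ ≤ _ := (norm_add_le _ _).trans (add_le_add h2 (hcmp.2.trans h3))
  -- summation over the differences
  have hsumm : Summable fun m : Mode d => ‖S.osc σ p τ (mom L m)‖ :=
    (integrable_latticeMeasure_iff_summable hL hosc.stronglyMeasurable).mp hoscL
  obtain ⟨hsq, hsqs⟩ := norm_tsum_sq_le hsumm
  have hconvert : ∀ h : Mode d, ∑' m : Mode d, S.osc σ p τ (mom L (m + h)) *
      (starRingEnd ℂ) (S.osc σ p τ (mom L m)) =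
        (L ^ d) • ∫ x, S.pairOsc σ p (mom L h) τ x ∂(latticeMeasure d L) := by
    intro h
    rw [integral_latticeMeasure_eq_tsum hL (hS.continuous_pairOsc σ p _ τ).stronglyMeasurable
      (hpair _).1, smul_smul, mul_inv_cancel₀ (by positivity), one_smul]
    refine tsum_congr fun m => ?_
    rw [mom_add, S.osc_mul_conj]
  have hφ1 : Continuous fun h : Mom d => ((1 + |τ| * ‖h‖) ^ 3)⁻¹ * decay h := by
    refine Continuous.mul (Continuous.inv₀ (by fun_prop) fun x => ?_) continuous_decay
    positivity
  have hφ2 : Continuous fun h : Mom d => (jap h ^ (d + 2))⁻¹ :=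
    (continuous_jap.pow _).inv₀ fun k => (pow_pos (jap_pos k) _).ne'
  have hφ1n : ∀ h : Mom d, 0 ≤ ((1 + |τ| * ‖h‖) ^ 3)⁻¹ * decay h := fun h => by
    have := decay_pos h; positivity
  have hφ2n : ∀ h : Mom d, 0 ≤ (jap h ^ (d + 2))⁻¹ := fun h => by
    have := jap_pos h; positivity
  -- lattice integrals restricted to the scale of the spacing
  obtain ⟨hs3, hs3'⟩ := b₃ |τ| (abs_nonneg τ)
  have hi1 : Integrable (fun h : Mom d => ((1 + |τ| * ‖h‖) ^ 3)⁻¹ * decay h) (latticeMeasure d L) ∧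
      ∫ h : Mom d, ((1 + |τ| * ‖h‖) ^ 3)⁻¹ * decay h ∂(latticeMeasure d L) ≤
        8 * c * K₃ * (1 + |τ|) ^ (-(5 / 2) : ℝ) := by
    have hle : ∀ x : Mom d, ((1 + |τ| * ‖roundMom L x‖) ^ 3)⁻¹ * decay (roundMom L x) ≤
        8 * c * (((1 + |τ| * ‖x‖) ^ 3)⁻¹ * decay x) := by
      intro x
      have hr := norm_roundMom_sub_le hL x
      have q1 : decay (roundMom L x) ≤ c * decay x := decay_le (hr.trans hL1)
      -- The condition `|τ| d spacing ≤ 1` enters here: rounding changes `1 + |τ|‖x‖` by at most a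
      -- factor two, so the weight concentrated on the scale `1/|τ|` is resolved by the lattice.
      have q2 : 1 + |τ| * ‖x‖ ≤ 2 * (1 + |τ| * ‖roundMom L x‖) := by
        have : ‖x‖ ≤ ‖roundMom L x‖ + d * spacing L := by
          have := norm_sub_le (roundMom L x) (roundMom L x - x)
          rw [sub_sub_cancel] at this
          linarith
        nlinarith [mul_le_mul_of_nonneg_left this (abs_nonneg τ),
          mul_nonneg (abs_nonneg τ) (norm_nonneg (roundMom L x))]
      have q3 : ((1 + |τ| * ‖roundMom L x‖) ^ 3)⁻¹ ≤ 8 * ((1 + |τ| * ‖x‖) ^ 3)⁻¹ := by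
        rw [inv_eq_one_div, ← div_eq_mul_inv, div_le_div_iff₀ (by positivity) (by positivity),
          one_mul]
        calc _ ≤ (2 * (1 + |τ| * ‖roundMom L x‖)) ^ 3 :=
              pow_le_pow_left₀ (by positivity) q2 3
          _ = _ := by ring
      calc _ ≤ (8 * ((1 + |τ| * ‖x‖) ^ 3)⁻¹) * (c * decay x) :=
            mul_le_mul q3 q1 (decay_pos _).le (by positivity)
        _ = _ := by ring
    have hi : Integrable fun x : Mom d =>
        ((1 + |τ| * ‖roundMom L x‖) ^ 3)⁻¹ * decay (roundMom L x) := by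
      refine (hs3.const_mul (8 * c)).mono'
        (hφ1.measurable.comp (measurable_roundMom L)).aestronglyMeasurable ?_
      refine Eventually.of_forall fun x => ?_
      rw [Real.norm_eq_abs, abs_of_nonneg (hφ1n _)]
      exact hle x
    refine ⟨(integrable_latticeMeasure_iff hL hφ1.stronglyMeasurable).mpr hi, ?_⟩
    rw [integral_latticeMeasure hL hφ1.stronglyMeasurable, integral_fullMeasure, smul_eq_mul]
    calc _ ≤ 1 * ∫ x : Mom d, ((1 + |τ| * ‖roundMom L x‖) ^ 3)⁻¹ * decay (roundMom L x) :=
          mul_le_mul_of_nonneg_right fullMeasure_const_le (integral_nonneg fun x => hφ1n _)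
      _ ≤ ∫ x, 8 * c * (((1 + |τ| * ‖x‖) ^ 3)⁻¹ * decay x) := by
          rw [one_mul]; exact integral_mono hi (hs3.const_mul _) hle
      _ = 8 * c * ∫ x : Mom d, ((1 + |τ| * ‖x‖) ^ 3)⁻¹ * decay x := integral_const_mul _ _
      _ ≤ 8 * c * (K₃ * (1 + |τ|) ^ (-(5 / 2) : ℝ)) :=
          mul_le_mul_of_nonneg_left hs3' (by positivity)
      _ = _ := by ring
  have hi2 := integral_roundMom_le hL hL1 hφ2 hφ2n
    ((integrable_jap_inv_pow (d := d) (r := d + 2) (by omega)).const_mul (2 ^ (d + 2)))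
    (fun x y h => jap_inv_pow_le _ h)
  rw [integral_const_mul, ← hR_def] at hi2
  have hbd := fun h : Mom d => (hpair h).2
  have htot : Integrable (fun h : Mom d => K₁ * W * (((1 + |τ| * ‖h‖) ^ 3)⁻¹ * decay h) +
      d * spacing L * (1 + |τ|) * (K₂ * W * (jap h ^ (d + 2))⁻¹)) (latticeMeasure d L) :=
    (hi1.1.const_mul _).add ((hi2.1.const_mul _).const_mul _)
  have htotc : Continuous (fun h : Mom d => K₁ * W * (((1 + |τ| * ‖h‖) ^ 3)⁻¹ * decay h) +
      d * spacing L * (1 + |τ|) * (K₂ * W * (jap h ^ (d + 2))⁻¹)) := by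
    exact (continuous_const.mul hφ1).add (continuous_const.mul (continuous_const.mul hφ2))
  have hts := (integrable_latticeMeasure_iff_summable hL htotc.stronglyMeasurable).mp htot
  rw [integral_latticeMeasure_eq_tsum hL hosc.stronglyMeasurable hoscL, norm_smul, mul_pow,
    Real.norm_eq_abs, abs_of_pos (by positivity : (0 : ℝ) < (L ^ d)⁻¹)]
  have hLd : (0 : ℝ) < L ^ d := by positivity
  have hle2 : ∀ h : Mode d, ‖∑' m : Mode d, S.osc σ p τ (mom L (m + h)) *
      (starRingEnd ℂ) (S.osc σ p τ (mom L m))‖ ≤ L ^ d * 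
      (K₁ * W * (((1 + |τ| * ‖mom L h‖) ^ 3)⁻¹ * decay (mom L h)) +
      d * spacing L * (1 + |τ|) * (K₂ * W * (jap (mom L h) ^ (d + 2))⁻¹)) := by
    intro h
    rw [hconvert h, norm_smul, Real.norm_eq_abs, abs_of_pos hLd]
    exact mul_le_mul_of_nonneg_left (hbd _) hLd.le
  have hfin : ∫ h : Mom d, (K₁ * W * (((1 + |τ| * ‖h‖) ^ 3)⁻¹ * decay h) +
      d * spacing L * (1 + |τ|) * (K₂ * W * (jap h ^ (d + 2))⁻¹)) ∂(latticeMeasure d L) ≤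
      (K₁ * W * (8 * c * K₃) + K₂ * W * (c * R)) *
        ((1 + |τ|) ^ (-(5 / 2) : ℝ) + d * spacing L * (1 + |τ|)) := by
    rw [integral_add (hi1.1.const_mul _) ((hi2.1.const_mul _).const_mul _), integral_const_mul,
      integral_const_mul, integral_const_mul]
    have hP : 0 < (1 + |τ|) ^ (-(5 / 2) : ℝ) := Real.rpow_pos_of_pos (by positivity) _
    have u1 : K₁ * W * ∫ h : Mom d, ((1 + |τ| * ‖h‖) ^ 3)⁻¹ * decay h ∂(latticeMeasure d L) ≤
        (K₁ * W * (8 * c * K₃)) * (1 + |τ|) ^ (-(5 / 2) : ℝ) := by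
      refine (mul_le_mul_of_nonneg_left hi1.2 (by positivity)).trans (le_of_eq (by ring))
    have hc2 : (2 : ℝ) ^ (d + 2) ≤ c := pow_le_pow_right₀ (by norm_num) (by omega)
    have u2 : d * spacing L * (1 + |τ|) * (K₂ * W *
        ∫ h : Mom d, (jap h ^ (d + 2))⁻¹ ∂(latticeMeasure d L)) ≤
        (K₂ * W * (c * R)) * (d * spacing L * (1 + |τ|)) := by
      have : ∫ h : Mom d, (jap h ^ (d + 2))⁻¹ ∂(latticeMeasure d L) ≤ c * R :=
        hi2.2.trans (mul_le_mul_of_nonneg_right hc2 hR)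
      calc _ ≤ d * spacing L * (1 + |τ|) * (K₂ * W * (c * R)) := by gcongr
        _ = _ := by ring
    have v1 : 0 ≤ (K₁ * W * (8 * c * K₃)) * (d * spacing L * (1 + |τ|)) := by positivity
    have v2 : 0 ≤ (K₂ * W * (c * R)) * (1 + |τ|) ^ (-(5 / 2) : ℝ) := by positivity
    nlinarith
  refine le_trans ?_ hfin
  rw [integral_latticeMeasure_eq_tsum hL htotc.stronglyMeasurable htot, smul_eq_mul]
  have hts' : Summable fun h : Mode d => L ^ d *
      (K₁ * W * (((1 + |τ| * ‖mom L h‖) ^ 3)⁻¹ * decay (mom L h)) +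
      d * spacing L * (1 + |τ|) * (K₂ * W * (jap (mom L h) ^ (d + 2))⁻¹)) :=
    hts.of_norm.mul_left _
  -- Of the factor `L^{-2d}` from the square, one `L^{-d}` normalises the inner sum and the other
  -- turns the sum over `h` into a lattice integral.
  calc _ ≤ ((L ^ d)⁻¹) ^ 2 * ∑' h : Mode d, L ^ d *
      (K₁ * W * (((1 + |τ| * ‖mom L h‖) ^ 3)⁻¹ * decay (mom L h)) +
      d * spacing L * (1 + |τ|) * (K₂ * W * (jap (mom L h) ^ (d + 2))⁻¹)) :=
        mul_le_mul_of_nonneg_left (hsq.trans (hsqs.tsum_le_tsum hle2 hts')) (by positivity)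
    _ = _ := by
      rw [tsum_mul_left, ← mul_assoc]
      congr 1
      field_simp

theorem rpow_five_quarters_sq (x : ℝ) (hx : 0 < x) :
    (x ^ (-(5 / 4) : ℝ)) ^ 2 = x ^ (-(5 / 2) : ℝ) := by
  rw [← Real.rpow_natCast, ← Real.rpow_mul hx.le]; norm_num

/-- **Dispersive estimate** in large boxes, uniformly in the momentum `p`. -/
theorem exists_dispersive_lattice (hd : 3 ≤ d) (C₁ C₂ C₃ C₄ C₆ C₇ β : ℝ) :
    ∃ G : ℝ, 0 ≤ G ∧ ∀ S : Model d, S.β = β → S.Admissible C₁ C₂ C₃ C₄ C₆ C₇ →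
      ∀ t : ℝ, 0 ≤ t → ∀ᶠ L : ℝ in atTop, ∀ (σ : ℤˣ) (p : Mom d) (τ : ℝ), |τ| ≤ t →
        ‖∫ k, S.osc σ p τ k ∂(latticeMeasure d L)‖ ≤ G * (1 + |τ|) ^ (-(5 / 4) : ℝ) := by
  obtain ⟨K, hK, b⟩ := exists_osc_lattice_sq hd C₁ C₂ C₃ C₄ C₆ C₇ β
  refine ⟨Real.sqrt (K * 2), Real.sqrt_nonneg _, fun S hβ hS t ht => ?_⟩
  have hP : 0 < (1 + t) ^ (-(5 / 2) : ℝ) := Real.rpow_pos_of_pos (by positivity) _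
  -- Times are bounded by `t`, so in large boxes the discretisation error falls below `(1 +
  -- t)^{-5/2}`, which is the smallest value of the main term. This is why the threshold for `L`
  -- depends on `t` while the constant does not.
  have hlim : Tendsto (fun L : ℝ => d * spacing L * (1 + t)) atTop (nhds 0) := by
    simpa using (tendsto_spacing.const_mul (d : ℝ)).mul_const (1 + t)
  filter_upwards [eventually_gt_atTop 0, hlim.eventually_le_const hP,
    hlim.eventually_le_const one_pos] with L hL h1 h2 σ p τ hτ
  have hs := spacing_pos hL
  have hds : 0 ≤ d * spacing L := by positivity
  have h3 := b S hβ hS σ p τ L hL (by nlinarith) (by nlinarith [abs_nonneg τ])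
  have hPτ : (1 + t) ^ (-(5 / 2) : ℝ) ≤ (1 + |τ|) ^ (-(5 / 2) : ℝ) :=
    Real.rpow_le_rpow_of_nonpos (by positivity) (by linarith) (by norm_num)
  have h4 : d * spacing L * (1 + |τ|) ≤ (1 + |τ|) ^ (-(5 / 2) : ℝ) := by
    refine le_trans ?_ (h1.trans hPτ)
    exact mul_le_mul_of_nonneg_left (by linarith) hds
  refine abs_le_of_sq_le_sq' ?_ (by positivity) |>.2
  rw [mul_pow, Real.sq_sqrt (by positivity), rpow_five_quarters_sq _ (by positivity)]
  refine h3.trans ?_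
  linarith [mul_le_mul_of_nonneg_left h4 hK]

/-- The oscillatory integrals are limits of lattice sums. -/
theorem tendsto_osc_lattice (hd : 3 ≤ d) {S : Model d} {C₁ C₂ C₃ C₄ C₆ C₇ : ℝ}
    (hS : S.Admissible C₁ C₂ C₃ C₄ C₆ C₇) (σ : ℤˣ) (p : Mom d) (τ : ℝ) :
    Tendsto (fun L => ∫ k, S.osc σ p τ k ∂(latticeMeasure d L)) atTop
      (nhds (∫ k, S.osc σ p τ k ∂(fullMeasure d))) := by
  obtain ⟨K, hK0, hK⟩ := Model.Admissible.exists_derivBound_M hd S.β C₂ C₆ C₇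
  obtain ⟨K₂, hK₂, hΦ⟩ := hS.Phi_lipschitz hd σ p
  obtain ⟨K₀, hK₀, b₀⟩ := exists_M_le_decay hd S.β C₂ C₆ C₇
  set c : ℝ := 2 ^ (d + 3)
  have hM : ∀ u : Mom d, ‖u‖ = 1 → DerivBound u decay 1 K fun k => S.M k σ := fun u hu =>
    (hK S C₁ C₃ C₄ rfl hS σ u hu).of_succ.of_succ
  set B : ℝ := |τ| * K₂ * (K₀ * c) + K * c
  have hG : Integrable fun x : Mom d => B * (jap x ^ (d + 2))⁻¹ :=
    (integrable_jap_inv_pow (by omega)).const_mul B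
  have hlip : ∀ x y : Mom d, ‖y - x‖ ≤ 1 → ‖S.osc σ p τ y - S.osc σ p τ x‖ ≤
      ‖y - x‖ * (B * (jap x ^ (d + 2))⁻¹) := by
    intro x y hxy
    refine (norm_osc_sub_le _ _ _ _).trans ?_
    have q1 := hΦ x y hxy
    have q2 : |S.M y σ| ≤ K₀ * (c * decay x) := by
      rw [abs_of_nonneg (hS.M_nonneg y σ)]
      exact (b₀ S C₁ C₃ C₄ rfl hS σ y).trans (mul_le_mul_of_nonneg_left (decay_le hxy) hK₀)
    have q3 := abs_sub_le_of_derivBound hK0 hM hxy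
    have e1 : decay x = (jap x)⁻¹ * (jap x ^ (d + 2))⁻¹ := by
      unfold decay; rw [← mul_inv, ← pow_succ']
    have jp := jap_pos x
    have e2 : decay x ≤ (jap x ^ (d + 2))⁻¹ := by
      rw [e1]
      exact mul_le_of_le_one_left (by positivity) (inv_le_one_of_one_le₀ (one_le_jap x))
    rw [← mul_sub, abs_mul]
    calc _ ≤ |τ| * (K₂ * jap x * ‖y - x‖) * (K₀ * (c * decay x)) +
          ‖y - x‖ * (K * (c * (jap x ^ (d + 2))⁻¹)) := by
          refine add_le_add ?_ (q3.trans ?_)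
          · exact mul_le_mul (mul_le_mul_of_nonneg_left q1 (abs_nonneg _)) q2 (abs_nonneg _)
              (by positivity)
          · gcongr
      _ = ‖y - x‖ * ((|τ| * K₂ * (K₀ * c) + K * c) * (jap x ^ (d + 2))⁻¹) := by
          rw [e1]; field_simp
  rw [tendsto_iff_norm_sub_tendsto_zero]
  have hlim : Tendsto (fun L : ℝ => d * spacing L * ∫ x : Mom d, B * (jap x ^ (d + 2))⁻¹) atTop
      (nhds 0) := by
    simpa using (tendsto_spacing.const_mul (d : ℝ)).mul_const _
  have h1 : Tendsto (fun L : ℝ => d * spacing L) atTop (nhds 0) := by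
    simpa using tendsto_spacing.const_mul (d : ℝ)
  refine squeeze_zero' (Eventually.of_forall fun _ => norm_nonneg _) ?_ hlim
  filter_upwards [eventually_gt_atTop 0, h1.eventually_le_const one_pos] with L hL hL1
  refine (norm_integral_lattice_sub_le hL hL1 (hS.continuous_osc σ p τ)
    (integrable_cexp_mul (hS.Phi_bound σ p).1.continuous (hS.integrable_M hd σ) τ) hG
    (fun x => ?_) hlip).2
  have := jap_pos x
  positivity

/-- **Dispersive estimate** in infinite volume. -/
theorem exists_dispersive (hd : 3 ≤ d) (C₁ C₂ C₃ C₄ C₆ C₇ β : ℝ) :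
    ∃ G : ℝ, 0 ≤ G ∧ ∀ S : Model d, S.β = β → S.Admissible C₁ C₂ C₃ C₄ C₆ C₇ →
      (∀ (σ : ℤˣ) (p : Mom d) (τ : ℝ),
        ‖∫ k, S.osc σ p τ k ∂(fullMeasure d)‖ ≤ G * (1 + |τ|) ^ (-(5 / 4) : ℝ)) ∧
      ∀ t : ℝ, 0 ≤ t → ∀ᶠ L : ℝ in atTop, ∀ (σ : ℤˣ) (p : Mom d) (τ : ℝ), |τ| ≤ t →
        ‖∫ k, S.osc σ p τ k ∂(latticeMeasure d L)‖ ≤ G * (1 + |τ|) ^ (-(5 / 4) : ℝ) := by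
  obtain ⟨G, hG, b⟩ := exists_dispersive_lattice hd C₁ C₂ C₃ C₄ C₆ C₇ β
  refine ⟨G, hG, fun S hβ hS => ⟨fun σ p τ => ?_, b S hβ hS⟩⟩
  -- For each fixed `τ` the lattice estimate is applied with `t = |τ|` before passing to the limit.
  refine le_of_tendsto (tendsto_osc_lattice hd hS σ p τ).norm ?_
  filter_upwards [b S hβ hS |τ| (abs_nonneg τ)] with L hL
  exact hL σ p τ le_rfl

end Polaron
end


noncomputable section

set_option linter.unusedSectionVars false

namespace Polaron

variable {d : ℕ}

/-! ### Iterated time integrals -/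

theorem isClosed_forall_nonneg {X : Type*} [TopologicalSpace X] {N : ℕ} {f : X → Fin N → ℝ}
    (hf : Continuous f) : IsClosed {x | ∀ j, 0 ≤ f x j} :=
  isClosed_Ici.preimage (t := Set.Ici (0 : Fin N → ℝ)) hf

theorem isClosed_setOf_and {X : Type*} [TopologicalSpace X] {p q : X → Prop}
    (hp : IsClosed {x | p x}) (hq : IsClosed {x | q x}) : IsClosed {x | p x ∧ q x} :=
  hp.inter hq

theorem isCompact_simplex (t : ℝ) (N : ℕ) :
    IsCompact {u : Fin N → ℝ | (∀ j, 0 ≤ u j) ∧ ∑ j, u j ≤ t} := by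
  refine IsCompact.of_isClosed_subset (isCompact_Icc (a := (0 : Fin N → ℝ)) (b := fun _ => t)) ?_ ?_
  · exact isClosed_setOf_and (isClosed_forall_nonneg continuous_id)
      (isClosed_le (by fun_prop) continuous_const)
  · rintro u ⟨h0, h1⟩
    exact ⟨h0, fun j => (Finset.single_le_sum (fun i _ => h0 i) (Finset.mem_univ j)).trans h1⟩

theorem isCompact_simplex_pairs (t : ℝ) (N : ℕ) :
    IsCompact {q : ℝ × (Fin N → ℝ) | (∀ j, 0 ≤ q.2 j) ∧ ∑ j, q.2 j ≤ q.1 ∧ q.1 ≤ t} := by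
  refine IsCompact.of_isClosed_subset
    ((isCompact_Icc (a := (0 : ℝ)) (b := t)).prod (isCompact_simplex t N)) ?_ ?_
  · exact isClosed_setOf_and (isClosed_forall_nonneg continuous_snd) (isClosed_setOf_and
      (isClosed_le (by fun_prop) (by fun_prop)) (isClosed_le (by fun_prop) continuous_const))
  · rintro q ⟨h0, h1, h2⟩
    exact ⟨⟨(Finset.sum_nonneg fun j _ => h0 j).trans h1, h2⟩, h0, h1.trans h2⟩

theorem timeInt_zero (t : ℝ) (ht : 0 ≤ t) (F : (Fin 1 → ℝ) → ℂ) :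
    timeInt t 0 F = F fun _ => t := by
  have e : {u : Fin 0 → ℝ | (∀ j, 0 ≤ u j) ∧ ∑ j, u j ≤ t} = Set.univ := by
    ext u; simp [ht]
  have e2 : ∀ u : Fin 0 → ℝ, (Fin.cons (t - ∑ j, u j) u : Fin 1 → ℝ) = fun _ => t := by
    intro u; funext i; fin_cases i; simp
  rw [timeInt, e, Measure.restrict_univ]
  simp_rw [e2]
  rw [integral_const, volume_pi, Measure.pi_of_empty]
  simp [Measure.real]

/-- Fubini after the shear `(u₀, v) ↦ (u₀ + ∑ v, v)`. The new first variable is the total time `s`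
left once the leftmost propagation `s₀ = t - s` has been removed. -/
theorem timeInt_succ (t : ℝ) (ht : 0 ≤ t) (N : ℕ) {F : (Fin (N + 2) → ℝ) → ℂ} (hF : Continuous F) :
    timeInt t (N + 1) F = ∫ s in 0..t, timeInt s N fun v => F (Fin.cons (t - s) v) := by
  classical
  set H : ℝ × (Fin N → ℝ) → ℂ := Set.indicator
    {q : ℝ × (Fin N → ℝ) | (∀ j, 0 ≤ q.2 j) ∧ ∑ j, q.2 j ≤ q.1 ∧ q.1 ≤ t}
    (fun q => F (Fin.cons (t - q.1) (Fin.cons (q.1 - ∑ j, q.2 j) q.2 : Fin (N + 1) → ℝ))) with hH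
  have hHi : Integrable H := by
    rw [hH, integrable_indicator_iff (isCompact_simplex_pairs t N).measurableSet]
    refine ContinuousOn.integrableOn_compact (isCompact_simplex_pairs t N)
      (Continuous.continuousOn ?_)
    refine hF.comp ?_
    refine continuous_pi fun i => ?_
    refine Fin.cases ?_ (fun i => ?_) i
    · simp only [Fin.cons_zero]; fun_prop
    · refine Fin.cases ?_ (fun i => ?_) i
      · simp only [Fin.cons_succ, Fin.cons_zero]; fun_prop
      · simp only [Fin.cons_succ]; fun_prop
  set K : ℝ × (Fin N → ℝ) → ℂ := fun q => H (q.1 + ∑ j, q.2 j, q.2) with hK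
  have hKi : Integrable K := by
    have e : K = Set.indicator {q : ℝ × (Fin N → ℝ) | (∀ j, 0 ≤ q.2 j) ∧ 0 ≤ q.1 ∧
        q.1 + ∑ j, q.2 j ≤ t} (fun q => F (Fin.cons (t - (q.1 + ∑ j, q.2 j))
          (Fin.cons q.1 q.2 : Fin (N + 1) → ℝ))) := by
      funext q
      simp only [hK, hH, Set.indicator, Set.mem_ofPred_eq, le_add_iff_nonneg_left,
        add_sub_cancel_right]
    have hc : IsCompact {q : ℝ × (Fin N → ℝ) | (∀ j, 0 ≤ q.2 j) ∧ 0 ≤ q.1 ∧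
        q.1 + ∑ j, q.2 j ≤ t} := by
      refine IsCompact.of_isClosed_subset
        ((isCompact_Icc (a := (0 : ℝ)) (b := t)).prod (isCompact_simplex t N)) ?_ ?_
      · exact isClosed_setOf_and (isClosed_forall_nonneg continuous_snd) (isClosed_setOf_and
          (isClosed_le (by fun_prop) (by fun_prop)) (isClosed_le (by fun_prop) continuous_const))
      · rintro q ⟨h0, h1, h2⟩
        have : 0 ≤ ∑ j, q.2 j := Finset.sum_nonneg fun j _ => h0 j
        exact ⟨⟨h1, by linarith⟩, h0, by linarith⟩
    rw [e, integrable_indicator_iff hc.measurableSet]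
    refine ContinuousOn.integrableOn_compact hc (Continuous.continuousOn ?_)
    refine hF.comp ?_
    refine continuous_pi fun i => ?_
    refine Fin.cases ?_ (fun i => ?_) i
    · simp only [Fin.cons_zero]; fun_prop
    · refine Fin.cases ?_ (fun i => ?_) i
      · simp only [Fin.cons_succ, Fin.cons_zero]; fun_prop
      · simp only [Fin.cons_succ]; fun_prop
  have step1 : timeInt t (N + 1) F = ∫ q, K q := by
    rw [timeInt, ← integral_indicator (isCompact_simplex t (N + 1)).measurableSet]
    have hmp := (volume_preserving_piFinSuccAbove (fun _ : Fin (N + 1) => ℝ) 0).symm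
    rw [← hmp.integral_comp (MeasurableEquiv.measurableEmbedding _)]
    refine integral_congr_ae (Eventually.of_forall fun q => ?_)
    have e : (MeasurableEquiv.piFinSuccAbove (fun _ : Fin (N + 1) => ℝ) 0).symm q =
        (Fin.cons q.1 q.2 : Fin (N + 1) → ℝ) := by
      simp [MeasurableEquiv.piFinSuccAbove, Fin.insertNthEquiv]
    show Set.indicator _ _ ((MeasurableEquiv.piFinSuccAbove (fun _ : Fin (N + 1) => ℝ) 0).symm q) =
      K q
    rw [e]
    simp only [hK, hH, Set.indicator, Set.mem_ofPred_eq, Fin.sum_univ_succ, Fin.cons_zero,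
      Fin.cons_succ, le_add_iff_nonneg_left, add_sub_cancel_right, Fin.forall_fin_succ]
    refine if_congr ?_ rfl rfl
    tauto
  -- For fixed `v` the shear is a translation in the first variable.
  have step2 : ∫ q, K q = ∫ q, H q := by
    rw [Measure.volume_eq_prod, integral_prod_symm _ (by rwa [← Measure.volume_eq_prod]),
      integral_prod_symm _ (by rwa [← Measure.volume_eq_prod])]
    refine integral_congr_ae (Eventually.of_forall fun v => ?_)
    exact integral_add_right_eq_self (fun s => H (s, v)) (∑ j, v j)
  have step3 : ∫ q, H q = ∫ s in 0..t, timeInt s N fun v => F (Fin.cons (t - s) v) := by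
    rw [Measure.volume_eq_prod, integral_prod _ (by rwa [← Measure.volume_eq_prod]),
      intervalIntegral.integral_of_le ht, ← integral_Icc_eq_integral_Ioc,
      ← integral_indicator measurableSet_Icc]
    refine integral_congr_ae (Eventually.of_forall fun s => ?_)
    by_cases hs : s ∈ Set.Icc 0 t
    · simp only [Set.indicator_of_mem hs]
      rw [timeInt, ← integral_indicator (isCompact_simplex s N).measurableSet]
      refine integral_congr_ae (Eventually.of_forall fun v => ?_)
      simp only [hH, Set.indicator, Set.mem_ofPred_eq]
      refine if_congr ?_ rfl rfl
      have := hs.2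
      tauto
    · simp only [Set.indicator_of_notMem hs]
      have : ∀ v : Fin N → ℝ, H (s, v) = 0 := by
        intro v
        refine Set.indicator_of_notMem ?_ _
        rintro ⟨h0, h1, h2⟩
        exact hs ⟨(Finset.sum_nonneg fun j _ => h0 j).trans h1, h2⟩
      simp [this]
  rw [step1, step2, step3]

/-! ### Patterns -/

/-- Collision patterns with `n` external phonons, `r` immediate recollisions and `N = n + 2 r`
vertices, built from the left. -/
inductive Pat : ℕ → ℕ → ℕ → Type
  | nil : Pat 0 0 0
  | ext {n r N : ℕ} (P : Pat n r N) : Pat (n + 1) r (N + 1)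
  | int {n r N : ℕ} (P : Pat n r N) : Pat n (r + 1) (N + 2)

/-- The tuple `(m_0, …, m_n)` of a pattern. -/
def Pat.toM : {n r N : ℕ} → Pat n r N → (Fin (n + 1) → ℕ)
  | _, _, _, .nil => fun _ => 0
  | _, _, _, .ext P => Fin.cons 0 P.toM
  | _, _, _, .int P => Fin.cons (P.toM 0 + 1) (Fin.tail P.toM)

theorem Pat.card_eq {n r N : ℕ} (P : Pat n r N) : N = n + 2 * r := by
  induction P with
  | nil => rfl
  | ext P ih => omega
  | int P ih => omega

theorem Pat.sum_toM {n r N : ℕ} (P : Pat n r N) : ∑ j, P.toM j = r := by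
  induction P with
  | nil => simp [Pat.toM]
  | ext P ih => rw [Fin.sum_univ_succ]; simp [Pat.toM, ih]
  | int P ih =>
    rw [Fin.sum_univ_succ] at ih ⊢
    simp only [Pat.toM, Fin.cons_zero, Fin.cons_succ, Fin.tail]
    omega

/-- The tuple is consumed from the left: the first entry is lowered to zero by recollisions and then
removed by an external phonon. -/
theorem exists_pat_aux (n : ℕ) (m : Fin (n + 1) → ℕ) (r N : ℕ) (hr : ∑ j, m j = r)
    (hN : N = n + 2 * r) : ∃ P : Pat n r N, P.toM = m := by
  induction n generalizing r N with
  | zero =>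
    obtain ⟨c, rfl⟩ : ∃ c, m = fun _ => c := ⟨m 0, by funext i; fin_cases i; rfl⟩
    have hr' : c = r := by simpa using hr
    subst hr' hN
    clear hr
    induction c with
    | zero => exact ⟨.nil, rfl⟩
    | succ c ih =>
      obtain ⟨P, hP⟩ := ih
      refine ⟨.int (N := 0 + 2 * c) P, ?_⟩
      simp only [Pat.toM, hP]
      funext i; fin_cases i; rfl
  | succ n ih =>
    obtain ⟨c, m', rfl⟩ : ∃ c m', m = Fin.cons c m' := ⟨m 0, Fin.tail m, (Fin.cons_self_tail m).symm⟩
    rw [Fin.sum_univ_succ] at hr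
    simp only [Fin.cons_zero, Fin.cons_succ] at hr
    subst hr hN
    induction c with
    | zero =>
      obtain ⟨P, hP⟩ := ih m' _ _ rfl rfl
      have e1 : 0 + ∑ i, m' i = ∑ i, m' i := by omega
      have e2 : n + 1 + 2 * (0 + ∑ i, m' i) = (n + 2 * ∑ i, m' i) + 1 := by omega
      rw [e2, e1]
      exact ⟨.ext P, by simp [Pat.toM, hP]⟩
    | succ c ihc =>
      obtain ⟨P, hP⟩ := ihc
      have e1 : c + 1 + ∑ i, m' i = (c + ∑ i, m' i) + 1 := by omega
      have e2 : n + 1 + 2 * (c + 1 + ∑ i, m' i) = (n + 1 + 2 * (c + ∑ i, m' i)) + 2 := by omega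
      rw [e2, e1]
      exact ⟨.int P, by simp [Pat.toM, hP]⟩

theorem mem_patterns {n N : ℕ} {m : Fin (n + 1) → ℕ} :
    m ∈ patterns n N ↔ n + 2 * ∑ j, m j = N := by
  unfold patterns
  rw [Finset.mem_filter, Fintype.mem_piFinset]
  refine ⟨fun h => h.2, fun h => ⟨fun j => ?_, h⟩⟩
  have := Finset.single_le_sum (f := m) (fun i _ => Nat.zero_le _) (Finset.mem_univ j)
  rw [Finset.mem_range]; omega

theorem exists_pat {n N : ℕ} {m : Fin (n + 1) → ℕ} (hm : m ∈ patterns n N) (r : ℕ)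
    (hr : N = n + 2 * r) : ∃ P : Pat n r N, P.toM = m := by
  rw [mem_patterns] at hm
  exact exists_pat_aux n m r N (by omega) hr

theorem Pat.toM_mem {n r N : ℕ} (P : Pat n r N) : P.toM ∈ patterns n N := by
  rw [mem_patterns, P.sum_toM, P.card_eq]

/-! ### Products over the index sets of a pattern -/

theorem muIdx_cons_zero {n : ℕ} (c : ℕ) (m : Fin (n + 1) → ℕ) :
    muIdx (Fin.cons c m : Fin (n + 2) → ℕ) 0 = 0 := by
  simp [muIdx]

theorem muIdx_zero {n : ℕ} (m : Fin (n + 1) → ℕ) : muIdx m 0 = 0 := by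
  simp [muIdx]

theorem muIdx_cons_succ {n : ℕ} (c : ℕ) (m : Fin (n + 1) → ℕ) (j : ℕ) :
    muIdx (Fin.cons c m : Fin (n + 2) → ℕ) (j + 1) = muIdx m j + 2 * c + 1 := by
  simp only [muIdx, Finset.sum_filter]
  rw [Fin.sum_univ_succ]
  simp only [Fin.val_zero, Nat.zero_lt_succ, if_true, Fin.cons_zero, Fin.val_succ,
    Nat.succ_lt_succ_iff, Fin.cons_succ]
  ring

/-- The product over a pattern, with the times indexed by natural numbers. -/
def patProd {n : ℕ} (m : Fin (n + 1) → ℕ) (X Y : Fin (n + 1) → ℝ → ℂ) (s : ℕ → ℝ) : ℂ :=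
  ∏ j : Fin (n + 1), ((∏ i ∈ Finset.range (m j + 1), X j (s (muIdx m j + 2 * i))) *
    ∏ i ∈ Finset.range (m j), Y j (s (muIdx m j + 2 * i + 1)))

theorem patProd_ext {n : ℕ} (m : Fin (n + 1) → ℕ) (X Y : Fin (n + 2) → ℝ → ℂ) (s : ℕ → ℝ) :
    patProd (Fin.cons 0 m : Fin (n + 2) → ℕ) X Y s =
      X 0 (s 0) * patProd m (Fin.tail X) (Fin.tail Y) fun i => s (i + 1) := by
  unfold patProd
  rw [Fin.prod_univ_succ]
  simp only [Fin.cons_zero, Finset.range_one, Finset.prod_singleton, Finset.range_zero,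
    Finset.prod_empty, mul_one, Fin.val_zero, muIdx_cons_zero, mul_zero, add_zero, zero_add,
    Fin.cons_succ, Fin.val_succ, muIdx_cons_succ, Fin.tail]
  congr 1
  refine Finset.prod_congr rfl fun j _ => ?_
  congr 1
  · refine Finset.prod_congr rfl fun i _ => ?_
    congr 2; omega
  · refine Finset.prod_congr rfl fun i _ => ?_
    congr 2; omega

theorem patProd_int {n : ℕ} (m : Fin (n + 1) → ℕ) (X Y : Fin (n + 1) → ℝ → ℂ) (s : ℕ → ℝ) :
    patProd (Fin.cons (m 0 + 1) (Fin.tail m) : Fin (n + 1) → ℕ) X Y s =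
      X 0 (s 0) * Y 0 (s 1) * patProd m X Y fun i => s (i + 2) := by
  unfold patProd
  rw [Fin.prod_univ_succ, Fin.prod_univ_succ (n := n)]
  simp only [Fin.cons_zero, Fin.val_zero, muIdx_zero, Fin.cons_succ, Fin.tail]
  rw [Finset.prod_range_succ' (fun i => X 0 (s (0 + 2 * i))) (m 0 + 1),
    Finset.prod_range_succ' (fun i => Y 0 (s (0 + 2 * i + 1))) (m 0)]
  have hmu : ∀ j : Fin n, muIdx (Fin.cons (m 0 + 1) (fun i : Fin n => m i.succ) :
      Fin (n + 1) → ℕ) j.succ.val = muIdx m j.succ.val + 2 := by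
    intro j
    simp only [muIdx, Finset.sum_filter]
    rw [Fin.sum_univ_succ, Fin.sum_univ_succ]
    simp only [Fin.val_zero, Fin.val_succ, Nat.zero_lt_succ, if_true, Fin.cons_zero, Fin.cons_succ]
    ring
  simp only [Fin.tail_def, hmu]
  have e1 : ∀ i, 0 + 2 * (i + 1) = 0 + 2 * i + 2 := fun i => by omega
  have e3 : ∀ j i, muIdx m j + 2 + 2 * i = muIdx m j + 2 * i + 2 := fun j i => by omega
  simp only [e1, e3]
  simp only [mul_zero, add_zero, zero_add]
  ring

theorem prod_fin_filter {N : ℕ} (A : Finset ℕ) (hA : ∀ b ∈ A, b < N) (f : ℝ → ℂ) (s : Fin N → ℝ)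
    (s' : ℕ → ℝ) (hs : ∀ b : Fin N, s' b = s b) :
    ∏ b : Fin N with b.val ∈ A, f (s b) = ∏ b ∈ A, f (s' b) := by
  refine Finset.prod_bij (fun b _ => b.val) (fun b hb => by simpa using hb)
    (fun a _ b _ h => Fin.ext h) (fun b hb => ⟨⟨b, hA b hb⟩, by simpa using hb, rfl⟩)
    (fun b _ => by rw [hs])

theorem muIdx_add_le {n N : ℕ} {m : Fin (n + 1) → ℕ} (hm : n + 2 * ∑ j, m j = N)
    (j : Fin (n + 1)) : muIdx m j + 2 * m j ≤ N := by
  have h1 : ∑ i with (i : Fin (n + 1)).val < j.val, m i + m j ≤ ∑ i, m i := by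
    rw [add_comm, ← Finset.sum_insert (by simp)]
    exact Finset.sum_le_sum_of_subset (Finset.subset_univ _)
  unfold muIdx
  have := j.2
  omega

theorem prod_pattern_eq {n N : ℕ} {m : Fin (n + 1) → ℕ} (hm : n + 2 * ∑ j, m j = N)
    (X Y : Fin (n + 1) → ℝ → ℂ) (s : Fin (N + 1) → ℝ) (s' : ℕ → ℝ)
    (hs : ∀ b : Fin (N + 1), s' b = s b) :
    ∏ j : Fin (n + 1), ((∏ b : Fin (N + 1) with b.val ∈ setIc m j, X j (s b)) *
      ∏ b : Fin (N + 1) with b.val ∈ setI m j, Y j (s b)) = patProd m X Y s' := by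
  unfold patProd
  refine Finset.prod_congr rfl fun j _ => ?_
  have hle := muIdx_add_le hm j
  rw [prod_fin_filter (setIc m j) ?_ _ s s' hs, prod_fin_filter (setI m j) ?_ _ s s' hs, setIc,
    setI, Finset.prod_image ?_, Finset.prod_image ?_]
  · intro a _ b _ h; simp only at h; omega
  · intro a _ b _ h; simp only at h; omega
  · intro b hb
    simp only [setI, Finset.mem_image, Finset.mem_range] at hb
    omega
  · intro b hb
    simp only [setIc, Finset.mem_image, Finset.mem_range] at hb
    omega

end Polaron
end

noncomputable section
set_option linter.unusedSectionVars false
namespace Polaron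
variable {d : ℕ}

/-! ### Time integrals of patterns as iterated convolutions -/

/-- The iterated convolution in time attached to a pattern. -/
def Pat.conv : {n r N : ℕ} → Pat n r N → (X Y : Fin (n + 1) → ℝ → ℂ) → ℝ → ℂ
  | _, _, _, .nil => fun X _ t => X 0 t
  | _, _, _, .ext P => fun X Y t =>
      ∫ s in (0 : ℝ)..t, X 0 (t - s) * P.conv (Fin.tail X) (Fin.tail Y) s
  | _, _, _, .int P => fun X Y t =>
      ∫ s in (0 : ℝ)..t, X 0 (t - s) * ∫ r in (0 : ℝ)..s, Y 0 (s - r) * P.conv X Y r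

/-- Extension of a finite family of times by zero. -/
def extendTime {N : ℕ} (s : Fin N → ℝ) (i : ℕ) : ℝ := if h : i < N then s ⟨i, h⟩ else 0

theorem extendTime_val {N : ℕ} (s : Fin N → ℝ) (b : Fin N) : extendTime s b = s b := by
  simp [extendTime]

theorem extendTime_cons_zero {N : ℕ} (a : ℝ) (s : Fin N → ℝ) :
    extendTime (Fin.cons a s : Fin (N + 1) → ℝ) 0 = a := by
  simp [extendTime]

theorem extendTime_cons_succ {N : ℕ} (a : ℝ) (s : Fin N → ℝ) (i : ℕ) :
    extendTime (Fin.cons a s : Fin (N + 1) → ℝ) (i + 1) = extendTime s i := by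
  unfold extendTime
  by_cases h : i < N
  · rw [dif_pos h, dif_pos (by omega)]
    exact Fin.cons_succ (α := fun _ => ℝ) a s ⟨i, h⟩
  · rw [dif_neg h, dif_neg (by omega)]

theorem continuous_extendTime {N : ℕ} (i : ℕ) :
    Continuous fun s : Fin N → ℝ => extendTime s i := by
  unfold extendTime
  by_cases h : i < N
  · simp only [dif_pos h]; fun_prop
  · simp only [dif_neg h]; fun_prop

theorem continuous_patProd {n N : ℕ} (m : Fin (n + 1) → ℕ) {X Y : Fin (n + 1) → ℝ → ℂ}
    (hX : ∀ j, Continuous (X j)) (hY : ∀ j, Continuous (Y j)) :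
    Continuous fun s : Fin N → ℝ => patProd m X Y (extendTime s) := by
  unfold patProd
  refine continuous_finsetProd _ fun j _ => ?_
  refine (continuous_finsetProd _ fun i _ => ?_).mul (continuous_finsetProd _ fun i _ => ?_)
  · exact (hX j).comp (continuous_extendTime _)
  · exact (hY j).comp (continuous_extendTime _)

theorem timeInt_const_mul (t : ℝ) (N : ℕ) (c : ℂ) (F : (Fin (N + 1) → ℝ) → ℂ) :
    timeInt t N (fun s => c * F s) = c * timeInt t N F := by
  unfold timeInt
  rw [integral_const_mul]

/-- The recursion of the pattern matches the peeling of times: an external vertex removes one time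
variable and a recollision removes two. The simplex integral becomes an iterated convolution, on
which later bounds can induct. -/
theorem Pat.timeInt_patProd {n r N : ℕ} (P : Pat n r N) {X Y : Fin (n + 1) → ℝ → ℂ}
    (hX : ∀ j, Continuous (X j)) (hY : ∀ j, Continuous (Y j)) {t : ℝ} (ht : 0 ≤ t) :
    timeInt t N (fun s => patProd P.toM X Y (extendTime s)) = P.conv X Y t := by
  induction P generalizing t with
  | nil =>
    rw [timeInt_zero t ht]
    simp [patProd, Pat.toM, Pat.conv, muIdx, extendTime]
  | @ext n r N P ih =>
    rw [timeInt_succ t ht N (continuous_patProd _ hX hY), Pat.conv]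
    refine intervalIntegral.integral_congr fun s hs => ?_
    rw [Set.uIcc_of_le ht] at hs
    have e : ∀ v : Fin (N + 1) → ℝ,
        patProd (Pat.ext P).toM X Y (extendTime (Fin.cons (t - s) v : Fin (N + 2) → ℝ)) =
          X 0 (t - s) * patProd P.toM (Fin.tail X) (Fin.tail Y) (extendTime v) := by
      intro v
      rw [Pat.toM, patProd_ext, extendTime_cons_zero]
      simp only [extendTime_cons_succ]
    simp only [e, timeInt_const_mul]
    rw [ih (X := Fin.tail X) (Y := Fin.tail Y) (fun j => hX j.succ) (fun j => hY j.succ) hs.1]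
  | @int n r N P ih =>
    rw [timeInt_succ t ht (N + 1) (continuous_patProd _ hX hY), Pat.conv]
    refine intervalIntegral.integral_congr fun s hs => ?_
    rw [Set.uIcc_of_le ht] at hs
    have hc : Continuous fun v : Fin (N + 2) → ℝ =>
        patProd (Pat.int P).toM X Y (extendTime (Fin.cons (t - s) v : Fin (N + 3) → ℝ)) := by
      refine (continuous_patProd (N := N + 3) _ hX hY).comp ?_
      refine continuous_pi fun i => ?_
      refine Fin.cases ?_ (fun i => ?_) i
      · simpa using continuous_const
      · simpa using continuous_apply i
    rw [timeInt_succ s hs.1 N hc, ← intervalIntegral.integral_const_mul]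
    refine intervalIntegral.integral_congr fun q hq => ?_
    rw [Set.uIcc_of_le hs.1] at hq
    have e : ∀ v : Fin (N + 1) → ℝ,
        patProd (Pat.int P).toM X Y
          (extendTime (Fin.cons (t - s) (Fin.cons (s - q) v : Fin (N + 2) → ℝ) : Fin (N + 3) → ℝ)) =
          (X 0 (t - s) * Y 0 (s - q)) * patProd P.toM X Y (extendTime v) := by
      intro v
      rw [Pat.toM, patProd_int, extendTime_cons_zero]
      have h1 := extendTime_cons_succ (t - s) (Fin.cons (s - q) v : Fin (N + 2) → ℝ) 0
      rw [zero_add, extendTime_cons_zero] at h1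
      rw [h1]
      have h2 : (fun i => extendTime (Fin.cons (t - s) (Fin.cons (s - q) v : Fin (N + 2) → ℝ) :
          Fin (N + 3) → ℝ) (i + 2)) = extendTime v := by
        funext i
        rw [show i + 2 = (i + 1) + 1 from rfl, extendTime_cons_succ, extendTime_cons_succ]
      rw [h2]
    simp only [e, timeInt_const_mul]
    rw [ih hX hY hq.1, mul_assoc]

theorem Pat.continuous_conv {Z : Type*} [TopologicalSpace Z] {n r N : ℕ} (P : Pat n r N)
    {X Y : Z → Fin (n + 1) → ℝ → ℂ} (hX : ∀ j, Continuous fun q : Z × ℝ => X q.1 j q.2)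
    (hY : ∀ j, Continuous fun q : Z × ℝ => Y q.1 j q.2) :
    Continuous fun q : Z × ℝ => P.conv (X q.1) (Y q.1) q.2 := by
  induction P generalizing Z with
  | nil => exact hX 0
  | @ext n r N P ih =>
    refine intervalIntegral.continuous_parametric_intervalIntegral_of_continuous
      (f := fun (q : Z × ℝ) s => X q.1 0 (q.2 - s) *
        P.conv (Fin.tail (X q.1)) (Fin.tail (Y q.1)) s) ?_ continuous_snd
    have h1 := (hX 0).comp (by fun_prop : Continuous fun u : (Z × ℝ) × ℝ => (u.1.1, u.1.2 - u.2))
    have h2 := (ih (X := fun z => Fin.tail (X z)) (Y := fun z => Fin.tail (Y z))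
      (fun j => hX j.succ) (fun j => hY j.succ)).comp
      (by fun_prop : Continuous fun u : (Z × ℝ) × ℝ => (u.1.1, u.2))
    exact h1.mul h2
  | @int n r N P ih =>
    refine intervalIntegral.continuous_parametric_intervalIntegral_of_continuous
      (f := fun (q : Z × ℝ) s => X q.1 0 (q.2 - s) *
        ∫ r in (0 : ℝ)..s, Y q.1 0 (s - r) * P.conv (X q.1) (Y q.1) r) ?_ continuous_snd
    have h1 := (hX 0).comp (by fun_prop : Continuous fun u : (Z × ℝ) × ℝ => (u.1.1, u.1.2 - u.2))
    refine h1.mul ?_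
    refine intervalIntegral.continuous_parametric_intervalIntegral_of_continuous
      (f := fun (u : (Z × ℝ) × ℝ) r => Y u.1.1 0 (u.2 - r) * P.conv (X u.1.1) (Y u.1.1) r) ?_
      continuous_snd
    have h2 := (hY 0).comp
      (by fun_prop : Continuous fun u : ((Z × ℝ) × ℝ) × ℝ => (u.1.1.1, u.1.2 - u.2))
    have h3 := (ih hX hY).comp (by fun_prop : Continuous fun u : ((Z × ℝ) × ℝ) × ℝ => (u.1.1.1, u.2))
    exact h2.mul h3

/-! ### Amplitudes -/

/-- Energy of the electron and the phonons in front of the `j`-th external vertex. -/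
def Model.energy {n : ℕ} (S : Model d) (p : Mom d) (k : Fin n → Mom d) (σ : Fin n → ℤˣ)
    (j : Fin (n + 1)) : ℝ :=
  S.e (elMom p k j) + S.Omega k σ j

/-- The free phases of an amplitude. -/
def Model.phase {n : ℕ} (S : Model d) (p : Mom d) (k : Fin n → Mom d) (σ : Fin n → ℤˣ)
    (j : Fin (n + 1)) (s : ℝ) : ℂ :=
  Complex.exp (-Complex.I * ((s * S.energy p k σ j : ℝ) : ℂ))

/-- The recollision factors of an amplitude. -/
def Model.recoll {n : ℕ} (S : Model d) (κ : Measure (Mom d)) (p : Mom d) (k : Fin n → Mom d)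
    (σ : Fin n → ℤˣ) (j : Fin (n + 1)) (s : ℝ) : ℂ :=
  S.Theta κ s (elMom p k j) (S.Omega k σ j)

/-- The amplitude of a pattern, as an iterated convolution. -/
def Pat.amp {n r N : ℕ} (P : Pat n r N) (S : Model d) (κ : Measure (Mom d)) (p : Mom d)
    (k : Fin n → Mom d) (σ : Fin n → ℤˣ) (t : ℝ) : ℂ :=
  P.conv (S.phase p k σ) (S.recoll κ p k σ) t

theorem elMom_succ {n : ℕ} (p : Mom d) (k : Fin (n + 1) → Mom d) (j : Fin (n + 1)) :
    elMom p k j.succ = elMom p (Fin.tail k) j := by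
  unfold elMom
  simp only [Finset.sum_filter]
  rw [Fin.sum_univ_succ]
  simp [Fin.tail]

theorem Model.Omega_succ {n : ℕ} (S : Model d) (k : Fin (n + 1) → Mom d) (σ : Fin (n + 1) → ℤˣ)
    (j : Fin (n + 1)) : S.Omega k σ j.succ = S.Omega (Fin.tail k) (Fin.tail σ) j := by
  unfold Model.Omega
  simp only [Finset.sum_filter]
  rw [Fin.sum_univ_succ]
  simp [Fin.tail]

theorem elMom_cons_zero {n : ℕ} (p k₀ : Mom d) (k : Fin n → Mom d) :
    elMom p (Fin.cons k₀ k : Fin (n + 1) → Mom d) 0 = k₀ + elMom p k 0 := by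
  simp only [elMom, Fin.val_zero, Nat.zero_le, Finset.filter_true, Fin.sum_univ_succ,
    Fin.cons_zero, Fin.cons_succ]
  abel

theorem Model.Omega_cons_zero {n : ℕ} (S : Model d) (k₀ : Mom d) (k : Fin n → Mom d) (σ₀ : ℤˣ)
    (σ : Fin n → ℤˣ) :
    S.Omega (Fin.cons k₀ k : Fin (n + 1) → Mom d) (Fin.cons σ₀ σ : Fin (n + 1) → ℤˣ) 0 =
      ((σ₀ : ℤ) : ℝ) * S.ω k₀ + S.Omega k σ 0 := by
  simp only [Model.Omega, Fin.val_zero, Nat.zero_le, Finset.filter_true, Fin.sum_univ_succ,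
    Fin.cons_zero, Fin.cons_succ]

/-- The outermost phonon `k₀` enters the amplitude only through this energy. With the other momenta
fixed the energy is `Φ` plus a constant, so the dispersive bound applies to the integral over `k₀`.
-/
theorem Model.energy_cons_zero {n : ℕ} (S : Model d) (p k₀ : Mom d) (k : Fin n → Mom d) (σ₀ : ℤˣ)
    (σ : Fin n → ℤˣ) :
    S.energy p (Fin.cons k₀ k : Fin (n + 1) → Mom d) (Fin.cons σ₀ σ : Fin (n + 1) → ℤˣ) 0 =
      S.Phi σ₀ (elMom p k 0) k₀ + S.Omega k σ 0 := by
  rw [Model.energy, elMom_cons_zero, Model.Omega_cons_zero, Model.Phi]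
  ring

theorem Pat.amp_nil (S : Model d) (κ : Measure (Mom d)) (p : Mom d) (k : Fin 0 → Mom d)
    (σ : Fin 0 → ℤˣ) (t : ℝ) :
    Pat.nil.amp S κ p k σ t = Complex.exp (-Complex.I * ((t * S.energy p k σ 0 : ℝ) : ℂ)) := rfl

theorem Pat.amp_ext {n r N : ℕ} (P : Pat n r N) (S : Model d) (κ : Measure (Mom d)) (p : Mom d)
    (k : Fin (n + 1) → Mom d) (σ : Fin (n + 1) → ℤˣ) (t : ℝ) :
    P.ext.amp S κ p k σ t = ∫ s in (0 : ℝ)..t,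
      Complex.exp (-Complex.I * (((t - s) * S.energy p k σ 0 : ℝ) : ℂ)) *
        P.amp S κ p (Fin.tail k) (Fin.tail σ) s := by
  have h1 : Fin.tail (S.phase p k σ) = S.phase p (Fin.tail k) (Fin.tail σ) := by
    funext j s
    simp only [Model.phase, Fin.tail_def, Model.energy, elMom_succ, Model.Omega_succ]
  have h2 : Fin.tail (S.recoll κ p k σ) = S.recoll κ p (Fin.tail k) (Fin.tail σ) := by
    funext j s
    simp only [Model.recoll, Fin.tail_def, elMom_succ, Model.Omega_succ]
  rw [Pat.amp, Pat.conv]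
  beta_reduce
  rw [h1, h2]
  rfl

theorem Pat.amp_int {n r N : ℕ} (P : Pat n r N) (S : Model d) (κ : Measure (Mom d)) (p : Mom d)
    (k : Fin n → Mom d) (σ : Fin n → ℤˣ) (t : ℝ) :
    P.int.amp S κ p k σ t = ∫ s in (0 : ℝ)..t,
      Complex.exp (-Complex.I * (((t - s) * S.energy p k σ 0 : ℝ) : ℂ)) *
        ∫ r in (0 : ℝ)..s, S.Theta κ (s - r) (elMom p k 0) (S.Omega k σ 0) *
          P.amp S κ p k σ r := rfl

/-- Continuity, integrability and dispersive decay of the form factor with respect to a momentum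
measure, for times up to `T`. -/
structure Model.Dispersive (S : Model d) (κ : Measure (Mom d)) (G T : ℝ) : Prop where
  continuous_e : Continuous S.e
  continuous_ω : Continuous S.ω
  continuous_M : ∀ σ, Continuous fun k => S.M k σ
  M_nonneg : ∀ k σ, 0 ≤ S.M k σ
  integrable_M : ∀ σ, Integrable (fun k => S.M k σ) κ
  norm_integral_osc_le : ∀ (σ : ℤˣ) (p : Mom d) (τ : ℝ), |τ| ≤ T →
    ‖∫ k, S.osc σ p τ k ∂κ‖ ≤ G * (1 + |τ|) ^ (-(5 / 4) : ℝ)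

variable {S : Model d} {κ : Measure (Mom d)} {G T : ℝ}

theorem Model.Dispersive.continuous_Theta (h : S.Dispersive κ G T) :
    Continuous fun q : ℝ × Mom d × ℝ => S.Theta κ q.1 q.2.1 q.2.2 := by
  have h1 := h.continuous_e
  have h2 := h.continuous_ω
  have h3 := h.continuous_M
  unfold Model.Theta Model.Phi
  refine continuous_finsetSum _ fun σ _ => ?_
  refine continuous_of_dominated (bound := fun k => S.M k σ) (fun q => ?_) (fun q => ?_)
    (h.integrable_M σ) ?_
  · exact Continuous.aestronglyMeasurable (by fun_prop)
  · refine Eventually.of_forall fun k => ?_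
    rw [norm_mul, norm_cexp_I, one_mul, Complex.norm_real, Real.norm_of_nonneg (h.M_nonneg k σ)]
  · exact Eventually.of_forall fun k => by fun_prop

theorem continuous_elMom {n : ℕ} (j : Fin (n + 1)) :
    Continuous fun z : Mom d × (Fin n → Mom d) => elMom z.1 z.2 j := by
  unfold elMom
  fun_prop

theorem Model.Dispersive.continuous_Omega (h : S.Dispersive κ G T) {n : ℕ} (σ : Fin n → ℤˣ)
    (j : Fin (n + 1)) : Continuous fun z : Mom d × (Fin n → Mom d) => S.Omega z.2 σ j := by
  have h2 := h.continuous_ω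
  unfold Model.Omega
  fun_prop

theorem Model.Dispersive.continuous_phase (h : S.Dispersive κ G T) {n : ℕ} (σ : Fin n → ℤˣ)
    (j : Fin (n + 1)) :
    Continuous fun q : (Mom d × (Fin n → Mom d)) × ℝ => S.phase q.1.1 q.1.2 σ j q.2 := by
  have h1 := h.continuous_e
  have h2 : Continuous fun q : (Mom d × (Fin n → Mom d)) × ℝ => S.Omega q.1.2 σ j :=
    (h.continuous_Omega σ j).comp continuous_fst
  have h3 : Continuous fun q : (Mom d × (Fin n → Mom d)) × ℝ => elMom q.1.1 q.1.2 j :=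
    (continuous_elMom j).comp continuous_fst
  unfold Model.phase Model.energy
  fun_prop

theorem Model.Dispersive.continuous_recoll (h : S.Dispersive κ G T) {n : ℕ} (σ : Fin n → ℤˣ)
    (j : Fin (n + 1)) :
    Continuous fun q : (Mom d × (Fin n → Mom d)) × ℝ => S.recoll κ q.1.1 q.1.2 σ j q.2 := by
  have h2 : Continuous fun q : (Mom d × (Fin n → Mom d)) × ℝ => S.Omega q.1.2 σ j :=
    (h.continuous_Omega σ j).comp continuous_fst
  have h3 : Continuous fun q : (Mom d × (Fin n → Mom d)) × ℝ => elMom q.1.1 q.1.2 j :=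
    (continuous_elMom j).comp continuous_fst
  have h4 := h.continuous_Theta
  exact h4.comp (by fun_prop : Continuous fun q : (Mom d × (Fin n → Mom d)) × ℝ =>
    (q.2, elMom q.1.1 q.1.2 j, S.Omega q.1.2 σ j))

theorem Model.Dispersive.continuous_amp (h : S.Dispersive κ G T) {n r N : ℕ} (P : Pat n r N)
    (σ : Fin n → ℤˣ) :
    Continuous fun q : (Mom d × (Fin n → Mom d)) × ℝ => P.amp S κ q.1.1 q.1.2 σ q.2 :=
  P.continuous_conv (X := fun z : Mom d × (Fin n → Mom d) => S.phase z.1 z.2 σ)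
    (Y := fun z : Mom d × (Fin n → Mom d) => S.recoll κ z.1 z.2 σ)
    (h.continuous_phase σ) (h.continuous_recoll σ)

theorem Model.Dispersive.halfY_eq (h : S.Dispersive κ G T) {n r N : ℕ} (P : Pat n r N)
    (p : Mom d) (k : Fin n → Mom d) (σ : Fin n → ℤˣ) {t : ℝ} (ht : 0 ≤ t) :
    S.halfY κ t N P.toM p k σ = P.amp S κ p k σ t := by
  have hm := mem_patterns.1 P.toM_mem
  have hX : ∀ j, Continuous (S.phase p k σ j) := fun j =>
    (h.continuous_phase σ j).comp (by fun_prop : Continuous fun s : ℝ => ((p, k), s))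
  have hY : ∀ j, Continuous (S.recoll κ p k σ j) := fun j =>
    (h.continuous_recoll σ j).comp (by fun_prop : Continuous fun s : ℝ => ((p, k), s))
  rw [Pat.amp, ← P.timeInt_patProd hX hY ht, Model.halfY]
  congr 1
  funext s
  rw [← prod_pattern_eq hm (S.phase p k σ) (S.recoll κ p k σ) s (extendTime s) (extendTime_val s)]
  rfl

end Polaron
end

noncomputable section
set_option linter.unusedSectionVars false
namespace Polaron
variable {d : ℕ}

/-! ### Mean square bounds for the amplitudes -/

/-- The dispersive decay in time. -/
def timeDecay (τ : ℝ) : ℝ := (1 + |τ|) ^ (-(5 / 4) : ℝ)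

theorem timeDecay_nonneg (τ : ℝ) : 0 ≤ timeDecay τ := by unfold timeDecay; positivity

theorem continuous_timeDecay : Continuous timeDecay := by
  unfold timeDecay
  refine Continuous.rpow_const (by fun_prop) fun x => Or.inl ?_
  positivity

theorem timeDecay_neg (τ : ℝ) : timeDecay (-τ) = timeDecay τ := by simp [timeDecay]

theorem integrable_timeDecay : Integrable timeDecay := by
  have := integrable_one_add_norm (E := ℝ) (μ := volume) (r := 5 / 4) (by norm_num)
  exact this

/-- The integral of the dispersive decay. -/
def decayMass : ℝ := ∫ τ, timeDecay τ

theorem decayMass_nonneg : 0 ≤ decayMass := integral_nonneg timeDecay_nonneg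

theorem lintegral_timeDecay : ∫⁻ τ, ENNReal.ofReal (timeDecay τ) = ENNReal.ofReal decayMass := by
  rw [decayMass, ofReal_integral_eq_lintegral_ofReal integrable_timeDecay
    (Eventually.of_forall timeDecay_nonneg)]

theorem lintegral_timeDecay_sub_le (c : ℝ) (hc : 0 ≤ c) (A : Set ℝ) (r : ℝ) :
    ∫⁻ s in A, ENNReal.ofReal (c * timeDecay (s - r)) ≤ ENNReal.ofReal (c * decayMass) := by
  refine (setLIntegral_le_lintegral _ _).trans ?_
  rw [lintegral_sub_right_eq_self (fun s => ENNReal.ofReal (c * timeDecay s)) r]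
  simp only [ENNReal.ofReal_mul hc]
  rw [lintegral_const_mul' _ _ ENNReal.ofReal_ne_top, lintegral_timeDecay]

theorem ENNReal.mul_le_sq_add_sq (a b : ENNReal) : a * b ≤ a ^ 2 + b ^ 2 := by
  rcases le_total a b with h | h
  · exact (mul_le_mul_left h b).trans (by rw [← sq]; exact le_add_self)
  · exact (mul_le_mul_right h a).trans (by rw [← sq]; exact le_self_add)

/-- The Schur test, with `ab ≤ a² + b²` in place of the sharp inequality. The lost factor two is
harmless, and no finiteness has to be discussed for extended nonnegative functions. -/
theorem lintegral_schur {α : Type*} [MeasurableSpace α] (μ : Measure α) [SFinite μ]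
    {K : α → α → ENNReal} (hK : Measurable (Function.uncurry K)) {f : α → ENNReal}
    (hf : Measurable f) {D : ENNReal} (h1 : ∀ s, ∫⁻ r, K s r ∂μ ≤ D)
    (h2 : ∀ r, ∫⁻ s, K s r ∂μ ≤ D) :
    ∫⁻ s, ∫⁻ r, K s r * (f s * f r) ∂μ ∂μ ≤ 2 * D * ∫⁻ s, f s ^ 2 ∂μ := by
  have hKf : ∀ s, Measurable (K s) := fun s => hK.comp measurable_prodMk_left
  have hKf' : ∀ r, Measurable fun s => K s r := fun r => hK.comp measurable_prodMk_right
  have m1 : Measurable (Function.uncurry fun s r => K s r * f s ^ 2) :=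
    hK.mul ((hf.comp measurable_fst).pow_const 2)
  have m2 : Measurable (Function.uncurry fun s r => K s r * f r ^ 2) :=
    hK.mul ((hf.comp measurable_snd).pow_const 2)
  calc ∫⁻ s, ∫⁻ r, K s r * (f s * f r) ∂μ ∂μ
      ≤ ∫⁻ s, ∫⁻ r, (K s r * f s ^ 2 + K s r * f r ^ 2) ∂μ ∂μ := by
        refine lintegral_mono fun s => lintegral_mono fun r => ?_
        rw [← mul_add]
        exact mul_le_mul_right (ENNReal.mul_le_sq_add_sq _ _) _
    _ = (∫⁻ s, ∫⁻ r, K s r * f s ^ 2 ∂μ ∂μ) + ∫⁻ s, ∫⁻ r, K s r * f r ^ 2 ∂μ ∂μ := by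
        rw [← lintegral_add_left (f := fun s => ∫⁻ r, K s r * f s ^ 2 ∂μ) m1.lintegral_prod_right']
        refine lintegral_congr fun s => lintegral_add_left ((hKf s).mul_const _) _
    _ ≤ D * (∫⁻ s, f s ^ 2 ∂μ) + D * ∫⁻ s, f s ^ 2 ∂μ := by
        refine add_le_add ?_ ?_
        · rw [← lintegral_const_mul _ (hf.pow_const 2)]
          refine lintegral_mono fun s => ?_
          rw [lintegral_mul_const _ (hKf s)]
          exact mul_le_mul_left (h1 s) _
        · rw [lintegral_lintegral_swap m2.aemeasurable, ← lintegral_const_mul _ (hf.pow_const 2)]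
          refine lintegral_mono fun s => ?_
          rw [lintegral_mul_const _ (hKf' s)]
          exact mul_le_mul_left (h2 s) _
    _ = 2 * D * ∫⁻ s, f s ^ 2 ∂μ := by ring

/-- Cauchy-Schwarz up to a factor two, as the Schur test for the kernel one. -/
theorem sq_lintegral_Ioc_le {f : ℝ → ENNReal} (hf : Measurable f) (t : ℝ) :
    (∫⁻ s in Set.Ioc 0 t, f s) ^ 2 ≤ 2 * ENNReal.ofReal t * ∫⁻ s in Set.Ioc 0 t, f s ^ 2 := by
  have := lintegral_schur (volume.restrict (Set.Ioc 0 t)) (K := fun _ _ => 1)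
    (by fun_prop) hf (D := ENNReal.ofReal t) (by simp) (by simp)
  refine le_trans (le_of_eq ?_) this
  simp only [one_mul]
  rw [sq, ← lintegral_mul_const _ hf]
  refine lintegral_congr fun s => ?_
  rw [lintegral_const_mul _ hf]

theorem lintegral_Ioc_pow {c t : ℝ} (hc : 0 ≤ c) (ht : 0 ≤ t) (N : ℕ) :
    ∫⁻ s in Set.Ioc 0 t, ENNReal.ofReal (c * s ^ N) =
      ENNReal.ofReal (c * (t ^ (N + 1) / (N + 1))) := by
  rw [← ofReal_integral_eq_lintegral_ofReal, ← intervalIntegral.integral_of_le ht]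
  · simp
  · exact (Continuous.integrableOn_Icc (by fun_prop)).mono_set Set.Ioc_subset_Icc_self
  · refine (ae_restrict_iff' measurableSet_Ioc).2 (Eventually.of_forall fun s hs => ?_)
    exact mul_nonneg hc (pow_nonneg hs.1.le _)

theorem lintegral_pi_succ {n : ℕ} (κ : Measure (Mom d)) [SigmaFinite κ]
    {F : (Fin (n + 1) → Mom d) → ENNReal} (hF : Measurable F) :
    ∫⁻ k, F k ∂(Measure.pi fun _ => κ) =
      ∫⁻ k : Fin n → Mom d, ∫⁻ k₀, F (Fin.cons k₀ k) ∂κ ∂(Measure.pi fun _ => κ) := by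
  have h := measurePreserving_piFinSuccAbove (n := n) (α := fun _ => Mom d) (fun _ => κ) 0
  rw [← h.symm.lintegral_comp_emb (MeasurableEquiv.measurableEmbedding _), lintegral_prod_symm]
  · simp only [MeasurableEquiv.piFinSuccAbove_symm_apply, Fin.insertNthEquiv, Equiv.coe_fn_mk,
      Fin.insertNth_zero]
    rfl
  · exact (hF.comp (MeasurableEquiv.measurable _)).aemeasurable

variable {S : Model d} {κ : Measure (Mom d)} {G T : ℝ}

theorem Model.Dispersive.G_nonneg (h : S.Dispersive κ G T) (hT : 0 ≤ T) : 0 ≤ G := by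
  have := (norm_nonneg _).trans (h.norm_integral_osc_le 1 0 0 (by simpa using hT))
  simpa using this

/-- The energy `Ω` contributes only a unimodular factor, and the two signs of the phonon give the
factor two. -/
theorem Model.Dispersive.enorm_Theta_le (h : S.Dispersive κ G T) {τ : ℝ} (hτ : |τ| ≤ T)
    (p : Mom d) (Ω : ℝ) :
    ‖S.Theta κ τ p Ω‖ₑ ≤ ENNReal.ofReal (2 * G * timeDecay τ) := by
  rw [← ofReal_norm]
  refine ENNReal.ofReal_le_ofReal ?_
  unfold Model.Theta
  refine (norm_sum_le _ _).trans ?_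
  have hb : ∀ σ : ℤˣ, ‖∫ k, Complex.exp (-Complex.I * ((τ * (S.Phi σ p k + Ω) : ℝ) : ℂ)) *
      (S.M k σ : ℂ) ∂κ‖ ≤ G * timeDecay τ := by
    intro σ
    have e : ∀ k, Complex.exp (-Complex.I * ((τ * (S.Phi σ p k + Ω) : ℝ) : ℂ)) * (S.M k σ : ℂ) =
        Complex.exp (-Complex.I * ((τ * Ω : ℝ) : ℂ)) * S.osc σ p τ k := by
      intro k
      rw [Model.osc, ← mul_assoc, ← Complex.exp_add]
      push_cast
      ring_nf
    simp only [e]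
    rw [integral_const_mul, norm_mul, norm_cexp_I, one_mul]
    exact h.norm_integral_osc_le σ p τ hτ
  refine (Finset.sum_le_sum fun σ _ => hb σ).trans (le_of_eq ?_)
  rw [Finset.sum_const, Finset.card_univ, Fintype.card_units_int]
  simp; ring

/-- The square is expanded into a double time integral and the integral over `k` is done first. It
is the oscillatory integral at the time difference, so the result is a quadratic form in `B` whose
kernel is bounded by the integrable function `G timeDecay`, and the Schur test applies. No power of
`t` is lost. -/
theorem Model.Dispersive.lintegral_vertex_le (h : S.Dispersive κ G T) [SFinite κ] {B : ℝ → ℂ}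
    (hB : Continuous B) (σ : ℤˣ) (p : Mom d) (Ω : ℝ) {t : ℝ} (ht : 0 ≤ t) (htT : t ≤ T) :
    ∫⁻ k, ENNReal.ofReal (S.M k σ) * ‖∫ s in (0 : ℝ)..t,
        Complex.exp (-Complex.I * (((t - s) * (S.Phi σ p k + Ω) : ℝ) : ℂ)) * B s‖ₑ ^ 2 ∂κ ≤
      2 * ENNReal.ofReal (G * decayMass) * ∫⁻ s in Set.Ioc 0 t, ‖B s‖ₑ ^ 2 := by
  have hG := h.G_nonneg (ht.trans htT)
  have hΦ : Continuous fun k => S.Phi σ p k := by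
    have h1 := h.continuous_e
    have h2 := h.continuous_ω
    unfold Model.Phi; fun_prop
  have hM := h.continuous_M σ
  set μ : Measure ℝ := volume.restrict (Set.Ioc 0 t) with hμ
  set g : Mom d → ℝ → ℂ := fun k s =>
    Complex.exp (-Complex.I * (((t - s) * (S.Phi σ p k + Ω) : ℝ) : ℂ)) * B s with hg
  set F : Mom d → ℝ × ℝ → ℂ := fun k q => (S.M k σ : ℂ) *
    (g k q.1 * (starRingEnd ℂ) (g k q.2)) with hF
  have hng : ∀ k s, ‖g k s‖ = ‖B s‖ := fun k s => by rw [hg]; simp only [norm_mul, norm_cexp_I, one_mul]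
  have hBi : Integrable B μ :=
    hB.integrableOn_Icc.mono_set Set.Ioc_subset_Icc_self
  -- Absolute integrability justifies exchanging the phonon integral with the two time integrals;
  -- the cancellations are used only after the exchange.
  have hFint : Integrable (Function.uncurry F) (κ.prod (μ.prod μ)) := by
    refine Integrable.mono' ((h.integrable_M σ).mul_prod (hBi.norm.mul_prod hBi.norm)) ?_ ?_
    · refine Continuous.aestronglyMeasurable ?_
      simp only [hF, hg, Function.uncurry_def]
      fun_prop
    · refine Eventually.of_forall fun z => ?_
      simp only [Function.uncurry_def, hF, norm_mul, RCLike.norm_conj, hng, Complex.norm_real]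
      rw [Real.norm_of_nonneg (h.M_nonneg _ _)]
  have hsq : ∀ k, ((S.M k σ * ‖∫ s, g k s ∂μ‖ ^ 2 : ℝ) : ℂ) = ∫ q, F k q ∂(μ.prod μ) := by
    intro k
    simp only [hF]
    rw [integral_const_mul, integral_prod_mul (g k) (fun s => (starRingEnd ℂ) (g k s)), integral_conj,
      Complex.mul_conj]
    push_cast
    rw [Complex.normSq_eq_norm_sq]
    push_cast
    rfl
  have hI : Integrable (fun k => S.M k σ * ‖∫ s, g k s ∂μ‖ ^ 2) κ := by
    have := hFint.integral_prod_left
    simp only [Function.uncurry_def, ← hsq] at this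
    exact this.re
  have hin : ∀ q : ℝ × ℝ, q ∈ Set.Ioc 0 t ×ˢ Set.Ioc 0 t → ‖∫ k, F k q ∂κ‖ₑ ≤
      ENNReal.ofReal (G * timeDecay (q.2 - q.1)) * (‖B q.1‖ₑ * ‖B q.2‖ₑ) := by
    rintro ⟨s, s'⟩ ⟨h1, h2⟩
    simp only at h1 h2 ⊢
    -- The final time `t` cancels between the two conjugate factors and only `s' - s` remains in the
    -- phase.
    have e : ∀ k, F k (s, s') = (B s * (starRingEnd ℂ) (B s') *
        Complex.exp (-Complex.I * (((s' - s) * Ω : ℝ) : ℂ))) * S.osc σ p (s' - s) k := by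
      intro k
      simp only [hF, hg, map_mul, ← Complex.exp_conj, Model.osc, map_neg, Complex.conj_I,
        Complex.conj_ofReal]
      have : Complex.exp (-Complex.I * (((t - s) * (S.Phi σ p k + Ω) : ℝ) : ℂ)) *
          Complex.exp (- -Complex.I * (((t - s') * (S.Phi σ p k + Ω) : ℝ) : ℂ)) =
          Complex.exp (-Complex.I * (((s' - s) * Ω : ℝ) : ℂ)) *
          Complex.exp (-Complex.I * (((s' - s) * S.Phi σ p k : ℝ) : ℂ)) := by
        rw [← Complex.exp_add, ← Complex.exp_add]
        push_cast
        ring_nf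
      linear_combination ((S.M k σ : ℂ) * B s * (starRingEnd ℂ) (B s')) * this
    simp only [e]
    rw [integral_const_mul, enorm_mul, enorm_mul, enorm_mul, mul_comm]
    have e1 : ‖Complex.exp (-Complex.I * (((s' - s) * Ω : ℝ) : ℂ))‖ₑ = 1 := by
      rw [← ofReal_norm, norm_cexp_I, ENNReal.ofReal_one]
    have e2 : ‖(starRingEnd ℂ) (B s')‖ₑ = ‖B s'‖ₑ := by
      rw [← ofReal_norm, ← ofReal_norm, RCLike.norm_conj]
    rw [e1, e2, mul_one]
    refine mul_le_mul_left ?_ _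
    rw [← ofReal_norm]
    refine ENNReal.ofReal_le_ofReal (h.norm_integral_osc_le σ p _ ?_)
    rw [abs_le]; constructor <;> linarith [h1.1, h1.2, h2.1, h2.2]
  calc _ = ∫⁻ k, ENNReal.ofReal (S.M k σ * ‖∫ s, g k s ∂μ‖ ^ 2) ∂κ := by
        refine lintegral_congr fun k => ?_
        rw [intervalIntegral.integral_of_le ht, ENNReal.ofReal_mul (h.M_nonneg _ _),
          ENNReal.ofReal_pow (norm_nonneg _), ofReal_norm]
    _ = ‖∫ k, ((S.M k σ * ‖∫ s, g k s ∂μ‖ ^ 2 : ℝ) : ℂ) ∂κ‖ₑ := by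
        have h0 : ∀ k, 0 ≤ S.M k σ * ‖∫ s, g k s ∂μ‖ ^ 2 := fun k =>
          mul_nonneg (h.M_nonneg _ _) (by positivity)
        rw [← ofReal_integral_eq_lintegral_ofReal hI (Eventually.of_forall h0), integral_complex_ofReal,
          ← ofReal_norm, Complex.norm_real, Real.norm_of_nonneg (integral_nonneg h0)]
    _ = ‖∫ q, ∫ k, F k q ∂κ ∂(μ.prod μ)‖ₑ := by
        simp only [hsq]
        rw [integral_integral_swap hFint]
    _ ≤ ∫⁻ q, ‖∫ k, F k q ∂κ‖ₑ ∂(μ.prod μ) := enorm_integral_le_lintegral_enorm _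
    _ ≤ ∫⁻ q, ENNReal.ofReal (G * timeDecay (q.2 - q.1)) * (‖B q.1‖ₑ * ‖B q.2‖ₑ) ∂(μ.prod μ) := by
        rw [hμ, Measure.prod_restrict]
        exact setLIntegral_mono' (measurableSet_Ioc.prod measurableSet_Ioc) hin
    _ = ∫⁻ s, ∫⁻ r, ENNReal.ofReal (G * timeDecay (r - s)) * (‖B s‖ₑ * ‖B r‖ₑ) ∂μ ∂μ := by
        have := continuous_timeDecay
        rw [lintegral_prod]
        exact Measurable.aemeasurable (by fun_prop)
    _ ≤ _ := by
        have := continuous_timeDecay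
        refine lintegral_schur μ (K := fun s r => ENNReal.ofReal (G * timeDecay (r - s)))
          (by simp only [Function.uncurry_def]; fun_prop) (by fun_prop) (fun s => ?_) fun r => ?_
        · exact lintegral_timeDecay_sub_le G hG _ s
        · simp only [← timeDecay_neg (r - _), neg_sub]
          exact lintegral_timeDecay_sub_le G hG _ r

/-- The kernel `Y` has integral at most `c decayMass`, so the inner convolution costs no time.
Cauchy-Schwarz on the remaining integral produces one factor `t` and one time integral. -/
theorem enorm_recollision_le {X Y A : ℝ → ℂ} (hA : Continuous A) {t c : ℝ} (ht : 0 ≤ t)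
    (hc : 0 ≤ c) (hX : ∀ s, ‖X s‖ₑ ≤ 1)
    (hY : ∀ s, |s| ≤ t → ‖Y s‖ₑ ≤ ENNReal.ofReal (c * timeDecay s)) :
    ‖∫ s in (0 : ℝ)..t, X (t - s) * ∫ r in (0 : ℝ)..s, Y (s - r) * A r‖ₑ ^ 2 ≤
      2 * ENNReal.ofReal ((c * decayMass) ^ 2 * t) * ∫⁻ r in Set.Ioc 0 t, ‖A r‖ₑ ^ 2 := by
  have hD := continuous_timeDecay.measurable
  have hAm := hA.measurable
  have hmeas : Measurable fun r => ‖A r‖ₑ := by fun_prop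
  have key : ‖∫ s in (0 : ℝ)..t, X (t - s) * ∫ r in (0 : ℝ)..s, Y (s - r) * A r‖ₑ ≤
      ENNReal.ofReal (c * decayMass) * ∫⁻ r in Set.Ioc 0 t, ‖A r‖ₑ := by
    rw [intervalIntegral.integral_of_le ht]
    refine (enorm_integral_le_lintegral_enorm _).trans ?_
    calc _ ≤ ∫⁻ s in Set.Ioc 0 t, ∫⁻ r in Set.Ioc 0 t,
          ENNReal.ofReal (c * timeDecay (s - r)) * ‖A r‖ₑ := by
          refine setLIntegral_mono' measurableSet_Ioc fun s hs => ?_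
          rw [enorm_mul]
          refine (mul_le_mul_left (hX _) _).trans ?_
          rw [one_mul, intervalIntegral.integral_of_le hs.1.le]
          refine (enorm_integral_le_lintegral_enorm _).trans ?_
          refine le_trans ?_ (lintegral_mono_set (Set.Ioc_subset_Ioc_right hs.2))
          refine setLIntegral_mono' measurableSet_Ioc fun r hr => ?_
          rw [enorm_mul]
          refine mul_le_mul_left (hY _ ?_) _
          rw [abs_le]; constructor <;> linarith [hr.1, hr.2, hs.2]
      _ = ∫⁻ r in Set.Ioc 0 t, ∫⁻ s in Set.Ioc 0 t,
          ENNReal.ofReal (c * timeDecay (s - r)) * ‖A r‖ₑ :=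
          lintegral_lintegral_swap (Measurable.aemeasurable
            (by simp only [Function.uncurry_def]; fun_prop))
      _ ≤ ∫⁻ r in Set.Ioc 0 t, ENNReal.ofReal (c * decayMass) * ‖A r‖ₑ := by
          refine lintegral_mono fun r => ?_
          rw [lintegral_mul_const _ (by fun_prop)]
          exact mul_le_mul_left (lintegral_timeDecay_sub_le c hc _ r) _
      _ = _ := lintegral_const_mul _ hmeas
  refine (pow_le_pow_left' key 2).trans ?_
  rw [mul_pow]
  refine (mul_le_mul_right (sq_lintegral_Ioc_le hmeas t) _).trans (le_of_eq ?_)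
  rw [ENNReal.ofReal_mul (p := (c * decayMass) ^ 2) (by positivity), ENNReal.ofReal_pow (mul_nonneg hc decayMass_nonneg)]
  ring

end Polaron
end

/-! ### Recursion for the mean squares over the external phonons. -/

noncomputable section
set_option linter.unusedSectionVars false
namespace Polaron
variable {d : ℕ}

/-- The mean square of the amplitude of a pattern over the external phonons. -/
def Pat.avg {n r N : ℕ} (P : Pat n r N) (S : Model d) (κ : Measure (Mom d)) (p : Mom d)
    (t : ℝ) : ENNReal :=
  ∑ σ : Fin n → ℤˣ, ∫⁻ k, ENNReal.ofReal (∏ j, S.M (k j) (σ j)) * ‖P.amp S κ p k σ t‖ₑ ^ 2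
    ∂(Measure.pi fun _ => κ)

variable {S : Model d} {κ : Measure (Mom d)} {G T : ℝ}

theorem Model.Dispersive.continuous_weight (h : S.Dispersive κ G T) {n : ℕ} (σ : Fin n → ℤˣ) :
    Continuous fun k : Fin n → Mom d => ∏ j, S.M (k j) (σ j) :=
  continuous_finsetProd _ fun j _ => (h.continuous_M (σ j)).comp (continuous_apply j)

theorem Model.Dispersive.lintegral_avg (h : S.Dispersive κ G T) [SigmaFinite κ] {n r N : ℕ}
    (P : Pat n r N) (p : Mom d) (t : ℝ) :
    ∑ σ : Fin n → ℤˣ, ∫⁻ k, ENNReal.ofReal (∏ j, S.M (k j) (σ j)) *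
        (∫⁻ s in Set.Ioc 0 t, ‖P.amp S κ p k σ s‖ₑ ^ 2) ∂(Measure.pi fun _ => κ) =
      ∫⁻ s in Set.Ioc 0 t, P.avg S κ p s := by
  have hc : ∀ σ, Measurable fun q : (Fin n → Mom d) × ℝ => P.amp S κ p q.1 σ q.2 := fun σ =>
    ((h.continuous_amp P σ).comp
      (by fun_prop : Continuous fun q : (Fin n → Mom d) × ℝ => ((p, q.1), q.2))).measurable
  have hw : ∀ σ : Fin n → ℤˣ, Measurable fun k : Fin n → Mom d => ∏ j, S.M (k j) (σ j) := fun (σ : Fin n → ℤˣ) =>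
    (h.continuous_weight σ).measurable
  have hm : ∀ σ : Fin n → ℤˣ, Measurable fun q : (Fin n → Mom d) × ℝ =>
      ENNReal.ofReal (∏ j, S.M (q.1 j) (σ j)) * ‖P.amp S κ p q.1 σ q.2‖ₑ ^ 2 := fun σ =>
    ((hw σ).comp measurable_fst).ennreal_ofReal.mul ((hc σ).enorm.pow_const 2)
  unfold Pat.avg
  rw [lintegral_finsetSum]
  · refine Finset.sum_congr rfl fun σ _ => ?_
    rw [← lintegral_lintegral_swap (hm σ).aemeasurable]
    refine lintegral_congr fun k => ?_
    rw [lintegral_const_mul]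
    exact ((hc σ).comp measurable_prodMk_left).enorm.pow_const 2
  · intro σ _
    exact Measurable.lintegral_prod_left' (f := fun q : (Fin n → Mom d) × ℝ =>
      ENNReal.ofReal (∏ j, S.M (q.1 j) (σ j)) * ‖P.amp S κ p q.1 σ q.2‖ₑ ^ 2) (hm σ)

/-- The factor four is the two of the Schur test times the two signs of the outermost phonon. -/
theorem Model.Dispersive.avg_ext_le (h : S.Dispersive κ G T) [SigmaFinite κ] {n r N : ℕ}
    (P : Pat n r N) (p : Mom d) {t : ℝ} (ht : 0 ≤ t) (htT : t ≤ T) :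
    P.ext.avg S κ p t ≤
      ENNReal.ofReal (4 * G * decayMass) * ∫⁻ s in Set.Ioc 0 t, P.avg S κ p s := by
  have hm : ∀ σ : Fin (n + 1) → ℤˣ, Measurable fun k : Fin (n + 1) → Mom d =>
      ENNReal.ofReal (∏ j, S.M (k j) (σ j)) * ‖P.ext.amp S κ p k σ t‖ₑ ^ 2 := fun σ =>
    (h.continuous_weight σ).measurable.ennreal_ofReal.mul
      ((((h.continuous_amp P.ext σ).comp (by fun_prop :
        Continuous fun k : Fin (n + 1) → Mom d => ((p, k), t))).measurable.enorm).pow_const 2)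
  have hin : ∀ (σ₀ : ℤˣ) (σ : Fin n → ℤˣ) (k : Fin n → Mom d),
      ∫⁻ k₀, ENNReal.ofReal (∏ j, S.M ((Fin.cons k₀ k : Fin (n + 1) → Mom d) j)
          ((Fin.cons σ₀ σ : Fin (n + 1) → ℤˣ) j)) *
        ‖P.ext.amp S κ p (Fin.cons k₀ k) (Fin.cons σ₀ σ) t‖ₑ ^ 2 ∂κ ≤
      2 * ENNReal.ofReal (G * decayMass) * (ENNReal.ofReal (∏ j, S.M (k j) (σ j)) *
        ∫⁻ s in Set.Ioc 0 t, ‖P.amp S κ p k σ s‖ₑ ^ 2) := by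
    intro σ₀ σ k
    have hB : Continuous fun s => P.amp S κ p k σ s :=
      (h.continuous_amp P σ).comp (by fun_prop : Continuous fun s : ℝ => ((p, k), s))
    have := h.lintegral_vertex_le hB σ₀ (elMom p k 0) (S.Omega k σ 0) ht htT
    simp only [Fin.prod_univ_succ, Fin.cons_zero, Fin.cons_succ, Pat.amp_ext,
      Model.energy_cons_zero, Fin.tail_cons]
    have hnn : 0 ≤ ∏ j, S.M (k j) (σ j) := Finset.prod_nonneg fun j _ => h.M_nonneg _ _
    calc _ = ENNReal.ofReal (∏ j, S.M (k j) (σ j)) * ∫⁻ k₀, ENNReal.ofReal (S.M k₀ σ₀) *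
          ‖∫ s in (0 : ℝ)..t, Complex.exp (-Complex.I *
            (((t - s) * (S.Phi σ₀ (elMom p k 0) k₀ + S.Omega k σ 0) : ℝ) : ℂ)) *
              P.amp S κ p k σ s‖ₑ ^ 2 ∂κ := by
          rw [← lintegral_const_mul' _ _ ENNReal.ofReal_ne_top]
          refine lintegral_congr fun k₀ => ?_
          rw [ENNReal.ofReal_mul (h.M_nonneg _ _)]
          ring
      _ ≤ _ := by
          refine (mul_le_mul_right this _).trans (le_of_eq ?_)
          ring
  calc P.ext.avg S κ p t = ∑ q : ℤˣ × (Fin n → ℤˣ), ∫⁻ k : Fin n → Mom d, ∫⁻ k₀,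
        ENNReal.ofReal (∏ j, S.M ((Fin.cons k₀ k : Fin (n + 1) → Mom d) j)
          ((Fin.cons q.1 q.2 : Fin (n + 1) → ℤˣ) j)) *
        ‖P.ext.amp S κ p (Fin.cons k₀ k) (Fin.cons q.1 q.2) t‖ₑ ^ 2 ∂κ
          ∂(Measure.pi fun _ => κ) := by
        unfold Pat.avg
        refine (Fintype.sum_equiv (Fin.consEquiv fun _ => ℤˣ) _ _ fun q => ?_).symm
        exact (lintegral_pi_succ κ (hm _)).symm
    _ ≤ ∑ q : ℤˣ × (Fin n → ℤˣ), 2 * ENNReal.ofReal (G * decayMass) *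
        ∫⁻ k : Fin n → Mom d, ENNReal.ofReal (∏ j, S.M (k j) (q.2 j)) *
          (∫⁻ s in Set.Ioc 0 t, ‖P.amp S κ p k q.2 s‖ₑ ^ 2) ∂(Measure.pi fun _ => κ) := by
        refine Finset.sum_le_sum fun q _ => ?_
        rw [← lintegral_const_mul' _ _ (by finiteness)]
        exact lintegral_mono fun k => hin q.1 q.2 k
    _ = _ := by
        rw [Fintype.sum_prod_type]
        simp only [← Finset.mul_sum, h.lintegral_avg P p t, Finset.sum_const, Finset.card_univ,
          Fintype.card_units_int]
        rw [show 4 * G * decayMass = 4 * (G * decayMass) by ring,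
          ENNReal.ofReal_mul (p := 4) (by norm_num)]
        simp only [nsmul_eq_mul, ENNReal.ofReal_ofNat, Nat.cast_ofNat]
        ring

theorem Model.Dispersive.avg_int_le (h : S.Dispersive κ G T) [SigmaFinite κ] {n r N : ℕ}
    (P : Pat n r N) (p : Mom d) {t : ℝ} (ht : 0 ≤ t) (htT : t ≤ T) :
    P.int.avg S κ p t ≤ ENNReal.ofReal ((4 * G * decayMass) ^ 2 * t) *
      ∫⁻ s in Set.Ioc 0 t, P.avg S κ p s := by
  have hG := h.G_nonneg (ht.trans htT)
  rw [← h.lintegral_avg P p t, Pat.avg, Finset.mul_sum]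
  refine Finset.sum_le_sum fun σ _ => ?_
  rw [← lintegral_const_mul' _ _ ENNReal.ofReal_ne_top]
  refine lintegral_mono fun k => ?_
  rw [mul_left_comm]
  refine mul_le_mul_right ?_ _
  have hA : Continuous fun s => P.amp S κ p k σ s :=
    (h.continuous_amp P σ).comp (by fun_prop : Continuous fun s : ℝ => ((p, k), s))
  rw [Pat.amp_int]
  have := enorm_recollision_le (X := fun s =>
      Complex.exp (-Complex.I * ((s * S.energy p k σ 0 : ℝ) : ℂ)))
    (Y := fun s => S.Theta κ s (elMom p k 0) (S.Omega k σ 0)) hA ht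
    (by positivity : 0 ≤ 2 * G)
    (fun s => by rw [← ofReal_norm, norm_cexp_I, ENNReal.ofReal_one])
    (fun s hs => h.enorm_Theta_le (hs.trans htT) _ _)
  refine this.trans (mul_le_mul_left ?_ _)
  rw [show (2 : ENNReal) = ENNReal.ofReal 2 by simp, ← ENNReal.ofReal_mul (by norm_num)]
  refine ENNReal.ofReal_le_ofReal ?_
  -- `2 (2 G decayMass)² ≤ (4 G decayMass)²`, so both kinds of step cost the same constant per
  -- vertex.
  nlinarith [mul_nonneg (sq_nonneg (G * decayMass)) ht]

/-- Each of the `n + r` steps contributes one time integration. Integrating `s ^ N` gives the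
denominator `N + 1`, which is at least the next factor of the factorial. Recollisions add a further
`t`, so the total power is `t ^ N`. The bound does not involve `p`. -/
theorem Model.Dispersive.avg_le (h : S.Dispersive κ G T) [SigmaFinite κ] {n r N : ℕ}
    (P : Pat n r N) (p : Mom d) {t : ℝ} (ht : 0 ≤ t) (htT : t ≤ T) :
    P.avg S κ p t ≤
      ENNReal.ofReal ((4 * G * decayMass) ^ N / ((n + r).factorial : ℝ) * t ^ N) := by
  have hG := h.G_nonneg (ht.trans htT)
  have hA : 0 ≤ 4 * G * decayMass := mul_nonneg (by positivity) decayMass_nonneg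
  induction P generalizing t with
  | nil =>
    unfold Pat.avg
    simp only [Pat.amp_nil, ← ofReal_norm, norm_cexp_I]
    simp
  | @ext n r N P ih =>
    refine (h.avg_ext_le P p ht htT).trans ?_
    have h1 : ∫⁻ s in Set.Ioc 0 t, P.avg S κ p s ≤ ∫⁻ s in Set.Ioc 0 t,
        ENNReal.ofReal ((4 * G * decayMass) ^ N / ((n + r).factorial : ℝ) * s ^ N) :=
      setLIntegral_mono' measurableSet_Ioc fun s hs => ih hs.1.le (hs.2.trans htT)
    rw [lintegral_Ioc_pow (by positivity) ht] at h1
    refine (mul_le_mul_right h1 _).trans ?_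
    rw [← ENNReal.ofReal_mul hA]
    refine ENNReal.ofReal_le_ofReal ?_
    -- The true denominator `N + 1` is traded for the smaller `n + r + 1`, because `N = n + 2 r`.
    have hle : ((n + 1 + r : ℕ) : ℝ) ≤ (N : ℝ) + 1 := by
      have := P.card_eq
      exact_mod_cast (by omega : n + 1 + r ≤ N + 1)
    rw [show n + 1 + r = (n + r) + 1 by ring] at hle ⊢
    rw [Nat.factorial_succ]
    have hp : (0 : ℝ) < ((n + r + 1 : ℕ) : ℝ) := by positivity
    calc 4 * G * decayMass * ((4 * G * decayMass) ^ N / ((n + r).factorial : ℝ) *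
          (t ^ (N + 1) / (N + 1)))
        = ((4 * G * decayMass) ^ (N + 1) * t ^ (N + 1) / ((n + r).factorial : ℝ)) / (N + 1) := by
          rw [pow_succ (4 * G * decayMass) N]; ring
      _ ≤ ((4 * G * decayMass) ^ (N + 1) * t ^ (N + 1) / ((n + r).factorial : ℝ)) /
          ((n + r + 1 : ℕ) : ℝ) := by
          gcongr
      _ = _ := by push_cast; field_simp
  | @int n r N P ih =>
    refine (h.avg_int_le P p ht htT).trans ?_
    have h1 : ∫⁻ s in Set.Ioc 0 t, P.avg S κ p s ≤ ∫⁻ s in Set.Ioc 0 t,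
        ENNReal.ofReal ((4 * G * decayMass) ^ N / ((n + r).factorial : ℝ) * s ^ N) :=
      setLIntegral_mono' measurableSet_Ioc fun s hs => ih hs.1.le (hs.2.trans htT)
    rw [lintegral_Ioc_pow (by positivity) ht] at h1
    refine (mul_le_mul_right h1 _).trans ?_
    rw [← ENNReal.ofReal_mul (by positivity)]
    refine ENNReal.ofReal_le_ofReal ?_
    have hle : ((n + r + 1 : ℕ) : ℝ) ≤ (N : ℝ) + 1 := by
      have := P.card_eq
      exact_mod_cast (by omega : n + r + 1 ≤ N + 1)
    rw [show n + (r + 1) = (n + r) + 1 by ring]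
    rw [Nat.factorial_succ]
    have hp : (0 : ℝ) < ((n + r + 1 : ℕ) : ℝ) := by positivity
    calc (4 * G * decayMass) ^ 2 * t * ((4 * G * decayMass) ^ N / ((n + r).factorial : ℝ) *
          (t ^ (N + 1) / (N + 1)))
        = ((4 * G * decayMass) ^ (N + 2) * t ^ (N + 2) / ((n + r).factorial : ℝ)) / (N + 1) := by
          ring
      _ ≤ ((4 * G * decayMass) ^ (N + 2) * t ^ (N + 2) / ((n + r).factorial : ℝ)) /
          ((n + r + 1 : ℕ) : ℝ) := by
          gcongr
      _ = _ := by push_cast; field_simp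

/-! ### The pairing bound -/

theorem ENNReal.two_mul_mul_le_sq_add_sq (a b : ENNReal) : 2 * (a * b) ≤ a ^ 2 + b ^ 2 := by
  rcases eq_or_ne a ⊤ with rfl | ha
  · simp
  rcases eq_or_ne b ⊤ with rfl | hb
  · simp
  lift a to NNReal using ha
  lift b to NNReal using hb
  have := two_mul_le_add_sq a b
  rw [mul_assoc] at this
  exact_mod_cast this

/-- The external momenta are integrated against a symmetric product weight and the signs are summed
over, so relabelling them changes nothing. -/
theorem Pat.avg_perm {n r N : ℕ} (P : Pat n r N) (S : Model d) (κ : Measure (Mom d))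
    [SigmaFinite κ] (π : Equiv.Perm (Fin n)) (p : Mom d) (t : ℝ) :
    ∑ σ : Fin n → ℤˣ, ∫⁻ k, ENNReal.ofReal (∏ j, S.M (k j) (σ j)) *
        ‖P.amp S κ p (fun l => k (π.symm l)) (fun l => σ (π.symm l)) t‖ₑ ^ 2
          ∂(Measure.pi fun _ => κ) = P.avg S κ p t := by
  unfold Pat.avg
  refine Fintype.sum_equiv (Equiv.arrowCongr π (Equiv.refl ℤˣ)) _ _ fun σ => ?_
  have hmp := measurePreserving_piCongrLeft (α := fun _ : Fin n => Mom d) (fun _ => κ) π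
  refine Eq.trans ?_ (hmp.lintegral_comp_emb (MeasurableEquiv.measurableEmbedding _) _)
  refine lintegral_congr fun k => ?_
  have e1 : (MeasurableEquiv.piCongrLeft (fun _ : Fin n => Mom d) π) k = fun l => k (π.symm l) := by
    funext l
    obtain ⟨i, rfl⟩ := π.surjective l
    simp [MeasurableEquiv.coe_piCongrLeft, Equiv.piCongrLeft_apply_apply]
  have e2 : (Equiv.arrowCongr π (Equiv.refl ℤˣ)) σ = fun l => σ (π.symm l) := rfl
  rw [e1, e2]
  congr 2
  exact (Equiv.prod_comp π.symm fun j => S.M (k j) (σ j)).symm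

theorem Model.Dispersive.continuous_Y (h : S.Dispersive κ G T) {n r N : ℕ} (P P' : Pat n r N)
    (π : Equiv.Perm (Fin n)) {t : ℝ} (ht : 0 ≤ t) (σ : Fin n → ℤˣ) :
    Continuous fun q : Mom d × (Fin n → Mom d) =>
      ((∏ j, S.M (q.2 j) (σ j) : ℝ) : ℂ) * S.Y κ t N P.toM P'.toM π q.1 q.2 σ := by
  have hc : ∀ (P : Pat n r N) (σ : Fin n → ℤˣ), Continuous fun q : Mom d × (Fin n → Mom d) =>
      P.amp S κ q.1 q.2 σ t := fun P σ => (h.continuous_amp P σ).comp (by fun_prop :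
        Continuous fun q : Mom d × (Fin n → Mom d) => (q, t))
  have hτ : Continuous fun q : Mom d × (Fin n → Mom d) =>
      ((q.1, fun l => q.2 (π.symm l)) : Mom d × (Fin n → Mom d)) := by fun_prop
  have h2 := (hc P' fun l => σ (π.symm l)).comp hτ
  have hw : Continuous fun q : Mom d × (Fin n → Mom d) =>
      ((∏ j, S.M (q.2 j) (σ j) : ℝ) : ℂ) :=
    Complex.continuous_ofReal.comp ((h.continuous_weight σ).comp continuous_snd)
  have e : (fun q : Mom d × (Fin n → Mom d) =>
      ((∏ j, S.M (q.2 j) (σ j) : ℝ) : ℂ) * S.Y κ t N P.toM P'.toM π q.1 q.2 σ) =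
      fun q => ((∏ j, S.M (q.2 j) (σ j) : ℝ) : ℂ) * (P.amp S κ q.1 q.2 σ t *
        (starRingEnd ℂ) (P'.amp S κ q.1 (fun l => q.2 (π.symm l))
          (fun l => σ (π.symm l)) t)) := by
    funext q
    rw [Model.Y, h.halfY_eq P _ _ _ ht, h.halfY_eq P' _ _ _ ht]
  rw [e]
  exact hw.mul ((hc P σ).mul (Complex.continuous_conj.comp h2))

/-- Cauchy-Schwarz in the form `2ab ≤ a² + b²` separates the two halves of the pairing. By
permutation invariance both squares are plain mean squares of patterns. Their bound is uniform in
`p`, so averaging over any probability measure preserves it. -/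
theorem Model.Dispersive.norm_C_le (h : S.Dispersive κ G T) [SigmaFinite κ] {n r N : ℕ}
    (P P' : Pat n r N) (π : Equiv.Perm (Fin n)) (ρ : Measure (Mom d)) [IsProbabilityMeasure ρ]
    (lam : ℝ) {t : ℝ} (ht : 0 ≤ t) (htT : t ≤ T) :
    ‖S.C κ ρ lam t N P.toM P'.toM π‖ ≤
      lam ^ (2 * N) * ((4 * G * decayMass) ^ N / ((n + r).factorial : ℝ) * t ^ N) := by
  have hG := h.G_nonneg (ht.trans htT)
  have hA : 0 ≤ 4 * G * decayMass := mul_nonneg (by positivity) decayMass_nonneg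
  set D := (4 * G * decayMass) ^ N / ((n + r).factorial : ℝ) * t ^ N with hD
  have hD0 : 0 ≤ D := by positivity
  set Z : (Fin n → ℤˣ) → Mom d → ENNReal := fun σ p => ∫⁻ k, ‖((∏ j, S.M (k j) (σ j) : ℝ) : ℂ) *
    S.Y κ t N P.toM P'.toM π p k σ‖ₑ ∂(Measure.pi fun _ => κ) with hZ
  have hmain : ∀ p, ∑ σ, Z σ p ≤ ENNReal.ofReal D := by
    intro p
    have hm : ∀ (P : Pat n r N) (σ : Fin n → ℤˣ), Measurable fun k : Fin n → Mom d =>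
        P.amp S κ p k σ t := fun P σ => ((h.continuous_amp P σ).comp (by fun_prop :
          Continuous fun k : Fin n → Mom d => ((p, k), t))).measurable
    have hle : ∀ σ, 2 * Z σ p ≤ (∫⁻ k, ENNReal.ofReal (∏ j, S.M (k j) (σ j)) *
          ‖P.amp S κ p k σ t‖ₑ ^ 2 ∂(Measure.pi fun _ => κ)) +
        ∫⁻ k, ENNReal.ofReal (∏ j, S.M (k j) (σ j)) *
          ‖P'.amp S κ p (fun l => k (π.symm l)) (fun l => σ (π.symm l)) t‖ₑ ^ 2
            ∂(Measure.pi fun _ => κ) := by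
      intro σ
      rw [← lintegral_add_left, ← lintegral_const_mul' _ _ ENNReal.ofNat_ne_top]
      · refine lintegral_mono fun k => ?_
        simp only [Model.Y, h.halfY_eq P _ _ _ ht, h.halfY_eq P' _ _ _ ht, enorm_mul]
        rw [← mul_add]
        have e1 : ‖((∏ j, S.M (k j) (σ j) : ℝ) : ℂ)‖ₑ = ENNReal.ofReal (∏ j, S.M (k j) (σ j)) := by
          rw [← ofReal_norm, Complex.norm_real,
            Real.norm_of_nonneg (Finset.prod_nonneg fun j _ => h.M_nonneg _ _)]
        rw [e1, ← ofReal_norm ((starRingEnd ℂ) _), RCLike.norm_conj, ofReal_norm]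
        rw [mul_left_comm]
        exact mul_le_mul_right (ENNReal.two_mul_mul_le_sq_add_sq _ _) _
      · exact (h.continuous_weight σ).measurable.ennreal_ofReal.mul ((hm P σ).enorm.pow_const 2)
    refine (ENNReal.mul_le_mul_iff_right two_ne_zero ENNReal.ofNat_ne_top).1 ?_
    rw [Finset.mul_sum]
    refine (Finset.sum_le_sum fun σ _ => hle σ).trans ?_
    rw [Finset.sum_add_distrib, P'.avg_perm S κ π p t, two_mul]
    exact add_le_add (h.avg_le P p ht htT) (h.avg_le P' p ht htT)
  have hZm : ∀ σ, Measurable (Z σ) := fun σ =>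
    (h.continuous_Y P P' π ht σ).measurable.enorm.lintegral_prod_right'
  have hfin : ‖∑ σ : Fin n → ℤˣ, ∫ p, ∫ k : Fin n → Mom d,
      ((∏ j, S.M (k j) (σ j) : ℝ) : ℂ) * S.Y κ t N P.toM P'.toM π p k σ
        ∂(Measure.pi fun _ => κ) ∂ρ‖ₑ ≤ ENNReal.ofReal D := by
    refine (enorm_sum_le _ _).trans ?_
    calc _ ≤ ∑ σ : Fin n → ℤˣ, ∫⁻ p, Z σ p ∂ρ := by
          refine Finset.sum_le_sum fun σ _ => ?_
          refine (enorm_integral_le_lintegral_enorm _).trans ?_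
          exact lintegral_mono fun p => enorm_integral_le_lintegral_enorm _
      _ = ∫⁻ p, ∑ σ : Fin n → ℤˣ, Z σ p ∂ρ := (lintegral_finsetSum _ fun σ _ => hZm σ).symm
      _ ≤ ∫⁻ _, ENNReal.ofReal D ∂ρ := lintegral_mono hmain
      _ = _ := by simp
  rw [← ofReal_norm, ENNReal.ofReal_le_ofReal_iff (by positivity)] at hfin
  unfold Model.C
  rw [norm_mul, norm_pow, Complex.norm_real, Real.norm_eq_abs, pow_mul, sq_abs, ← pow_mul]
  exact mul_le_mul_of_nonneg_left hfin (by rw [pow_mul]; positivity)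

end Polaron
end

noncomputable section
set_option linter.unusedSectionVars false
namespace Polaron
variable {d : ℕ}

/-! ### The momentum measures -/

instance sigmaFinite_fullMeasure : SigmaFinite (fullMeasure d) := by
  unfold fullMeasure
  exact inferInstanceAs (SigmaFinite (Real.toNNReal (((2 * Real.pi) ^ ((d : ℝ) / 2))⁻¹) • volume))

theorem mom_injective {L : ℝ} (hL : 0 < L) : Function.Injective (mom (d := d) L) := by
  intro a b h
  funext i
  have h1 := congrArg (fun x : Mom d => x i) h
  simp only [mom] at h1
  have hs := (spacing_pos hL).ne'
  unfold spacing at hs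
  exact_mod_cast mul_left_cancel₀ hs h1

theorem sigmaFinite_latticeMeasure {L : ℝ} (hL : 0 < L) : SigmaFinite (latticeMeasure d L) := by
  have h : SigmaFinite ((Measure.count : Measure (Mode d)).map (mom L)) := by
    refine MeasurableEmbedding.sigmaFinite_map ?_
    exact ⟨mom_injective hL, measurable_mom L, fun {s} _ => ((Set.to_countable s).image _).measurableSet⟩
  rw [latticeMeasure_eq_count]
  exact inferInstanceAs (SigmaFinite (Real.toNNReal ((L ^ d)⁻¹) •
    (Measure.count : Measure (Mode d)).map (mom L)))

theorem elMat_self_nonneg {γ : ElSpace d →L[ℂ] ElSpace d} (h : IsDensity γ) (p : Mode d) :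
    0 ≤ (elMat γ p p).re :=
  h.1.re_inner_nonneg_right _

theorem hasSum_elMat_re {γ : ElSpace d →L[ℂ] ElSpace d} (h : IsDensity γ) :
    HasSum (fun p => (elMat γ p p).re) 1 := by
  simpa using Complex.hasSum_re h.2

theorem tsum_ofReal_elMat {γ : ElSpace d →L[ℂ] ElSpace d} (h : IsDensity γ) :
    ∑' p, ENNReal.ofReal (elMat γ p p).re = 1 := by
  have h0 : ∀ p, 0 ≤ (elMat γ p p).re := elMat_self_nonneg h
  rw [← ENNReal.ofReal_tsum_of_nonneg h0 (hasSum_elMat_re h).summable, (hasSum_elMat_re h).tsum_eq,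
    ENNReal.ofReal_one]

theorem isProbabilityMeasure_momDist (L : ℝ) {γ : ElSpace d →L[ℂ] ElSpace d} (h : IsDensity γ) :
    IsProbabilityMeasure (momDist L γ) := by
  refine ⟨?_⟩
  rw [momDist, Measure.sum_apply _ MeasurableSet.univ]
  simpa using tsum_ofReal_elMat h

theorem decay_smul_le {c : ℝ} (hc : 0 < c) (x : Mom d) :
    decay (c • x) ≤ (max 1 c⁻¹) ^ (d + 3) * decay x := by
  have hm : 0 < max 1 c⁻¹ := lt_max_of_lt_left one_pos
  have h1 : jap x ≤ max 1 c⁻¹ * jap (c • x) := by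
    unfold jap
    rw [norm_smul, Real.norm_of_nonneg hc.le, mul_add, mul_one]
    have h2 : ‖x‖ = c⁻¹ * (c * ‖x‖) := by rw [← mul_assoc, inv_mul_cancel₀ hc.ne', one_mul]
    have h3 : c⁻¹ * (c * ‖x‖) ≤ max 1 c⁻¹ * (c * ‖x‖) :=
      mul_le_mul_of_nonneg_right (le_max_right _ _) (by positivity)
    have := le_max_left 1 c⁻¹
    linarith
  have hx := jap_pos x
  have hcx := jap_pos (c • x)
  unfold decay
  rw [← div_eq_mul_inv, le_div_iff₀ (by positivity), inv_mul_le_iff₀ (by positivity), ← mul_pow,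
    mul_comm (jap (c • x))]
  exact pow_le_pow_left₀ hx.le h1 _

theorem exists_summable_decay : ∃ L₀ : ℝ, 0 < L₀ ∧ ∃ K : ℝ, 0 ≤ K ∧ ∀ L : ℝ, L₀ ≤ L →
    Summable (fun m : Mode d => decay (mom L m)) ∧
    (L ^ d)⁻¹ * ∑' m : Mode d, decay (mom L m) ≤ K := by
  obtain ⟨L₀, hL₀⟩ := (((tendsto_spacing.const_mul (d : ℝ)).eventually
    (eventually_le_nhds (by simp : (d : ℝ) * 0 < 1))).and (eventually_gt_atTop 0)).exists_forall_of_atTop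
  refine ⟨L₀, (hL₀ L₀ le_rfl).2, ∫ x : Mom d, 2 ^ (d + 3) * decay x,
    integral_nonneg fun x => mul_nonneg (by positivity) (decay_pos x).le, fun L hL => ?_⟩
  · obtain ⟨h1, h2⟩ := integral_roundMom_le (d := d) (hL₀ L hL).2 (hL₀ L hL).1 continuous_decay
      (fun x => (decay_pos x).le) (integrable_decay.const_mul (2 ^ (d + 3)))
      (fun x y h => decay_le h)
    have hm : StronglyMeasurable (decay (d := d)) := continuous_decay.stronglyMeasurable
    have hs := (integrable_latticeMeasure_iff_summable (hL₀ L hL).2 hm).1 h1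
    rw [integral_latticeMeasure_eq_tsum (hL₀ L hL).2 hm h1, smul_eq_mul] at h2
    refine ⟨?_, h2⟩
    simpa only [Real.norm_of_nonneg (decay_pos _).le] using hs

/-- The dual lattices of different boxes are dilates of each other, and dilation changes the weight
by a bounded factor. Summability in one large box therefore gives summability in every box. -/
theorem summable_decay_mom {L : ℝ} (hL : 0 < L) : Summable fun m : Mode d => decay (mom L m) := by
  obtain ⟨L₀, hL₀, K, hK, h⟩ := exists_summable_decay (d := d)
  obtain ⟨h1, -⟩ := h L₀ le_rfl
  refine Summable.of_nonneg_of_le (fun m => (decay_pos _).le) (fun m => ?_)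
    (h1.mul_left (max 1 (L₀ / L)⁻¹ ^ (d + 3)))
  have e : mom L m = (L₀ / L) • mom L₀ m := by
    ext i
    simp only [mom, PiLp.smul_apply, smul_eq_mul]
    field_simp
  rw [e]
  exact decay_smul_le (div_pos hL₀ hL) _

variable {S : Model d} {C₁ C₂ C₃ C₄ C₆ C₇ : ℝ}

theorem Model.Admissible.integrable_M_lattice (hd : 3 ≤ d) (hS : S.Admissible C₁ C₂ C₃ C₄ C₆ C₇)
    {L : ℝ} (hL : 0 < L) (σ : ℤˣ) : Integrable (fun k => S.M k σ) (latticeMeasure d L) := by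
  obtain ⟨K, hK0, hK⟩ := exists_M_le_decay hd S.β C₂ C₆ C₇
  rw [integrable_latticeMeasure_iff_summable hL (hS.continuous_M σ).stronglyMeasurable]
  refine Summable.of_nonneg_of_le (fun m => norm_nonneg _) (fun m => ?_)
    ((summable_decay_mom hL).mul_left K)
  rw [Real.norm_of_nonneg (hS.M_nonneg _ _)]
  exact hK S C₁ C₃ C₄ rfl hS σ _

theorem exists_dispersive_constant (hd : 3 ≤ d) (C₁ C₂ C₃ C₄ C₆ C₇ β : ℝ) :
    ∃ G : ℝ, 0 ≤ G ∧ ∀ S : Model d, S.β = β → S.Admissible C₁ C₂ C₃ C₄ C₆ C₇ →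
      (∀ T : ℝ, S.Dispersive (fullMeasure d) G T) ∧
      ∀ t : ℝ, 0 ≤ t → ∀ᶠ L : ℝ in atTop, S.Dispersive (latticeMeasure d L) G t := by
  obtain ⟨G, hG, h⟩ := exists_dispersive hd C₁ C₂ C₃ C₄ C₆ C₇ β
  refine ⟨G, hG, fun S hβ hS => ⟨fun T => ?_, fun t ht => ?_⟩⟩
  · exact ⟨hS.e_smooth.continuous, hS.ω_smooth.continuous, hS.continuous_M, hS.M_nonneg,
      fun σ => integrable_fullMeasure_iff.2 (hS.integrable_M hd σ),
      fun σ p τ _ => (h S hβ hS).1 σ p τ⟩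
  · filter_upwards [(h S hβ hS).2 t ht, eventually_gt_atTop 0] with L hL hL0
    exact ⟨hS.e_smooth.continuous, hS.ω_smooth.continuous, hS.continuous_M, hS.M_nonneg,
      fun σ => hS.integrable_M_lattice hd hL0 σ, hL⟩

/-- `M! ≥ [M!]^a`. -/
theorem pairing_bound_le {A lam t a : ℝ} (hA : 0 ≤ A) (ht : 0 ≤ t) (ha1 : a < 1) {n r N : ℕ}
    (hN : N = n + 2 * r) {Ca : ℝ} (hCa : A ≤ Ca) :
    lam ^ (2 * N) * (A ^ N / ((n + r).factorial : ℝ) * t ^ N) ≤ aprioriBound Ca a lam t n N := by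
  have hM : (n + N) / 2 = n + r := by omega
  have hf : (1 : ℝ) ≤ ((n + r).factorial : ℝ) := by exact_mod_cast Nat.succ_le_of_lt (Nat.factorial_pos _)
  unfold aprioriBound
  rw [hM]
  have h1 : ((n + r).factorial : ℝ) ^ a ≤ ((n + r).factorial : ℝ) := by
    conv_rhs => rw [← Real.rpow_one ((n + r).factorial : ℝ)]
    exact Real.rpow_le_rpow_of_exponent_le hf ha1.le
  have h2 : 0 < ((n + r).factorial : ℝ) ^ a := Real.rpow_pos_of_pos (by linarith) _
  calc lam ^ (2 * N) * (A ^ N / ((n + r).factorial : ℝ) * t ^ N)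
      = (A * lam ^ 2 * t) ^ N / ((n + r).factorial : ℝ) := by rw [mul_pow, mul_pow, pow_mul]; ring
    _ ≤ (Ca * lam ^ 2 * t) ^ N / ((n + r).factorial : ℝ) := by gcongr
    _ ≤ (Ca * lam ^ 2 * t) ^ N / ((n + r).factorial : ℝ) ^ a := by
        have : 0 ≤ Ca := hA.trans hCa
        gcongr

end Polaron
end

noncomputable section
set_option linter.unusedSectionVars false
namespace Polaron
variable {d : ℕ}

/-! ### Words of emission and absorption events -/

/-- Emission (`σ = 1`) or absorption (`σ = -1`) of a phonon, shifting the electron by `k`. -/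
abbrev Letter (d : ℕ) := Mode d × ℤˣ

/-- The phonon mode affected by an event. -/
def Letter.mode (a : Letter d) : Mode d := (a.2 : ℤ) • a.1

/-- The opposite event. -/
def Letter.inv (a : Letter d) : Letter d := (-a.1, -a.2)

/-- The occupation numbers after an event. -/
def step (a : Letter d) (ν : Config d) : Config d :=
  -- Absorption from an empty mode is truncated and leaves the mode empty; the matrix element
  -- `stepWeight` vanishes in that case.
  if a.2 = 1 then ν + Finsupp.single a.mode 1 else ν - Finsupp.single a.mode 1

/-- The matrix element of an event. -/
def stepWeight (a : Letter d) (ν : Config d) : ℝ :=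
  -- The minus sign is that of `-c_{-k}` in `b_k`.
  if a.2 = 1 then Real.sqrt (ν a.mode + 1) else -Real.sqrt (ν a.mode)

/-- The occupation numbers after a word of events, the last letter acting first. -/
def path : {N : ℕ} → (Fin N → Letter d) → Config d → Config d
  | 0, _, ν => ν
  | _ + 1, w, ν => step (w 0) (path (Fin.tail w) ν)

/-- The matrix element of a word of events. -/
def pathWeight : {N : ℕ} → (Fin N → Letter d) → Config d → ℝ
  | 0, _, _ => 1
  | _ + 1, w, ν => stepWeight (w 0) (path (Fin.tail w) ν) * pathWeight (Fin.tail w) ν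

/-- Total momentum transfer of a word. -/
def wordMom {N : ℕ} (w : Fin N → Letter d) : Mode d := ∑ i, (w i).1

/-- The total energy of the phonons created by a word. -/
def Model.wordOmega (S : Model d) (L : ℝ) {N : ℕ} (w : Fin N → Letter d) : ℝ :=
  ∑ i, (((w i).2 : ℤ) : ℝ) * S.ω (mom L (w i).1)

/-- The phases along a word, relative to the energy of the initial phonons. -/
def Model.wordPhase (S : Model d) (L : ℝ) (p : Mode d) :
    {N : ℕ} → (Fin N → Letter d) → (Fin (N + 1) → ℝ) → ℂ
  | 0, _, s => Complex.exp (-Complex.I * ((s 0 * S.e (mom L p) : ℝ) : ℂ))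
  | _ + 1, w, s =>
      Complex.exp (-Complex.I *
        ((s 0 * (S.e (mom L (p + wordMom w)) + S.wordOmega L w) : ℝ) : ℂ)) *
      S.wordPhase L p (Fin.tail w) (Fin.tail s)

/-- The time integral of the phases along a word. -/
def Model.wordAmp (S : Model d) (L t : ℝ) (p : Mode d) {N : ℕ} (w : Fin N → Letter d) : ℂ :=
  timeInt t N (S.wordPhase L p w)

/-- The product of the form factors along a word. -/
def Model.wordQ (S : Model d) (L : ℝ) {N : ℕ} (w : Fin N → Letter d) : ℝ :=
  ∏ i, S.Q (mom L (w i).1)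

/-- An additive functional of the occupation numbers. -/
def cfgSum {B : Type*} [AddCommGroup B] (φ : Mode d → B) (ν : Config d) : B :=
  ν.sum fun q c => c • φ q

theorem cfgSum_add_single {B : Type*} [AddCommGroup B] (φ : Mode d → B) (ν : Config d)
    (q : Mode d) : cfgSum φ (ν + Finsupp.single q 1) = cfgSum φ ν + φ q := by
  unfold cfgSum
  rw [Finsupp.sum_add_index' (h := fun q c => c • φ q) (fun _ => zero_smul _ _)
    (fun _ _ _ => add_smul _ _ _),
    Finsupp.sum_single_index (h := fun q c => c • φ q) (zero_smul _ _), one_smul]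

theorem single_le_of_ne_zero {ν : Config d} {q : Mode d} (h : ν q ≠ 0) :
    Finsupp.single q 1 ≤ ν := by
  rw [Finsupp.single_le_iff]; omega

/-- A nonzero matrix element excludes absorption from an empty mode, so the subtraction is genuine
and additive functionals change by exactly one phonon. -/
theorem cfgSum_step {B : Type*} [AddCommGroup B] (φ : Mode d → B) {a : Letter d} {ν : Config d}
    (h : stepWeight a ν ≠ 0) : cfgSum φ (step a ν) = cfgSum φ ν + (a.2 : ℤ) • φ a.mode := by
  unfold stepWeight at h
  unfold step
  rcases Int.units_eq_one_or a.2 with h1 | h1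
  · rw [if_pos h1, cfgSum_add_single, h1]; simp
  · have hne : a.2 ≠ 1 := by rw [h1]; decide
    rw [if_neg hne] at h ⊢
    have hq : ν a.mode ≠ 0 := by
      intro h0; apply h; simp [h0]
    have e := tsub_add_cancel_of_le (single_le_of_ne_zero hq)
    have := cfgSum_add_single φ (ν - Finsupp.single a.mode 1) a.mode
    rw [e] at this
    rw [this, h1]; simp

theorem cfgSum_path {B : Type*} [AddCommGroup B] (φ : Mode d → B) {N : ℕ}
    {w : Fin N → Letter d} {ν : Config d} (h : pathWeight w ν ≠ 0) :
    cfgSum φ (path w ν) = cfgSum φ ν + ∑ i, ((w i).2 : ℤ) • φ (w i).mode := by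
  induction N with
  | zero => simp [path]
  | succ N ih =>
    simp only [pathWeight] at h
    rw [path, cfgSum_step φ (left_ne_zero_of_mul h), ih (right_ne_zero_of_mul h),
      Fin.sum_univ_succ]
    simp only [Fin.tail]
    abel

theorem unit_smul_mode (a : Letter d) : (a.2 : ℤ) • a.mode = a.1 := by
  unfold Letter.mode
  rw [smul_smul]
  rcases Int.units_eq_one_or a.2 with h1 | h1 <;> simp [h1]

theorem sum_mode_path {N : ℕ} {w : Fin N → Letter d} {ν : Config d} (h : pathWeight w ν ≠ 0) :
    cfgSum (fun q => q) (path w ν) = cfgSum (fun q => q) ν + wordMom w := by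
  rw [cfgSum_path _ h]
  simp only [unit_smul_mode, wordMom]

theorem Model.phEnergy_eq_cfgSum (S : Model d) (L : ℝ) (ν : Config d) :
    S.phEnergy L ν = cfgSum (fun q => S.ω (mom L q)) ν := by
  unfold Model.phEnergy cfgSum
  refine Finsupp.sum_congr fun q _ => ?_
  rw [nsmul_eq_mul, mul_comm]

theorem Model.phEnergy_path {S : Model d} (hω : ∀ k, S.ω (-k) = S.ω k) (L : ℝ) {N : ℕ}
    {w : Fin N → Letter d} {ν : Config d} (h : pathWeight w ν ≠ 0) :
    S.phEnergy L (path w ν) = S.phEnergy L ν + S.wordOmega L w := by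
  rw [S.phEnergy_eq_cfgSum, S.phEnergy_eq_cfgSum, cfgSum_path _ h, Model.wordOmega]
  congr 1
  refine Finset.sum_congr rfl fun i _ => ?_
  have : S.ω (mom L (w i).mode) = S.ω (mom L (w i).1) := by
    unfold Letter.mode
    rcases Int.units_eq_one_or (w i).2 with h1 | h1
    · simp [h1]
    · simp [h1, mom_neg, hω]
  rw [this, zsmul_eq_mul]

/-! ### The chain of vertices on basis vectors -/

open Classical in
theorem Model.vertex_single (S : Model d) (L : ℝ) (k : Mode d) (y : Label d) (c : ℂ)
    (x : Label d) :
    S.vertex L k (fun z => if z = y then c else 0) x =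
      ∑ σ : ℤˣ, if x = (y.1 + k, step (k, σ) y.2) then
        ((S.Q (mom L k) * (L ^ ((d : ℝ) / 2) * stepWeight (k, σ) y.2) : ℝ) : ℂ) * c else 0 := by
  obtain ⟨p, ν⟩ := y
  obtain ⟨p', ν'⟩ := x
  have hp : p' - k = p ↔ p' = p + k := sub_eq_iff_eq_add
  have hsum : ∀ f : ℤˣ → ℂ, ∑ σ, f σ = f 1 + f (-1) := by
    intro f
    rw [show (Finset.univ : Finset ℤˣ) = {1, -1} from rfl, Finset.sum_pair (by decide)]
  rw [hsum]
  unfold Model.vertex bOp creat annih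
  simp only [Prod.mk.injEq, hp]
  by_cases h : p' = p + k
  swap
  · simp [h]
  simp only [h, true_and]
  have h1 : (step (k, 1) ν : Config d) = ν + Finsupp.single k 1 := by simp [step, Letter.mode]
  have h2 : (step (k, -1) ν : Config d) = ν - Finsupp.single (-k) 1 := by
    simp [step, Letter.mode]
  have w1 : stepWeight (k, 1) ν = Real.sqrt (ν k + 1) := by simp [stepWeight, Letter.mode]
  have w2 : stepWeight (k, -1) ν = -Real.sqrt (ν (-k)) := by simp [stepWeight, Letter.mode]
  rw [h1, h2, w1, w2, mul_sub, sub_eq_add_neg]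
  congr 1
  · by_cases hν : ν' = ν + Finsupp.single k 1
    · rw [if_pos hν, if_pos (by rw [hν, add_tsub_cancel_right])]
      rw [hν]; simp [mul_assoc]
    · rw [if_neg hν]
      -- If the mode is empty in the final state, truncated subtraction could still reproduce `ν`,
      -- but the square root in the creation operator vanishes.
      by_cases h0 : ν' k = 0
      · simp [h0]
      · rw [if_neg, mul_zero, mul_zero]
        intro h3
        apply hν
        rw [← h3, tsub_add_cancel_of_le (single_le_of_ne_zero h0)]
  · by_cases h0 : ν (-k) = 0
    · rw [if_neg, h0]
      · simp
      · intro h3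
        have := DFunLike.congr_fun h3 (-k)
        simp [h0] at this
    · have e : ν' + Finsupp.single (-k) 1 = ν ↔ ν' = ν - Finsupp.single (-k) 1 := by
        constructor
        · intro h3; rw [← h3, add_tsub_cancel_right]
        · intro h3; rw [h3, tsub_add_cancel_of_le (single_le_of_ne_zero h0)]
      rw [if_congr e rfl rfl]
      by_cases hν : ν' = ν - Finsupp.single (-k) 1
      · rw [if_pos hν, if_pos hν]
        have h3 := e.2 hν
        have h4 : (ν (-k) : ℝ) = ν' (-k) + 1 := by
          rw [← h3]; simp
        rw [h4]
        push_cast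
        ring
      · rw [if_neg hν, if_neg hν]; simp

theorem Model.vertex_sum (S : Model d) (L : ℝ) (k : Mode d) {ι : Type*} (s : Finset ι)
    (Ψ : ι → Wave d) (x : Label d) :
    S.vertex L k (fun z => ∑ i ∈ s, Ψ i z) x = ∑ i ∈ s, S.vertex L k (Ψ i) x := by
  unfold Model.vertex bOp creat annih
  rw [← Finset.mul_sum, Finset.sum_sub_distrib, Finset.mul_sum, Finset.mul_sum]

/-- The phases along a path of occupation numbers. -/
def Model.pathPhase (S : Model d) (L : ℝ) (p : Mode d) (ν : Config d) :
    {N : ℕ} → (Fin N → Letter d) → (Fin (N + 1) → ℝ) → ℂ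
  | 0, _, s => Complex.exp (-Complex.I * ((s 0 * (S.e (mom L p) + S.phEnergy L ν) : ℝ) : ℂ))
  | _ + 1, w, s =>
      Complex.exp (-Complex.I *
        ((s 0 * (S.e (mom L (p + wordMom w)) + S.phEnergy L (path w ν)) : ℝ) : ℂ)) *
      S.pathPhase L p ν (Fin.tail w) (Fin.tail s)

/-- The word with prescribed momenta and signs. -/
def word {N : ℕ} (k : Fin N → Mode d) (σ : Fin N → ℤˣ) : Fin N → Letter d := fun i => (k i, σ i)

open Classical in
-- Each vertex maps a basis vector to a combination of two, one for either sign. Iteration gives a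
-- sum over sign sequences, each of which ends in a single basis vector.
theorem Model.chain_single (S : Model d) (L : ℝ) {N : ℕ} (k : Fin N → Mode d)
    (s : Fin (N + 1) → ℝ) (y x : Label d) :
    S.chain L N k s (fun z => if z = y then 1 else 0) x =
      ∑ σ : Fin N → ℤˣ, if x = (y.1 + wordMom (word k σ), path (word k σ) y.2) then
        ((S.wordQ L (word k σ) * ((L ^ ((d : ℝ) / 2)) ^ N * pathWeight (word k σ) y.2) : ℝ) : ℂ) *
          S.pathPhase L y.1 y.2 (word k σ) s else 0 := by
  induction N generalizing x with
  | zero =>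
    rw [Fintype.sum_unique]
    simp only [Model.chain, Model.free, path, wordMom, Finset.univ_eq_empty, Finset.sum_empty,
      add_zero, Model.wordQ, Finset.prod_empty, pow_zero, pathWeight, Model.pathPhase]
    by_cases h : x = y
    · simp [h]
    · simp [h]
  | succ N ih =>
    simp only [Model.chain, Model.free]
    have e : S.chain L N (Fin.tail k) (Fin.tail s) (fun z => if z = y then 1 else 0) =
        fun x => ∑ σ : Fin N → ℤˣ, if x = (y.1 + wordMom (word (Fin.tail k) σ),
          path (word (Fin.tail k) σ) y.2) then
        ((S.wordQ L (word (Fin.tail k) σ) * ((L ^ ((d : ℝ) / 2)) ^ N *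
          pathWeight (word (Fin.tail k) σ) y.2) : ℝ) : ℂ) *
          S.pathPhase L y.1 y.2 (word (Fin.tail k) σ) (Fin.tail s) else 0 := by
      funext x; exact ih (Fin.tail k) (Fin.tail s) x
    rw [e, Model.vertex_sum]
    simp only [Model.vertex_single]
    rw [← Fintype.sum_equiv (Fin.consEquiv fun _ => ℤˣ) (fun q => _) _ fun q => rfl,
      Fintype.sum_prod_type, Finset.sum_comm, Finset.mul_sum]
    refine Finset.sum_congr rfl fun σ _ => ?_
    rw [Finset.mul_sum]
    refine Finset.sum_congr rfl fun τ _ => ?_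
    have hw : word k ((Fin.consEquiv fun _ => ℤˣ) (σ, τ)) =
        (Fin.cons (k 0, σ) (word (Fin.tail k) τ) : Fin (N + 1) → Letter d) := by
      funext i
      refine Fin.cases ?_ (fun i => ?_) i <;> simp [word, Fin.consEquiv, Fin.tail]
    rw [hw]
    set w := word (Fin.tail k) τ
    have m1 : wordMom (Fin.cons (k 0, σ) w : Fin (N + 1) → Letter d) = wordMom w + k 0 := by
      simp [wordMom, Fin.sum_univ_succ, add_comm]
    have m2 : path (Fin.cons (k 0, σ) w : Fin (N + 1) → Letter d) y.2 =
        step (k 0, σ) (path w y.2) := by simp [path]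
    have m3 : pathWeight (Fin.cons (k 0, σ) w : Fin (N + 1) → Letter d) y.2 =
        stepWeight (k 0, σ) (path w y.2) * pathWeight w y.2 := by simp [pathWeight]
    have m4 : S.wordQ L (Fin.cons (k 0, σ) w : Fin (N + 1) → Letter d) =
        S.Q (mom L (k 0)) * S.wordQ L w := by simp [Model.wordQ, Fin.prod_univ_succ]
    simp only [Model.pathPhase, m1, m2, m3, m4, Fin.tail_cons]
    by_cases hx : x = (y.1 + (wordMom w + k 0), step (k 0, σ) (path w y.2))
    · rw [if_pos hx, if_pos (by rw [hx, add_assoc]), hx]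
      push_cast
      ring
    · rw [if_neg hx, if_neg (by rw [add_assoc]; exact hx), mul_zero]

/-- The energy of the initial phonons is present throughout the word, and the times add up to the
total. It therefore contributes one phase independent of the word, which later drops out of all
absolute values. -/
theorem Model.pathPhase_eq {S : Model d} (hω : ∀ k, S.ω (-k) = S.ω k) (L : ℝ) (p : Mode d)
    (ν : Config d) {N : ℕ} {w : Fin N → Letter d} (h : pathWeight w ν ≠ 0)
    (s : Fin (N + 1) → ℝ) :
    S.pathPhase L p ν w s =
      Complex.exp (-Complex.I * (((∑ i, s i) * S.phEnergy L ν : ℝ) : ℂ)) * S.wordPhase L p w s := by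
  induction N with
  | zero =>
    simp only [Model.pathPhase, Model.wordPhase]
    rw [← Complex.exp_add]
    congr 1
    simp
    ring
  | succ N ih =>
    have h' := h
    simp only [pathWeight] at h'
    simp only [Model.pathPhase, Model.wordPhase, Model.phEnergy_path hω L h]
    rw [ih (right_ne_zero_of_mul h'), ← mul_assoc, ← mul_assoc, ← Complex.exp_add,
      ← Complex.exp_add, show ∑ i, s i = s 0 + ∑ i, Fin.tail s i from Fin.sum_univ_succ s]
    congr 2
    push_cast
    ring

theorem timeInt_congr {t : ℝ} {N : ℕ} {F G : (Fin (N + 1) → ℝ) → ℂ}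
    (h : ∀ s, ∑ i, s i = t → F s = G s) : timeInt t N F = timeInt t N G := by
  unfold timeInt
  congr 1
  funext u
  refine h _ ?_
  rw [Fin.sum_univ_succ]
  simp

theorem timeInt_finset_sum {ι : Type*} (s : Finset ι) (t : ℝ) (N : ℕ)
    {F : ι → (Fin (N + 1) → ℝ) → ℂ} (hF : ∀ i ∈ s, Continuous (F i)) :
    timeInt t N (fun v => ∑ i ∈ s, F i v) = ∑ i ∈ s, timeInt t N (F i) := by
  unfold timeInt
  rw [integral_finsetSum]
  intro i hi
  refine ContinuousOn.integrableOn_compact (isCompact_simplex t N) (Continuous.continuousOn ?_)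
  refine (hF i hi).comp (continuous_pi fun j => ?_)
  refine Fin.cases ?_ (fun j => ?_) j
  · simpa using by fun_prop
  · simpa using continuous_apply j

theorem Model.continuous_pathPhase (S : Model d) (L : ℝ) (p : Mode d) (ν : Config d) {N : ℕ}
    (w : Fin N → Letter d) : Continuous (S.pathPhase L p ν w) := by
  induction N with
  | zero =>
    have : Continuous fun s => S.pathPhase L p ν w s := by simp only [Model.pathPhase]; fun_prop
    exact this
  | succ N ih =>
    suffices Continuous fun s => S.pathPhase L p ν w s from this
    simp only [Model.pathPhase]
    have : Continuous fun s : Fin (N + 2) → ℝ => Fin.tail s := by unfold Fin.tail; fun_prop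
    exact Continuous.mul (by fun_prop) ((ih _).comp this)

theorem Model.continuous_wordPhase (S : Model d) (L : ℝ) (p : Mode d) {N : ℕ}
    (w : Fin N → Letter d) : Continuous (S.wordPhase L p w) := by
  induction N with
  | zero =>
    have : Continuous fun s => S.wordPhase L p w s := by simp only [Model.wordPhase]; fun_prop
    exact this
  | succ N ih =>
    suffices Continuous fun s => S.wordPhase L p w s from this
    simp only [Model.wordPhase]
    have : Continuous fun s : Fin (N + 2) → ℝ => Fin.tail s := by unfold Fin.tail; fun_prop
    exact Continuous.mul (by fun_prop) ((ih _).comp this)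

/-- The iterated integral form of the time integral of the phases along a word. -/
def Model.wordConv (S : Model d) (L : ℝ) (p : Mode d) : {N : ℕ} → (Fin N → Letter d) → ℝ → ℂ
  | 0, _, t => Complex.exp (-Complex.I * ((t * S.e (mom L p) : ℝ) : ℂ))
  | _ + 1, w, t => ∫ s in (0 : ℝ)..t, Complex.exp (-Complex.I *
      (((t - s) * (S.e (mom L (p + wordMom w)) + S.wordOmega L w) : ℝ) : ℂ)) *
      S.wordConv L p (Fin.tail w) s

theorem Model.continuous_wordConv (S : Model d) (L : ℝ) (p : Mode d) {N : ℕ}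
    (w : Fin N → Letter d) : Continuous (S.wordConv L p w) := by
  induction N with
  | zero =>
    suffices Continuous fun t => S.wordConv L p w t from this
    simp only [Model.wordConv]
    fun_prop
  | succ N ih =>
    have := ih (Fin.tail w)
    refine intervalIntegral.continuous_parametric_intervalIntegral_of_continuous
      (f := fun t s => Complex.exp (-Complex.I *
        (((t - s) * (S.e (mom L (p + wordMom w)) + S.wordOmega L w) : ℝ) : ℂ)) *
        S.wordConv L p (Fin.tail w) s) ?_ continuous_id
    simp only [Function.uncurry_def]
    fun_prop

theorem Model.wordAmp_eq (S : Model d) (L : ℝ) (p : Mode d) {N : ℕ} (w : Fin N → Letter d) {t : ℝ}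
    (ht : 0 ≤ t) : S.wordAmp L t p w = S.wordConv L p w t := by
  induction N generalizing t with
  | zero => rw [Model.wordAmp, timeInt_zero t ht, Model.wordPhase, Model.wordConv]
  | succ N ih =>
    rw [Model.wordAmp, timeInt_succ t ht N (S.continuous_wordPhase L p w), Model.wordConv]
    refine intervalIntegral.integral_congr fun s hs => ?_
    rw [Set.uIcc_of_le ht] at hs
    simp only [Model.wordPhase, Fin.cons_zero, Fin.tail_cons, timeInt_const_mul]
    rw [← ih (Fin.tail w) hs.1, Model.wordAmp]

/-- A crude bound without factorial and without oscillation. It serves for absolute convergence and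
for contributions that vanish in the limit of large boxes. -/
theorem Model.norm_wordConv_le (S : Model d) (L : ℝ) (p : Mode d) {N : ℕ} (w : Fin N → Letter d)
    {t : ℝ} (ht : 0 ≤ t) : ‖S.wordConv L p w t‖ ≤ t ^ N := by
  induction N generalizing t with
  | zero => rw [Model.wordConv, norm_cexp_I, pow_zero]
  | succ N ih =>
    rw [Model.wordConv]
    have := intervalIntegral.norm_integral_le_of_norm_le_const (a := 0) (b := t) (C := t ^ N)
      (f := fun s => Complex.exp (-Complex.I *
        (((t - s) * (S.e (mom L (p + wordMom w)) + S.wordOmega L w) : ℝ) : ℂ)) *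
        S.wordConv L p (Fin.tail w) s) ?_
    · rwa [sub_zero, abs_of_nonneg ht, ← pow_succ] at this
    · intro s hs
      rw [Set.uIoc_of_le ht] at hs
      rw [norm_mul, norm_cexp_I, one_mul]
      exact (ih _ hs.1.le).trans (pow_le_pow_left₀ hs.1.le hs.2 N)

theorem Model.norm_wordAmp_le (S : Model d) (L : ℝ) {t : ℝ} (ht : 0 ≤ t) (p : Mode d) {N : ℕ}
    (w : Fin N → Letter d) : ‖S.wordAmp L t p w‖ ≤ t ^ N := by
  rw [S.wordAmp_eq L p w ht]
  exact S.norm_wordConv_le L p w ht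

open Classical in
/-- The contribution of a single word to the matrix element of `ℬ`. -/
def Model.wordTerm (S : Model d) (L lam t : ℝ) {N : ℕ} (x y : Label d) (w : Fin N → Letter d) : ℂ :=
  if x = (y.1 + wordMom w, path w y.2) then
    ((lam ^ N * (L ^ ((d : ℝ) / 2)) ^ N * S.wordQ L w * pathWeight w y.2 : ℝ) : ℂ) *
      (Complex.exp (-Complex.I * ((t * S.phEnergy L y.2 : ℝ) : ℂ)) * S.wordAmp L t y.1 w) else 0

open Classical in
theorem Model.B_single {S : Model d} (hω : ∀ k, S.ω (-k) = S.ω k) (L lam t : ℝ) {N : ℕ}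
    (k : Fin N → Mode d) (y x : Label d) :
    S.B L lam t N k (fun z => if z = y then 1 else 0) x =
      ∑ σ : Fin N → ℤˣ, S.wordTerm L lam t x y (word k σ) := by
  unfold Model.B
  simp only [Model.chain_single]
  rw [timeInt_finset_sum, Finset.mul_sum]
  · refine Finset.sum_congr rfl fun σ _ => ?_
    unfold Model.wordTerm
    by_cases hx : x = (y.1 + wordMom (word k σ), path (word k σ) y.2)
    · simp only [if_pos hx]
      rw [timeInt_const_mul]
      by_cases hw : pathWeight (word k σ) y.2 = 0
      · simp [hw]
      have e : timeInt t N (S.pathPhase L y.1 y.2 (word k σ)) =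
          Complex.exp (-Complex.I * ((t * S.phEnergy L y.2 : ℝ) : ℂ)) *
            S.wordAmp L t y.1 (word k σ) := by
        rw [Model.wordAmp, ← timeInt_const_mul]
        refine timeInt_congr fun s hs => ?_
        rw [Model.pathPhase_eq hω L _ _ hw, hs]
      rw [e]
      push_cast
      ring
    · simp only [if_neg hx]
      simp [timeInt]
  · intro σ _
    by_cases hx : x = (y.1 + wordMom (word k σ), path (word k σ) y.2)
    · simp only [if_pos hx]
      exact continuous_const.mul (S.continuous_pathPhase L _ _ _)
    · simp only [if_neg hx]
      exact continuous_const

end Polaron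
end

noncomputable section
set_option linter.unusedSectionVars false
namespace Polaron
variable {d : ℕ}

/-! ### The index sets of a pattern -/

theorem mem_extIdx {n : ℕ} {m : Fin (n + 1) → ℕ} {x : ℕ} :
    x ∈ extIdx m ↔ ∃ j : Fin n, muIdx m (j.val + 1) = x := by
  simp [extIdx]

theorem mem_intIdx {n : ℕ} {m : Fin (n + 1) → ℕ} {x : ℕ} :
    x ∈ intIdx m ↔ ∃ j : Fin (n + 1), ∃ i, i < m j ∧ muIdx m j.val + 2 * i + 1 = x := by
  simp [intIdx, setI]

theorem le_muIdx {n : ℕ} (m : Fin (n + 1) → ℕ) (j : ℕ) : j ≤ muIdx m j :=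
  Nat.le_add_right _ _

theorem zero_notMem_extIdx {n : ℕ} (m : Fin (n + 1) → ℕ) : 0 ∉ extIdx m := by
  rw [mem_extIdx]
  rintro ⟨j, hj⟩
  have := le_muIdx m (j.val + 1)
  omega

theorem zero_notMem_intIdx {n : ℕ} (m : Fin (n + 1) → ℕ) : 0 ∉ intIdx m := by
  rw [mem_intIdx]
  rintro ⟨j, i, -, h⟩
  omega

theorem mem_extIdx_ext {n : ℕ} (m : Fin (n + 1) → ℕ) (x : ℕ) :
    x + 1 ∈ extIdx (Fin.cons 0 m : Fin (n + 2) → ℕ) ↔ x = 0 ∨ x ∈ extIdx m := by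
  rw [mem_extIdx, mem_extIdx, Fin.exists_fin_succ]
  simp only [Fin.val_zero, Fin.val_succ, muIdx_cons_succ, muIdx_zero]
  constructor
  · rintro (h | ⟨j, h⟩)
    · left; omega
    · right; exact ⟨j, by omega⟩
  · rintro (h | ⟨j, h⟩)
    · left; omega
    · right; exact ⟨j, by omega⟩

theorem mem_intIdx_ext {n : ℕ} (m : Fin (n + 1) → ℕ) (x : ℕ) :
    x + 1 ∈ intIdx (Fin.cons 0 m : Fin (n + 2) → ℕ) ↔ x ∈ intIdx m := by
  rw [mem_intIdx, mem_intIdx, Fin.exists_fin_succ]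
  simp only [Fin.cons_zero, Fin.cons_succ, Fin.val_succ, muIdx_cons_succ]
  constructor
  · rintro (⟨i, hi, h⟩ | ⟨j, i, hi, h⟩)
    · omega
    · exact ⟨j, i, hi, by omega⟩
  · rintro ⟨j, i, hi, h⟩
    exact Or.inr ⟨j, i, hi, by omega⟩

theorem muIdx_int_succ {n : ℕ} (m : Fin (n + 1) → ℕ) (j : ℕ) :
    muIdx (Fin.cons (m 0 + 1) (Fin.tail m) : Fin (n + 1) → ℕ) (j + 1) = muIdx m (j + 1) + 2 := by
  simp only [muIdx, Finset.sum_filter]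
  rw [Fin.sum_univ_succ, Fin.sum_univ_succ]
  simp only [Fin.val_zero, Fin.val_succ, Nat.zero_lt_succ, if_true, Fin.cons_zero, Fin.cons_succ,
    Fin.tail]
  ring

theorem mem_extIdx_int {n : ℕ} (m : Fin (n + 1) → ℕ) (x : ℕ) :
    x ∈ extIdx (Fin.cons (m 0 + 1) (Fin.tail m) : Fin (n + 1) → ℕ) ↔
      ∃ y ∈ extIdx m, x = y + 2 := by
  simp only [mem_extIdx, muIdx_int_succ]
  constructor
  · rintro ⟨j, rfl⟩; exact ⟨_, ⟨j, rfl⟩, rfl⟩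
  · rintro ⟨_, ⟨j, rfl⟩, rfl⟩; exact ⟨j, rfl⟩

theorem mem_intIdx_int {n : ℕ} (m : Fin (n + 1) → ℕ) (x : ℕ) :
    x ∈ intIdx (Fin.cons (m 0 + 1) (Fin.tail m) : Fin (n + 1) → ℕ) ↔
      x = 1 ∨ ∃ y ∈ intIdx m, x = y + 2 := by
  simp only [mem_intIdx]
  rw [Fin.exists_fin_succ]
  simp only [Fin.exists_fin_succ (n := n), Fin.cons_zero, Fin.cons_succ, Fin.val_zero, Fin.val_succ,
    muIdx_int_succ, muIdx_zero, Fin.tail]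
  constructor
  · rintro (⟨i, hi, h⟩ | ⟨j, i, hi, h⟩)
    · rcases i with _ | i
      · left; omega
      · right; exact ⟨_, Or.inl ⟨i, by omega, rfl⟩, by omega⟩
    · right; exact ⟨_, Or.inr ⟨j, i, hi, rfl⟩, by omega⟩
  · rintro (h | ⟨y, ⟨i, hi, rfl⟩ | ⟨j, i, hi, rfl⟩, h⟩)
    · exact Or.inl ⟨0, by omega, by omega⟩
    · exact Or.inl ⟨i + 1, by omega, by omega⟩
    · exact Or.inr ⟨j, i, hi, by omega⟩

theorem allowed_ext {n N : ℕ} (m : Fin (n + 1) → ℕ) (k : Fin (N + 1) → Mode d) :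
    Allowed (Fin.cons 0 m : Fin (n + 2) → ℕ) k ↔ Allowed m (Fin.tail k) ∧
      ∀ b : Fin N, b.val + 1 ∈ extIdx m → k 0 + Fin.tail k b ≠ 0 := by
  unfold Allowed
  constructor
  · rintro ⟨h1, h2⟩
    refine ⟨⟨fun b c hb hc => ?_, fun b c hbc hb hc => ?_⟩, fun b hb => ?_⟩
    · exact h1 b.succ c.succ (by rw [Fin.val_succ, mem_intIdx_ext]; exact hb)
        (by simp only [Fin.val_succ]; omega)
    · exact h2 b.succ c.succ (fun h => hbc (Fin.succ_injective _ h))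
        ((mem_extIdx_ext m _).2 (Or.inr hb)) ((mem_extIdx_ext m _).2 (Or.inr hc))
    · exact h2 0 b.succ (Fin.succ_ne_zero b).symm ((mem_extIdx_ext m _).2 (Or.inl rfl))
        ((mem_extIdx_ext m _).2 (Or.inr hb))
  · rintro ⟨⟨h1, h2⟩, h3⟩
    refine ⟨fun b c hb hc => ?_, fun b c hbc hb hc => ?_⟩
    · rw [mem_intIdx_ext] at hb
      refine Fin.cases (fun hb _ => ?_) (fun b hb hc => ?_) b hb hc
      · exact absurd hb (zero_notMem_intIdx m)
      · refine Fin.cases (fun hc => ?_) (fun c hc => ?_) c hc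
        · simp at hc
        · exact h1 b c hb (by simp only [Fin.val_succ] at hc; omega)
    · rw [mem_extIdx_ext] at hb hc
      revert hbc hb hc
      refine Fin.cases ?_ (fun b => ?_) b <;> refine Fin.cases ?_ (fun c => ?_) c
      · intro h; exact absurd rfl h
      · intro _ _ hc; exact h3 c (by simpa using hc)
      · intro _ hb _; rw [add_comm]; exact h3 b (by simpa using hb)
      · intro hbc hb hc
        exact h2 b c (fun h => hbc (by rw [h])) (by simpa using hb) (by simpa using hc)

theorem allowed_int {n N : ℕ} (m : Fin (n + 1) → ℕ) (k : Fin (N + 2) → Mode d) :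
    Allowed (Fin.cons (m 0 + 1) (Fin.tail m) : Fin (n + 1) → ℕ) k ↔
      Allowed m (Fin.tail (Fin.tail k)) ∧ k 0 + k 1 = 0 := by
  unfold Allowed
  simp only [mem_extIdx_int, mem_intIdx_int]
  constructor
  · rintro ⟨h1, h2⟩
    refine ⟨⟨fun b c hb hc => ?_, fun b c hbc hb hc => ?_⟩, ?_⟩
    · exact h1 b.succ.succ c.succ.succ (Or.inr ⟨_, hb, rfl⟩) (by simp only [Fin.val_succ]; omega)
    · exact h2 b.succ.succ c.succ.succ
        (fun h => hbc (Fin.succ_injective _ (Fin.succ_injective _ h))) ⟨_, hb, rfl⟩ ⟨_, hc, rfl⟩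
    · exact h1 0 1 (Or.inl rfl) rfl
  · rintro ⟨⟨h1, h2⟩, h3⟩
    have hz : ∀ y ∈ extIdx m, y ≠ 0 := fun y hy h => zero_notMem_extIdx m (h ▸ hy)
    have hz' : ∀ y ∈ intIdx m, y ≠ 0 := fun y hy h => zero_notMem_intIdx m (h ▸ hy)
    refine ⟨fun b c hb hc => ?_, fun b c hbc hb hc => ?_⟩
    · rcases hb with hb | ⟨y, hy, hb⟩
      · have e1 : b = 0 := Fin.ext (by simpa using hb)
        have e2 : c = 1 := Fin.ext (by rw [hc, e1]; rfl)
        rw [e1, e2, h3]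
      · have := hz' y hy
        obtain ⟨b', rfl⟩ : ∃ b' : Fin N, b = b'.succ.succ :=
          ⟨⟨b.val - 2, by omega⟩, Fin.ext (by simp only [Fin.val_succ]; omega)⟩
        obtain ⟨c', rfl⟩ : ∃ c' : Fin N, c = c'.succ.succ :=
          ⟨⟨c.val - 2, by omega⟩, Fin.ext (by simp only [Fin.val_succ] at hc ⊢; omega)⟩
        simp only [Fin.val_succ] at hb hc
        exact h1 b' c' (by rwa [show b'.val + 1 = y by omega]) (by omega)
    · obtain ⟨y, hy, hb⟩ := hb
      obtain ⟨z, hz0, hc⟩ := hc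
      have hy' := hz y hy
      have hz' := hz z hz0
      obtain ⟨b', rfl⟩ : ∃ b' : Fin N, b = b'.succ.succ :=
        ⟨⟨b.val - 2, by omega⟩, Fin.ext (by simp only [Fin.val_succ]; omega)⟩
      obtain ⟨c', rfl⟩ : ∃ c' : Fin N, c = c'.succ.succ :=
        ⟨⟨c.val - 2, by omega⟩, Fin.ext (by simp only [Fin.val_succ] at hc ⊢; omega)⟩
      simp only [Fin.val_succ] at hb hc
      exact h2 b' c' (fun h => hbc (by rw [h])) (by rwa [show b'.val + 1 = y by omega])
        (by rwa [show c'.val + 1 = z by omega])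

/-! ### Momentum classes -/

/-- The momentum class `{k, -k}` of an event. -/
def Letter.cls (a : Letter d) : Sym2 (Mode d) := s(a.1, -a.1)

theorem Letter.cls_eq_iff {a b : Letter d} : a.cls = b.cls ↔ a.1 = b.1 ∨ a.1 = -b.1 := by
  unfold Letter.cls
  rw [Sym2.eq_iff]
  constructor
  · rintro (⟨h, -⟩ | ⟨h, -⟩)
    · exact Or.inl h
    · exact Or.inr h
  · rintro (h | h)
    · exact Or.inl ⟨h, by rw [h]⟩
    · exact Or.inr ⟨h, by rw [h, neg_neg]⟩

theorem Letter.inv_inv (a : Letter d) : a.inv.inv = a := by simp [Letter.inv]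

theorem Letter.inv_ne_self (a : Letter d) : a.inv ≠ a := by
  intro h
  have := congrArg Prod.snd h
  simp only [Letter.inv] at this
  rcases Int.units_eq_one_or a.2 with h1 | h1 <;> rw [h1] at this <;> exact absurd this (by decide)

theorem Letter.cls_inv (a : Letter d) : a.inv.cls = a.cls := by
  rw [Letter.cls_eq_iff]; exact Or.inr rfl

theorem Letter.mode_inv (a : Letter d) : a.inv.mode = a.mode := by
  simp [Letter.inv, Letter.mode]

theorem Letter.cls_of_mode_eq {a b : Letter d} (h : a.mode = b.mode) : a.cls = b.cls := by
  rw [Letter.cls_eq_iff, ← unit_smul_mode a, ← unit_smul_mode b, h]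
  rcases Int.units_eq_one_or a.2 with h1 | h1 <;> rcases Int.units_eq_one_or b.2 with h2 | h2 <;>
    simp [h1, h2]

theorem Letter.ext_mode {a b : Letter d} (h : a.mode = b.mode) (h' : a.2 = b.2) : a = b := by
  refine Prod.ext ?_ h'
  rw [← unit_smul_mode a, ← unit_smul_mode b, h, h']

theorem Letter.eq_inv_of_mode {a b : Letter d} (h : a.mode = b.mode) (h' : a.2 ≠ b.2) :
    b = a.inv := by
  refine Letter.ext_mode (by rw [Letter.mode_inv, h]) ?_
  simp only [Letter.inv]
  rcases Int.units_eq_one_or a.2 with h1 | h1 <;> rcases Int.units_eq_one_or b.2 with h2 | h2 <;>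
    simp_all

/-- A word is degenerate if two of its events have the same class without being opposite. -/
def Degenerate {N : ℕ} (w : Fin N → Letter d) : Prop :=
  ∃ i j, i ≠ j ∧ (w i).cls = (w j).cls ∧ w j ≠ (w i).inv

/-- The classes of the letters of two words are all different. -/
def Separated {n r : ℕ} (v : Fin n → Letter d) (u : Fin r → Letter d) : Prop :=
  Function.Injective (Sum.elim (fun j => (v j).cls) fun i => (u i).cls)

/-- The word of a pattern with external letters `v` and recollision letters `u`. -/
def Pat.expand : {n r N : ℕ} → Pat n r N → (Fin n → Letter d) → (Fin r → Letter d) →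
    (Fin N → Letter d)
  | _, _, _, .nil => fun _ _ => Fin.elim0
  | _, _, _, .ext P => fun v u => Fin.cons (v 0) (P.expand (Fin.tail v) u)
  | _, _, _, .int P => fun v u => Fin.cons (u 0).inv (Fin.cons (u 0) (P.expand v (Fin.tail u)))

theorem Pat.expand_injective {n r N : ℕ} (P : Pat n r N) {v v' : Fin n → Letter d}
    {u u' : Fin r → Letter d} (h : P.expand v u = P.expand v' u') : v = v' ∧ u = u' := by
  induction P with
  | nil => exact ⟨Subsingleton.elim _ _, Subsingleton.elim _ _⟩
  | ext P ih =>
    simp only [Pat.expand] at h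
    obtain ⟨h1, h2⟩ := Fin.cons_inj.1 h
    obtain ⟨h3, h4⟩ := ih h2
    refine ⟨?_, h4⟩
    rw [← Fin.cons_self_tail v, ← Fin.cons_self_tail v', h1, h3]
  | int P ih =>
    simp only [Pat.expand] at h
    obtain ⟨-, h2⟩ := Fin.cons_inj.1 h
    obtain ⟨h1, h2⟩ := Fin.cons_inj.1 h2
    obtain ⟨h3, h4⟩ := ih h2
    refine ⟨h3, ?_⟩
    rw [← Fin.cons_self_tail u, ← Fin.cons_self_tail u', h1, h4]

theorem Pat.expand_cls {n r N : ℕ} (P : Pat n r N) (v : Fin n → Letter d) (u : Fin r → Letter d)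
    (b : Fin N) : (∃ j, P.expand v u b = v j) ∨
      ∃ i, P.expand v u b = u i ∨ P.expand v u b = (u i).inv := by
  induction P with
  | nil => exact b.elim0
  | ext P ih =>
    simp only [Pat.expand]
    refine Fin.cases (Or.inl ⟨0, rfl⟩) (fun b => ?_) b
    simp only [Fin.cons_succ]
    rcases ih (Fin.tail v) u b with ⟨j, h⟩ | h
    · exact Or.inl ⟨j.succ, h⟩
    · exact Or.inr h
  | int P ih =>
    simp only [Pat.expand]
    refine Fin.cases (Or.inr ⟨0, Or.inr rfl⟩) (fun b => ?_) b
    refine Fin.cases (Or.inr ⟨0, Or.inl rfl⟩) (fun b => ?_) b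
    simp only [Fin.cons_succ]
    rcases ih v (Fin.tail u) b with h | ⟨i, h⟩
    · exact Or.inl h
    · exact Or.inr ⟨i.succ, h⟩

theorem Pat.exists_expand_ext {n r N : ℕ} (P : Pat n r N) (v : Fin n → Letter d)
    (u : Fin r → Letter d) (j : Fin n) :
    ∃ b : Fin N, b.val + 1 ∈ extIdx P.toM ∧ P.expand v u b = v j := by
  induction P with
  | nil => exact j.elim0
  | ext P ih =>
    simp only [Pat.expand, Pat.toM]
    refine Fin.cases ⟨0, (mem_extIdx_ext _ _).2 (Or.inl rfl), rfl⟩ (fun j => ?_) j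
    obtain ⟨b, h1, h2⟩ := ih (Fin.tail v) u j
    exact ⟨b.succ, (mem_extIdx_ext _ _).2 (Or.inr h1), h2⟩
  | int P ih =>
    obtain ⟨b, h1, h2⟩ := ih v (Fin.tail u) j
    exact ⟨b.succ.succ, (mem_extIdx_int _ _).2 ⟨_, h1, rfl⟩, h2⟩

theorem Pat.expand_ext_pos {n r N : ℕ} (P : Pat n r N) (v : Fin n → Letter d)
    (u : Fin r → Letter d) (b : Fin N) (hb : b.val + 1 ∈ extIdx P.toM) :
    ∃ j, P.expand v u b = v j := by
  induction P with
  | nil => exact b.elim0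
  | ext P ih =>
    simp only [Pat.expand, Pat.toM, mem_extIdx_ext] at hb ⊢
    revert hb
    refine Fin.cases (fun _ => ⟨0, rfl⟩) (fun b hb => ?_) b
    simp only [Fin.cons_succ]
    obtain ⟨j, h⟩ := ih (Fin.tail v) u b (by simpa using hb)
    exact ⟨j.succ, h⟩
  | int P ih =>
    simp only [Pat.expand, Pat.toM, mem_extIdx_int] at hb ⊢
    obtain ⟨y, hy, hb⟩ := hb
    have hy0 : y ≠ 0 := fun h => zero_notMem_extIdx _ (h ▸ hy)
    obtain ⟨b', rfl⟩ : ∃ b' : Fin _, b = b'.succ.succ :=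
      ⟨⟨b.val - 2, by omega⟩, Fin.ext (by simp only [Fin.val_succ]; omega)⟩
    simp only [Fin.cons_succ]
    simp only [Fin.val_succ] at hb
    exact ih v (Fin.tail u) b' (by rwa [show b'.val + 1 = y by omega])

theorem Pat.exists_expand_int {n r N : ℕ} (P : Pat n r N) (v : Fin n → Letter d)
    (u : Fin r → Letter d) (i : Fin r) :
    ∃ b c : Fin N, P.expand v u b = (u i).inv ∧ P.expand v u c = u i := by
  induction P with
  | nil => exact i.elim0
  | ext P ih =>
    obtain ⟨b, c, h1, h2⟩ := ih (Fin.tail v) u i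
    exact ⟨b.succ, c.succ, h1, h2⟩
  | int P ih =>
    refine Fin.cases ⟨0, 1, rfl, rfl⟩ (fun i => ?_) i
    obtain ⟨b, c, h1, h2⟩ := ih v (Fin.tail u) i
    exact ⟨b.succ.succ, c.succ.succ, h1, h2⟩

theorem Degenerate.cons {N : ℕ} {a : Letter d} {w : Fin N → Letter d} (h : Degenerate w) :
    Degenerate (Fin.cons a w : Fin (N + 1) → Letter d) := by
  obtain ⟨i, j, hij, h1, h2⟩ := h
  exact ⟨i.succ, j.succ, fun h => hij (Fin.succ_injective _ h), h1, h2⟩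

theorem not_degenerate_cons {N : ℕ} {a : Letter d} {w : Fin N → Letter d} :
    ¬Degenerate (Fin.cons a w : Fin (N + 1) → Letter d) ↔
      ¬Degenerate w ∧ ∀ b, a.cls = (w b).cls → w b = a.inv := by
  constructor
  · intro h
    refine ⟨fun hw => h hw.cons, fun b hb => ?_⟩
    by_contra hne
    exact h ⟨0, b.succ, (Fin.succ_ne_zero b).symm, hb, hne⟩
  · rintro ⟨h1, h2⟩ ⟨i, j, hij, h3, h4⟩
    revert hij h3 h4
    refine Fin.cases ?_ (fun i => ?_) i <;> refine Fin.cases ?_ (fun j => ?_) j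
    · intro h; exact absurd rfl h
    · intro _ h3 h4; exact h4 (h2 j h3)
    · intro _ h3 h4
      simp only [Fin.cons_zero, Fin.cons_succ] at h3 h4
      apply h4
      rw [h2 i h3.symm, Letter.inv_inv]
    · intro hij h3 h4
      exact h1 ⟨i, j, fun h => hij (by rw [h]), h3, h4⟩

/-- Being allowed excludes `k + k' = 0` for external letters, while nondegeneracy permits a
coincidence of classes only between opposite letters. An external letter cannot share its class with
a recollision, because the recollision contains both a letter and its opposite and nothing is
opposite to both. The same argument separates two recollisions. -/
theorem Pat.separated_iff {n r N : ℕ} (P : Pat n r N) (v : Fin n → Letter d)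
    (u : Fin r → Letter d) :
    Separated v u ↔ Allowed P.toM (fun b => (P.expand v u b).1) ∧ ¬Degenerate (P.expand v u) := by
  induction P with
  | nil =>
    refine ⟨fun _ => ⟨⟨fun b => b.elim0, fun b => b.elim0⟩, fun ⟨b, _⟩ => b.elim0⟩, fun _ => ?_⟩
    intro x
    exact x.elim (fun b => b.elim0) fun b => b.elim0
  | @ext n r N P ih =>
    have hsep : Separated v u ↔ Separated (Fin.tail v) u ∧
        (∀ j, (v 0).cls ≠ (Fin.tail v j).cls) ∧ ∀ i, (v 0).cls ≠ (u i).cls := by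
      constructor
      · intro h
        refine ⟨?_, fun j hj => ?_, fun i hi => ?_⟩
        · rintro (j | i) (j' | i') h1
          · have := @h (Sum.inl j.succ) (Sum.inl j'.succ) h1
            rw [Fin.succ_injective _ (Sum.inl_injective this)]
          · have := @h (Sum.inl j.succ) (Sum.inr i') h1
            simp at this
          · have := @h (Sum.inr i) (Sum.inl j'.succ) h1
            simp at this
          · have := @h (Sum.inr i) (Sum.inr i') h1
            rw [Sum.inr_injective this]
        · have := @h (Sum.inl 0) (Sum.inl j.succ) hj
          exact (Fin.succ_ne_zero j).symm (Sum.inl_injective this)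
        · have := @h (Sum.inl 0) (Sum.inr i) hi
          simp at this
      · rintro ⟨h, h1, h2⟩ (j | i) (j' | i') h3
        · revert h3
          refine Fin.cases ?_ (fun j => ?_) j <;> refine Fin.cases ?_ (fun j' => ?_) j' <;> intro h3
          · rfl
          · exact absurd h3 (h1 j')
          · exact absurd h3.symm (h1 j)
          · have := @h (Sum.inl j) (Sum.inl j') h3
            rw [Sum.inl_injective this]
        · revert h3
          refine Fin.cases ?_ (fun j => ?_) j <;> intro h3
          · exact absurd h3 (h2 i')
          · have := @h (Sum.inl j) (Sum.inr i') h3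
            simp at this
        · revert h3
          refine Fin.cases ?_ (fun j' => ?_) j' <;> intro h3
          · exact absurd h3.symm (h2 i)
          · have := @h (Sum.inr i) (Sum.inl j') h3
            simp at this
        · have := @h (Sum.inr i) (Sum.inr i') h3
          rw [Sum.inr_injective this]
    have hk : (fun b => (P.ext.expand v u b).1) =
        (Fin.cons (v 0).1 fun b => (P.expand (Fin.tail v) u b).1 : Fin (N + 1) → Mode d) := by
      funext b
      refine Fin.cases rfl (fun b => rfl) b
    rw [hsep, ih, hk, Pat.toM, allowed_ext, Pat.expand, not_degenerate_cons]
    simp only [Fin.tail_cons, Fin.cons_zero]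
    constructor
    · rintro ⟨⟨h1, h2⟩, h3, h4⟩
      refine ⟨⟨h1, fun b hb hz => ?_⟩, h2, fun b hb => ?_⟩
      · obtain ⟨j, hj⟩ := P.expand_ext_pos (Fin.tail v) u b hb
        refine h3 j (Letter.cls_eq_iff.2 (Or.inr ?_))
        rw [← hj]
        exact eq_neg_of_add_eq_zero_left hz
      · exfalso
        rcases P.expand_cls (Fin.tail v) u b with ⟨j, hj⟩ | ⟨i, hi | hi⟩
        · exact h3 j (by rw [hb, hj])
        · exact h4 i (by rw [hb, hi])
        · exact h4 i (by rw [hb, hi, Letter.cls_inv])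
    · rintro ⟨⟨h1, h2⟩, h3, h4⟩
      refine ⟨⟨h1, h3⟩, fun j hj => ?_, fun i hi => ?_⟩
      · obtain ⟨b, hb, hb'⟩ := P.exists_expand_ext (Fin.tail v) u j
        have := h4 b (by rw [hj, hb'])
        refine h2 b hb ?_
        rw [this]
        exact add_neg_cancel _
      -- Both letters of the recollision would have to equal the opposite of `v 0`, yet they are
      -- opposite to each other.
      · obtain ⟨b, c, hb, hc⟩ := P.exists_expand_int (Fin.tail v) u i
        have e1 := h4 b (by rw [hi, hb, Letter.cls_inv])
        have e2 := h4 c (by rw [hi, hc])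
        rw [hb] at e1
        rw [hc] at e2
        exact Letter.inv_ne_self (u i) (by rw [e1, e2])
  | @int n r N P ih =>
    have hsep : Separated v u ↔ Separated v (Fin.tail u) ∧
        (∀ j, (u 0).cls ≠ (v j).cls) ∧ ∀ i, (u 0).cls ≠ (Fin.tail u i).cls := by
      constructor
      · intro h
        refine ⟨?_, fun j hj => ?_, fun i hi => ?_⟩
        · rintro (j | i) (j' | i') h1
          · have := @h (Sum.inl j) (Sum.inl j') h1
            rw [Sum.inl_injective this]
          · have := @h (Sum.inl j) (Sum.inr i'.succ) h1
            simp at this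
          · have := @h (Sum.inr i.succ) (Sum.inl j') h1
            simp at this
          · have := @h (Sum.inr i.succ) (Sum.inr i'.succ) h1
            rw [Fin.succ_injective _ (Sum.inr_injective this)]
        · have := @h (Sum.inr 0) (Sum.inl j) hj
          simp at this
        · have := @h (Sum.inr 0) (Sum.inr i.succ) hi
          exact (Fin.succ_ne_zero i).symm (Sum.inr_injective this)
      · rintro ⟨h, h1, h2⟩ (j | i) (j' | i') h3
        · have := @h (Sum.inl j) (Sum.inl j') h3
          rw [Sum.inl_injective this]
        · revert h3
          refine Fin.cases ?_ (fun i' => ?_) i' <;> intro h3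
          · exact absurd h3.symm (h1 j)
          · have := @h (Sum.inl j) (Sum.inr i') h3
            simp at this
        · revert h3
          refine Fin.cases ?_ (fun i => ?_) i <;> intro h3
          · exact absurd h3 (h1 j')
          · have := @h (Sum.inr i) (Sum.inl j') h3
            simp at this
        · revert h3
          refine Fin.cases ?_ (fun i => ?_) i <;> refine Fin.cases ?_ (fun i' => ?_) i' <;> intro h3
          · rfl
          · exact absurd h3 (h2 i')
          · exact absurd h3.symm (h2 i)
          · have := @h (Sum.inr i) (Sum.inr i') h3
            rw [Sum.inr_injective this]
    have hk : (fun b => (P.int.expand v u b).1) =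
        (Fin.cons (u 0).inv.1 (Fin.cons (u 0).1 fun b => (P.expand v (Fin.tail u) b).1 :
          Fin (N + 1) → Mode d) : Fin (N + 2) → Mode d) := by
      funext b
      refine Fin.cases rfl (fun b => ?_) b
      refine Fin.cases rfl (fun b => rfl) b
    rw [hsep, ih, hk, Pat.toM, allowed_int, Pat.expand, not_degenerate_cons, not_degenerate_cons]
    simp only [Fin.tail_cons]
    have hzero : ((Fin.cons (u 0).inv.1 (Fin.cons (u 0).1 fun b => (P.expand v (Fin.tail u) b).1 :
          Fin (N + 1) → Mode d) : Fin (N + 2) → Mode d) 0 +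
        (Fin.cons (u 0).inv.1 (Fin.cons (u 0).1 fun b => (P.expand v (Fin.tail u) b).1 :
          Fin (N + 1) → Mode d) : Fin (N + 2) → Mode d) 1) = 0 := by
      change (u 0).inv.1 + (u 0).1 = 0
      exact neg_add_cancel _
    constructor
    · rintro ⟨⟨h1, h2⟩, h3, h4⟩
      have hne : ∀ b, (u 0).cls ≠ (P.expand v (Fin.tail u) b).cls := by
        intro b hb
        rcases P.expand_cls v (Fin.tail u) b with ⟨j, hj⟩ | ⟨i, hi | hi⟩
        · exact h3 j (by rw [hb, hj])
        · exact h4 i (by rw [hb, hi])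
        · exact h4 i (by rw [hb, hi, Letter.cls_inv])
      refine ⟨⟨h1, hzero⟩, ⟨h2, fun b hb => absurd hb (hne b)⟩, fun b => ?_⟩
      refine Fin.cases (fun _ => (Letter.inv_inv _).symm) (fun b hb => ?_) b
      rw [Letter.cls_inv] at hb
      exact absurd hb (hne b)
    · rintro ⟨⟨h1, -⟩, ⟨h2, h3⟩, h4⟩
      -- A later letter in the class of `u 0` would be opposite to `u 0` and also to its inverse.
      have hne : ∀ b, (u 0).cls ≠ (P.expand v (Fin.tail u) b).cls := by
        intro b hb
        have e1 := h3 b hb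
        have e2 := h4 b.succ (by rw [Letter.cls_inv]; exact hb)
        simp only [Fin.cons_succ, Letter.inv_inv] at e2
        exact Letter.inv_ne_self (u 0) (by rw [← e1, e2])
      refine ⟨⟨h1, h2⟩, fun j hj => ?_, fun i hi => ?_⟩
      · obtain ⟨b, -, hb⟩ := P.exists_expand_ext v (Fin.tail u) j
        exact hne b (by rw [hj, hb])
      · obtain ⟨-, c, -, hc⟩ := P.exists_expand_int v (Fin.tail u) i
        exact hne c (by rw [hi, hc])

/-- The constraint on a recollision fixes only the momenta, so the two events could still both be
emissions, into `k` and `-k`. Nondegeneracy forces them to be opposite, which is the shape produced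
by `expand`. -/
theorem Pat.exists_expand {n r N : ℕ} (P : Pat n r N) {w : Fin N → Letter d}
    (h1 : Allowed P.toM fun b => (w b).1) (h2 : ¬Degenerate w) :
    ∃ v u, P.expand v u = w := by
  induction P with
  | nil => exact ⟨Fin.elim0, Fin.elim0, funext fun b => b.elim0⟩
  | @ext n r N P ih =>
    obtain ⟨a, w, rfl⟩ : ∃ a w', w = (Fin.cons a w' : Fin (N + 1) → Letter d) :=
      ⟨w 0, Fin.tail w, (Fin.cons_self_tail w).symm⟩
    rw [Pat.toM, allowed_ext] at h1
    rw [not_degenerate_cons] at h2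
    obtain ⟨v, u, h⟩ := ih (w := w) h1.1 h2.1
    refine ⟨Fin.cons a v, u, ?_⟩
    simp only [Pat.expand, Fin.tail_cons, Fin.cons_zero, h]
  | @int n r N P ih =>
    obtain ⟨a, w, rfl⟩ : ∃ a w', w = (Fin.cons a w' : Fin (N + 2) → Letter d) :=
      ⟨w 0, Fin.tail w, (Fin.cons_self_tail w).symm⟩
    obtain ⟨b, w, rfl⟩ : ∃ a w', w = (Fin.cons a w' : Fin (N + 1) → Letter d) :=
      ⟨w 0, Fin.tail w, (Fin.cons_self_tail w).symm⟩
    rw [Pat.toM, allowed_int] at h1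
    rw [not_degenerate_cons, not_degenerate_cons] at h2
    obtain ⟨v, u, h⟩ := ih (w := w) h1.1 h2.1.1
    have hab : a.1 + b.1 = 0 := h1.2
    have e := h2.2 0 (Letter.cls_eq_iff.2 (Or.inr (eq_neg_of_add_eq_zero_left hab)))
    simp only [Fin.cons_zero] at e
    refine ⟨v, Fin.cons b u, ?_⟩
    simp only [Pat.expand, Fin.tail_cons, Fin.cons_zero, h, e, Letter.inv_inv]

end Polaron
end

noncomputable section
set_option linter.unusedSectionVars false
namespace Polaron
variable {d : ℕ}

theorem Pat.expand_ext {n r N : ℕ} (P : Pat n r N) (v : Fin (n + 1) → Letter d)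
    (u : Fin r → Letter d) : P.ext.expand v u = Fin.cons (v 0) (P.expand (Fin.tail v) u) := rfl

theorem Pat.expand_int {n r N : ℕ} (P : Pat n r N) (v : Fin n → Letter d)
    (u : Fin (r + 1) → Letter d) :
    P.int.expand v u = Fin.cons (u 0).inv (Fin.cons (u 0) (P.expand v (Fin.tail u))) := rfl

/-! ### Net occupation changes -/

/-- The change of the occupation number of the mode `q` along a word. -/
def net {N : ℕ} (w : Fin N → Letter d) (q : Mode d) : ℤ :=
  ∑ i, if (w i).mode = q then ((w i).2 : ℤ) else 0

theorem path_apply {N : ℕ} {w : Fin N → Letter d} {ν : Config d} (h : pathWeight w ν ≠ 0)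
    (q : Mode d) : (path w ν q : ℤ) = ν q + net w q := by
  have e : ∀ ν : Config d, cfgSum (fun q' => if q' = q then (1 : ℤ) else 0) ν = ν q := by
    intro ν
    unfold cfgSum
    simp only [Finsupp.sum, smul_ite, smul_zero, nsmul_eq_mul, mul_one, Finset.sum_ite_eq',
      Finsupp.mem_support_iff, ne_eq, ite_not]
    split_ifs with h0
    · rw [h0, Nat.cast_zero]
    · rfl
  rw [← e, ← e, cfgSum_path _ h, net]
  congr 1
  refine Finset.sum_congr rfl fun i _ => ?_
  split_ifs <;> simp

theorem net_cons {N : ℕ} (a : Letter d) (w : Fin N → Letter d) (q : Mode d) :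
    net (Fin.cons a w : Fin (N + 1) → Letter d) q =
      (if a.mode = q then (a.2 : ℤ) else 0) + net w q := by
  simp [net, Fin.sum_univ_succ]

theorem Pat.net_expand {n r N : ℕ} (P : Pat n r N) (v : Fin n → Letter d)
    (u : Fin r → Letter d) : net (P.expand v u) = net v := by
  induction P with
  | nil => funext q; simp [net]
  | ext P ih =>
    funext q
    rw [Pat.expand, net_cons, ih]
    conv_rhs => rw [← Fin.cons_self_tail v, net_cons]
  | int P ih =>
    funext q
    rw [Pat.expand, net_cons, net_cons, ih, Letter.mode_inv]
    simp only [Letter.inv]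
    split_ifs <;> simp

theorem Pat.wordMom_expand {n r N : ℕ} (P : Pat n r N) (v : Fin n → Letter d)
    (u : Fin r → Letter d) : wordMom (P.expand v u) = wordMom v := by
  induction P with
  | nil => simp [wordMom]
  | ext P ih =>
    have h1 := ih (Fin.tail v) u
    unfold wordMom at h1 ⊢
    rw [Fin.sum_univ_succ, Fin.sum_univ_succ]
    simp only [Pat.expand, Fin.cons_zero, Fin.cons_succ, h1, Fin.tail]
  | int P ih =>
    have h1 := ih v (Fin.tail u)
    unfold wordMom at h1 ⊢
    rw [Fin.sum_univ_succ, Fin.sum_univ_succ]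
    simp only [Pat.expand, Fin.cons_zero, Fin.cons_succ, h1, Letter.inv]
    abel

theorem Pat.wordOmega_expand {n r N : ℕ} (P : Pat n r N) {S : Model d}
    (hω : ∀ k, S.ω (-k) = S.ω k) (L : ℝ) (v : Fin n → Letter d)
    (u : Fin r → Letter d) : S.wordOmega L (P.expand v u) = S.wordOmega L v := by
  induction P with
  | nil => simp [Model.wordOmega]
  | ext P ih =>
    have h1 := ih (Fin.tail v) u
    unfold Model.wordOmega at h1 ⊢
    rw [Fin.sum_univ_succ, Fin.sum_univ_succ]
    simp only [Pat.expand, Fin.cons_zero, Fin.cons_succ, h1, Fin.tail]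
  | int P ih =>
    have h1 := ih v (Fin.tail u)
    unfold Model.wordOmega at h1 ⊢
    rw [Fin.sum_univ_succ, Fin.sum_univ_succ]
    simp only [Pat.expand, Fin.cons_zero, Fin.cons_succ, h1, Letter.inv, mom_neg, hω]
    push_cast
    ring

theorem Pat.wordQ_expand {n r N : ℕ} (P : Pat n r N) {S : Model d}
    (hQ : ∀ k, S.Q (-k) = S.Q k) (L : ℝ) (v : Fin n → Letter d) (u : Fin r → Letter d) :
    S.wordQ L (P.expand v u) = S.wordQ L v * S.wordQ L u ^ 2 := by
  induction P with
  | nil => simp [Model.wordQ]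
  | ext P ih =>
    have h1 := ih (Fin.tail v) u
    unfold Model.wordQ at h1 ⊢
    rw [Fin.prod_univ_succ, Fin.prod_univ_succ (n := _) (f := fun i => S.Q (mom L (v i).1))]
    simp only [Pat.expand, Fin.cons_zero, Fin.cons_succ, h1, Fin.tail]
    ring
  | int P ih =>
    have h1 := ih v (Fin.tail u)
    unfold Model.wordQ at h1 ⊢
    rw [Fin.prod_univ_succ, Fin.prod_univ_succ,
      Fin.prod_univ_succ (n := _) (f := fun i => S.Q (mom L (u i).1))]
    simp only [Pat.expand, Fin.cons_zero, Fin.cons_succ, h1, Letter.inv, mom_neg, hQ, Fin.tail]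
    ring

/-! ### Matrix elements of separated words -/

/-- The occupation factor of an event: `ν_q + 1` for emission, `ν_q` for absorption. -/
def occFactor (a : Letter d) (ν : Config d) : ℝ := ν a.mode + (((a.2 : ℤ) : ℝ) + 1) / 2

theorem occFactor_nonneg (a : Letter d) (ν : Config d) : 0 ≤ occFactor a ν := by
  unfold occFactor
  rcases Int.units_eq_one_or a.2 with h | h <;> (simp only [h]; norm_num; try positivity)

theorem stepWeight_sq (a : Letter d) (ν : Config d) : stepWeight a ν ^ 2 = occFactor a ν := by
  unfold stepWeight occFactor
  rcases Int.units_eq_one_or a.2 with h | h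
  · rw [if_pos h, h, Real.sq_sqrt (by positivity)]; simp
  · rw [if_neg (by rw [h]; decide), h, neg_sq, Real.sq_sqrt (by positivity)]; simp

theorem step_apply_of_ne {a : Letter d} {ν : Config d} {q : Mode d} (h : a.mode ≠ q) :
    step a ν q = ν q := by
  unfold step
  split_ifs <;> simp [h]

theorem path_apply_of_ne {N : ℕ} {w : Fin N → Letter d} {ν : Config d} {q : Mode d}
    (h : ∀ b, (w b).mode ≠ q) : path w ν q = ν q := by
  induction N with
  | zero => rfl
  | succ N ih => rw [path, step_apply_of_ne (h 0), ih (w := Fin.tail w) fun b => h b.succ]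

theorem stepWeight_congr {a : Letter d} {ν ν' : Config d} (h : ν a.mode = ν' a.mode) :
    stepWeight a ν = stepWeight a ν' := by
  unfold stepWeight
  rw [h]

/-- Undoing an event repeats the same square root with the other sign, since `b_k` is the difference
of a creation and an annihilation operator. Each recollision thus contributes minus its occupation
factor. -/
theorem stepWeight_inv_mul (a : Letter d) (ν : Config d) :
    stepWeight a.inv (step a ν) * stepWeight a ν = -occFactor a ν := by
  have h1 : stepWeight a.inv (step a ν) * stepWeight a ν = - (stepWeight a ν ^ 2) := by
    rcases Int.units_eq_one_or a.2 with h | h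
    · have h' : ¬ a.inv.2 = 1 := by simp only [Letter.inv, h]; decide
      rw [stepWeight, if_neg h', stepWeight, if_pos h, Letter.mode_inv, step, if_pos h]
      simp
      ring
    · have h' : a.inv.2 = 1 := by simp only [Letter.inv, h]; decide
      have h2 : ¬ a.2 = 1 := by rw [h]; decide
      rw [stepWeight, if_pos h', stepWeight, if_neg h2, Letter.mode_inv, step, if_neg h2]
      by_cases h0 : ν a.mode = 0
      · simp [h0]
      · have : (((ν - Finsupp.single a.mode 1 : Config d) a.mode : ℕ) : ℝ) + 1 = ν a.mode := by
          simp only [Finsupp.tsub_apply, Finsupp.single_eq_same]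
          have : 1 ≤ ν a.mode := by omega
          push_cast [this]
          ring
        rw [this]
        ring
  rw [h1, stepWeight_sq]

theorem Pat.cls_ne_expand {n r N : ℕ} (P : Pat n r N) {v : Fin n → Letter d}
    {u : Fin r → Letter d} {a : Letter d} (h1 : ∀ j, a.cls ≠ (v j).cls)
    (h2 : ∀ i, a.cls ≠ (u i).cls) (b : Fin N) : a.cls ≠ (P.expand v u b).cls := by
  intro hb
  rcases P.expand_cls v u b with ⟨j, hj⟩ | ⟨i, hi | hi⟩
  · exact h1 j (by rw [hb, hj])
  · exact h2 i (by rw [hb, hi])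
  · exact h2 i (by rw [hb, hi, Letter.cls_inv])

theorem Separated.tail_left {n r : ℕ} {v : Fin (n + 1) → Letter d} {u : Fin r → Letter d}
    (h : Separated v u) : Separated (Fin.tail v) u := by
  have e : Sum.elim (fun j => (Fin.tail v j).cls) (fun i => (u i).cls) =
      Sum.elim (fun j => (v j).cls) (fun i => (u i).cls) ∘ Sum.map Fin.succ id := by
    funext x; rcases x with x | x <;> rfl
  unfold Separated
  rw [e]
  exact h.comp (Sum.map_injective.2 ⟨Fin.succ_injective _, Function.injective_id⟩)

theorem Separated.tail_right {n r : ℕ} {v : Fin n → Letter d} {u : Fin (r + 1) → Letter d}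
    (h : Separated v u) : Separated v (Fin.tail u) := by
  have e : Sum.elim (fun j => (v j).cls) (fun i => (Fin.tail u i).cls) =
      Sum.elim (fun j => (v j).cls) (fun i => (u i).cls) ∘ Sum.map id Fin.succ := by
    funext x; rcases x with x | x <;> rfl
  unfold Separated
  rw [e]
  exact h.comp (Sum.map_injective.2 ⟨Function.injective_id, Fin.succ_injective _⟩)

/-- Different classes affect different modes, and a recollision restores its own mode. Every event
therefore sees the initial occupation number of its mode, and the matrix element becomes a product
that can be averaged mode by mode. -/
theorem Pat.pathWeight_expand {n r N : ℕ} (P : Pat n r N) {v : Fin n → Letter d}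
    {u : Fin r → Letter d} (h : Separated v u) (ν : Config d) :
    pathWeight (P.expand v u) ν = (∏ j, stepWeight (v j) ν) * ∏ i, -occFactor (u i) ν := by
  induction P with
  | nil => simp [pathWeight]
  | ext P ih =>
    rw [Pat.expand_ext, pathWeight, Fin.tail_cons, Fin.cons_zero, ih h.tail_left, Fin.prod_univ_succ]
    rw [stepWeight_congr (path_apply_of_ne fun b hb => ?_)]
    · simp only [Fin.tail]; ring
    · refine P.cls_ne_expand (a := v 0) (fun j hj => ?_) (fun i hi => ?_) b
        (Letter.cls_of_mode_eq hb.symm)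
      · have := @h (Sum.inl 0) (Sum.inl j.succ) hj
        exact (Fin.succ_ne_zero j).symm (Sum.inl_injective this)
      · have := @h (Sum.inl 0) (Sum.inr i) hi
        simp at this
  | int P ih =>
    rw [Pat.expand_int, pathWeight, Fin.tail_cons, Fin.cons_zero, pathWeight, Fin.tail_cons,
      Fin.cons_zero, ih h.tail_right, path, Fin.tail_cons, Fin.cons_zero, ← mul_assoc,
      stepWeight_inv_mul, Fin.prod_univ_succ (n := _) (f := fun i => -occFactor (u i) ν)]
    have : occFactor (u 0) (path (P.expand v (Fin.tail u)) ν) = occFactor (u 0) ν := by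
      unfold occFactor
      rw [path_apply_of_ne fun b hb => ?_]
      refine P.cls_ne_expand (a := u 0) (fun j hj => ?_) (fun i hi => ?_) b
        (Letter.cls_of_mode_eq hb.symm)
      · have := @h (Sum.inr 0) (Sum.inl j) hj
        simp at this
      · have := @h (Sum.inr 0) (Sum.inr i.succ) hi
        exact (Fin.succ_ne_zero i).symm (Sum.inr_injective this)
    rw [this]
    simp only [Fin.tail]
    ring

/-! ### Combinatorics of degenerate and separated words -/

theorem net_eq_zero {N : ℕ} {w : Fin N → Letter d} {q : Mode d} (h : ∀ j, (w j).mode ≠ q) :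
    net w q = 0 :=
  Finset.sum_eq_zero fun j _ => if_neg (h j)

theorem net_eq_of_unique {N : ℕ} {w : Fin N → Letter d} {i : Fin N}
    (h : ∀ j, j ≠ i → (w j).mode ≠ (w i).mode) : net w (w i).mode = ((w i).2 : ℤ) := by
  unfold net
  rw [Finset.sum_eq_single i (fun j _ hj => if_neg (h j hj)) (fun h => absurd (Finset.mem_univ i) h),
    if_pos rfl]

theorem unit_ne_zero (σ : ℤˣ) : (σ : ℤ) ≠ 0 := σ.ne_zero

/-- Every class occurring among the `2N` letters occurs at least twice: a solitary letter would
change the net occupation along one word and not along the other. The class of the degenerate pair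
even occurs three times. Hence twice the number of classes is smaller than `2N`. -/
theorem Degenerate.card_classes {N : ℕ} {w w' : Fin N → Letter d} (hw : Degenerate w)
    (h : net w = net w') :
    (Finset.univ.image (Sum.elim (fun j => (w j).cls) fun j => (w' j).cls)).card + 1 ≤ N := by
  classical
  set f : Fin N ⊕ Fin N → Sym2 (Mode d) := Sum.elim (fun j => (w j).cls) fun j => (w' j).cls with hf
  set F : Sym2 (Mode d) → Finset (Fin N ⊕ Fin N) := fun c => Finset.univ.filter fun x => f x = c
  have hmem : ∀ x c, x ∈ F c ↔ f x = c := fun x c => by simp [F]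
  have h2 : ∀ c ∈ Finset.univ.image f, 2 ≤ (F c).card := by
    intro c hc
    obtain ⟨x, -, hx⟩ := Finset.mem_image.1 hc
    by_contra hlt
    have huniq : ∀ y, f y = c → y = x := by
      intro y hy
      exact Finset.card_le_one.1 (by omega : (F c).card ≤ 1) y ((hmem y c).2 hy) x
        ((hmem x c).2 hx)
    rcases x with i | i
    · have e1 : net w (w i).mode = ((w i).2 : ℤ) := net_eq_of_unique fun j hj hm => hj
        (Sum.inl_injective (huniq (Sum.inl j) (by rw [← hx]; exact Letter.cls_of_mode_eq hm)))
      have e2 : net w' (w i).mode = 0 := net_eq_zero fun j hm => by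
        have := huniq (Sum.inr j) (by rw [← hx]; exact Letter.cls_of_mode_eq hm)
        simp at this
      rw [h, e2] at e1
      exact unit_ne_zero _ e1.symm
    · have e1 : net w' (w' i).mode = ((w' i).2 : ℤ) := net_eq_of_unique fun j hj hm => hj
        (Sum.inr_injective (huniq (Sum.inr j) (by rw [← hx]; exact Letter.cls_of_mode_eq hm)))
      have e2 : net w (w' i).mode = 0 := net_eq_zero fun j hm => by
        have := huniq (Sum.inl j) (by rw [← hx]; exact Letter.cls_of_mode_eq hm)
        simp at this
      rw [← h, e2] at e1
      exact unit_ne_zero _ e1.symm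
  obtain ⟨i, j, hij, hc, hne⟩ := hw
  have h3 : 3 ≤ (F (w i).cls).card := by
    by_contra hlt
    have hsub : ({Sum.inl i, Sum.inl j} : Finset (Fin N ⊕ Fin N)) ⊆ F (w i).cls := by
      intro x hx
      simp only [Finset.mem_insert, Finset.mem_singleton] at hx
      rcases hx with rfl | rfl
      · exact (hmem _ _).2 rfl
      · exact (hmem _ _).2 hc.symm
    have hcard : ({Sum.inl i, Sum.inl j} : Finset (Fin N ⊕ Fin N)).card = 2 :=
      Finset.card_pair fun h => hij (Sum.inl_injective h)
    have heq := Finset.eq_of_subset_of_card_le hsub (by omega)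
    have hall : ∀ y, f y = (w i).cls → y = Sum.inl i ∨ y = Sum.inl j := by
      intro y hy
      have := (hmem y _).2 hy
      rw [← heq] at this
      simpa using this
    have e2 : net w' (w i).mode = 0 := net_eq_zero fun l hm => by
      have := hall (Sum.inr l) (Letter.cls_of_mode_eq hm)
      simp at this
    -- If only this pair lay in the class, letters of equal mode would have equal sign and change
    -- the occupation number by two, while letters of different modes would each change theirs by
    -- one. The other word could compensate neither.
    by_cases hm : (w j).mode = (w i).mode
    · have hs : (w j).2 = (w i).2 := by
        by_contra hs
        exact hne (Letter.eq_inv_of_mode hm.symm fun h => hs h.symm)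
      have e1 : net w (w i).mode = ((w i).2 : ℤ) + ((w i).2 : ℤ) := by
        unfold net
        rw [← Finset.sum_subset (Finset.subset_univ {i, j}), Finset.sum_pair hij, if_pos rfl,
          if_pos hm, hs]
        intro l _ hl
        refine if_neg fun hm' => hl ?_
        have := hall (Sum.inl l) (Letter.cls_of_mode_eq hm')
        simpa using this
      rw [h, e2] at e1
      have := unit_ne_zero (w i).2
      omega
    · have e1 : net w (w i).mode = ((w i).2 : ℤ) := net_eq_of_unique fun l hl hm' => by
        rcases hall (Sum.inl l) (Letter.cls_of_mode_eq hm') with h' | h'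
        · exact hl (Sum.inl_injective h')
        · rw [Sum.inl_injective h'] at hm'
          exact hm hm'
      rw [h, e2] at e1
      exact unit_ne_zero _ e1.symm
  have htot := Finset.card_eq_sum_card_image f Finset.univ
  rw [Finset.card_univ, Fintype.card_sum, Fintype.card_fin] at htot
  have hi : (w i).cls ∈ Finset.univ.image f := Finset.mem_image.2 ⟨Sum.inl i, Finset.mem_univ _, rfl⟩
  have hlt : ∑ _c ∈ Finset.univ.image f, 2 < ∑ c ∈ Finset.univ.image f, (F c).card :=
    Finset.sum_lt_sum h2 ⟨_, hi, by omega⟩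
  rw [Finset.sum_const, smul_eq_mul] at hlt
  have hF : ∑ c ∈ Finset.univ.image f, (F c).card = N + N := htot.symm
  omega

/-- When all classes differ, each mode is touched at most once, so the set of letters can be read
off from the net change. Only their order is free, and this is the origin of the factor `n!` in the
trace bound. -/
theorem exists_finset_of_net {n : ℕ} (η : Mode d → ℤ) :
    ∃ s : Finset (Fin n → Letter d), s.card ≤ n.factorial ∧
      ∀ v : Fin n → Letter d, Function.Injective (fun j => (v j).cls) → net v = η → v ∈ s := by
  classical
  by_cases h : ∃ v₀ : Fin n → Letter d, Function.Injective (fun j => (v₀ j).cls) ∧ net v₀ = η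
  · obtain ⟨v₀, h0, h1⟩ := h
    refine ⟨Finset.univ.image fun (π : Equiv.Perm (Fin n)) j => v₀ (π j),
      Finset.card_image_le.trans (by rw [Finset.card_univ, Fintype.card_perm, Fintype.card_fin]),
      fun v hv hn => ?_⟩
    have hinj : ∀ {v : Fin n → Letter d}, Function.Injective (fun j => (v j).cls) → ∀ i j, j ≠ i →
        (v j).mode ≠ (v i).mode := fun hv i j hij hm => hij (hv (Letter.cls_of_mode_eq hm))
    have hex : ∀ i, ∃ j, v i = v₀ j := by
      intro i
      have e : net v₀ (v i).mode = ((v i).2 : ℤ) := by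
        rw [h1, ← hn, net_eq_of_unique (hinj hv i)]
      have hj : ∃ j, (v₀ j).mode = (v i).mode := by
        by_contra hno
        push Not at hno
        rw [net_eq_zero hno] at e
        exact unit_ne_zero _ e.symm
      obtain ⟨j, hj⟩ := hj
      rw [← hj, net_eq_of_unique (hinj h0 j)] at e
      exact ⟨j, Letter.ext_mode hj.symm (Units.ext e.symm)⟩
    choose π hπ using hex
    have hπi : Function.Injective π := fun i j hij => hv (by simp only [hπ, hij])
    refine Finset.mem_image.2 ⟨Equiv.ofBijective π (Finite.injective_iff_bijective.1 hπi),
      Finset.mem_univ _, ?_⟩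
    funext j
    exact (hπ j).symm
  · exact ⟨∅, Nat.zero_le _, fun v hv hn => absurd ⟨v, hv, hn⟩ h⟩

theorem enorm_tsum_sq_le {α : Type*} {f : α → ℂ} {s : Finset α} (hs : ∀ a, f a ≠ 0 → a ∈ s)
    {c : ℕ} (hc : s.card ≤ c) : ‖∑' a, f a‖ₑ ^ 2 ≤ c * ∑' a, ‖f a‖ₑ ^ 2 := by
  have h0 : ∀ a, a ∉ s → f a = 0 := fun a ha => by_contra fun h => ha (hs a h)
  rw [tsum_eq_sum (s := s) fun a ha => h0 a ha, tsum_eq_sum (s := s) fun a ha => by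
    rw [h0 a ha, enorm_zero]; simp]
  have h1 : ‖∑ a ∈ s, f a‖ ^ 2 ≤ c * ∑ a ∈ s, ‖f a‖ ^ 2 := by
    have h2 := norm_sum_le s f
    have h3 := sq_sum_le_card_mul_sum_sq (s := s) (f := fun a => ‖f a‖)
    have h4 : (0 : ℝ) ≤ ∑ a ∈ s, ‖f a‖ ^ 2 := Finset.sum_nonneg fun a _ => by positivity
    calc ‖∑ a ∈ s, f a‖ ^ 2 ≤ (∑ a ∈ s, ‖f a‖) ^ 2 := pow_le_pow_left₀ (norm_nonneg _) h2 2
      _ ≤ (s.card : ℝ) * ∑ a ∈ s, ‖f a‖ ^ 2 := h3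
      _ ≤ c * ∑ a ∈ s, ‖f a‖ ^ 2 := mul_le_mul_of_nonneg_right (by exact_mod_cast hc) h4
  have h5 := ENNReal.ofReal_le_ofReal h1
  rw [ENNReal.ofReal_pow (norm_nonneg _), ofReal_norm, ENNReal.ofReal_mul (by positivity),
    ENNReal.ofReal_natCast, ENNReal.ofReal_sum_of_nonneg (fun a _ => by positivity)] at h5
  simpa only [ENNReal.ofReal_pow (norm_nonneg _), ofReal_norm] using h5

end Polaron
end

noncomputable section
set_option linter.unusedSectionVars false
namespace Polaron
variable {d : ℕ}

/-! ### Expansion of the amplitudes on the lattice -/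

theorem intervalIntegral_tsum {ι : Type*} [Countable ι] {F : ι → ℝ → ℂ} {b : ι → ℝ} {t : ℝ}
    (ht : 0 ≤ t) (hF : ∀ i, Continuous (F i)) (hb : ∀ i, ∀ s, 0 ≤ s → s ≤ t → ‖F i s‖ ≤ b i)
    (hs : Summable b) :
    ∫ s in (0 : ℝ)..t, ∑' i, F i s = ∑' i, ∫ s in (0 : ℝ)..t, F i s := by
  refine (intervalIntegral.hasSum_integral_of_dominated_convergence (fun i _ => b i)
    (fun i => (hF i).aestronglyMeasurable) (fun i => ?_) ?_ ?_ ?_).tsum_eq.symm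
  · refine Eventually.of_forall fun s hs => ?_
    rw [Set.uIoc_of_le ht] at hs
    exact hb i s hs.1.le hs.2
  · exact Eventually.of_forall fun _ _ => hs
  · exact intervalIntegrable_const
  · refine Eventually.of_forall fun s hs' => ?_
    rw [Set.uIoc_of_le ht] at hs'
    exact (Summable.of_norm_bounded hs fun i => hb i s hs'.1.le hs'.2).hasSum

theorem summable_prod_fin {α : Type*} {f : α → ℝ} (h0 : ∀ a, 0 ≤ f a) (hf : Summable f) (r : ℕ) :
    Summable fun u : Fin r → α => ∏ i, f (u i) := by
  induction r with
  | zero => exact Summable.of_finite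
  | succ r ih =>
    rw [← (Fin.consEquiv fun _ : Fin (r + 1) => α).summable_iff]
    refine (hf.mul_of_nonneg ih h0 fun u => Finset.prod_nonneg fun i _ => h0 _).congr fun q => ?_
    simp [Fin.consEquiv, Fin.prod_univ_succ]

/-- The weight of an event in the box. -/
def Model.latWeight (S : Model d) (L : ℝ) (a : Letter d) : ℝ := (L ^ d)⁻¹ * S.M (mom L a.1) a.2

variable {S : Model d} {L G T : ℝ}

theorem Model.Dispersive.latWeight_nonneg (h : S.Dispersive (latticeMeasure d L) G T) (hL : 0 < L)
    (a : Letter d) : 0 ≤ S.latWeight L a :=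
  mul_nonneg (by positivity) (h.M_nonneg _ _)

theorem summable_letter {f : Letter d → ℝ} (h0 : ∀ a, 0 ≤ f a)
    (h : ∀ σ, Summable fun k => f (k, σ)) : Summable f := by
  rw [← (Equiv.prodComm _ _).summable_iff]
  exact (summable_prod_of_nonneg (f := f ∘ Equiv.prodComm ℤˣ (Mode d)) fun a => h0 _).2
    ⟨h, Summable.of_finite⟩

theorem tsum_letter {f : Letter d → ℂ} (h : Summable f) :
    ∑' a, f a = ∑ σ : ℤˣ, ∑' k, f (k, σ) := by
  have h' := (Equiv.prodComm ℤˣ (Mode d)).summable_iff.2 h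
  rw [← (Equiv.prodComm ℤˣ (Mode d)).tsum_eq]
  exact h'.tsum_prod.trans (tsum_fintype _)

theorem Model.Dispersive.summable_latWeight (h : S.Dispersive (latticeMeasure d L) G T)
    (hL : 0 < L) : Summable (S.latWeight L) := by
  refine summable_letter (h.latWeight_nonneg hL) fun σ => ?_
  have := (integrable_latticeMeasure_iff_summable hL (h.continuous_M σ).stronglyMeasurable).1
    (h.integrable_M σ)
  simp only [Real.norm_of_nonneg (h.M_nonneg _ _)] at this
  exact this.mul_left _

theorem Model.Dispersive.Theta_lattice (h : S.Dispersive (latticeMeasure d L) G T) (hL : 0 < L)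
    (s : ℝ) (p : Mom d) (Ω : ℝ) :
    S.Theta (latticeMeasure d L) s p Ω = ∑' a : Letter d, (S.latWeight L a : ℂ) *
      Complex.exp (-Complex.I * ((s * (S.Phi a.2 p (mom L a.1) + Ω) : ℝ) : ℂ)) := by
  have h1 := h.continuous_e
  have h2 := h.continuous_ω
  have h3 := h.continuous_M
  rw [tsum_letter]
  · unfold Model.Theta
    refine Finset.sum_congr rfl fun σ _ => ?_
    have hc : Continuous fun k => Complex.exp (-Complex.I * ((s * (S.Phi σ p k + Ω) : ℝ) : ℂ)) *
        (S.M k σ : ℂ) := by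
      have := h3 σ
      unfold Model.Phi
      fun_prop
    rw [integral_latticeMeasure_eq_tsum hL hc.stronglyMeasurable, Complex.real_smul,
      ← tsum_mul_left]
    · refine tsum_congr fun k => ?_
      unfold Model.latWeight
      push_cast
      ring
    · refine (h.integrable_M σ).mono' hc.aestronglyMeasurable (Eventually.of_forall fun k => ?_)
      rw [norm_mul, norm_cexp_I, one_mul, Complex.norm_real, Real.norm_of_nonneg (h.M_nonneg _ _)]
  · refine Summable.of_norm_bounded (h.summable_latWeight hL) fun a => ?_
    rw [norm_mul, norm_cexp_I, mul_one, Complex.norm_real,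
      Real.norm_of_nonneg (h.latWeight_nonneg hL a)]

theorem elMom_zero_mom (L : ℝ) (p : Mode d) {n : ℕ} (v : Fin n → Letter d) :
    elMom (mom L p) (fun j => mom L (v j).1) 0 = mom L (p + wordMom v) := by
  have hsum : ∀ (n : ℕ) (v : Fin n → Letter d), mom L (wordMom v) = ∑ j, mom L (v j).1 := by
    intro n v
    induction n with
    | zero => simp [wordMom, mom_zero]
    | succ n ih =>
      have := ih (Fin.tail v)
      unfold wordMom at this ⊢
      rw [Fin.sum_univ_succ, mom_add, Fin.sum_univ_succ]
      exact congrArg _ this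
  rw [mom_add, hsum]
  simp [elMom]

theorem Omega_zero_word (S : Model d) (L : ℝ) {n : ℕ} (v : Fin n → Letter d) :
    S.Omega (fun j => mom L (v j).1) (fun j => (v j).2) 0 = S.wordOmega L v := by
  simp [Model.Omega, Model.wordOmega]

theorem energy_zero_word (S : Model d) (L : ℝ) (p : Mode d) {n : ℕ} (v : Fin n → Letter d) :
    S.energy (mom L p) (fun j => mom L (v j).1) (fun j => (v j).2) 0 =
      S.e (mom L (p + wordMom v)) + S.wordOmega L v := by
  rw [Model.energy, elMom_zero_mom, Omega_zero_word]

/-- On the lattice each `Θ` is a sum over the letter of the recollision. Expanding all of them turns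
the amplitude of a pattern into a sum of word integrals. The sums are exchanged with the time
integrals under the bound `t ^ N` times a product of summable weights. -/
theorem Model.Dispersive.amp_lattice (h : S.Dispersive (latticeMeasure d L) G T) (hL : 0 < L)
    (hω : ∀ k, S.ω (-k) = S.ω k) {n r N : ℕ} (P : Pat n r N) (p : Mode d) (v : Fin n → Letter d)
    {t : ℝ} (ht : 0 ≤ t) :
    P.amp S (latticeMeasure d L) (mom L p) (fun j => mom L (v j).1) (fun j => (v j).2) t =
      ∑' u : Fin r → Letter d, ((∏ i, S.latWeight L (u i) : ℝ) : ℂ) *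
        S.wordConv L p (P.expand v u) t := by
  have hW0 := h.latWeight_nonneg hL
  have hWs := h.summable_latWeight hL
  have hnorm : ∀ {r N : ℕ} (u : Fin r → Letter d) (w : Fin N → Letter d) {s t : ℝ}, 0 ≤ s →
      s ≤ t → ‖((∏ i, S.latWeight L (u i) : ℝ) : ℂ) * S.wordConv L p w s‖ ≤
        (∏ i, S.latWeight L (u i)) * t ^ N := by
    intro r N u w s t h0 h1
    rw [norm_mul, Complex.norm_real, Real.norm_of_nonneg (Finset.prod_nonneg fun i _ => hW0 _)]
    exact mul_le_mul_of_nonneg_left ((S.norm_wordConv_le L p w h0).trans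
      (pow_le_pow_left₀ h0 h1 N)) (Finset.prod_nonneg fun i _ => hW0 _)
  induction P generalizing t with
  | nil =>
    rw [Pat.amp_nil, energy_zero_word, tsum_eq_single (Fin.elim0 : Fin 0 → Letter d)
      (fun u hu => absurd (Subsingleton.elim _ _) hu)]
    simp [Model.wordConv, wordMom, Model.wordOmega]
  | @ext n r N P ih =>
    have e1 : ∀ s, 0 ≤ s → P.amp S (latticeMeasure d L) (mom L p)
        (Fin.tail fun j => mom L (v j).1) (Fin.tail fun j => (v j).2) s = _ :=
      fun s h0 => ih (Fin.tail v) h0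
    rw [Pat.amp_ext, energy_zero_word]
    have e2 : ∀ u : Fin r → Letter d, ((∏ i, S.latWeight L (u i) : ℝ) : ℂ) *
        S.wordConv L p (P.ext.expand v u) t = ∫ s in (0 : ℝ)..t,
          Complex.exp (-Complex.I * (((t - s) *
            (S.e (mom L (p + wordMom v)) + S.wordOmega L v) : ℝ) : ℂ)) *
          (((∏ i, S.latWeight L (u i) : ℝ) : ℂ) * S.wordConv L p (P.expand (Fin.tail v) u) s) := by
      intro u
      rw [← P.ext.wordMom_expand v u, ← P.ext.wordOmega_expand hω L v u, Pat.expand_ext,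
        Model.wordConv, ← intervalIntegral.integral_const_mul]
      refine intervalIntegral.integral_congr fun s _ => ?_
      simp only [Fin.tail_cons]
      ring
    simp only [e2]
    rw [← intervalIntegral_tsum ht (b := fun u : Fin r → Letter d =>
      (∏ i, S.latWeight L (u i)) * t ^ N)]
    · refine intervalIntegral.integral_congr fun s hs => ?_
      rw [Set.uIcc_of_le ht] at hs
      rw [tsum_mul_left, e1 s hs.1]
    · intro u
      have := S.continuous_wordConv L p (P.expand (Fin.tail v) u)
      fun_prop
    · intro u s h0 h1
      rw [norm_mul, norm_cexp_I, one_mul]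
      exact hnorm u _ h0 h1
    · exact (summable_prod_fin hW0 hWs r).mul_right _
  | @int n r N P ih =>
    have e1 := fun s (h0 : 0 ≤ s) => ih v h0
    rw [Pat.amp_int, energy_zero_word, elMom_zero_mom, Omega_zero_word]
    -- Between the two vertices of the recollision the event `u 0` has taken place and its inverse
    -- has not, so the energy there is `Φ` at the current electron momentum plus the external phonon
    -- energy.
    have hE : ∀ u : Fin (r + 1) → Letter d,
        S.e (mom L (p + wordMom (Fin.cons (u 0) (P.expand v (Fin.tail u)) :
          Fin (N + 1) → Letter d))) +
        S.wordOmega L (Fin.cons (u 0) (P.expand v (Fin.tail u)) : Fin (N + 1) → Letter d) =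
        S.Phi (u 0).2 (mom L (p + wordMom v)) (mom L (u 0).1) + S.wordOmega L v := by
      intro u
      have m1 : wordMom (Fin.cons (u 0) (P.expand v (Fin.tail u)) : Fin (N + 1) → Letter d) =
          (u 0).1 + wordMom v := by
        rw [← P.wordMom_expand v (Fin.tail u)]
        simp [wordMom, Fin.sum_univ_succ]
      have m2 : S.wordOmega L (Fin.cons (u 0) (P.expand v (Fin.tail u)) :
          Fin (N + 1) → Letter d) = (((u 0).2 : ℤ) : ℝ) * S.ω (mom L (u 0).1) +
          S.wordOmega L v := by
        rw [← P.wordOmega_expand hω L v (Fin.tail u)]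
        simp [Model.wordOmega, Fin.sum_univ_succ]
      rw [m1, m2, Model.Phi, ← mom_add, show p + ((u 0).1 + wordMom v) =
        (u 0).1 + (p + wordMom v) by abel]
      ring
    have e2 : ∀ s, 0 ≤ s → ∫ q in (0 : ℝ)..s,
        S.Theta (latticeMeasure d L) (s - q) (mom L (p + wordMom v)) (S.wordOmega L v) *
          P.amp S (latticeMeasure d L) (mom L p) (fun j => mom L (v j).1) (fun j => (v j).2) q =
        ∑' u : Fin (r + 1) → Letter d, ((∏ i, S.latWeight L (u i) : ℝ) : ℂ) *
          S.wordConv L p (Fin.cons (u 0) (P.expand v (Fin.tail u)) : Fin (N + 1) → Letter d) s := by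
      intro s h0
      have e3 : ∀ u : Fin (r + 1) → Letter d, ((∏ i, S.latWeight L (u i) : ℝ) : ℂ) *
          S.wordConv L p (Fin.cons (u 0) (P.expand v (Fin.tail u)) : Fin (N + 1) → Letter d) s =
          ∫ q in (0 : ℝ)..s, ((S.latWeight L (u 0) : ℂ) * Complex.exp (-Complex.I * (((s - q) *
            (S.Phi (u 0).2 (mom L (p + wordMom v)) (mom L (u 0).1) + S.wordOmega L v) : ℝ) : ℂ))) *
            (((∏ i, S.latWeight L (Fin.tail u i) : ℝ) : ℂ) *
              S.wordConv L p (P.expand v (Fin.tail u)) q) := by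
        intro u
        rw [Model.wordConv, ← intervalIntegral.integral_const_mul, hE]
        refine intervalIntegral.integral_congr fun q _ => ?_
        simp only [Fin.tail_cons, Fin.prod_univ_succ, Fin.tail]
        push_cast
        ring
      simp only [e3]
      rw [← intervalIntegral_tsum h0 (b := fun u : Fin (r + 1) → Letter d =>
        (∏ i, S.latWeight L (u i)) * s ^ N)]
      · refine intervalIntegral.integral_congr fun q hq => ?_
        rw [Set.uIcc_of_le h0] at hq
        rw [h.Theta_lattice hL, e1 q hq.1, tsum_mul_tsum_of_summable_norm]
        · rw [← (Fin.consEquiv fun _ : Fin (r + 1) => Letter d).tsum_eq]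
          refine tsum_congr fun z => ?_
          simp [Fin.consEquiv]
        · simp only [norm_mul, norm_cexp_I, mul_one, Complex.norm_real,
            Real.norm_of_nonneg (hW0 _)]
          exact hWs
        · exact ((summable_prod_fin hW0 hWs r).mul_right (s ^ N)).of_nonneg_of_le
            (fun u => norm_nonneg _) fun u => hnorm u _ hq.1 hq.2
      · intro u
        have := S.continuous_wordConv L p (P.expand v (Fin.tail u))
        fun_prop
      · intro u q h2 h3
        rw [norm_mul, norm_mul, norm_cexp_I, mul_one, Complex.norm_real,
          Real.norm_of_nonneg (hW0 _), Fin.prod_univ_succ, mul_assoc]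
        exact mul_le_mul_of_nonneg_left (hnorm (Fin.tail u) _ h2 h3) (hW0 _)
      · exact (summable_prod_fin hW0 hWs _).mul_right _
    have e4 : ∀ u : Fin (r + 1) → Letter d, ((∏ i, S.latWeight L (u i) : ℝ) : ℂ) *
        S.wordConv L p (P.int.expand v u) t = ∫ s in (0 : ℝ)..t,
          Complex.exp (-Complex.I * (((t - s) *
            (S.e (mom L (p + wordMom v)) + S.wordOmega L v) : ℝ) : ℂ)) *
          (((∏ i, S.latWeight L (u i) : ℝ) : ℂ) * S.wordConv L p
            (Fin.cons (u 0) (P.expand v (Fin.tail u)) : Fin (N + 1) → Letter d) s) := by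
      intro u
      rw [← P.int.wordMom_expand v u, ← P.int.wordOmega_expand hω L v u, Pat.expand_int,
        Model.wordConv, ← intervalIntegral.integral_const_mul]
      refine intervalIntegral.integral_congr fun s _ => ?_
      simp only [Fin.tail_cons]
      ring
    simp only [e4]
    rw [← intervalIntegral_tsum ht (b := fun u : Fin (r + 1) → Letter d =>
      (∏ i, S.latWeight L (u i)) * t ^ (N + 1))]
    · refine intervalIntegral.integral_congr fun s hs => ?_
      rw [Set.uIcc_of_le ht] at hs
      rw [tsum_mul_left, e2 s hs.1]
    · intro u
      have := S.continuous_wordConv L p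
        (Fin.cons (u 0) (P.expand v (Fin.tail u)) : Fin (N + 1) → Letter d)
      fun_prop
    · intro u s h0 h1
      rw [norm_mul, norm_cexp_I, one_mul]
      exact hnorm u _ h0 h1
    · exact (summable_prod_fin hW0 hWs _).mul_right _

end Polaron
end

noncomputable section
set_option linter.unusedSectionVars false
namespace Polaron
variable {d : ℕ}

/-! ### Counting words with few classes -/

/-- The constant in the count of words with few classes. -/
def countConst (B : ENNReal) (T : ℕ) : ENNReal := ∏ i ∈ Finset.range T, (1 + i * B)

theorem tsum_fin_succ {α : Type*} {T : ℕ} (F : (Fin (T + 1) → α) → ENNReal) :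
    ∑' w, F w = ∑' w : Fin T → α, ∑' a, F (Fin.cons a w) := by
  rw [← (Fin.consEquiv fun _ : Fin (T + 1) => α).tsum_eq, ENNReal.tsum_prod', ENNReal.tsum_comm]
  rfl

open Classical in
-- Letters are added one at a time. A letter in a new class costs the full sum `S`, but this happens
-- at most `r` times. A letter repeating the class of one of `i` earlier letters costs at most `i
-- B`. In the application `S` grows like the volume and `B` is bounded.
theorem tsum_few_classes_le {α γ : Type*} {f : α → ENNReal} {cls : α → γ} {S B : ENNReal}
    (hS : 1 ≤ S) (h1 : ∑' a, f a ≤ S) (h2 : ∀ c, ∑' a, (if cls a = c then f a else 0) ≤ B)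
    (T r : ℕ) :
    ∑' w : Fin T → α, (if (Finset.univ.image fun i => cls (w i)).card ≤ r then ∏ i, f (w i) else 0) ≤
      countConst B T * S ^ r := by
  induction T generalizing r with
  | zero =>
    rw [tsum_eq_single Fin.elim0 fun w hw => absurd (Subsingleton.elim _ _) hw]
    simpa [countConst] using one_le_pow₀ hS
  | succ T ih =>
    rw [tsum_fin_succ]
    have hpt : ∀ (w : Fin T → α) (a : α),
        (if (Finset.univ.image fun i => cls ((Fin.cons a w : Fin (T + 1) → α) i)).card ≤ r then
          ∏ i, f ((Fin.cons a w : Fin (T + 1) → α) i) else 0) ≤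
        f a * (if (Finset.univ.image fun i => cls (w i)).card + 1 ≤ r then ∏ i, f (w i) else 0) +
        (∑ j, if cls a = cls (w j) then f a else 0) *
          (if (Finset.univ.image fun i => cls (w i)).card ≤ r then ∏ i, f (w i) else 0) := by
      intro w a
      have him : (Finset.univ.image fun i => cls ((Fin.cons a w : Fin (T + 1) → α) i)) =
          insert (cls a) (Finset.univ.image fun i => cls (w i)) := by
        ext c
        simp [Fin.exists_fin_succ, eq_comm]
      rw [him, Fin.prod_univ_succ]
      simp only [Fin.cons_zero, Fin.cons_succ]
      by_cases hc : cls a ∈ Finset.univ.image fun i => cls (w i)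
      · rw [Finset.insert_eq_of_mem hc]
        refine le_trans ?_ le_add_self
        split_ifs with hr
        · refine mul_le_mul_left ?_ _
          obtain ⟨j, -, hj⟩ := Finset.mem_image.1 hc
          refine le_trans ?_ (Finset.single_le_sum (fun i _ => zero_le) (Finset.mem_univ j))
          rw [if_pos hj.symm]
        · exact zero_le
      · rw [Finset.card_insert_of_notMem hc]
        refine le_trans ?_ le_self_add
        split_ifs <;> simp
    have hrec : ∀ w : Fin T → α, ∑' a, (if (Finset.univ.image fun i =>
          cls ((Fin.cons a w : Fin (T + 1) → α) i)).card ≤ r then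
          ∏ i, f ((Fin.cons a w : Fin (T + 1) → α) i) else 0) ≤
        S * (if (Finset.univ.image fun i => cls (w i)).card + 1 ≤ r then ∏ i, f (w i) else 0) +
        (T * B) * (if (Finset.univ.image fun i => cls (w i)).card ≤ r then ∏ i, f (w i) else 0) := by
      intro w
      refine (ENNReal.tsum_le_tsum (hpt w)).trans ?_
      rw [ENNReal.tsum_add, ENNReal.tsum_mul_right, ENNReal.tsum_mul_right]
      refine add_le_add (mul_le_mul_left h1 _) (mul_le_mul_left ?_ _)
      rw [Summable.tsum_finsetSum fun _ _ => ENNReal.summable]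
      refine (Finset.sum_le_sum fun j _ => h2 _).trans ?_
      simp
    refine (ENNReal.tsum_le_tsum hrec).trans ?_
    rw [ENNReal.tsum_add, ENNReal.tsum_mul_left, ENNReal.tsum_mul_left, countConst,
      Finset.prod_range_succ, ← countConst]
    have ha : S * ∑' w : Fin T → α,
        (if (Finset.univ.image fun i => cls (w i)).card + 1 ≤ r then ∏ i, f (w i) else 0) ≤
        countConst B T * S ^ r := by
      rcases r with _ | r
      · simp
      · simp only [Nat.add_le_add_iff_right]
        refine (mul_le_mul_right (ih r) _).trans (le_of_eq ?_)
        ring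
    refine (add_le_add ha (mul_le_mul_right (ih r) _)).trans (le_of_eq ?_)
    ring

open Classical in
theorem tsum_few_classes_le' {α γ ι : Type*} [Fintype ι] {f : α → ENNReal} {cls : α → γ}
    {S B : ENNReal} (hS : 1 ≤ S) (h1 : ∑' a, f a ≤ S)
    (h2 : ∀ c, ∑' a, (if cls a = c then f a else 0) ≤ B) (r : ℕ) :
    ∑' w : ι → α, (if (Finset.univ.image fun i => cls (w i)).card ≤ r then ∏ i, f (w i) else 0) ≤
      countConst B (Fintype.card ι) * S ^ r := by
  refine le_trans (le_of_eq ?_) (tsum_few_classes_le hS h1 h2 (Fintype.card ι) r)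
  set e := Fintype.equivFin ι
  rw [← (Equiv.arrowCongr e (Equiv.refl α)).tsum_eq]
  refine tsum_congr fun w => ?_
  have h3 : (Finset.univ.image fun i => cls ((Equiv.arrowCongr e (Equiv.refl α)) w i)) =
      Finset.univ.image fun i => cls (w i) := by
    ext c
    simp only [Finset.mem_image, Finset.mem_univ, true_and, Equiv.arrowCongr_apply,
      Equiv.coe_refl, Function.comp_apply, id]
    exact ⟨fun ⟨i, hi⟩ => ⟨e.symm i, hi⟩, fun ⟨i, hi⟩ => ⟨e i, by simpa using hi⟩⟩
  rw [h3]
  congr 1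
  exact (Equiv.prod_comp e.symm fun i => f (w i)).symm

theorem countConst_ne_top {B : ENNReal} (hB : B ≠ ⊤) (T : ℕ) : countConst B T ≠ ⊤ :=
  ENNReal.prod_ne_top fun i _ => by finiteness

theorem tsum_prod_pow {α : Type*} (f : α → ENNReal) (T : ℕ) :
    ∑' w : Fin T → α, ∏ i, f (w i) = (∑' a, f a) ^ T := by
  induction T with
  | zero => rw [tsum_eq_single Fin.elim0 fun w hw => absurd (Subsingleton.elim _ _) hw]; simp
  | succ T ih =>
    rw [tsum_fin_succ]
    simp only [Fin.prod_univ_succ, Fin.cons_zero, Fin.cons_succ, ENNReal.tsum_mul_right,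
      ENNReal.tsum_mul_left]
    rw [ih, pow_succ']

/-- The product is dominated by a power of its largest factor; the summand one covers the empty
product. This allows moments to be bounded when the factors are not independent. -/
theorem prod_le_one_add_sum_pow {ι : Type*} [Fintype ι] (a : ι → ENNReal) :
    ∏ i, a i ≤ 1 + ∑ i, a i ^ Fintype.card ι := by
  rcases isEmpty_or_nonempty ι with h | h
  · simp
  · obtain ⟨j, -, hj⟩ := Finset.exists_max_image Finset.univ a Finset.univ_nonempty
    refine le_trans ?_ le_add_self
    refine (Finset.prod_le_pow_card _ _ _ hj).trans ?_
    exact Finset.single_le_sum (f := fun i => a i ^ Fintype.card ι) (fun i _ => zero_le)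
      (Finset.mem_univ j)

end Polaron
end

noncomputable section
set_option linter.unusedSectionVars false
namespace Polaron

/-! ### Product states of occupation numbers -/

variable {α : Type*} {X : α → ENNReal}

/-- The weight `∏ X_q ^ ν_q` of the occupation numbers `ν`. -/
def bWeight (X : α → ENNReal) (ν : α →₀ ℕ) : ENNReal := ν.prod fun q c => X q ^ c

/-- The normalised weight of the occupation numbers `ν`. -/
def gibWeight (X : α → ENNReal) (ν : α →₀ ℕ) : ENNReal := bWeight X ν / ∑' ν', bWeight X ν'

/-- The mean of a function of a geometric random variable. -/
def modeMean (x : ENNReal) (f : ℕ → ENNReal) : ENNReal := (1 - x) * ∑' n, x ^ n * f n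

theorem bWeight_add_single (ν : α →₀ ℕ) (q : α) (n : ℕ) :
    bWeight X (ν + Finsupp.single q n) = bWeight X ν * X q ^ n := by
  classical
  unfold bWeight
  rw [Finsupp.prod_add_index' (h := fun q c => X q ^ c) (fun _ => pow_zero _)
    (fun _ _ _ => pow_add _ _ _), Finsupp.prod_single_index (h := fun q c => X q ^ c) (pow_zero _)]

theorem tsum_finsupp_split (q : α) (F : (α →₀ ℕ) → ENNReal) :
    ∑' ν, F ν = ∑' ν : {ν : α →₀ ℕ // ν q = 0}, ∑' n, F ((ν : α →₀ ℕ) + Finsupp.single q n) := by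
  classical
  have hb : Function.Bijective fun z : {ν : α →₀ ℕ // ν q = 0} × ℕ =>
      (z.1 : α →₀ ℕ) + Finsupp.single q z.2 := by
    constructor
    · rintro ⟨⟨ν, h⟩, n⟩ ⟨⟨ν', h'⟩, n'⟩ e
      simp only at e
      have e1 := DFunLike.congr_fun e q
      simp only [Finsupp.add_apply, Finsupp.single_eq_same, h, h', zero_add] at e1
      subst e1
      simp only [add_left_inj] at e
      subst e
      rfl
    · intro ν
      refine ⟨⟨⟨ν.erase q, Finsupp.erase_same⟩, ν q⟩, ?_⟩
      simp only
      rw [add_comm, Finsupp.single_add_erase]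
  rw [← ENNReal.tsum_prod, ← (Equiv.ofBijective _ hb).tsum_eq]
  rfl

theorem tsum_bWeight_mul {q : α} {h : (α →₀ ℕ) → ENNReal} (f : ℕ → ENNReal)
    (hh : ∀ ν n, h (ν + Finsupp.single q n) = h ν) :
    ∑' ν, bWeight X ν * (f (ν q) * h ν) =
      (∑' n, X q ^ n * f n) * ∑' ν : {ν : α →₀ ℕ // ν q = 0}, bWeight X ν * h ν := by
  rw [tsum_finsupp_split q, ← ENNReal.tsum_mul_left]
  refine tsum_congr fun ν => ?_
  rw [← ENNReal.tsum_mul_right]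
  refine tsum_congr fun n => ?_
  rw [bWeight_add_single, hh]
  simp only [Finsupp.add_apply, ν.2, Finsupp.single_eq_same, zero_add]
  ring

theorem tsum_bWeight_eq {q : α} {h : (α →₀ ℕ) → ENNReal}
    (hh : ∀ ν n, h (ν + Finsupp.single q n) = h ν) :
    ∑' ν, bWeight X ν * h ν =
      (1 - X q)⁻¹ * ∑' ν : {ν : α →₀ ℕ // ν q = 0}, bWeight X ν * h ν := by
  have := tsum_bWeight_mul (X := X) (fun _ => 1) hh
  simpa [ENNReal.tsum_geometric] using this

theorem one_le_tsum_bWeight : 1 ≤ ∑' ν, bWeight X ν := by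
  refine le_trans ?_ (ENNReal.le_tsum (0 : α →₀ ℕ))
  simp [bWeight]

theorem one_sub_mul_inv {x : ENNReal} (hx : x < 1) : (1 - x) * (1 - x)⁻¹ = 1 :=
  ENNReal.mul_inv_cancel (tsub_pos_of_lt hx).ne' (by finiteness)

/-- One mode is independent of the others. The sum over its occupation number factors out as a
geometric series, with `1 - X q` in place of its share of the partition function. -/
theorem tsum_gibWeight_mul {q : α} (hq : X q < 1) {h : (α →₀ ℕ) → ENNReal} (f : ℕ → ENNReal)
    (hh : ∀ ν n, h (ν + Finsupp.single q n) = h ν) :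
    ∑' ν, gibWeight X ν * (f (ν q) * h ν) = modeMean (X q) f * ∑' ν, gibWeight X ν * h ν := by
  have e : ∀ g : (α →₀ ℕ) → ENNReal, ∑' ν, gibWeight X ν * g ν =
      (∑' ν', bWeight X ν')⁻¹ * ∑' ν, bWeight X ν * g ν := by
    intro g
    rw [← ENNReal.tsum_mul_left]
    refine tsum_congr fun ν => ?_
    rw [gibWeight, div_eq_mul_inv]
    ring
  rw [e, e, tsum_bWeight_mul f hh, tsum_bWeight_eq hh, modeMean]
  calc _ = (∑' ν', bWeight X ν')⁻¹ * ((∑' n, X q ^ n * f n) *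
        ∑' ν : {ν : α →₀ ℕ // ν q = 0}, bWeight X ν * h ν) * ((1 - X q) * (1 - X q)⁻¹) := by
        rw [one_sub_mul_inv hq, mul_one]
    _ = _ := by ring

theorem tsum_gibWeight (hZ : ∑' ν, bWeight X ν ≠ ⊤) : ∑' ν, gibWeight X ν = 1 := by
  simp only [gibWeight, div_eq_mul_inv]
  rw [ENNReal.tsum_mul_right, ENNReal.mul_inv_cancel _ hZ]
  exact (one_pos.trans_le one_le_tsum_bWeight).ne'

theorem tsum_gibWeight_prod (hX : ∀ q, X q < 1) (hZ : ∑' ν, bWeight X ν ≠ ⊤) {ι : Type*}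
    [DecidableEq ι] {q : ι → α} (hq : Function.Injective q) (f : ι → ℕ → ENNReal) (s : Finset ι) :
    ∑' ν, gibWeight X ν * ∏ i ∈ s, f i (ν (q i)) = ∏ i ∈ s, modeMean (X (q i)) (f i) := by
  induction s using Finset.induction_on with
  | empty => simpa using tsum_gibWeight hZ
  | insert i s hi ih =>
    rw [Finset.prod_insert hi, ← ih, ← tsum_gibWeight_mul (hX _)]
    · simp only [Finset.prod_insert hi]
    · intro ν n
      refine Finset.prod_congr rfl fun j hj => ?_
      have : q i ≠ q j := fun h => hi (hq h ▸ hj)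
      simp [this]

theorem tsum_gibWeight_single (hX : ∀ q, X q < 1) (hZ : ∑' ν, bWeight X ν ≠ ⊤) (q : α)
    (f : ℕ → ENNReal) : ∑' ν, gibWeight X ν * f (ν q) = modeMean (X q) f := by
  have := tsum_gibWeight_prod hX hZ (q := fun _ : Unit => q)
    (fun _ _ _ => rfl) (fun _ => f) Finset.univ
  simpa using this

/-- Each active mode multiplies the partition function by a finite geometric series, so modes are
switched off one after the other by setting their weight to zero. -/
theorem tsum_bWeight_ne_top_of_finset (hX : ∀ q, X q < 1) (A : Finset α)
    (hA : ∀ q, q ∉ A → X q = 0) : ∑' ν, bWeight X ν ≠ ⊤ := by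
  classical
  induction A using Finset.induction_on generalizing X with
  | empty =>
    rw [tsum_eq_single (0 : α →₀ ℕ)]
    · simp [bWeight]
    · intro ν hν
      obtain ⟨q, hq⟩ := Finsupp.ne_iff.1 hν
      refine Finset.prod_eq_zero (i := q) (Finsupp.mem_support_iff.2 hq) ?_
      simp only [hA q (Finset.notMem_empty q), zero_pow (show ν q ≠ 0 from hq)]
  | insert q A hq ih =>
    have h1 := tsum_bWeight_eq (X := X) (q := q) (h := fun _ => 1) fun _ _ => rfl
    simp only [mul_one] at h1
    rw [h1]
    have h2 := ih (X := Function.update X q 0)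
      (fun q' => by
        by_cases h : q' = q
        · subst h; simp
        · rw [Function.update_of_ne h]; exact hX q')
      (fun q' hq' => by
        by_cases h : q' = q
        · subst h; simp
        · rw [Function.update_of_ne h]; exact hA q' (by simp [h, hq']))
    refine ENNReal.mul_ne_top (ENNReal.inv_ne_top.2 (tsub_pos_of_lt (hX q)).ne') ?_
    refine ne_top_of_le_ne_top h2 ?_
    refine le_trans (le_of_eq (tsum_congr fun ν => ?_))
      (ENNReal.tsum_comp_le_tsum_of_injective
        (f := fun ν : {ν : α →₀ ℕ // ν q = 0} => (ν : α →₀ ℕ)) Subtype.val_injective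
        (bWeight (Function.update X q 0)))
    refine Finset.prod_congr rfl fun q' hq' => ?_
    have : q' ≠ q := fun h => by
      subst h
      exact Finsupp.mem_support_iff.1 hq' ν.2
    simp only [Function.update_of_ne this]

/-! ### Means of a geometric random variable -/

theorem modeMean_mono {x : ENNReal} {f g : ℕ → ENNReal} (h : ∀ n, f n ≤ g n) :
    modeMean x f ≤ modeMean x g :=
  mul_le_mul_right (ENNReal.tsum_le_tsum fun n => mul_le_mul_right (h n) _) _

/-- A bound on the moments of geometric random variables. -/
def momentConst (x : ENNReal) (N : ℕ) : ENNReal := ∑' n : ℕ, x ^ n * ((n : ENNReal) + N + 1) ^ N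

theorem modeMean_pow_le {x y : ENNReal} (hxy : x ≤ y) (N : ℕ) :
    modeMean x (fun n => ((n : ENNReal) + N + 1) ^ N) ≤ momentConst y N := by
  unfold modeMean momentConst
  refine (mul_le_of_le_one_left zero_le tsub_le_self).trans ?_
  exact ENNReal.tsum_le_tsum fun n => mul_le_mul_left (pow_le_pow_left' hxy n) _

theorem summable_pow_mul_geometric {r : ℝ} (h0 : 0 ≤ r) (h1 : r < 1) (c : ℝ) (hc : 0 ≤ c) (N : ℕ) :
    Summable fun n : ℕ => r ^ n * ((n : ℝ) + c) ^ N := by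
  have h2 := summable_pow_mul_geometric_of_norm_lt_one (R := ℝ) N
    (r := r) (by rwa [Real.norm_of_nonneg h0])
  have h3 := (summable_geometric_of_lt_one h0 h1).mul_left (c ^ N)
  refine Summable.of_nonneg_of_le (fun n => by positivity) (fun n => ?_)
    ((h2.add h3).mul_left (2 ^ (N - 1)))
  calc r ^ n * ((n : ℝ) + c) ^ N ≤ r ^ n * (2 ^ (N - 1) * ((n : ℝ) ^ N + c ^ N)) := by
        gcongr
        exact add_pow_le (by positivity) hc N
    _ = _ := by ring

theorem momentConst_ne_top {x : ENNReal} (hx : x < 1) (N : ℕ) : momentConst x N ≠ ⊤ := by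
  have hx' : x ≠ ⊤ := (hx.trans ENNReal.one_lt_top).ne
  lift x to NNReal using hx'
  have hx1 : (x : ℝ) < 1 := by exact_mod_cast hx
  have h := summable_pow_mul_geometric x.2 hx1 (N + 1) (by positivity) N
  have h' : Summable fun n : ℕ => x ^ n * ((n : NNReal) + N + 1) ^ N := by
    rw [← NNReal.summable_coe]
    refine h.congr fun n => ?_
    push_cast [add_assoc]
    rfl
  unfold momentConst
  have := ENNReal.tsum_coe_ne_top_iff_summable.2 h'
  simpa using this

/-- The mean of the geometric law is `r / (1 - r)`. For `r = exp(-βω + μ)` this is the Bose-Einstein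
occupation number, which is how the weight `M` arises from the Gibbs state. -/
theorem modeMean_occ {r : ℝ} (h0 : 0 ≤ r) (h1 : r < 1) {s : ℝ} (hs : 0 ≤ s) :
    modeMean (ENNReal.ofReal r) (fun n => ENNReal.ofReal (n + s)) =
      ENNReal.ofReal (r / (1 - r) + s) := by
  have hr : (0 : ℝ) < 1 - r := by linarith
  have h2 : HasSum (fun n : ℕ => r ^ n * ((n : ℝ) + s)) (r / (1 - r) ^ 2 + (1 - r)⁻¹ * s) := by
    have e1 := hasSum_coe_mul_geometric_of_norm_lt_one (𝕜 := ℝ) (r := r)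
      (by rwa [Real.norm_of_nonneg h0])
    have e2 := (hasSum_geometric_of_lt_one h0 h1).mul_right s
    refine (e1.add e2).congr_fun fun n => ?_
    ring
  unfold modeMean
  have e : ∀ n : ℕ, ENNReal.ofReal r ^ n * ENNReal.ofReal (n + s) =
      ENNReal.ofReal (r ^ n * ((n : ℝ) + s)) := by
    intro n
    rw [ENNReal.ofReal_mul (by positivity), ENNReal.ofReal_pow h0]
  simp only [e]
  rw [← ENNReal.ofReal_tsum_of_nonneg (fun n => by positivity) h2.summable, h2.tsum_eq,
    ← ENNReal.ofReal_one, ← ENNReal.ofReal_sub _ h0, ← ENNReal.ofReal_mul hr.le]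
  congr 1
  field_simp

end Polaron
end

noncomputable section
set_option linter.unusedSectionVars false
namespace Polaron
variable {d : ℕ}

/-! ### The Gibbs states -/

variable {S : Model d} {C₁ C₂ C₃ C₄ C₆ C₇ : ℝ}

open Classical in
/-- The Boltzmann factor of one phonon in the mode `q`. -/
def Model.bose (S : Model d) (L : ℝ) (A : Set (Mode d)) (q : Mode d) : ℝ :=
  if q ∈ A then Real.exp (-S.β * S.ω (mom L q) + S.chem) else 0

theorem Model.bose_nonneg (S : Model d) (L : ℝ) (A : Set (Mode d)) (q : Mode d) :
    0 ≤ S.bose L A q := by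
  unfold Model.bose
  split_ifs <;> positivity

theorem Model.Admissible.bose_le (hS : S.Admissible C₁ C₂ C₃ C₄ C₆ C₇) (L : ℝ) (A : Set (Mode d))
    (q : Mode d) : S.bose L A q ≤ Real.exp (-(S.β * C₆)) := by
  unfold Model.bose
  split_ifs
  · exact hS.exp_le _
  · positivity

/-- The Boltzmann factors as extended nonnegative numbers. -/
def Model.eBose (S : Model d) (L : ℝ) (A : Set (Mode d)) (q : Mode d) : ENNReal :=
  ENNReal.ofReal (S.bose L A q)

theorem Model.Admissible.eBose_le (hS : S.Admissible C₁ C₂ C₃ C₄ C₆ C₇) (L : ℝ)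
    (A : Set (Mode d)) (q : Mode d) :
    S.eBose L A q ≤ ENNReal.ofReal (Real.exp (-(S.β * C₆))) :=
  ENNReal.ofReal_le_ofReal (hS.bose_le L A q)

theorem Model.Admissible.ofReal_exp_gap_lt_one (hS : S.Admissible C₁ C₂ C₃ C₄ C₆ C₇) :
    ENNReal.ofReal (Real.exp (-(S.β * C₆))) < 1 := by
  rw [← ENNReal.ofReal_one]
  exact (ENNReal.ofReal_lt_ofReal_iff one_pos).2 hS.exp_gap_lt_one

theorem Model.Admissible.eBose_lt_one (hS : S.Admissible C₁ C₂ C₃ C₄ C₆ C₇) (L : ℝ)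
    (A : Set (Mode d)) (q : Mode d) : S.eBose L A q < 1 :=
  (hS.eBose_le L A q).trans_lt hS.ofReal_exp_gap_lt_one

theorem Model.boltz_nonneg (S : Model d) (L : ℝ) (A : Set (Mode d)) (ν : Config d) :
    0 ≤ S.boltz L A ν := by
  unfold Model.boltz
  split_ifs <;> positivity

theorem Model.ofReal_boltz (S : Model d) (L : ℝ) (A : Set (Mode d)) (ν : Config d) :
    ENNReal.ofReal (S.boltz L A ν) = bWeight (S.eBose L A) ν := by
  have e : S.boltz L A ν = ∏ q ∈ ν.support, S.bose L A q ^ ν q := by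
    unfold Model.boltz
    split_ifs with h
    · rw [Finsupp.sum, Real.exp_sum]
      refine Finset.prod_congr rfl fun q hq => ?_
      rw [Model.bose, if_pos (h hq), ← Real.exp_nat_mul, mul_comm]
    · obtain ⟨q, hq, hA⟩ := Set.not_subset.1 h
      rw [eq_comm]
      refine Finset.prod_eq_zero (i := q) hq ?_
      rw [Model.bose, if_neg hA, zero_pow (Finsupp.mem_support_iff.1 hq)]
  rw [e, ENNReal.ofReal_prod_of_nonneg fun q _ => pow_nonneg (S.bose_nonneg L A q) _]
  unfold bWeight Finsupp.prod
  exact Finset.prod_congr rfl fun q _ => ENNReal.ofReal_pow (S.bose_nonneg L A q) _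

theorem Model.tsum_bWeight_eq_ofReal {L : ℝ} {A : Set (Mode d)} (h : Summable (S.boltz L A)) :
    ∑' ν, bWeight (S.eBose L A) ν = ENNReal.ofReal (∑' ν, S.boltz L A ν) := by
  rw [ENNReal.ofReal_tsum_of_nonneg (S.boltz_nonneg L A) h]
  exact tsum_congr fun ν => (S.ofReal_boltz L A ν).symm

theorem Model.tsum_bWeight_ne_top {L : ℝ} {A : Set (Mode d)} (h : Summable (S.boltz L A)) :
    ∑' ν, bWeight (S.eBose L A) ν ≠ ⊤ := by
  rw [Model.tsum_bWeight_eq_ofReal h]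
  exact ENNReal.ofReal_ne_top

theorem Model.Admissible.summable_boltz (hS : S.Admissible C₁ C₂ C₃ C₄ C₆ C₇) (L : ℝ)
    (A : Finset (Mode d)) : Summable (S.boltz L (A : Set (Mode d))) := by
  have h := tsum_bWeight_ne_top_of_finset (hS.eBose_lt_one L (A : Set (Mode d))) A fun q hq => by
    simp [Model.eBose, Model.bose, hq]
  have h2 : ∀ ν, bWeight (S.eBose L (A : Set (Mode d))) ν =
      ENNReal.ofReal (S.boltz L (A : Set (Mode d)) ν) := fun ν => (S.ofReal_boltz L _ ν).symm
  simp only [h2] at h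
  have h3 := ENNReal.summable_toReal h
  refine h3.congr fun ν => ?_
  rw [ENNReal.toReal_ofReal (S.boltz_nonneg _ _ _)]

theorem Model.gibbs_nonneg (S : Model d) (L : ℝ) (A : Set (Mode d)) (ν : Config d) :
    0 ≤ S.gibbs L A ν :=
  div_nonneg (S.boltz_nonneg L A ν) (tsum_nonneg (S.boltz_nonneg L A))

theorem Model.ofReal_gibbs {L : ℝ} {A : Set (Mode d)} (h : Summable (S.boltz L A)) (ν : Config d) :
    ENNReal.ofReal (S.gibbs L A ν) = gibWeight (S.eBose L A) ν := by
  have h1 := Model.tsum_bWeight_eq_ofReal h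
  have h2 := one_le_tsum_bWeight (X := S.eBose L A)
  rw [h1] at h2
  have h3 : 0 < ∑' ν, S.boltz L A ν := by
    by_contra hc
    rw [ENNReal.ofReal_of_nonpos (not_lt.1 hc)] at h2
    simp at h2
  rw [Model.gibbs, ENNReal.ofReal_div_of_pos h3, S.ofReal_boltz, gibWeight, h1]

open Classical in
/-- The occupation number of a mode in the Gibbs state of the phonons in `A`. -/
def Model.occIn (S : Model d) (L : ℝ) (A : Set (Mode d)) (q : Mode d) : ℝ :=
  if q ∈ A then S.occ (mom L q) else 0

theorem sign_half_nonneg (σ : ℤˣ) : (0 : ℝ) ≤ (((σ : ℤ) : ℝ) + 1) / 2 := by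
  rcases Int.units_eq_one_or σ with h | h <;> (simp only [h]; norm_num)

theorem Model.Admissible.modeMean_eq (hS : S.Admissible C₁ C₂ C₃ C₄ C₆ C₇) (L : ℝ)
    (A : Set (Mode d)) (q : Mode d) (σ : ℤˣ) :
    modeMean (S.eBose L A q) (fun n => ENNReal.ofReal (n + (((σ : ℤ) : ℝ) + 1) / 2)) =
      ENNReal.ofReal (S.occIn L A q + (((σ : ℤ) : ℝ) + 1) / 2) := by
  rw [Model.eBose, modeMean_occ (S.bose_nonneg L A q)
    ((hS.bose_le L A q).trans_lt hS.exp_gap_lt_one) (sign_half_nonneg σ)]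
  congr 2
  unfold Model.bose Model.occIn Model.occ
  split_ifs <;> simp

/-! ### Matrix elements as sums over words -/

/-- The word `w` leads from the basis state `y` to the basis state `x`. -/
def Leads (y x : Label d) {N : ℕ} (w : Fin N → Letter d) : Prop :=
  x.1 = y.1 + wordMom w ∧ ∀ q, (x.2 q : ℤ) = y.2 q + net w q

theorem Leads.unique {y x x' : Label d} {N : ℕ} {w : Fin N → Letter d} (h : Leads y x w)
    (h' : Leads y x' w) : x = x' := by
  refine Prod.ext (h.1.trans h'.1.symm) (Finsupp.ext fun q => ?_)
  have h1 := h.2 q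
  have h2 := h'.2 q
  omega

theorem Leads.net_eq {y x : Label d} {N N' : ℕ} {w : Fin N → Letter d} {w' : Fin N' → Letter d}
    (h : Leads y x w) (h' : Leads y x w') : net w = net w' := by
  funext q
  have h1 := h.2 q
  have h2 := h'.2 q
  omega

/-- The amplitude of a word acting on a basis state. -/
def Model.wordCoef (S : Model d) (L lam t : ℝ) (y : Label d) {N : ℕ} (w : Fin N → Letter d) : ℂ :=
  (((lam * ((L ^ d)⁻¹ * L ^ ((d : ℝ) / 2))) ^ N * S.wordQ L w * pathWeight w y.2 : ℝ) : ℂ) *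
    (Complex.exp (-Complex.I * ((t * S.phEnergy L y.2 : ℝ) : ℂ)) * S.wordAmp L t y.1 w)

open Classical in
theorem Model.wordTerm_eq (S : Model d) (L lam t : ℝ) (x y : Label d) {N : ℕ}
    (w : Fin N → Letter d) :
    (((L ^ d)⁻¹ ^ N : ℝ) : ℂ) * S.wordTerm L lam t x y w =
      if Leads y x w then S.wordCoef L lam t y w else 0 := by
  unfold Model.wordTerm Model.wordCoef
  -- For words of zero weight the truncated path and the integer-valued condition `Leads` may
  -- disagree, but then both sides vanish.
  by_cases hp : pathWeight w y.2 = 0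
  · simp [hp]
  have e : x = (y.1 + wordMom w, path w y.2) ↔ Leads y x w := by
    have h2 : Leads y (y.1 + wordMom w, path w y.2) w := ⟨rfl, fun q => path_apply hp q⟩
    exact ⟨fun h => h ▸ h2, fun h => h.unique h2⟩
  rw [if_congr e rfl rfl]
  split_ifs
  · push_cast
    ring
  · rw [mul_zero]

theorem path_le {N : ℕ} (w : Fin N → Letter d) (ν : Config d) (q : Mode d) :
    path w ν q ≤ ν q + N := by
  classical
  induction N with
  | zero => simp [path]
  | succ N ih =>
    have h := ih (Fin.tail w)
    simp only [path, step]
    have hs : (Finsupp.single (w 0).mode 1 : Config d) q ≤ 1 := by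
      rw [Finsupp.single_apply]
      split_ifs <;> simp
    split_ifs
    · simp only [Finsupp.add_apply]
      omega
    · simp only [Finsupp.tsub_apply]
      omega

theorem pathWeight_sq_le {N : ℕ} (w : Fin N → Letter d) (ν : Config d) {K : ℕ} (hK : N ≤ K) :
    pathWeight w ν ^ 2 ≤ ∏ i, ((ν (w i).mode : ℝ) + K) := by
  induction N with
  | zero => simp [pathWeight]
  | succ N ih =>
    rw [pathWeight, mul_pow, stepWeight_sq, Fin.prod_univ_succ]
    refine mul_le_mul ?_ (ih (Fin.tail w) (by omega)) (sq_nonneg _) (by positivity)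
    have h1 := path_le (Fin.tail w) ν (w 0).mode
    have h2 : (path (Fin.tail w) ν (w 0).mode : ℝ) ≤ ν (w 0).mode + N := by exact_mod_cast h1
    have h3 : (((((w 0).2 : ℤˣ) : ℤ) : ℝ) + 1) / 2 ≤ 1 := by
      rcases Int.units_eq_one_or (w 0).2 with h | h <;> (simp only [h]; norm_num)
    have h4 : (N : ℝ) + 1 ≤ K := by exact_mod_cast hK
    unfold occFactor
    linarith

theorem enorm_pathWeight_sq_le {N : ℕ} (w : Fin N → Letter d) (ν : Config d) :
    ‖pathWeight w ν‖ₑ ^ 2 ≤ ∏ i, ((ν (w i).mode : ENNReal) + N + 1) := by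
  have h := pathWeight_sq_le w ν le_rfl
  rw [Real.enorm_eq_ofReal_abs, ← ENNReal.ofReal_pow (abs_nonneg _), sq_abs]
  refine (ENNReal.ofReal_le_ofReal h).trans ?_
  rw [ENNReal.ofReal_prod_of_nonneg fun i _ => by positivity]
  refine Finset.prod_le_prod' fun i _ => ?_
  rw [show ((ν (w i).mode : ℝ) + N) = ((ν (w i).mode + N : ℕ) : ℝ) by push_cast; rfl,
    ENNReal.ofReal_natCast]
  push_cast
  exact le_self_add

/-- The sum of the form factors over the letters of a word, in absolute value. -/
def Model.eQ (S : Model d) (L : ℝ) (a : Letter d) : ENNReal := ‖S.Q (mom L a.1)‖ₑ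

theorem Model.enorm_wordQ (S : Model d) (L : ℝ) {N : ℕ} (w : Fin N → Letter d) :
    ‖S.wordQ L w‖ₑ = ∏ i, S.eQ L (w i) := by
  unfold Model.wordQ Model.eQ
  induction N with
  | zero => simp
  | succ N ih => rw [Fin.prod_univ_succ, Fin.prod_univ_succ, enorm_mul, ih fun i => w i.succ]

/-- The prefactor `λ² t² L⁻ᵈ` of a vertex pair. -/
def vertexConst (d : ℕ) (L lam t : ℝ) : ℝ := lam ^ 2 * (L ^ d)⁻¹ * t ^ 2

theorem sq_scale {L : ℝ} (hL : 0 < L) : ((L ^ d)⁻¹ * L ^ ((d : ℝ) / 2)) ^ 2 = (L ^ d)⁻¹ := by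
  have h1 : (L ^ ((d : ℝ) / 2)) ^ 2 = L ^ d := by
    rw [← Real.rpow_natCast (L ^ ((d : ℝ) / 2)), ← Real.rpow_mul hL.le]
    push_cast
    rw [div_mul_cancel₀ _ two_ne_zero, Real.rpow_natCast]
  have h2 := (pow_pos hL d).ne'
  rw [mul_pow, h1]
  field_simp

theorem Model.enorm_wordCoef_sq (S : Model d) {L lam t : ℝ} (hL : 0 < L) (ht : 0 ≤ t)
    (y : Label d) {N : ℕ} (w : Fin N → Letter d) :
    ‖S.wordCoef L lam t y w‖ₑ ^ 2 ≤ ENNReal.ofReal (vertexConst d L lam t) ^ N *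
      ((∏ i, S.eQ L (w i)) ^ 2 * ‖pathWeight w y.2‖ₑ ^ 2) := by
  unfold Model.wordCoef
  have h1 : ‖Complex.exp (-Complex.I * ((t * S.phEnergy L y.2 : ℝ) : ℂ)) *
      S.wordAmp L t y.1 w‖ₑ ≤ ENNReal.ofReal (t ^ N) := by
    rw [← ofReal_norm, norm_mul, norm_cexp_I, one_mul]
    exact ENNReal.ofReal_le_ofReal (S.norm_wordAmp_le L ht _ _)
  have h2 : ‖(lam * ((L ^ d)⁻¹ * L ^ ((d : ℝ) / 2))) ^ N‖ₑ ^ 2 *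
      ENNReal.ofReal (t ^ N) ^ 2 = ENNReal.ofReal (vertexConst d L lam t) ^ N := by
    rw [← ofReal_norm, ← ENNReal.ofReal_pow (norm_nonneg _), ← ENNReal.ofReal_pow (by positivity),
      ← ENNReal.ofReal_mul (by positivity), ← ENNReal.ofReal_pow (by unfold vertexConst; positivity)]
    congr 1
    have h3 := sq_scale (d := d) hL
    obtain ⟨c, hc⟩ : ∃ c, c = (L ^ d)⁻¹ * L ^ ((d : ℝ) / 2) := ⟨_, rfl⟩
    rw [← hc] at h3 ⊢
    rw [Real.norm_eq_abs, sq_abs, vertexConst, ← h3]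
    ring
  have h4 : ∀ a : ℝ, ‖(a : ℂ)‖ₑ = ‖a‖ₑ := fun a => by
    rw [← ofReal_norm, Complex.norm_real, ofReal_norm]
  rw [enorm_mul, ← S.enorm_wordQ, h4, enorm_mul, enorm_mul, mul_pow, mul_pow, mul_pow]
  calc _ ≤ ‖(lam * ((L ^ d)⁻¹ * L ^ ((d : ℝ) / 2))) ^ N‖ₑ ^ 2 *
        ‖S.wordQ L w‖ₑ ^ 2 * ‖pathWeight w y.2‖ₑ ^ 2 * ENNReal.ofReal (t ^ N) ^ 2 := by gcongr
    _ = _ := by rw [← h2]; ring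

theorem summable_of_tsum_enorm {ι : Type*} {f : ι → ℂ} (h : ∑' i, ‖f i‖ₑ ≠ ⊤) : Summable f := by
  refine Summable.of_norm ?_
  refine (ENNReal.summable_toReal h).congr fun i => ?_
  simp

theorem enorm_tsum_le {ι : Type*} (f : ι → ℂ) : ‖∑' i, f i‖ₑ ≤ ∑' i, ‖f i‖ₑ := by
  by_cases h : ∑' i, ‖f i‖ₑ = ⊤
  · rw [h]; exact le_top
  · have h1 := (ENNReal.summable_toReal h)
    have h2 : Summable fun i => ‖f i‖ := h1.congr fun i => by simp
    rw [← ofReal_norm]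
    refine (ENNReal.ofReal_le_ofReal (norm_tsum_le_tsum_norm h2)).trans (le_of_eq ?_)
    rw [ENNReal.ofReal_tsum_of_nonneg (fun i => norm_nonneg _) h2]
    exact tsum_congr fun i => ofReal_norm _

theorem le_mul_of_sq_le {a b c : ENNReal} (h : a ^ 2 ≤ b * c ^ 2) : a ≤ (1 + b) * c := by
  rw [← ENNReal.pow_le_pow_left_iff two_ne_zero, mul_pow]
  refine h.trans (mul_le_mul_left ?_ _)
  rw [sq]
  exact (le_add_self).trans (le_mul_of_one_le_left zero_le le_self_add)

/-- For a fixed initial state all occupation numbers lie below its total phonon number, so the path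
weights are bounded uniformly in the word and the sum is controlled by the summability of `Q`. -/
theorem Model.tsum_enorm_wordCoef_ne_top {L lam t : ℝ} (hL : 0 < L)
    (ht : 0 ≤ t) (hQ : ∑' a : Letter d, S.eQ L a ≠ ⊤) (y : Label d) (N : ℕ) :
    ∑' w : Fin N → Letter d, ‖S.wordCoef L lam t y w‖ₑ ≠ ⊤ := by
  set b : ℕ := y.2.sum fun _ c => c
  have hb : ∀ q, y.2 q ≤ b := by
    intro q
    by_cases hq : q ∈ y.2.support
    · exact Finset.single_le_sum (f := fun q => y.2 q) (fun _ _ => Nat.zero_le _) hq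
    · rw [Finsupp.notMem_support_iff.1 hq]; exact Nat.zero_le _
  set D : ENNReal := ENNReal.ofReal (vertexConst d L lam t) ^ N * ((b : ENNReal) + N + 1) ^ N
  have h : ∀ w : Fin N → Letter d, ‖S.wordCoef L lam t y w‖ₑ ≤ (1 + D) * ∏ i, S.eQ L (w i) := by
    intro w
    refine le_mul_of_sq_le ((S.enorm_wordCoef_sq hL ht y w).trans ?_)
    have h1 : ‖pathWeight w y.2‖ₑ ^ 2 ≤ ((b : ENNReal) + N + 1) ^ N := by
      refine (enorm_pathWeight_sq_le w y.2).trans ?_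
      refine (Finset.prod_le_pow_card _ _ ((b : ENNReal) + N + 1) fun i _ => ?_).trans (by simp)
      gcongr
      exact_mod_cast hb _
    calc _ ≤ ENNReal.ofReal (vertexConst d L lam t) ^ N *
          ((∏ i, S.eQ L (w i)) ^ 2 * ((b : ENNReal) + N + 1) ^ N) := by gcongr
      _ = _ := by ring
  refine ne_top_of_le_ne_top ?_ (ENNReal.tsum_le_tsum h)
  rw [ENNReal.tsum_mul_left, tsum_prod_pow]
  have : D ≠ ⊤ := by finiteness
  finiteness

open Classical in
/-- The contribution of the words with a given property to the matrix elements. -/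
def Model.wordSum (S : Model d) (L lam t : ℝ) {N : ℕ} (R : (Fin N → Letter d) → Prop)
    (x y : Label d) : ℂ :=
  ∑' w : Fin N → Letter d, if R w ∧ Leads y x w then S.wordCoef L lam t y w else 0

open Classical in
theorem Model.summable_wordSum {L lam t : ℝ} (hL : 0 < L)
    (ht : 0 ≤ t) (hQ : ∑' a : Letter d, S.eQ L a ≠ ⊤) {N : ℕ} (R : (Fin N → Letter d) → Prop)
    (x y : Label d) :
    Summable fun w : Fin N → Letter d =>
      if R w ∧ Leads y x w then S.wordCoef L lam t y w else 0 := by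
  refine summable_of_tsum_enorm (ne_top_of_le_ne_top
    (Model.tsum_enorm_wordCoef_ne_top (lam := lam) hL ht hQ y N) (ENNReal.tsum_le_tsum fun w => ?_))
  split_ifs <;> simp

theorem Model.E0Mat_eq {L lam t : ℝ} (hL : 0 < L) (ht : 0 ≤ t)
    (hω : ∀ k, S.ω (-k) = S.ω k) (hQ : ∑' a : Letter d, S.eQ L a ≠ ⊤) (n N : ℕ) (x y : Label d) :
    S.E0Mat L lam t n N x y = ∑ m ∈ patterns n N,
      S.wordSum L lam t (fun w : Fin N → Letter d => Allowed m fun b => (w b).1) x y := by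
  classical
  unfold Model.E0Mat Model.E0
  refine Finset.sum_congr rfl fun m _ => ?_
  have hs := Model.summable_wordSum (lam := lam) hL ht hQ
    (fun w : Fin N → Letter d => Allowed m fun b => (w b).1) x y
  unfold Model.wordSum
  set e := Equiv.arrowProdEquivProdArrow (Fin N) (fun _ => Mode d) (fun _ => ℤˣ)
  rw [← e.symm.tsum_eq, ← tsum_mul_left]
  rw [← e.symm.summable_iff] at hs
  refine Eq.trans (tsum_congr fun k => ?_) hs.tsum_prod.symm
  rw [tsum_fintype]
  simp only [Function.comp_apply]
  have hw : ∀ σ, e.symm (k, σ) = word k σ := fun σ => rfl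
  simp only [hw]
  by_cases hk : Allowed m k
  · have hk' : ∀ σ : Fin N → ℤˣ, Allowed m fun b => (word k σ b).1 := fun σ => hk
    simp only [hk, if_true, hk', true_and]
    rw [Model.B_single hω, Finset.mul_sum]
    exact Finset.sum_congr rfl fun σ _ => S.wordTerm_eq L lam t x y _
  · have hk' : ∀ σ : Fin N → ℤˣ, ¬Allowed m fun b => (word k σ b).1 := fun σ => hk
    simp [hk, hk']

end Polaron
end

noncomputable section
set_option linter.unusedSectionVars false
namespace Polaron
variable {d : ℕ}

/-! ### Mean squares of sums over pairs of words -/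

variable {S : Model d} {C₁ C₂ C₃ C₄ C₆ C₇ : ℝ}

/-- Stars and bars give the binomial coefficient of `n + r` over `r`, which is at most `2 ^ (n +
r)`. -/
theorem card_patterns_le {n r N : ℕ} (hN : N = n + 2 * r) : (patterns n N).card ≤ 2 ^ N := by
  let _ : Fintype {m : Fin (n + 1) → ℕ // ∑ i, m i = r} :=
    Fintype.ofEquiv _ (Sym.equivNatSumOfFintype (Fin (n + 1)) r)
  have h1 : Fintype.card {m : Fin (n + 1) → ℕ // ∑ i, m i = r} = (n + r).choose r := by
    rw [← Fintype.card_congr (Sym.equivNatSumOfFintype (Fin (n + 1)) r), Sym.card_sym_eq_choose,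
      Fintype.card_fin]
    congr 1
    omega
  have h2 : (patterns n N).card ≤ Fintype.card {m : Fin (n + 1) → ℕ // ∑ i, m i = r} := by
    rw [← Fintype.card_coe]
    refine Fintype.card_le_of_injective (fun m => ⟨m.1, ?_⟩) fun m m' h => ?_
    · have := (Finset.mem_filter.1 m.2).2
      omega
    · have h' := congrArg Subtype.val h
      exact Subtype.ext h'
  rw [h1] at h2
  refine h2.trans ((Nat.choose_le_two_pow (n + r) r).trans ?_)
  exact Nat.pow_le_pow_right (by norm_num) (by omega)

theorem tsum_if_leads_le (y : Label d) {N : ℕ} (w : Fin N → Letter d) (c : ENNReal)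
    [∀ x, Decidable (Leads y x w)] : ∑' x, (if Leads y x w then c else 0) ≤ c := by
  by_cases h : ∃ x, Leads y x w
  · obtain ⟨x, hx⟩ := h
    rw [tsum_eq_single x fun x' hx' => if_neg fun h => hx' (h.unique hx), if_pos hx]
  · have : ∀ x, ¬Leads y x w := fun x hx => h ⟨x, hx⟩
    simp [this]

open Classical in
-- Two words leading from `y` to the same `x` have the same net change, and each word leads to at
-- most one `x`. The sum over final states therefore reduces the double sum to pairs of words with
-- equal net change.
theorem Model.tsum_wordSum_sq_le (S : Model d) (L lam t : ℝ) {N : ℕ}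
    (R : (Fin N → Letter d) → Prop) (y : Label d) :
    ∑' x, ‖S.wordSum L lam t R x y‖ₑ ^ 2 ≤ ∑' (w : Fin N → Letter d) (w' : Fin N → Letter d),
      if R w ∧ net w = net w' then ‖S.wordCoef L lam t y w‖ₑ * ‖S.wordCoef L lam t y w'‖ₑ
      else 0 := by
  have h : ∀ x, ‖S.wordSum L lam t R x y‖ₑ ^ 2 ≤ ∑' (w : Fin N → Letter d)
      (w' : Fin N → Letter d), if Leads y x w then (if R w ∧ net w = net w' then
        ‖S.wordCoef L lam t y w‖ₑ * ‖S.wordCoef L lam t y w'‖ₑ else 0) else 0 := by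
    intro x
    have h1 := enorm_tsum_le fun w : Fin N → Letter d =>
      if R w ∧ Leads y x w then S.wordCoef L lam t y w else 0
    refine (pow_le_pow_left' h1 2).trans ?_
    rw [sq, ← ENNReal.tsum_mul_right]
    refine ENNReal.tsum_le_tsum fun w => ?_
    rw [← ENNReal.tsum_mul_left]
    refine ENNReal.tsum_le_tsum fun w' => ?_
    by_cases h1 : R w ∧ Leads y x w
    · by_cases h2 : R w' ∧ Leads y x w'
      · rw [if_pos h1, if_pos h2, if_pos h1.2, if_pos ⟨h1.1, h1.2.net_eq h2.2⟩]
      · rw [if_neg h2]; simp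
    · rw [if_neg h1]; simp
  refine (ENNReal.tsum_le_tsum h).trans ?_
  rw [ENNReal.tsum_comm]
  refine ENNReal.tsum_le_tsum fun w => ?_
  rw [ENNReal.tsum_comm]
  refine ENNReal.tsum_le_tsum fun w' => tsum_if_leads_le y w _

/-- A bound on the means of products of occupation numbers. -/
def meanConst (x : ENNReal) (N : ℕ) : ENNReal := 1 + N * momentConst x N

theorem meanConst_ne_top {x : ENNReal} (hx : x < 1) (N : ℕ) : meanConst x N ≠ ⊤ := by
  have := momentConst_ne_top hx N
  unfold meanConst
  finiteness

/-- The modes may coincide, so independence is not available. The product is replaced by a sum of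
high powers of single occupation numbers, whose moments are uniformly bounded. -/
theorem tsum_gibWeight_prod_le {α : Type*} {X : α → ENNReal} {x : ENNReal} (hX : ∀ q, X q < 1)
    (hx : ∀ q, X q ≤ x) (hZ : ∑' ν, bWeight X ν ≠ ⊤) {ι : Type*} [Fintype ι] (q : ι → α) :
    ∑' ν, gibWeight X ν * ∏ i, ((ν (q i) : ENNReal) + Fintype.card ι + 1) ≤
      meanConst x (Fintype.card ι) := by
  refine (ENNReal.tsum_le_tsum fun ν => mul_le_mul_right (prod_le_one_add_sum_pow _) _).trans ?_
  simp only [mul_add, mul_one, ENNReal.tsum_add, Finset.mul_sum]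
  rw [tsum_gibWeight hZ, Summable.tsum_finsetSum fun _ _ => ENNReal.summable]
  refine add_le_add le_rfl ?_
  have : ∀ i, ∑' ν, gibWeight X ν * ((ν (q i) : ENNReal) + Fintype.card ι + 1) ^ Fintype.card ι ≤
      momentConst x (Fintype.card ι) := by
    intro i
    rw [tsum_gibWeight_single hX hZ (q i)
      fun n => ((n : ENNReal) + Fintype.card ι + 1) ^ Fintype.card ι]
    exact modeMean_pow_le (hx _) _
  refine (Finset.sum_le_sum fun i _ => this i).trans ?_
  simp

theorem tsum_gibWeight_pathWeight_le {X : Mode d → ENNReal} {x : ENNReal} (hX : ∀ q, X q < 1)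
    (hx : ∀ q, X q ≤ x) (hZ : ∑' ν, bWeight X ν ≠ ⊤) {N : ℕ} (w w' : Fin N → Letter d) :
    ∑' ν, gibWeight X ν * (‖pathWeight w ν‖ₑ * ‖pathWeight w' ν‖ₑ) ≤ meanConst x N := by
  have h1 : ∀ w : Fin N → Letter d,
      ∑' ν, gibWeight X ν * ‖pathWeight w ν‖ₑ ^ 2 ≤ meanConst x N := by
    intro w
    have := tsum_gibWeight_prod_le hX hx hZ fun i => (w i).mode
    rw [Fintype.card_fin] at this
    exact (ENNReal.tsum_le_tsum fun ν => mul_le_mul_right (enorm_pathWeight_sq_le w ν) _).trans this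
  refine (ENNReal.mul_le_mul_iff_right two_ne_zero ENNReal.ofNat_ne_top).1 ?_
  rw [← ENNReal.tsum_mul_left, two_mul (meanConst x N)]
  refine le_trans ?_ (add_le_add (h1 w) (h1 w'))
  rw [← ENNReal.tsum_add]
  refine ENNReal.tsum_le_tsum fun ν => ?_
  rw [mul_left_comm, ← mul_add]
  exact mul_le_mul_right (ENNReal.two_mul_mul_le_sq_add_sq _ _) _

open Classical in
theorem Model.Admissible.tsum_gib_wordSum_le (hS : S.Admissible C₁ C₂ C₃ C₄ C₆ C₇) {L lam t : ℝ}
    (hL : 0 < L) (ht : 0 ≤ t) {A : Set (Mode d)} (hA : Summable (S.boltz L A)) {N : ℕ}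
    (R : (Fin N → Letter d) → Prop) (p : Mode d) :
    ∑' ν, gibWeight (S.eBose L A) ν * ∑' x, ‖S.wordSum L lam t R x (p, ν)‖ₑ ^ 2 ≤
      ENNReal.ofReal (vertexConst d L lam t) ^ N *
        meanConst (ENNReal.ofReal (Real.exp (-(S.β * C₆)))) N *
        ∑' (w : Fin N → Letter d) (w' : Fin N → Letter d), if R w ∧ net w = net w' then
          (∏ i, S.eQ L (w i)) * ∏ i, S.eQ L (w' i) else 0 := by
  set κ := ENNReal.ofReal (vertexConst d L lam t) ^ N with hκ
  have hv : 0 ≤ vertexConst d L lam t := by unfold vertexConst; positivity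
  set k := ENNReal.ofReal (Real.sqrt (vertexConst d L lam t)) ^ N
  have hk : k * k = κ := by
    rw [← mul_pow, ← ENNReal.ofReal_mul (Real.sqrt_nonneg _), Real.mul_self_sqrt hv]
  have hc : ∀ ν (w : Fin N → Letter d), ‖S.wordCoef L lam t (p, ν) w‖ₑ ≤
      k * ((∏ i, S.eQ L (w i)) * ‖pathWeight w ν‖ₑ) := by
    intro ν w
    rw [← ENNReal.pow_le_pow_left_iff two_ne_zero]
    refine (S.enorm_wordCoef_sq hL ht (p, ν) w).trans (le_of_eq ?_)
    rw [← hκ, ← hk]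
    ring
  have h1 : ∀ ν, gibWeight (S.eBose L A) ν * ∑' x, ‖S.wordSum L lam t R x (p, ν)‖ₑ ^ 2 ≤
      ∑' (w : Fin N → Letter d) (w' : Fin N → Letter d), gibWeight (S.eBose L A) ν *
        (‖pathWeight w ν‖ₑ * ‖pathWeight w' ν‖ₑ) * (κ * if R w ∧ net w = net w' then
          (∏ i, S.eQ L (w i)) * ∏ i, S.eQ L (w' i) else 0) := by
    intro ν
    refine (mul_le_mul_right (S.tsum_wordSum_sq_le L lam t R (p, ν)) _).trans ?_
    rw [← ENNReal.tsum_mul_left]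
    refine ENNReal.tsum_le_tsum fun w => ?_
    rw [← ENNReal.tsum_mul_left]
    refine ENNReal.tsum_le_tsum fun w' => ?_
    split_ifs
    · rw [mul_assoc]
      refine mul_le_mul_right ((mul_le_mul' (hc ν w) (hc ν w')).trans (le_of_eq ?_)) _
      rw [← hk]
      ring
    · simp
  refine (ENNReal.tsum_le_tsum h1).trans ?_
  rw [ENNReal.tsum_comm, ← ENNReal.tsum_mul_left]
  refine ENNReal.tsum_le_tsum fun w => ?_
  rw [ENNReal.tsum_comm, ← ENNReal.tsum_mul_left]
  refine ENNReal.tsum_le_tsum fun w' => ?_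
  rw [ENNReal.tsum_mul_right]
  refine (mul_le_mul_left (tsum_gibWeight_pathWeight_le (hS.eBose_lt_one L A) (hS.eBose_le L A)
    (Model.tsum_bWeight_ne_top hA) w w') _).trans (le_of_eq ?_)
  ring

theorem Model.Admissible.tsum_gib_wordSum_ne_top (hS : S.Admissible C₁ C₂ C₃ C₄ C₆ C₇)
    {L lam t : ℝ} (hL : 0 < L) (ht : 0 ≤ t) {A : Set (Mode d)} (hA : Summable (S.boltz L A))
    (hQ : ∑' a : Letter d, S.eQ L a ≠ ⊤) {N : ℕ} (R : (Fin N → Letter d) → Prop) :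
    ∃ K : ENNReal, K ≠ ⊤ ∧ ∀ p, ∑' ν, gibWeight (S.eBose L A) ν *
      ∑' x, ‖S.wordSum L lam t R x (p, ν)‖ₑ ^ 2 ≤ K := by
  classical
  refine ⟨ENNReal.ofReal (vertexConst d L lam t) ^ N *
    meanConst (ENNReal.ofReal (Real.exp (-(S.β * C₆)))) N *
    ((∑' a : Letter d, S.eQ L a) ^ N * (∑' a : Letter d, S.eQ L a) ^ N), ?_, fun p => ?_⟩
  · have := meanConst_ne_top hS.ofReal_exp_gap_lt_one N
    finiteness
  · refine (hS.tsum_gib_wordSum_le hL ht hA R p).trans (mul_le_mul_right ?_ _)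
    rw [← tsum_prod_pow, ← ENNReal.tsum_mul_right]
    refine ENNReal.tsum_le_tsum fun w => ?_
    rw [← ENNReal.tsum_mul_left]
    refine ENNReal.tsum_le_tsum fun w' => ?_
    split_ifs <;> simp

/-- A class contains at most four letters: two momenta with two signs each. -/
theorem tsum_class_le {f : Letter d → ENNReal} {b : ENNReal} (hf : ∀ a, f a ≤ b)
    (c : Sym2 (Mode d)) [∀ a : Letter d, Decidable (a.cls = c)] :
    ∑' a : Letter d, (if a.cls = c then f a else 0) ≤ 4 * b := by
  classical
  by_cases h : ∃ a : Letter d, a.cls = c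
  · obtain ⟨a, rfl⟩ := h
    have hs : ∀ a' ∉ ({a.1, -a.1} : Finset (Mode d)) ×ˢ (Finset.univ : Finset ℤˣ),
        (if Letter.cls a' = a.cls then f a' else 0) = 0 := by
      intro a' ha'
      refine if_neg fun h => ha' ?_
      rw [Finset.mem_product]
      exact ⟨by simpa using Letter.cls_eq_iff.1 h, Finset.mem_univ _⟩
    rw [tsum_eq_sum hs]
    refine (Finset.sum_le_card_nsmul _ _ b fun a' _ => ?_).trans ?_
    · split_ifs
      · exact hf _
      · exact zero_le
    · rw [nsmul_eq_mul, Finset.card_product]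
      refine mul_le_mul_left ?_ _
      have h1 : ({a.1, -a.1} : Finset (Mode d)).card ≤ 2 := Finset.card_le_two
      have h2 : (Finset.univ : Finset ℤˣ).card = 2 := rfl
      rw [h2]
      exact_mod_cast Nat.mul_le_mul_right 2 h1
  · have : ∀ a : Letter d, ¬a.cls = c := fun a ha => h ⟨a, ha⟩
    simp [this]

/-- At most `N - 1` of the `2N` letters of the pair open a new class. As `s` is of the order of the
volume and `vertexConst` of the order of its inverse, the bound is of order `L^{-d}`. For `N = 0`
there is no degenerate word. -/
theorem Model.Admissible.tsum_gib_degenerate_le (hS : S.Admissible C₁ C₂ C₃ C₄ C₆ C₇)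
    {L lam t : ℝ} (hL : 0 < L) (ht : 0 ≤ t) {A : Set (Mode d)} (hA : Summable (S.boltz L A))
    {s b : ENNReal} (hs : 1 ≤ s) (hQ : ∑' a : Letter d, S.eQ L a ≤ s) (hb : ∀ a, S.eQ L a ≤ b)
    {N : ℕ} (R : (Fin N → Letter d) → Prop) (hR : ∀ w, R w → Degenerate w) (p : Mode d) :
    ∑' ν, gibWeight (S.eBose L A) ν * ∑' x, ‖S.wordSum L lam t R x (p, ν)‖ₑ ^ 2 ≤
      ENNReal.ofReal (vertexConst d L lam t) ^ N *
        meanConst (ENNReal.ofReal (Real.exp (-(S.β * C₆)))) N *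
        (countConst (4 * b) (N + N) * s ^ (N - 1)) := by
  classical
  refine (hS.tsum_gib_wordSum_le hL ht hA R p).trans (mul_le_mul_right ?_ _)
  have h := tsum_few_classes_le' (ι := Fin N ⊕ Fin N) (cls := Letter.cls) hs hQ
    (fun c => by convert tsum_class_le hb c) (N - 1)
  rw [Fintype.card_sum, Fintype.card_fin] at h
  refine le_trans ?_ h
  rw [← (Equiv.sumArrowEquivProdArrow (Fin N) (Fin N) (Letter d)).symm.tsum_eq, ENNReal.tsum_prod']
  refine ENNReal.tsum_le_tsum fun w => ENNReal.tsum_le_tsum fun w' => ?_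
  by_cases hw : R w ∧ net w = net w'
  · have h1 := (hR w hw.1).card_classes hw.2
    have h2 : (fun i => ((Equiv.sumArrowEquivProdArrow (Fin N) (Fin N) (Letter d)).symm
        (w, w') i).cls) = Sum.elim (fun j => (w j).cls) fun j => (w' j).cls := by
      funext i
      rcases i with i | i <;> rfl
    rw [if_pos hw, h2, if_pos (by convert Nat.le_sub_of_add_le h1), Fintype.prod_sum_type]
    rfl
  · rw [if_neg hw]
    exact zero_le

end Polaron
end

noncomputable section
set_option linter.unusedSectionVars false
namespace Polaron

/-! ### Means of squares of random sums -/

theorem enorm_ofReal_mul {x : ℝ} (hx : 0 ≤ x) (c : ℂ) : ‖(x : ℂ) * c‖ₑ = ENNReal.ofReal x * ‖c‖ₑ := by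
  rw [enorm_mul, ← ofReal_norm, Complex.norm_real, Real.norm_of_nonneg hx]

theorem summable_norm_of_tsum_enorm {U : Type*} {f : U → ℂ} (hf : ∑' u, ‖f u‖ₑ ≠ ⊤) :
    Summable fun u => ‖f u‖ :=
  (ENNReal.summable_toReal hf).congr fun _ => toReal_enorm _

theorem summable_mul_conj {U : Type*} {f : U → ℂ} (hf : Summable fun u => ‖f u‖) :
    Summable fun q : U × U => f q.1 * (starRingEnd ℂ) (f q.2) := by
  have h2 : Summable fun u => ‖(starRingEnd ℂ) (f u)‖ := hf.congr fun u => (RCLike.norm_conj _).symm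
  have h3 := (hf.mul_of_nonneg h2 (fun u => norm_nonneg _) fun u => norm_nonneg _)
  refine Summable.of_norm (h3.congr fun q => ?_)
  rw [norm_mul]

theorem tsum_mul_conj {U : Type*} {f : U → ℂ} (hf : Summable fun u => ‖f u‖) :
    ∑' q : U × U, f q.1 * (starRingEnd ℂ) (f q.2) = ((‖∑' u, f u‖ ^ 2 : ℝ) : ℂ) := by
  have h2 : Summable fun u => ‖(starRingEnd ℂ) (f u)‖ := hf.congr fun u => (RCLike.norm_conj _).symm
  have h3 := tsum_mul_tsum_of_summable_norm hf h2
  rw [← h3, ← Complex.conj_tsum, Complex.mul_conj, Complex.normSq_eq_norm_sq]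

/-- The square is expanded into pairs. For pairs in `J` the mean of the product is the product of
the means, as it would be for independent weights. Completing these to all pairs reassembles the
square for the mean weights. The remaining pairs are estimated absolutely, once for the true mean
and once for the added product. -/
theorem tsum_mul_enorm_sq_le {V U : Type*} {g : V → ℝ} (hg : ∀ ν, 0 ≤ g ν) {b : U → V → ℝ}
    (hb : ∀ u ν, 0 ≤ b u ν) {c : U → ℂ} {W₀ : ℝ} (hW₀ : 0 ≤ W₀) {W : U → ℝ} (hW : ∀ u, 0 ≤ W u)
    (J : U × U → Prop) [DecidablePred J] {m : U × U → ENNReal}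
    (hm : ∀ q, m q = ∑' ν, ENNReal.ofReal (g ν * (b q.1 ν * b q.2 ν)))
    (hfin : ∑' q : U × U, m q * (‖c q.1‖ₑ * ‖c q.2‖ₑ) ≠ ⊤)
    (hWfin : ∑' u, ENNReal.ofReal (W u) * ‖c u‖ₑ ≠ ⊤)
    (hJ : ∀ q, J q → m q = ENNReal.ofReal (W₀ * (W q.1 * W q.2))) :
    ∑' ν, ENNReal.ofReal (g ν) * ‖∑' u, (b u ν : ℂ) * c u‖ₑ ^ 2 ≤
      ENNReal.ofReal W₀ * ‖∑' u, (W u : ℂ) * c u‖ₑ ^ 2 +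
      ∑' q : U × U, if J q then 0 else
        (m q + ENNReal.ofReal (W₀ * (W q.1 * W q.2))) * (‖c q.1‖ₑ * ‖c q.2‖ₑ) := by
  have hgb : ∀ ν (q : U × U), 0 ≤ g ν * (b q.1 ν * b q.2 ν) := fun ν q =>
    mul_nonneg (hg ν) (mul_nonneg (hb _ _) (hb _ _))
  set z : V → U × U → ℂ := fun ν q =>
    ((g ν * (b q.1 ν * b q.2 ν) : ℝ) : ℂ) * (c q.1 * (starRingEnd ℂ) (c q.2)) with hz
  have hconj : ∀ x : ℂ, ‖(starRingEnd ℂ) x‖ₑ = ‖x‖ₑ := fun x => by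
    rw [← ofReal_norm, RCLike.norm_conj, ofReal_norm]
  have hzn : ∀ ν q, ‖z ν q‖ₑ =
      ENNReal.ofReal (g ν * (b q.1 ν * b q.2 ν)) * (‖c q.1‖ₑ * ‖c q.2‖ₑ) := by
    intro ν q
    rw [hz, enorm_ofReal_mul (hgb ν q), enorm_mul, hconj]
  have htot : ∑' ν, ∑' q, ‖z ν q‖ₑ ≠ ⊤ := by
    rw [ENNReal.tsum_comm]
    simp only [hzn, ENNReal.tsum_mul_right, ← hm]
    exact hfin
  have hzs : Summable (Function.uncurry z) := by
    refine summable_of_tsum_enorm ?_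
    rw [ENNReal.tsum_prod']
    exact htot
  have hfib : ∀ ν, ∑' q, z ν q = ((g ν * ‖∑' u, (b u ν : ℂ) * c u‖ ^ 2 : ℝ) : ℂ) := by
    intro ν
    -- Where `g` vanishes there is nothing to prove. Where it is positive, finiteness of the total
    -- forces the inner sum to converge absolutely, so its square may be expanded.
    rcases (hg ν).eq_or_lt with h0 | h0
    · simp [hz, ← h0]
    · have h1 : ∑' q, ‖z ν q‖ₑ ≠ ⊤ := ne_top_of_le_ne_top htot (ENNReal.le_tsum ν)
      have h2 : ∑' q, ‖z ν q‖ₑ = ENNReal.ofReal (g ν) * ((∑' u, ‖(b u ν : ℂ) * c u‖ₑ) *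
          ∑' u, ‖(b u ν : ℂ) * c u‖ₑ) := by
        rw [← ENNReal.tsum_mul_right, ← ENNReal.tsum_mul_left, ENNReal.tsum_prod']
        refine tsum_congr fun u => ?_
        rw [← ENNReal.tsum_mul_left, ← ENNReal.tsum_mul_left]
        refine tsum_congr fun u' => ?_
        rw [hzn, enorm_ofReal_mul (hb _ _), enorm_ofReal_mul (hb _ _), ENNReal.ofReal_mul (hg ν),
          ENNReal.ofReal_mul (hb _ _)]
        ring
      have h3 : ∑' u, ‖(b u ν : ℂ) * c u‖ₑ ≠ ⊤ := by
        intro h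
        rw [h2, h, ENNReal.top_mul_top, ENNReal.mul_top (by simpa using h0)] at h1
        exact h1 rfl
      have h4 := tsum_mul_conj (summable_norm_of_tsum_enorm h3)
      rw [Complex.ofReal_mul, ← h4, ← tsum_mul_left]
      refine tsum_congr fun q => ?_
      simp only [hz, map_mul, Complex.conj_ofReal]
      push_cast
      ring
  have hcol : ∀ q, ∑' ν, z ν q = (((m q).toReal : ℝ) : ℂ) * (c q.1 * (starRingEnd ℂ) (c q.2)) := by
    intro q
    simp only [hz]
    rw [tsum_mul_right, ← Complex.ofReal_tsum, hm, ENNReal.tsum_toReal_eq fun _ => ENNReal.ofReal_ne_top]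
    congr 3
    funext ν
    rw [ENNReal.toReal_ofReal (hgb ν q)]
  have hWfin' : ∑' u, ‖(W u : ℂ) * c u‖ₑ ≠ ⊤ := by
    simpa only [enorm_ofReal_mul (hW _)] using hWfin
  have hs0 := summable_mul_conj (summable_norm_of_tsum_enorm hWfin')
  have ht0 := tsum_mul_conj (summable_norm_of_tsum_enorm hWfin')
  set z₀ : U × U → ℂ := fun q => (W₀ : ℂ) * ((W q.1 : ℂ) * c q.1 *
    (starRingEnd ℂ) ((W q.2 : ℂ) * c q.2)) with hz₀
  have hz₀' : ∀ q, z₀ q = ((W₀ * (W q.1 * W q.2) : ℝ) : ℂ) * (c q.1 * (starRingEnd ℂ) (c q.2)) := by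
    intro q
    simp only [hz₀, map_mul, Complex.conj_ofReal]
    push_cast
    ring
  have hsum0 : ∑' q, z₀ q = ((W₀ * ‖∑' u, (W u : ℂ) * c u‖ ^ 2 : ℝ) : ℂ) := by
    rw [hz₀, tsum_mul_left, ht0, Complex.ofReal_mul]
  have hrow : Summable fun ν => ∑' q, z ν q := hzs.prod
  have hsq : Summable fun q => ∑' ν, z ν q := hzs.prod_symm.prod
  have hcomm : ∑' ν, ∑' q, z ν q = ∑' q, ∑' ν, z ν q := hzs.tsum_comm.symm
  have hr : Summable fun ν => g ν * ‖∑' u, (b u ν : ℂ) * c u‖ ^ 2 := by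
    rw [← Complex.summable_ofReal]
    simpa only [hfib] using hrow
  have hL : ∑' ν, ENNReal.ofReal (g ν) * ‖∑' u, (b u ν : ℂ) * c u‖ₑ ^ 2 =
      ‖∑' q, ∑' ν, z ν q‖ₑ := by
    have h0 : ∀ ν, 0 ≤ g ν * ‖∑' u, (b u ν : ℂ) * c u‖ ^ 2 := fun ν =>
      mul_nonneg (hg ν) (by positivity)
    rw [← hcomm]
    simp only [hfib]
    rw [← Complex.ofReal_tsum, ← ofReal_norm, Complex.norm_real,
      Real.norm_of_nonneg (tsum_nonneg h0), ENNReal.ofReal_tsum_of_nonneg h0 hr]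
    refine tsum_congr fun ν => ?_
    rw [ENNReal.ofReal_mul (hg ν), ENNReal.ofReal_pow (norm_nonneg _), ofReal_norm]
  have hR : ENNReal.ofReal W₀ * ‖∑' u, (W u : ℂ) * c u‖ₑ ^ 2 = ‖∑' q, z₀ q‖ₑ := by
    rw [hsum0, ← ofReal_norm ((_ : ℝ) : ℂ), Complex.norm_real, Real.norm_of_nonneg (by positivity),
      ENNReal.ofReal_mul hW₀, ENNReal.ofReal_pow (norm_nonneg _), ofReal_norm]
  rw [hL, hR]
  -- The factorised expression is added and subtracted for every pair; the difference vanishes on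
  -- `J`.
  have hsplit : ∑' q, ∑' ν, z ν q = ∑' q, z₀ q + ∑' q, (∑' ν, z ν q - z₀ q) := by
    rw [← Summable.tsum_add (hs0.mul_left _) (hsq.sub (hs0.mul_left _))]
    exact tsum_congr fun q => (add_sub_cancel (z₀ q) _).symm
  rw [hsplit]
  refine (enorm_add_le _ _).trans (add_le_add le_rfl ((enorm_tsum_le _).trans ?_))
  refine ENNReal.tsum_le_tsum fun q => ?_
  have hw : 0 ≤ W₀ * (W q.1 * W q.2) := mul_nonneg hW₀ (mul_nonneg (hW _) (hW _))
  rw [hcol, hz₀', ← sub_mul, ← Complex.ofReal_sub]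
  split_ifs with hj
  · rw [hJ q hj, ENNReal.toReal_ofReal hw]
    simp
  · rw [enorm_mul, enorm_mul, hconj]
    refine mul_le_mul_left ?_ _
    rw [← ofReal_norm, Complex.norm_real]
    refine (ENNReal.ofReal_le_ofReal (norm_sub_le _ _)).trans ?_
    rw [ENNReal.ofReal_add (norm_nonneg _) (norm_nonneg _), Real.norm_of_nonneg ENNReal.toReal_nonneg,
      Real.norm_of_nonneg hw]
    exact add_le_add ENNReal.ofReal_toReal_le le_rfl

end Polaron
end

noncomputable section
set_option linter.unusedSectionVars false
namespace Polaron
variable {d : ℕ}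

/-! ### Words without accidental coincidences -/

variable {S : Model d} {C₁ C₂ C₃ C₄ C₆ C₇ : ℝ}

/-- The weight of a letter for given occupation numbers. -/
def Model.randWeight (S : Model d) (L : ℝ) (a : Letter d) (ν : Config d) : ℝ :=
  (L ^ d)⁻¹ * S.Q (mom L a.1) ^ 2 * occFactor a ν

/-- The mean weight of a letter in the Gibbs state of the phonons in `A`. -/
def Model.meanWeight (S : Model d) (L : ℝ) (A : Set (Mode d)) (a : Letter d) : ℝ :=
  (L ^ d)⁻¹ * S.Q (mom L a.1) ^ 2 * (S.occIn L A a.mode + (((a.2 : ℤ) : ℝ) + 1) / 2)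

/-- The mean square of the amplitude of a pattern, for given weights of the letters. -/
def Pat.wordAvg {n r N : ℕ} (P : Pat n r N) (S : Model d) (L : ℝ) (W : Letter d → ℝ) (p : Mode d)
    (t : ℝ) : ENNReal :=
  ∑' v : Fin n → Letter d, ENNReal.ofReal (∏ j, W (v j)) *
    ‖∑' u : Fin r → Letter d, ((∏ i, W (u i) : ℝ) : ℂ) * S.wordConv L p (P.expand v u) t‖ₑ ^ 2

theorem Model.randWeight_nonneg (S : Model d) {L : ℝ} (hL : 0 < L) (a : Letter d) (ν : Config d) :
    0 ≤ S.randWeight L a ν :=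
  mul_nonneg (by positivity) (occFactor_nonneg a ν)

theorem Model.Admissible.occIn_nonneg (hS : S.Admissible C₁ C₂ C₃ C₄ C₆ C₇) (L : ℝ)
    (A : Set (Mode d)) (q : Mode d) : 0 ≤ S.occIn L A q := by
  unfold Model.occIn
  split_ifs
  · exact hS.occ_nonneg _
  · exact le_rfl

theorem Model.Admissible.meanWeight_nonneg (hS : S.Admissible C₁ C₂ C₃ C₄ C₆ C₇) {L : ℝ}
    (hL : 0 < L) (A : Set (Mode d)) (a : Letter d) : 0 ≤ S.meanWeight L A a :=
  mul_nonneg (by positivity) (add_nonneg (hS.occIn_nonneg L A _) (sign_half_nonneg _))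

/-- The words of a pattern without accidental coincidences of modes. -/
def Pat.Good {n r N : ℕ} (P : Pat n r N) (w : Fin N → Letter d) : Prop :=
  Allowed P.toM (fun b => (w b).1) ∧ ¬Degenerate w

open Classical in
theorem Pat.wordSum_eq {n r N : ℕ} (P : Pat n r N) {L lam t : ℝ} (hL : 0 < L) (ht : 0 ≤ t)
    (hQ : ∑' a : Letter d, S.eQ L a ≠ ⊤) (x y : Label d) :
    S.wordSum L lam t P.Good x y =
      ∑' v : Fin n → Letter d, if Leads y x v then ∑' u : Fin r → Letter d,
        (if Separated v u then S.wordCoef L lam t y (P.expand v u) else 0) else 0 := by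
  have hs := Model.summable_wordSum (lam := lam) hL ht hQ P.Good x y
  set F : (Fin N → Letter d) → ℂ :=
    fun w => if P.Good w ∧ Leads y x w then S.wordCoef L lam t y w else 0 with hF
  have hinj : Function.Injective fun z : (Fin n → Letter d) × (Fin r → Letter d) =>
      P.expand z.1 z.2 := fun z z' h => by
    obtain ⟨h1, h2⟩ := P.expand_injective h
    exact Prod.ext h1 h2
  have hsupp : Function.support F ⊆ Set.range fun z : (Fin n → Letter d) × (Fin r → Letter d) =>
      P.expand z.1 z.2 := by
    intro w hw
    have h1 : P.Good w := by
      by_contra h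
      exact hw (if_neg fun h' => h h'.1)
    obtain ⟨v, u, h⟩ := P.exists_expand h1.1 h1.2
    exact ⟨(v, u), h⟩
  have hlead : ∀ v u, Leads y x (P.expand v u) ↔ Leads y x v := by
    intro v u
    unfold Leads
    rw [P.wordMom_expand, P.net_expand]
  change ∑' w, F w = _
  rw [← hinj.tsum_eq hsupp]
  have hs' := hs.comp_injective hinj
  refine (Summable.tsum_prod hs').trans (tsum_congr fun v => ?_)
  simp only [Function.comp_apply, hF, hlead]
  split_ifs with hv
  · refine tsum_congr fun u => ?_
    have : P.Good (P.expand v u) ↔ Separated v u := (P.separated_iff v u).symm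
    simp only [this, hv, and_true]
  · simp [hv]

open Classical in
-- For given endpoints at most `n!` external words contribute, so Cauchy-Schwarz costs `n!` and
-- makes the sum diagonal in the external word. The recollision letters remain inside the absolute
-- value, where their oscillations are still needed.
theorem Pat.tsum_wordSum_sq_le {n r N : ℕ} (P : Pat n r N) {L lam t : ℝ} (hL : 0 < L) (ht : 0 ≤ t)
    (hQ : ∑' a : Letter d, S.eQ L a ≠ ⊤) (y : Label d) :
    ∑' x, ‖S.wordSum L lam t P.Good x y‖ₑ ^ 2 ≤
      n.factorial * ∑' v : Fin n → Letter d, ‖∑' u : Fin r → Letter d,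
        (if Separated v u then S.wordCoef L lam t y (P.expand v u) else 0)‖ₑ ^ 2 := by
  set G : (Fin n → Letter d) → ℂ := fun v => ∑' u : Fin r → Letter d,
        (if Separated v u then S.wordCoef L lam t y (P.expand v u) else 0) with hG
  have h : ∀ x, ‖S.wordSum L lam t P.Good x y‖ₑ ^ 2 ≤
      n.factorial * ∑' v, if Leads y x v then ‖G v‖ₑ ^ 2 else 0 := by
    intro x
    obtain ⟨s, hs, hv⟩ := exists_finset_of_net (n := n) fun q => (x.2 q : ℤ) - y.2 q
    rw [P.wordSum_eq hL ht hQ x y]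
    refine (enorm_tsum_sq_le (s := s) (fun v hne => ?_) hs).trans (le_of_eq ?_)
    · have h1 : Leads y x v := by
        by_contra h1
        exact hne (if_neg h1)
      rw [if_pos h1] at hne
      have h2 : ∃ u : Fin r → Letter d, Separated v u := by
        by_contra h2
        push Not at h2
        exact hne (by simp [h2])
      obtain ⟨u, hu⟩ := h2
      refine hv v ?_ (funext fun q => ?_)
      · intro i j hij
        exact Sum.inl_injective (hu (a₁ := Sum.inl i) (a₂ := Sum.inl j) hij)
      · have := h1.2 q
        omega
    · congr 1
      refine tsum_congr fun v => ?_
      split_ifs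
      · rfl
      · simp
  refine (ENNReal.tsum_le_tsum h).trans ?_
  rw [ENNReal.tsum_mul_left, ENNReal.tsum_comm]
  exact mul_le_mul_right (ENNReal.tsum_le_tsum fun v => tsum_if_leads_le y v _) _

open Classical in
-- A recollision letter accounts for two vertices and appears with its full weight inside the sum.
-- An external letter accounts for one vertex, so only its square root appears in the amplitude and
-- its weight arises on squaring.
theorem Pat.enorm_coefSum_sq {n r N : ℕ} (P : Pat n r N) {L lam t : ℝ} (hL : 0 < L) (ht : 0 ≤ t)
    (hQ : ∀ k, S.Q (-k) = S.Q k) (p : Mode d) (ν : Config d) (v : Fin n → Letter d) :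
    ‖∑' u : Fin r → Letter d,
        (if Separated v u then S.wordCoef L lam t (p, ν) (P.expand v u) else 0)‖ₑ ^ 2 =
      ENNReal.ofReal (lam ^ 2) ^ N * (ENNReal.ofReal (∏ j, S.randWeight L (v j) ν) *
        ‖∑' u : Fin r → Letter d, ((if Separated v u then ∏ i, S.randWeight L (u i) ν else 0 : ℝ) : ℂ)
          * S.wordConv L p (P.expand v u) t‖ₑ ^ 2) := by
  set s : ℝ := (L ^ d)⁻¹ * L ^ ((d : ℝ) / 2) with hs
  have hs2 : s ^ 2 = (L ^ d)⁻¹ := sq_scale hL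
  set E : ℂ := Complex.exp (-Complex.I * ((t * S.phEnergy L ν : ℝ) : ℂ))
  -- Everything that does not depend on the recollision letters, including the sign of the `r`
  -- recollisions.
  set K : ℝ := lam ^ N * (-1) ^ r * ∏ j, (s * S.Q (mom L (v j).1) * stepWeight (v j) ν) with hK
  have hterm : ∀ u : Fin r → Letter d,
      (if Separated v u then S.wordCoef L lam t (p, ν) (P.expand v u) else 0) =
      ((K : ℂ) * E) * (((if Separated v u then ∏ i, S.randWeight L (u i) ν else 0 : ℝ) : ℂ)
          * S.wordConv L p (P.expand v u) t) := by
    intro u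
    split_ifs with hu
    · unfold Model.wordCoef
      rw [S.wordAmp_eq L p _ ht, P.wordQ_expand hQ, P.pathWeight_expand hu]
      have e : (lam * s) ^ N * (S.wordQ L v * S.wordQ L u ^ 2) *
          ((∏ j, stepWeight (v j) ν) * ∏ i, -occFactor (u i) ν) =
          K * ∏ i, S.randWeight L (u i) ν := by
        rw [hK]
        simp only [Model.randWeight, Model.wordQ, Finset.prod_mul_distrib, Finset.prod_const,
          Finset.card_univ, Fintype.card_fin, Finset.prod_neg, Finset.prod_pow, ← hs2]
        rw [mul_pow, P.card_eq, pow_add s n, pow_mul s 2]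
        ring
      rw [e, Complex.ofReal_mul]
      ring
    · simp
  simp only [hterm]
  rw [tsum_mul_left, enorm_mul, mul_pow, ← mul_assoc]
  congr 1
  have hE : ‖E‖ₑ = 1 := by rw [← ofReal_norm, norm_cexp_I, ENNReal.ofReal_one]
  rw [enorm_mul, hE, mul_one, ← ofReal_norm, Complex.norm_real, ← ENNReal.ofReal_pow (norm_nonneg _),
    Real.norm_eq_abs, sq_abs, ← ENNReal.ofReal_pow (by positivity),
    ← ENNReal.ofReal_mul (by positivity)]
  congr 1
  rw [hK, mul_pow, mul_pow, ← Finset.prod_pow, ← pow_mul, ← pow_mul, mul_comm r 2, pow_mul (-1 : ℝ)]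
  simp only [mul_pow, stepWeight_sq, hs2, Model.randWeight]
  rw [neg_one_sq, one_pow, mul_one, ← pow_mul, mul_comm N 2]

end Polaron
end

noncomputable section
set_option linter.unusedSectionVars false
namespace Polaron
variable {d : ℕ}

/-! ### Comparison with the mean weights -/

variable {S : Model d} {C₁ C₂ C₃ C₄ C₆ C₇ : ℝ}

/-- The bound on the weight of a letter for occupation number zero. -/
def Model.latQ (S : Model d) (L : ℝ) (a : Letter d) : ENNReal :=
  ENNReal.ofReal ((L ^ d)⁻¹) * S.eQ L a ^ 2

theorem Model.ofReal_latQ (S : Model d) {L : ℝ} (hL : 0 < L) (a : Letter d) :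
    ENNReal.ofReal ((L ^ d)⁻¹ * S.Q (mom L a.1) ^ 2) = S.latQ L a := by
  rw [Model.latQ, Model.eQ, ENNReal.ofReal_mul (by positivity), ← ofReal_norm,
    ← ENNReal.ofReal_pow (norm_nonneg _), Real.norm_eq_abs, sq_abs]

/-- The random weight of a letter as a function of the occupation number of its mode. -/
def Model.modeWeight (S : Model d) (L : ℝ) (a : Letter d) (n : ℕ) : ENNReal :=
  S.latQ L a * ENNReal.ofReal (n + (((a.2 : ℤ) : ℝ) + 1) / 2)

theorem Model.ofReal_randWeight (S : Model d) {L : ℝ} (hL : 0 < L) (a : Letter d) (ν : Config d) :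
    ENNReal.ofReal (S.randWeight L a ν) = S.modeWeight L a (ν a.mode) := by
  rw [Model.randWeight, ENNReal.ofReal_mul (by positivity), S.ofReal_latQ hL]
  rfl

theorem Model.Admissible.modeMean_modeWeight (hS : S.Admissible C₁ C₂ C₃ C₄ C₆ C₇) {L : ℝ}
    (hL : 0 < L) (A : Set (Mode d)) (a : Letter d) :
    modeMean (S.eBose L A a.mode) (S.modeWeight L a) = ENNReal.ofReal (S.meanWeight L A a) := by
  rw [Model.meanWeight, ENNReal.ofReal_mul (by positivity), S.ofReal_latQ hL, ← hS.modeMean_eq L A]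
  unfold modeMean Model.modeWeight
  simp only [mul_left_comm _ (S.latQ L a)]
  rw [ENNReal.tsum_mul_left, mul_left_comm]

theorem Model.modeWeight_le (S : Model d) (L : ℝ) (a : Letter d) (n N : ℕ) :
    S.modeWeight L a n ≤ S.latQ L a * ((n : ENNReal) + N + 1) := by
  refine mul_le_mul_right ?_ _
  have h3 : (((a.2 : ℤ) : ℝ) + 1) / 2 ≤ 1 := by
    rcases Int.units_eq_one_or a.2 with h | h <;> (simp only [h]; norm_num)
  refine (ENNReal.ofReal_le_ofReal (show (n : ℝ) + (((a.2 : ℤ) : ℝ) + 1) / 2 ≤ ((n + 1 : ℕ) : ℝ) by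
    push_cast; linarith)).trans ?_
  rw [ENNReal.ofReal_natCast]
  push_cast
  gcongr
  exact le_self_add

theorem Model.Admissible.ofReal_meanWeight_le (hS : S.Admissible C₁ C₂ C₃ C₄ C₆ C₇) {L : ℝ}
    (hL : 0 < L) (A : Set (Mode d)) (a : Letter d) :
    ENNReal.ofReal (S.meanWeight L A a) ≤
      S.latQ L a * momentConst (ENNReal.ofReal (Real.exp (-(S.β * C₆)))) 1 := by
  rw [← hS.modeMean_modeWeight hL]
  refine (modeMean_mono fun n => S.modeWeight_le L a n 1).trans ?_
  have := modeMean_pow_le (hS.eBose_le L A a.mode) 1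
  simp only [pow_one, Nat.cast_one] at this
  refine le_trans (le_of_eq ?_) (mul_le_mul_right this _)
  unfold modeMean
  simp only [mul_left_comm _ (S.latQ L a), Nat.cast_one]
  rw [ENNReal.tsum_mul_left, mul_left_comm]

/-- The external letters and two families of recollision letters. -/
def joint {n r : ℕ} (v : Fin n → Letter d) (q : (Fin r → Letter d) × (Fin r → Letter d)) :
    Fin n ⊕ (Fin r ⊕ Fin r) → Letter d := Sum.elim v (Sum.elim q.1 q.2)

/-- The letters of a family belong to different classes. -/
def ClsInjective {ι : Type*} (a : ι → Letter d) : Prop := Function.Injective fun i => (a i).cls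

theorem ClsInjective.separated_left {n r : ℕ} {v : Fin n → Letter d}
    {q : (Fin r → Letter d) × (Fin r → Letter d)} (h : ClsInjective (joint v q)) :
    Separated v q.1 := by
  have e : Sum.elim (fun j => (v j).cls) (fun i => (q.1 i).cls) =
      (fun i => (joint v q i).cls) ∘ Sum.map id Sum.inl := by
    funext x; rcases x with x | x <;> rfl
  unfold Separated
  rw [e]
  exact h.comp (Sum.map_injective.2 ⟨Function.injective_id, Sum.inl_injective⟩)

theorem ClsInjective.separated_right {n r : ℕ} {v : Fin n → Letter d}
    {q : (Fin r → Letter d) × (Fin r → Letter d)} (h : ClsInjective (joint v q)) :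
    Separated v q.2 := by
  have e : Sum.elim (fun j => (v j).cls) (fun i => (q.2 i).cls) =
      (fun i => (joint v q i).cls) ∘ Sum.map id Sum.inr := by
    funext x; rcases x with x | x <;> rfl
  unfold Separated
  rw [e]
  exact h.comp (Sum.map_injective.2 ⟨Function.injective_id, Sum.inr_injective⟩)

theorem ClsInjective.mode_injective {ι : Type*} {a : ι → Letter d} (h : ClsInjective a) :
    Function.Injective fun i => (a i).mode := fun _ _ hij => h (Letter.cls_of_mode_eq hij)

theorem prod_joint {B : Type*} [CommMonoid B] {n r : ℕ} (f : Letter d → B) (v : Fin n → Letter d)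
    (q : (Fin r → Letter d) × (Fin r → Letter d)) :
    ∏ i, f (joint v q i) = (∏ j, f (v j)) * ((∏ i, f (q.1 i)) * ∏ i, f (q.2 i)) := by
  rw [Fintype.prod_sum_type, Fintype.prod_sum_type]
  rfl

theorem joint_injective {n r : ℕ} : Function.Injective
    fun z : (Fin n → Letter d) × (Fin r → Letter d) × (Fin r → Letter d) => joint z.1 z.2 := by
  rintro ⟨v, u, u'⟩ ⟨w, x, x'⟩ h
  have h1 : ∀ i, joint v (u, u') i = joint w (x, x') i := fun i => congrFun h i
  refine Prod.ext (funext fun j => h1 (.inl j)) (Prod.ext (funext fun j => h1 (.inr (.inl j)))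
    (funext fun j => h1 (.inr (.inr j))))

/-- The error constant in the comparison of the random weights with their means. -/
def errConst (x : ENNReal) (N : ℕ) : ENNReal := meanConst x N + momentConst x 1 ^ N

theorem errConst_ne_top {x : ENNReal} (hx : x < 1) (N : ℕ) : errConst x N ≠ ⊤ := by
  have h1 := momentConst_ne_top hx 1
  have h2 := meanConst_ne_top hx N
  unfold errConst
  finiteness

open Classical in
-- The expanded square involves the external letters and two families of recollision letters. If all
-- their classes differ, the modes are distinct, hence independent in the Gibbs state, and the mean
-- factorises. The last sum collects the coincidences, which are again missing a factor of the
-- volume.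
theorem Model.Admissible.tsum_gib_coefSum_le (hS : S.Admissible C₁ C₂ C₃ C₄ C₆ C₇) {L t : ℝ}
    (hL : 0 < L) (ht : 0 ≤ t) {A : Set (Mode d)} (hA : Summable (S.boltz L A))
    (hQ : ∑' a : Letter d, S.latQ L a ≠ ⊤) {n r N : ℕ} (P : Pat n r N) (p : Mode d)
    (v : Fin n → Letter d) :
    ∑' ν, gibWeight (S.eBose L A) ν * (ENNReal.ofReal (∏ j, S.randWeight L (v j) ν) *
        ‖∑' u : Fin r → Letter d, ((if Separated v u then ∏ i, S.randWeight L (u i) ν else 0 : ℝ) : ℂ)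
          * S.wordConv L p (P.expand v u) t‖ₑ ^ 2) ≤
      ENNReal.ofReal (∏ j, S.meanWeight L A (v j)) * ‖∑' u : Fin r → Letter d,
        ((∏ i, S.meanWeight L A (u i) : ℝ) : ℂ) * S.wordConv L p (P.expand v u) t‖ₑ ^ 2 +
      ENNReal.ofReal (t ^ N) ^ 2 * errConst (ENNReal.ofReal (Real.exp (-(S.β * C₆)))) N *
        ∑' q : (Fin r → Letter d) × (Fin r → Letter d),
          if ClsInjective (joint v q) then 0 else ∏ i, S.latQ L (joint v q i) := by
  set x := ENNReal.ofReal (Real.exp (-(S.β * C₆)))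
  -- The expanded square contains `n + 2 r = N` letters, one for each vertex of the pattern.
  have hN : N = Fintype.card (Fin n ⊕ (Fin r ⊕ Fin r)) := by
    rw [P.card_eq]
    simp
    omega
  have hr0 : ∀ {k : ℕ} (u : Fin k → Letter d) ν, 0 ≤ ∏ i, S.randWeight L (u i) ν :=
    fun u ν => Finset.prod_nonneg fun i _ => S.randWeight_nonneg hL _ _
  have hW0 : ∀ {k : ℕ} (u : Fin k → Letter d), 0 ≤ ∏ i, S.meanWeight L A (u i) :=
    fun u => Finset.prod_nonneg fun i _ => hS.meanWeight_nonneg hL _ _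
  set c : (Fin r → Letter d) → ℂ := fun u => S.wordConv L p (P.expand v u) t
  have hc : ∀ u, ‖c u‖ₑ ≤ ENNReal.ofReal (t ^ N) := fun u => by
    rw [← ofReal_norm]
    exact ENNReal.ofReal_le_ofReal (S.norm_wordConv_le L p _ ht)
  set b : (Fin r → Letter d) → Config d → ℝ :=
    fun u ν => if Separated v u then ∏ i, S.randWeight L (u i) ν else 0 with hb
  have hb0 : ∀ u ν, 0 ≤ b u ν := fun u ν => by
    simp only [hb]
    split_ifs
    · exact hr0 u ν
    · exact le_rfl
  have hble : ∀ u ν, b u ν ≤ ∏ i, S.randWeight L (u i) ν := fun u ν => by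
    simp only [hb]
    split_ifs
    · exact le_rfl
    · exact hr0 u ν
  set g : Config d → ℝ := fun ν => S.gibbs L A ν * ∏ j, S.randWeight L (v j) ν with hg
  have hg0 : ∀ ν, 0 ≤ g ν := fun ν => mul_nonneg (S.gibbs_nonneg L A ν) (hr0 v ν)
  set m : (Fin r → Letter d) × (Fin r → Letter d) → ENNReal :=
    fun q => ∑' ν, ENNReal.ofReal (g ν * (b q.1 ν * b q.2 ν)) with hm
  have hprod : ∀ (q : (Fin r → Letter d) × (Fin r → Letter d)) ν, ENNReal.ofReal (S.gibbs L A ν * (∏ j, S.randWeight L (v j) ν) *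
      ((∏ i, S.randWeight L (q.1 i) ν) * ∏ i, S.randWeight L (q.2 i) ν)) =
      gibWeight (S.eBose L A) ν * ∏ i, S.modeWeight L (joint v q i) (ν (joint v q i).mode) := by
    intro q ν
    rw [mul_assoc, ENNReal.ofReal_mul (S.gibbs_nonneg L A ν), Model.ofReal_gibbs hA,
      ← prod_joint (fun a => S.randWeight L a ν) v q,
      ENNReal.ofReal_prod_of_nonneg fun i _ => S.randWeight_nonneg hL _ _]
    simp only [S.ofReal_randWeight hL]
  have hX := hS.eBose_lt_one L A
  have hx : ∀ q, S.eBose L A q ≤ x := hS.eBose_le L A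
  have hZ := Model.tsum_bWeight_ne_top hA
  have hmle : ∀ q, m q ≤ (∏ i, S.latQ L (joint v q i)) * meanConst x N := by
    intro q
    have h1 : ∀ ν, ENNReal.ofReal (g ν * (b q.1 ν * b q.2 ν)) ≤ (∏ i, S.latQ L (joint v q i)) *
        (gibWeight (S.eBose L A) ν * ∏ i, ((ν (joint v q i).mode : ENNReal) +
          Fintype.card (Fin n ⊕ (Fin r ⊕ Fin r)) + 1)) := by
      intro ν
      refine (ENNReal.ofReal_le_ofReal (mul_le_mul_of_nonneg_left (mul_le_mul (hble _ ν) (hble _ ν)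
        (hb0 _ _) (hr0 _ _)) (hg0 ν))).trans ?_
      rw [hg, hprod q ν, mul_left_comm, ← Finset.prod_mul_distrib]
      exact mul_le_mul_right (Finset.prod_le_prod' fun i _ => S.modeWeight_le L _ _ _) _
    refine (ENNReal.tsum_le_tsum h1).trans ?_
    rw [ENNReal.tsum_mul_left]
    conv_rhs => rw [hN]
    exact mul_le_mul_right (tsum_gibWeight_prod_le hX hx hZ _) _
  have hWle : ∀ {ι : Type} [Fintype ι] (a : ι → Letter d),
      ENNReal.ofReal (∏ i, S.meanWeight L A (a i)) ≤
        (∏ i, S.latQ L (a i)) * momentConst x 1 ^ Fintype.card ι := by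
    intro ι _ a
    rw [ENNReal.ofReal_prod_of_nonneg fun i _ => hS.meanWeight_nonneg hL _ _]
    refine (Finset.prod_le_prod' fun i _ => hS.ofReal_meanWeight_le hL A (a i)).trans ?_
    rw [Finset.prod_mul_distrib, Finset.prod_const, Finset.card_univ]
  have hx1 : x < 1 := hS.ofReal_exp_gap_lt_one
  have hmom := momentConst_ne_top hx1 1
  have hmean := meanConst_ne_top hx1 N
  have hjoint : ∀ q : (Fin r → Letter d) × (Fin r → Letter d), (∏ j, S.meanWeight L A (v j)) *
      ((∏ i, S.meanWeight L A (q.1 i)) * ∏ i, S.meanWeight L A (q.2 i)) =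
      ∏ i, S.meanWeight L A (joint v q i) := fun q => (prod_joint _ v q).symm
  have hQv : ∏ j, S.latQ L (v j) ≠ ⊤ :=
    ENNReal.prod_ne_top fun j _ => ne_top_of_le_ne_top hQ (ENNReal.le_tsum _)
  have key := tsum_mul_enorm_sq_le hg0 hb0 (c := c) (hW0 v) (fun u => hW0 u)
    (fun q => ClsInjective (joint v q)) (m := m) (fun q => rfl) ?_ ?_ ?_
  · refine le_trans (le_of_eq (tsum_congr fun ν => ?_)) (key.trans (add_le_add le_rfl ?_))
    · rw [← Model.ofReal_gibbs hA, ← mul_assoc, hg, ENNReal.ofReal_mul (S.gibbs_nonneg L A ν)]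
    · rw [← ENNReal.tsum_mul_left]
      refine ENNReal.tsum_le_tsum fun q => ?_
      split_ifs
      · exact zero_le
      · rw [hjoint]
        refine (mul_le_mul' (add_le_add (hmle q) (hWle _)) (mul_le_mul' (hc _) (hc _))).trans ?_
        rw [← hN, errConst]
        exact le_of_eq (by ring)
  · have h1 : ∀ q, m q * (‖c q.1‖ₑ * ‖c q.2‖ₑ) ≤ ((∏ j, S.latQ L (v j)) * meanConst x N *
        ENNReal.ofReal (t ^ N) ^ 2) * ((∏ i, S.latQ L (q.1 i)) * ∏ i, S.latQ L (q.2 i)) := by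
      intro q
      refine (mul_le_mul' (hmle q) (mul_le_mul' (hc _) (hc _))).trans (le_of_eq ?_)
      rw [prod_joint]
      ring
    refine ne_top_of_le_ne_top ?_ (ENNReal.tsum_le_tsum h1)
    rw [ENNReal.tsum_mul_left, ENNReal.tsum_prod']
    simp only [ENNReal.tsum_mul_left, ENNReal.tsum_mul_right, tsum_prod_pow]
    finiteness
  · have h1 : ∀ u, ENNReal.ofReal (∏ i, S.meanWeight L A (u i)) * ‖c u‖ₑ ≤
        (∏ i, S.latQ L (u i)) * (momentConst x 1 ^ Fintype.card (Fin r) * ENNReal.ofReal (t ^ N)) :=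
      fun u => (mul_le_mul' (hWle u) (hc u)).trans (le_of_eq (by ring))
    refine ne_top_of_le_ne_top ?_ (ENNReal.tsum_le_tsum h1)
    rw [ENNReal.tsum_mul_right, tsum_prod_pow]
    finiteness
  · intro q hq
    rw [hjoint, ENNReal.ofReal_prod_of_nonneg fun i _ => hS.meanWeight_nonneg hL _ _]
    simp only [← hS.modeMean_modeWeight hL, hm]
    rw [← tsum_gibWeight_prod hX hZ hq.mode_injective (fun i => S.modeWeight L (joint v q i))]
    refine tsum_congr fun ν => ?_
    rw [← hprod q ν]
    simp only [hg, hb, if_pos hq.separated_left, if_pos hq.separated_right]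

theorem tsum_not_clsInjective_le {f : Letter d → ENNReal} {s b : ENNReal} (hs : 1 ≤ s)
    (h1 : ∑' a, f a ≤ s) (hb : ∀ a, f a ≤ b) {ι : Type*} [Fintype ι]
    [DecidablePred fun a : ι → Letter d => ClsInjective a] :
    ∑' a : ι → Letter d, (if ClsInjective a then 0 else ∏ i, f (a i)) ≤
      countConst (4 * b) (Fintype.card ι) * s ^ (Fintype.card ι - 1) := by
  classical
  refine le_trans (ENNReal.tsum_le_tsum fun a => ?_) (tsum_few_classes_le' (ι := ι)
    (cls := Letter.cls) hs h1 (fun c => by convert tsum_class_le hb c) (Fintype.card ι - 1))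
  split_ifs with h2 h3 h3
  · exact zero_le
  · exact zero_le
  · exact le_rfl
  · refine absurd ?_ h3
    have h4 : (Finset.univ.image fun i => (a i).cls).card ≠ Fintype.card ι := by
      intro h4
      rw [← Finset.card_univ, Finset.card_image_iff] at h4
      exact h2 (Set.injOn_univ.1 (by simpa using h4))
    have h5 : (Finset.univ.image fun i => (a i).cls).card ≤ Fintype.card ι :=
      Finset.card_image_le
    convert (show (Finset.univ.image fun i => (a i).cls).card ≤ Fintype.card ι - 1 by omega)

end Polaron
end

noncomputable section
set_option linter.unusedSectionVars false
namespace Polaron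
variable {d : ℕ}

/-! ### The trace as a mean square -/

variable {S : Model d} {C₁ C₂ C₃ C₄ C₆ C₇ : ℝ}

theorem enorm_sum_sq_le {ι : Type*} [Fintype ι] (f : ι → ℂ) :
    ‖∑ i, f i‖ₑ ^ 2 ≤ Fintype.card ι * ∑ i, ‖f i‖ₑ ^ 2 := by
  have := enorm_tsum_sq_le (f := f) (s := Finset.univ) (fun a _ => Finset.mem_univ a) le_rfl
  rwa [tsum_fintype, tsum_fintype, Finset.card_univ] at this

/-- The matrix elements of the expanded operator conserve the total momentum. -/
theorem Model.total_mom_eq {L lam t : ℝ} {N : ℕ} {R : (Fin N → Letter d) → Prop} {x y : Label d}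
    (h : S.wordSum L lam t R x y ≠ 0) :
    x.1 - cfgSum (fun q => q) x.2 = y.1 - cfgSum (fun q => q) y.2 := by
  classical
  obtain ⟨w, hw⟩ : ∃ w : Fin N → Letter d,
      (if R w ∧ Leads y x w then S.wordCoef L lam t y w else 0) ≠ 0 := by
    by_contra hc
    push Not at hc
    exact h (by simp [Model.wordSum, hc])
  have hl : Leads y x w := by
    by_contra hc
    exact hw (if_neg fun h' => hc h'.2)
  have hp : pathWeight w y.2 ≠ 0 := by
    intro hp
    apply hw
    simp [Model.wordCoef, hp]
  have e : x = (y.1 + wordMom w, path w y.2) := hl.unique ⟨rfl, fun q => path_apply hp q⟩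
  rw [e]
  simp only [sum_mode_path hp]
  abel

theorem Model.total_mom_eq_of_E0Mat {L lam t : ℝ} (hL : 0 < L) (ht : 0 ≤ t)
    (hω : ∀ k, S.ω (-k) = S.ω k) (hQ : ∑' a : Letter d, S.eQ L a ≠ ⊤) {n N : ℕ} {x y : Label d}
    (h : S.E0Mat L lam t n N x y ≠ 0) :
    x.1 - cfgSum (fun q => q) x.2 = y.1 - cfgSum (fun q => q) y.2 := by
  rw [Model.E0Mat_eq hL ht hω hQ] at h
  obtain ⟨m, -, hm⟩ := Finset.exists_ne_zero_of_sum_ne_zero h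
  exact Model.total_mom_eq hm

/-- The mean square of the matrix elements of the expanded operator. -/
def Model.meanSq (S : Model d) (L : ℝ) (A : Set (Mode d)) (lam t : ℝ) (n N : ℕ) (p : Mode d) :
    ENNReal :=
  ∑' ν, gibWeight (S.eBose L A) ν * ∑' x, ‖S.E0Mat L lam t n N x (p, ν)‖ₑ ^ 2

theorem Model.Admissible.exists_meanSq_le (hS : S.Admissible C₁ C₂ C₃ C₄ C₆ C₇) {L : ℝ}
    (lam : ℝ) {t : ℝ} (hL : 0 < L) (ht : 0 ≤ t) {A : Set (Mode d)} (hA : Summable (S.boltz L A))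
    (hQ : ∑' a : Letter d, S.eQ L a ≠ ⊤) (n N : ℕ) :
    ∃ K : ENNReal, K ≠ ⊤ ∧ ∀ p, S.meanSq L A lam t n N p ≤ K := by
  have h := fun m : patterns n N => hS.tsum_gib_wordSum_ne_top (lam := lam) hL ht hA hQ
    (fun w : Fin N → Letter d => Allowed m.1 fun b => (w b).1)
  choose K hK hle using h
  refine ⟨Fintype.card (patterns n N) * ∑ m, K m, ?_, fun p => ?_⟩
  · exact ENNReal.mul_ne_top (by simp) (ENNReal.sum_ne_top.2 fun m _ => hK m)
  · have h1 : ∀ ν, gibWeight (S.eBose L A) ν * ∑' x, ‖S.E0Mat L lam t n N x (p, ν)‖ₑ ^ 2 ≤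
        Fintype.card (patterns n N) * ∑ m : patterns n N, gibWeight (S.eBose L A) ν * ∑' x,
          ‖S.wordSum L lam t (fun w : Fin N → Letter d => Allowed m.1 fun b => (w b).1)
            x (p, ν)‖ₑ ^ 2 := by
      intro ν
      rw [← Finset.mul_sum, mul_left_comm]
      refine mul_le_mul_right ?_ _
      rw [← Summable.tsum_finsetSum fun _ _ => ENNReal.summable, ← ENNReal.tsum_mul_left]
      refine ENNReal.tsum_le_tsum fun x => ?_
      rw [Model.E0Mat_eq hL ht hS.ω_even hQ, ← Finset.sum_coe_sort]
      exact enorm_sum_sq_le _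
    refine (ENNReal.tsum_le_tsum h1).trans ?_
    rw [ENNReal.tsum_mul_left, Summable.tsum_finsetSum fun _ _ => ENNReal.summable]
    exact mul_le_mul_right (Finset.sum_le_sum fun m _ => hle m p) _

/-- Both matrix elements conserve electron momentum minus phonon momentum, and `Γ_0` does not change
occupation numbers. The two inner states therefore coincide, the coherences of the electron state
drop out, and the trace is an average of mean squares over its momentum distribution. -/
theorem Model.Admissible.trace_le (hS : S.Admissible C₁ C₂ C₃ C₄ C₆ C₇) {L lam t : ℝ}
    (hL : 0 < L) (ht : 0 ≤ t) {A : Set (Mode d)} (hA : Summable (S.boltz L A))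
    (hQ : ∑' a : Letter d, S.eQ L a ≠ ⊤) {γ : ElSpace d →L[ℂ] ElSpace d} (hγ : IsDensity γ)
    (n N : ℕ) :
    Summable (S.trTerm L A γ lam t n N) ∧
    S.tr L A γ lam t n N ≤
      (∑' p, ENNReal.ofReal (elMat γ p p).re * S.meanSq L A lam t n N p).toReal := by
  classical
  set f := S.trTerm L A γ lam t n N with hf
  set δ : Label d × Label d → Label d × Label d × Label d := fun z => (z.2, z.1, z.1) with hδ
  have hinj : Function.Injective δ := by
    rintro ⟨y, x⟩ ⟨y', x'⟩ h
    simp only [hδ, Prod.mk.injEq] at h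
    exact Prod.ext h.2.1 h.1
  have hsupp : ∀ w, f w ≠ 0 → w ∈ Set.range δ := by
    rintro ⟨x, y, z⟩ hw
    simp only [hf, Model.trTerm] at hw
    have h1 := left_ne_zero_of_mul (left_ne_zero_of_mul hw)
    have h2 := right_ne_zero_of_mul (left_ne_zero_of_mul hw)
    have h3 : S.E0Mat L lam t n N x z ≠ 0 := fun h => right_ne_zero_of_mul hw (by rw [h, map_zero])
    have h4 : y.2 = z.2 := by
      by_contra hc
      exact h2 (by simp [Model.Gamma0, hc])
    have e1 := Model.total_mom_eq_of_E0Mat hL ht hS.ω_even hQ h1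
    have e2 := Model.total_mom_eq_of_E0Mat hL ht hS.ω_even hQ h3
    have e3 : y = z := by
      refine Prod.ext ?_ h4
      rw [e1, h4] at e2
      exact sub_left_injective e2
    exact ⟨(y, x), by simp only [hδ, e3]⟩
  have hsupp' : ∀ w ∉ Set.range δ, f w = 0 := fun w hw => by
    by_contra h
    exact hw (hsupp w h)
  have hval : ∀ z : Label d × Label d, f (δ z) =
      ((S.gibbs L A z.1.2 * ‖S.E0Mat L lam t n N z.2 z.1‖ ^ 2 : ℝ) : ℂ) * elMat γ z.1.1 z.1.1 := by
    rintro ⟨y, x⟩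
    simp only [hf, hδ, Model.trTerm, Model.Gamma0, if_true]
    rw [mul_right_comm, Complex.mul_conj, Complex.normSq_eq_norm_sq]
    push_cast
    ring
  have hg0 : ∀ z : Label d × Label d,
      0 ≤ S.gibbs L A z.1.2 * ‖S.E0Mat L lam t n N z.2 z.1‖ ^ 2 :=
    fun z => mul_nonneg (S.gibbs_nonneg L A _) (by positivity)
  have hgE : ∀ z : Label d × Label d,
      ENNReal.ofReal (S.gibbs L A z.1.2 * ‖S.E0Mat L lam t n N z.2 z.1‖ ^ 2) =
      gibWeight (S.eBose L A) z.1.2 * ‖S.E0Mat L lam t n N z.2 z.1‖ₑ ^ 2 := by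
    intro z
    rw [ENNReal.ofReal_mul (S.gibbs_nonneg L A _), Model.ofReal_gibbs hA,
      ENNReal.ofReal_pow (norm_nonneg _), ofReal_norm]
  have hsum : ∀ c : Mode d → ENNReal, ∑' z : Label d × Label d,
      gibWeight (S.eBose L A) z.1.2 * ‖S.E0Mat L lam t n N z.2 z.1‖ₑ ^ 2 * c z.1.1 =
      ∑' p, c p * S.meanSq L A lam t n N p := by
    intro c
    rw [ENNReal.tsum_prod', ENNReal.tsum_prod']
    refine tsum_congr fun p => ?_
    rw [Model.meanSq, ← ENNReal.tsum_mul_left]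
    refine tsum_congr fun ν => ?_
    rw [← ENNReal.tsum_mul_left, ← ENNReal.tsum_mul_left]
    refine tsum_congr fun x => ?_
    ring
  obtain ⟨K, hK, hle⟩ := hS.exists_meanSq_le lam hL ht hA hQ n N
  have hfin : ∀ c : Mode d → ENNReal, ∑' p, c p ≠ ⊤ → ∑' p, c p * S.meanSq L A lam t n N p ≠ ⊤ := by
    intro c hc
    refine ne_top_of_le_ne_top ?_ (ENNReal.tsum_le_tsum fun p => mul_le_mul_right (hle p) (c p))
    rw [ENNReal.tsum_mul_right]
    exact ENNReal.mul_ne_top hc hK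
  have hel : ∑' p, ‖elMat γ p p‖ₑ ≠ ⊤ := by
    have h1 := hγ.2.summable.norm
    have h2 := h1.tsum_ofReal_ne_top
    simpa only [ofReal_norm] using h2
  have hs1 : Summable (f ∘ δ) := by
    refine summable_of_tsum_enorm ?_
    have e : ∀ z, ‖(f ∘ δ) z‖ₑ = gibWeight (S.eBose L A) z.1.2 *
        ‖S.E0Mat L lam t n N z.2 z.1‖ₑ ^ 2 * ‖elMat γ z.1.1 z.1.1‖ₑ := fun z => by
      rw [Function.comp_apply, hval, enorm_ofReal_mul (hg0 z), hgE]
    simp only [e]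
    rw [hsum fun p => ‖elMat γ p p‖ₑ]
    exact hfin _ hel
  have hs : Summable f := (hinj.summable_iff hsupp').1 hs1
  refine ⟨hs, ?_⟩
  have htr : S.tr L A γ lam t n N = ∑' z : Label d × Label d,
      S.gibbs L A z.1.2 * ‖S.E0Mat L lam t n N z.2 z.1‖ ^ 2 * (elMat γ z.1.1 z.1.1).re := by
    unfold Model.tr
    rw [← hf, ← hinj.tsum_eq (fun w hw => hsupp w hw)]
    refine (Complex.re_tsum hs1).trans (tsum_congr fun z => ?_)
    rw [Function.comp_apply, hval, Complex.re_ofReal_mul]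
  have hpos : ∀ z : Label d × Label d, 0 ≤ S.gibbs L A z.1.2 *
      ‖S.E0Mat L lam t n N z.2 z.1‖ ^ 2 * (elMat γ z.1.1 z.1.1).re :=
    fun z => mul_nonneg (hg0 z) (elMat_self_nonneg hγ _)
  have hsre : Summable fun z : Label d × Label d => S.gibbs L A z.1.2 *
      ‖S.E0Mat L lam t n N z.2 z.1‖ ^ 2 * (elMat γ z.1.1 z.1.1).re := by
    refine ((Complex.hasSum_re hs1.hasSum).summable).congr fun z => ?_
    rw [Function.comp_apply, hval, Complex.re_ofReal_mul]
  rw [htr, ← hsum fun p => ENNReal.ofReal (elMat γ p p).re]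
  rw [← ENNReal.toReal_ofReal (tsum_nonneg hpos), ENNReal.ofReal_tsum_of_nonneg hpos hsre]
  refine le_of_eq (congrArg _ (tsum_congr fun z => ?_))
  rw [ENNReal.ofReal_mul (hg0 z), hgE]

end Polaron
end

noncomputable section
set_option linter.unusedSectionVars false
namespace Polaron
variable {d : ℕ}

/-! ### The mean square and the pattern amplitudes -/

variable {S : Model d} {C₁ C₂ C₃ C₄ C₆ C₇ : ℝ}

/-- The words of a pattern with accidental coincidences of modes. -/
def Pat.Bad {n r N : ℕ} (P : Pat n r N) (w : Fin N → Letter d) : Prop :=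
  Allowed P.toM (fun b => (w b).1) ∧ Degenerate w

/-- The factor two of `|a + b|² ≤ 2(|a|² + |b|²)` is hidden in `2 ^ N`; for `N = 0` there is no bad
word and no factor is needed. The constants thus stay `N`-th powers. -/
theorem Pat.enorm_wordSum_sq_le {n r N : ℕ} (P : Pat n r N) {L lam t : ℝ} (hL : 0 < L)
    (ht : 0 ≤ t) (hQ : ∑' a : Letter d, S.eQ L a ≠ ⊤) (x y : Label d) :
    ‖S.wordSum L lam t (fun w : Fin N → Letter d => Allowed P.toM fun b => (w b).1) x y‖ₑ ^ 2 ≤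
      2 ^ N * (‖S.wordSum L lam t P.Good x y‖ₑ ^ 2 + ‖S.wordSum L lam t P.Bad x y‖ₑ ^ 2) := by
  classical
  have h1 := Model.summable_wordSum (lam := lam) hL ht hQ P.Good x y
  have h2 := Model.summable_wordSum (lam := lam) hL ht hQ P.Bad x y
  have e : S.wordSum L lam t (fun w : Fin N → Letter d => Allowed P.toM fun b => (w b).1) x y =
      S.wordSum L lam t P.Good x y + S.wordSum L lam t P.Bad x y := by
    refine Eq.trans (tsum_congr fun w => ?_) (h1.tsum_add h2)
    unfold Pat.Good Pat.Bad
    by_cases hD : Degenerate w <;> simp [hD]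
  rw [e]
  rcases Nat.eq_zero_or_pos N with h0 | h0
  · subst h0
    have hb : S.wordSum L lam t P.Bad x y = 0 := by
      unfold Model.wordSum
      refine (tsum_congr fun w => if_neg fun h => ?_).trans tsum_zero
      obtain ⟨i, -⟩ := h.1.2
      exact i.elim0
    rw [hb]
    simp
  · have h3 : (2 : ENNReal) ≤ 2 ^ N := by
      conv_lhs => rw [← pow_one (2 : ENNReal)]
      exact pow_le_pow_right₀ one_le_two h0
    refine le_trans ?_ (mul_le_mul_left h3 _)
    refine (pow_le_pow_left' (enorm_add_le _ _) 2).trans ?_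
    rw [add_sq', mul_assoc, two_mul (_ ^ 2 + _ ^ 2)]
    exact add_le_add le_rfl (ENNReal.two_mul_mul_le_sq_add_sq _ _)

theorem Model.eQ_tsum_sq_le {L : ℝ} {s b : ENNReal} (hQ : ∑' a : Letter d, S.eQ L a ≤ s)
    (hb : ∀ a, S.eQ L a ≤ b) : ∑' a : Letter d, S.eQ L a ^ 2 ≤ b * s := by
  refine le_trans (ENNReal.tsum_le_tsum fun a => ?_) ((ENNReal.tsum_mul_left (a := b)
    (f := fun a : Letter d => S.eQ L a)).le.trans (mul_le_mul_right hQ b))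
  rw [sq]
  exact mul_le_mul_left (hb a) _

open Classical in
theorem Model.tsum_joint_le {L : ℝ} {n r N : ℕ} (hN : N = n + 2 * r) {s b : ENNReal} (hs : 1 ≤ s)
    (hb1 : 1 ≤ b) (hQ : ∑' a : Letter d, S.eQ L a ≤ s) (hb : ∀ a, S.eQ L a ≤ b) :
    ∑' (v : Fin n → Letter d) (q : (Fin r → Letter d) × (Fin r → Letter d)),
      (if ClsInjective (joint v q) then 0 else ∏ i, S.latQ L (joint v q i)) ≤
    (if N = 0 then 0 else countConst (4 * b ^ 2) N * b ^ (N - 1)) *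
      (ENNReal.ofReal ((L ^ d)⁻¹) ^ N * s ^ (N - 1)) := by
  have hc : Fintype.card (Fin n ⊕ (Fin r ⊕ Fin r)) = N := by
    simp
    omega
  have h1 : ∑' (v : Fin n → Letter d) (q : (Fin r → Letter d) × (Fin r → Letter d)),
      (if ClsInjective (joint v q) then 0 else ∏ i, S.latQ L (joint v q i)) ≤
      ∑' a : Fin n ⊕ (Fin r ⊕ Fin r) → Letter d,
        (if ClsInjective a then 0 else ∏ i, S.latQ L (a i)) := by
    have h := ENNReal.tsum_comp_le_tsum_of_injective (joint_injective (d := d) (n := n) (r := r))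
      fun a => if ClsInjective a then 0 else ∏ i, S.latQ L (a i)
    rw [ENNReal.tsum_prod'] at h
    exact h
  refine h1.trans ?_
  -- Without letters nothing can coincide. This case is separated because the truncated exponent `N
  -- - 1` would otherwise leave an error that does not decay.
  split_ifs with h0
  · have : ∀ a : Fin n ⊕ (Fin r ⊕ Fin r) → Letter d, ClsInjective a := by
      intro a
      have : IsEmpty (Fin n ⊕ (Fin r ⊕ Fin r)) := Fintype.card_eq_zero_iff.1 (hc.trans h0)
      exact fun i => isEmptyElim i
    simp [this]
  · have h2 : ∀ a : Fin n ⊕ (Fin r ⊕ Fin r) → Letter d,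
        (if ClsInjective a then 0 else ∏ i, S.latQ L (a i)) =
        ENNReal.ofReal ((L ^ d)⁻¹) ^ N * if ClsInjective a then 0 else ∏ i, S.eQ L (a i) ^ 2 := by
      intro a
      split_ifs
      · rw [mul_zero]
      · simp only [Model.latQ, Finset.prod_mul_distrib, Finset.prod_const, Finset.card_univ, hc]
    simp only [h2]
    rw [ENNReal.tsum_mul_left]
    have h3 := tsum_not_clsInjective_le (ι := Fin n ⊕ (Fin r ⊕ Fin r)) (f := fun a => S.eQ L a ^ 2)
      (one_le_mul hb1 hs) (Model.eQ_tsum_sq_le hQ hb) fun a => pow_le_pow_left' (hb a) 2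
    rw [hc] at h3
    refine (mul_le_mul_right h3 _).trans (le_of_eq ?_)
    rw [mul_pow]
    ring

theorem Model.Admissible.tsum_gib_good_le (hS : S.Admissible C₁ C₂ C₃ C₄ C₆ C₇) {L lam t : ℝ}
    (hL : 0 < L) (ht : 0 ≤ t) {A : Set (Mode d)} (hA : Summable (S.boltz L A)) {n r N : ℕ}
    {s b : ENNReal} (hs : 1 ≤ s) (hs' : s ≠ ⊤) (hb1 : 1 ≤ b) (hb' : b ≠ ⊤)
    (hQ : ∑' a : Letter d, S.eQ L a ≤ s) (hb : ∀ a, S.eQ L a ≤ b) (P : Pat n r N) (p : Mode d) :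
    ∑' ν, gibWeight (S.eBose L A) ν * ∑' x, ‖S.wordSum L lam t P.Good x (p, ν)‖ₑ ^ 2 ≤
      n.factorial * ENNReal.ofReal (lam ^ 2) ^ N * (P.wordAvg S L (S.meanWeight L A) p t +
        ENNReal.ofReal (t ^ N) ^ 2 * errConst (ENNReal.ofReal (Real.exp (-(S.β * C₆)))) N *
        ((if N = 0 then 0 else countConst (4 * b ^ 2) N * b ^ (N - 1)) *
          (ENNReal.ofReal ((L ^ d)⁻¹) ^ N * s ^ (N - 1)))) := by
  classical
  have hQ' : ∑' a : Letter d, S.eQ L a ≠ ⊤ := ne_top_of_le_ne_top hs' hQ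
  have hlat : ∑' a : Letter d, S.latQ L a ≠ ⊤ := by
    unfold Model.latQ
    rw [ENNReal.tsum_mul_left]
    have := ne_top_of_le_ne_top (ENNReal.mul_ne_top hb' hs') (Model.eQ_tsum_sq_le hQ hb)
    finiteness
  have h1 : ∀ ν, gibWeight (S.eBose L A) ν * ∑' x, ‖S.wordSum L lam t P.Good x (p, ν)‖ₑ ^ 2 ≤
      n.factorial * ENNReal.ofReal (lam ^ 2) ^ N * ∑' v : Fin n → Letter d,
        gibWeight (S.eBose L A) ν * (ENNReal.ofReal (∏ j, S.randWeight L (v j) ν) *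
        ‖∑' u : Fin r → Letter d, ((if Separated v u then ∏ i, S.randWeight L (u i) ν else 0 : ℝ) : ℂ)
          * S.wordConv L p (P.expand v u) t‖ₑ ^ 2) := by
    intro ν
    refine (mul_le_mul_right (P.tsum_wordSum_sq_le hL ht hQ' (p, ν)) _).trans (le_of_eq ?_)
    simp only [P.enorm_coefSum_sq hL ht hS.Q_even]
    rw [ENNReal.tsum_mul_left, ENNReal.tsum_mul_left]
    ring
  refine (ENNReal.tsum_le_tsum h1).trans ?_
  rw [ENNReal.tsum_mul_left, ENNReal.tsum_comm]
  refine mul_le_mul_right ?_ _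
  refine (ENNReal.tsum_le_tsum fun v => hS.tsum_gib_coefSum_le hL ht hA hlat P p v).trans ?_
  rw [ENNReal.tsum_add, ENNReal.tsum_mul_left]
  exact add_le_add le_rfl (mul_le_mul_right (Model.tsum_joint_le P.card_eq hs hb1 hQ hb) _)

/-- The factor `4 ^ N` consists of `2 ^ N` for Cauchy-Schwarz over the patterns and `2 ^ N` for the
split into good and bad words. `K` is independent of the box, the active modes and the momentum. It
vanishes for `N = 0`, where the truncated exponent would not produce a small error. -/
theorem Model.Admissible.exists_meanSq_le_wordAvg (hS : S.Admissible C₁ C₂ C₃ C₄ C₆ C₇) (lam : ℝ)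
    {t : ℝ} (ht : 0 ≤ t) {n r N : ℕ} (hN : N = n + 2 * r) {b : ENNReal} (hb1 : 1 ≤ b)
    (hb' : b ≠ ⊤) (Pf : patterns n N → Pat n r N) (hPf : ∀ m, (Pf m).toM = m.1) :
    ∃ K : ENNReal, K ≠ ⊤ ∧ (N = 0 → K = 0) ∧ ∀ L : ℝ, 0 < L → ∀ A : Set (Mode d), Summable (S.boltz L A) →
      ∀ s : ENNReal, 1 ≤ s → s ≠ ⊤ → ∑' a : Letter d, S.eQ L a ≤ s → (∀ a, S.eQ L a ≤ b) →
      ∀ p, S.meanSq L A lam t n N p ≤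
        4 ^ N * (n.factorial * ENNReal.ofReal (lam ^ 2) ^ N) *
          ∑ m, (Pf m).wordAvg S L (S.meanWeight L A) p t +
        K * (ENNReal.ofReal ((L ^ d)⁻¹) ^ N * s ^ (N - 1)) := by
  set x := ENNReal.ofReal (Real.exp (-(S.β * C₆)))
  have hx1 : x < 1 := hS.ofReal_exp_gap_lt_one
  set a₁ : ENNReal := n.factorial * ENNReal.ofReal (lam ^ 2) ^ N with ha₁
  set a₂ : ENNReal := ENNReal.ofReal (t ^ N) ^ 2 * errConst x N *
    (if N = 0 then 0 else countConst (4 * b ^ 2) N * b ^ (N - 1)) with ha₂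
  set a₃ : ENNReal := if N = 0 then 0 else ENNReal.ofReal (lam ^ 2) ^ N *
    ENNReal.ofReal (t ^ 2) ^ N * meanConst x N * countConst (4 * b) (N + N) with ha₃
  have ha₁' : a₁ ≠ ⊤ := by finiteness
  have ha₂' : a₂ ≠ ⊤ := by
    have h1 := errConst_ne_top hx1 N
    have h2 := countConst_ne_top (B := 4 * b ^ 2) (by finiteness) N
    rw [ha₂]
    split_ifs <;> finiteness
  have ha₃' : a₃ ≠ ⊤ := by
    have h1 := meanConst_ne_top hx1 N
    have h2 := countConst_ne_top (B := 4 * b) (by finiteness) (N + N)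
    rw [ha₃]
    split_ifs <;> finiteness
  refine ⟨4 ^ N * (Fintype.card (patterns n N) * (a₁ * a₂ + a₃)), by finiteness,
    fun h0 => by simp [ha₂, ha₃, h0], fun L hL A hA s hs hs' hQ hb p => ?_⟩
  have hQ' : ∑' a : Letter d, S.eQ L a ≠ ⊤ := ne_top_of_le_ne_top hs' hQ
  set ε := ENNReal.ofReal ((L ^ d)⁻¹) ^ N * s ^ (N - 1) with hε
  have hgood : ∀ m, ∑' ν, gibWeight (S.eBose L A) ν *
      ∑' y, ‖S.wordSum L lam t (Pf m).Good y (p, ν)‖ₑ ^ 2 ≤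
      a₁ * ((Pf m).wordAvg S L (S.meanWeight L A) p t + a₂ * ε) := by
    intro m
    refine (hS.tsum_gib_good_le hL ht hA hs hs' hb1 hb' hQ hb (Pf m) p).trans (le_of_eq ?_)
    rw [ha₂, mul_assoc (ENNReal.ofReal (t ^ N) ^ 2 * errConst x N)]
  have hbad : ∀ m, ∑' ν, gibWeight (S.eBose L A) ν *
      ∑' y, ‖S.wordSum L lam t (Pf m).Bad y (p, ν)‖ₑ ^ 2 ≤ a₃ * ε := by
    intro m
    rw [ha₃]
    split_ifs with h0
    · have : ∀ ν y, S.wordSum L lam t (Pf m).Bad y (p, ν) = 0 := by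
        intro ν y
        unfold Model.wordSum
        refine (tsum_congr fun w => if_neg fun h => ?_).trans tsum_zero
        obtain ⟨i, -⟩ := h.1.2
        exact absurd i.2 (by omega)
      simp [this]
    · refine (hS.tsum_gib_degenerate_le hL ht hA hs hQ hb (Pf m).Bad (fun w hw => hw.2) p).trans
        (le_of_eq ?_)
      have hv : ENNReal.ofReal (vertexConst d L lam t) = ENNReal.ofReal (lam ^ 2) *
          ENNReal.ofReal ((L ^ d)⁻¹) * ENNReal.ofReal (t ^ 2) := by
        rw [vertexConst, ENNReal.ofReal_mul (by positivity), ENNReal.ofReal_mul (by positivity)]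
      rw [hv, mul_pow, mul_pow, hε]
      ring
  have hcard : (Fintype.card (patterns n N) : ENNReal) ≤ 2 ^ N := by
    rw [Fintype.card_coe]
    exact_mod_cast card_patterns_le hN
  have hpt : ∀ ν, gibWeight (S.eBose L A) ν * ∑' y, ‖S.E0Mat L lam t n N y (p, ν)‖ₑ ^ 2 ≤
      4 ^ N * ∑ m, (gibWeight (S.eBose L A) ν *
        ∑' y, ‖S.wordSum L lam t (Pf m).Good y (p, ν)‖ₑ ^ 2 + gibWeight (S.eBose L A) ν *
        ∑' y, ‖S.wordSum L lam t (Pf m).Bad y (p, ν)‖ₑ ^ 2) := by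
    intro ν
    simp only [← mul_add]
    rw [← Finset.mul_sum, mul_left_comm]
    refine mul_le_mul_right ?_ _
    simp only [← ENNReal.tsum_add]
    rw [← Summable.tsum_finsetSum fun _ _ => ENNReal.summable, ← ENNReal.tsum_mul_left]
    refine ENNReal.tsum_le_tsum fun y => ?_
    rw [Model.E0Mat_eq hL ht hS.ω_even hQ', ← Finset.sum_coe_sort]
    have h1 : ∀ m : patterns n N, ‖S.wordSum L lam t
        (fun w : Fin N → Letter d => Allowed m.1 fun b => (w b).1) y (p, ν)‖ₑ ^ 2 ≤
        2 ^ N * (‖S.wordSum L lam t (Pf m).Good y (p, ν)‖ₑ ^ 2 +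
        ‖S.wordSum L lam t (Pf m).Bad y (p, ν)‖ₑ ^ 2) := fun m => by
      rw [← hPf m]
      exact (Pf m).enorm_wordSum_sq_le hL ht hQ' y (p, ν)
    refine ((enorm_sum_sq_le _).trans (mul_le_mul' hcard
      (Finset.sum_le_sum fun m _ => h1 m))).trans (le_of_eq ?_)
    rw [← Finset.mul_sum, ← mul_assoc, ← mul_pow]
    norm_num
  unfold Model.meanSq
  refine (ENNReal.tsum_le_tsum hpt).trans ?_
  rw [ENNReal.tsum_mul_left, Summable.tsum_finsetSum fun _ _ => ENNReal.summable]
  simp only [ENNReal.tsum_add]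
  refine (mul_le_mul_right (Finset.sum_le_sum fun m _ => add_le_add (hgood m) (hbad m)) _).trans
    (le_of_eq ?_)
  rw [Finset.sum_add_distrib, ← Finset.mul_sum, Finset.sum_add_distrib, Finset.sum_const,
    Finset.sum_const, Finset.card_univ, nsmul_eq_mul, nsmul_eq_mul]
  ring

end Polaron
end

noncomputable section
set_option linter.unusedSectionVars false
namespace Polaron
variable {d : ℕ}

/-! ### The pattern averages of the box -/

variable {S : Model d} {C₁ C₂ C₃ C₄ C₆ C₇ : ℝ}

theorem Model.meanWeight_univ (hω : ∀ k, S.ω (-k) = S.ω k) (L : ℝ) (a : Letter d) :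
    S.meanWeight L Set.univ a = S.latWeight L a := by
  have h : S.occ (mom L a.mode) = S.occ (mom L a.1) := by
    have : S.ω (mom L a.mode) = S.ω (mom L a.1) := by
      unfold Letter.mode
      rcases Int.units_eq_one_or a.2 with h1 | h1
      · simp [h1]
      · simp [h1, mom_neg, hω]
    unfold Model.occ
    rw [this]
  unfold Model.meanWeight Model.latWeight Model.M Model.occIn
  rw [if_pos (Set.mem_univ _), h]
  ring

theorem Model.Admissible.meanWeight_le (hS : S.Admissible C₁ C₂ C₃ C₄ C₆ C₇) {L : ℝ} (hL : 0 < L)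
    (A : Set (Mode d)) (a : Letter d) : S.meanWeight L A a ≤ S.latWeight L a := by
  rw [← Model.meanWeight_univ hS.ω_even]
  unfold Model.meanWeight
  refine mul_le_mul_of_nonneg_left ?_ (by positivity)
  unfold Model.occIn
  rw [if_pos (Set.mem_univ _)]
  split_ifs
  · exact le_rfl
  · have := hS.occ_nonneg (mom L a.mode)
    linarith

theorem Model.Admissible.tendsto_meanWeight (hS : S.Admissible C₁ C₂ C₃ C₄ C₆ C₇) (L : ℝ)
    (a : Letter d) : Tendsto (fun A : Finset (Mode d) => S.meanWeight L (A : Set (Mode d)) a) atTop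
      (nhds (S.latWeight L a)) := by
  refine tendsto_const_nhds.congr' ?_
  filter_upwards [eventually_ge_atTop {a.mode}] with A hA
  rw [← Model.meanWeight_univ hS.ω_even]
  have : a.mode ∈ (A : Set (Mode d)) := hA (Finset.mem_singleton_self _)
  unfold Model.meanWeight Model.occIn
  rw [if_pos (Set.mem_univ _), if_pos this]

theorem lintegral_latticeMeasure (L : ℝ) (f : Mom d → ENNReal) :
    ∫⁻ k, f k ∂(latticeMeasure d L) = ENNReal.ofReal ((L ^ d)⁻¹) * ∑' m, f (mom L m) := by
  unfold latticeMeasure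
  rw [lintegral_smul_measure, lintegral_sum_measure]
  simp

theorem lintegral_pi_latticeMeasure {L : ℝ} (hL : 0 < L) {n : ℕ} {f : (Fin n → Mom d) → ENNReal}
    (hf : Measurable f) : ∫⁻ k, f k ∂(Measure.pi fun _ => latticeMeasure d L) =
      ENNReal.ofReal ((L ^ d)⁻¹) ^ n * ∑' m : Fin n → Mode d, f fun j => mom L (m j) := by
  have := sigmaFinite_latticeMeasure (d := d) hL
  induction n with
  | zero =>
    rw [Measure.pi_of_empty _ (fun i => i.elim0), lintegral_dirac,
      tsum_eq_single Fin.elim0 fun w hw => absurd (Subsingleton.elim _ _) hw]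
    simp only [pow_zero, one_mul]
    congr 1
    exact Subsingleton.elim _ _
  | succ n ih =>
    have hcons : ∀ x : Mom d, Measurable fun k : Fin n → Mom d =>
        (Fin.cons x k : Fin (n + 1) → Mom d) := fun x => by
      refine measurable_pi_lambda _ fun j => ?_
      refine Fin.cases ?_ (fun j => ?_) j
      · simp
      · simpa using measurable_pi_apply j
    rw [lintegral_pi_succ _ hf]
    simp only [lintegral_latticeMeasure]
    have hm : Measurable fun k : Fin n → Mom d =>
        ENNReal.ofReal ((L ^ d)⁻¹) * ∑' m, f (Fin.cons (mom L m) k) :=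
      (Measurable.tsum fun m => hf.comp (hcons _)).const_mul _
    rw [ih hm, tsum_fin_succ, ENNReal.tsum_mul_left, pow_succ, mul_assoc]
    congr 3
    funext w
    refine tsum_congr fun a => congrArg f (funext fun j => ?_)
    refine Fin.cases ?_ (fun j => ?_) j <;> simp

variable {L G T : ℝ}

/-- External integrals over the lattice are sums over letters with `L^{-d}` per phonon, and the
inner sums come from `amp_lattice`. This identification transfers the factorial bound to the trace.
-/
theorem Model.Dispersive.avg_eq_wordAvg (h : S.Dispersive (latticeMeasure d L) G T) (hL : 0 < L)
    (hω : ∀ k, S.ω (-k) = S.ω k) {n r N : ℕ} (P : Pat n r N) (p : Mode d) {t : ℝ} (ht : 0 ≤ t) :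
    P.avg S (latticeMeasure d L) (mom L p) t = P.wordAvg S L (S.latWeight L) p t := by
  have hm : ∀ σ : Fin n → ℤˣ, Measurable fun k : Fin n → Mom d =>
      ENNReal.ofReal (∏ j, S.M (k j) (σ j)) *
        ‖P.amp S (latticeMeasure d L) (mom L p) k σ t‖ₑ ^ 2 := fun σ =>
    (h.continuous_weight σ).measurable.ennreal_ofReal.mul
      ((((h.continuous_amp P σ).comp (by fun_prop :
        Continuous fun k : Fin n → Mom d => ((mom L p, k), t))).measurable.enorm).pow_const 2)
  unfold Pat.avg Pat.wordAvg
  set e := Equiv.arrowProdEquivProdArrow (Fin n) (fun _ => Mode d) (fun _ => ℤˣ)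
  rw [← e.symm.tsum_eq, ENNReal.tsum_prod', ENNReal.tsum_comm, tsum_fintype]
  refine Finset.sum_congr rfl fun σ _ => ?_
  rw [lintegral_pi_latticeMeasure hL (hm σ), ← ENNReal.tsum_mul_left]
  refine tsum_congr fun m => ?_
  have hamp := h.amp_lattice hL hω P p (e.symm (m, σ)) ht
  have e1 : (fun j => mom L (e.symm (m, σ) j).1) = fun j => mom L (m j) := rfl
  have e2 : (fun j => (e.symm (m, σ) j).2) = σ := rfl
  rw [e1, e2] at hamp
  rw [hamp, ← mul_assoc]
  congr 1
  rw [← ENNReal.ofReal_pow (by positivity), ← ENNReal.ofReal_mul (by positivity)]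
  congr 1
  have e3 : ∀ j, S.latWeight L (e.symm (m, σ) j) = (L ^ d)⁻¹ * S.M (mom L (m j)) (σ j) :=
    fun j => rfl
  simp only [e3, Finset.prod_mul_distrib, Finset.prod_const, Finset.card_univ, Fintype.card_fin]

theorem tendsto_tsum_of_dominated {ι B : Type*} {l : Filter B} {f : B → ι → ENNReal}
    {f₀ g : ι → ENNReal} (hg : ∑' i, g i ≠ ⊤) (hle : ∀ b i, f b i ≤ g i) (h0 : ∀ i, f₀ i ≤ g i)
    (h : ∀ i, Tendsto (fun b => f b i) l (nhds (f₀ i))) :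
    Tendsto (fun b => ∑' i, f b i) l (nhds (∑' i, f₀ i)) := by
  have hgi : ∀ i, g i ≠ ⊤ := fun i => ne_top_of_le_ne_top hg (ENNReal.le_tsum i)
  have hf : ∀ b, ∑' i, f b i ≠ ⊤ := fun b => ne_top_of_le_ne_top hg (ENNReal.tsum_le_tsum (hle b))
  have hf0 : ∑' i, f₀ i ≠ ⊤ := ne_top_of_le_ne_top hg (ENNReal.tsum_le_tsum h0)
  have h0i : ∀ i, f₀ i ≠ ⊤ := fun i => ne_top_of_le_ne_top (hgi i) (h0 i)
  have hfi : ∀ b i, f b i ≠ ⊤ := fun b i => ne_top_of_le_ne_top (hgi i) (hle b i)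
  rw [← ENNReal.tendsto_toReal_iff hf hf0]
  simp only [ENNReal.tsum_toReal_eq (hfi _), ENNReal.tsum_toReal_eq h0i]
  refine tendsto_tsum_of_dominated_convergence (bound := fun i => (g i).toReal)
    (ENNReal.summable_toReal hg) (fun i => (ENNReal.tendsto_toReal (h0i i)).comp (h i))
    (Eventually.of_forall fun b i => ?_)
  rw [Real.norm_of_nonneg ENNReal.toReal_nonneg]
  exact ENNReal.toReal_mono (hgi i) (hle b i)

theorem Pat.inner_bound {n r N : ℕ} (P : Pat n r N) (L : ℝ) {W : Letter d → ℝ}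
    {W' : Letter d → ℝ} (h0 : ∀ a, 0 ≤ W' a) (hle : ∀ a, W' a ≤ W a) (p : Mode d) {t : ℝ}
    (ht : 0 ≤ t) (v : Fin n → Letter d) (u : Fin r → Letter d) :
    ‖((∏ i, W' (u i) : ℝ) : ℂ) * S.wordConv L p (P.expand v u) t‖ ≤ (∏ i, W (u i)) * t ^ N := by
  rw [norm_mul, Complex.norm_real, Real.norm_of_nonneg (Finset.prod_nonneg fun i _ => h0 _)]
  exact mul_le_mul (Finset.prod_le_prod (fun i _ => h0 _) fun i _ => hle _)
    (S.norm_wordConv_le L p _ ht) (norm_nonneg _)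
    (Finset.prod_nonneg fun i _ => (h0 _).trans (hle _))

theorem Pat.wordAvg_term_le {n r N : ℕ} (P : Pat n r N) (L : ℝ) {W : Letter d → ℝ}
    (hW : Summable W) {W' : Letter d → ℝ} (h0 : ∀ a, 0 ≤ W' a) (hle : ∀ a, W' a ≤ W a) (p : Mode d)
    {t : ℝ} (ht : 0 ≤ t) (v : Fin n → Letter d) :
    ENNReal.ofReal (∏ j, W' (v j)) *
      ‖∑' u : Fin r → Letter d, ((∏ i, W' (u i) : ℝ) : ℂ) * S.wordConv L p (P.expand v u) t‖ₑ ^ 2 ≤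
    (∏ j, ENNReal.ofReal (W (v j))) *
      ENNReal.ofReal ((∑' u : Fin r → Letter d, (∏ i, W (u i)) * t ^ N) ^ 2) := by
  have hs := (summable_prod_fin (fun a => (h0 a).trans (hle a)) hW r).mul_right (t ^ N)
  refine mul_le_mul' ?_ ?_
  · rw [← ENNReal.ofReal_prod_of_nonneg fun i _ => (h0 _).trans (hle _)]
    exact ENNReal.ofReal_le_ofReal (Finset.prod_le_prod (fun i _ => h0 _) fun i _ => hle _)
  · rw [← ofReal_norm, ← ENNReal.ofReal_pow (norm_nonneg _)]
    refine ENNReal.ofReal_le_ofReal (pow_le_pow_left₀ (norm_nonneg _) ?_ 2)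
    exact tsum_of_norm_bounded hs.hasSum fun u => P.inner_bound L h0 hle p ht v u

/-- Dominated convergence twice, inside the absolute value and over the external words, with the
limiting weights as majorant. The bound holds for all smaller weights and all momenta, so a further
average over the electron state is possible. -/
theorem Pat.tendsto_wordAvg {n r N : ℕ} (P : Pat n r N) (S : Model d) (L : ℝ) {W : Letter d → ℝ}
    (hW0 : ∀ a, 0 ≤ W a) (hW : Summable W) {t : ℝ} (ht : 0 ≤ t) :
    ∃ K : ENNReal, K ≠ ⊤ ∧ (∀ W' : Letter d → ℝ, (∀ a, 0 ≤ W' a) → (∀ a, W' a ≤ W a) → ∀ p,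
      P.wordAvg S L W' p t ≤ K) ∧
    ∀ {B : Type} (l : Filter B) (W' : B → Letter d → ℝ), (∀ b a, 0 ≤ W' b a) →
      (∀ b a, W' b a ≤ W a) → (∀ a, Tendsto (fun b => W' b a) l (nhds (W a))) → ∀ p,
      Tendsto (fun b => P.wordAvg S L (W' b) p t) l (nhds (P.wordAvg S L W p t)) := by
  set D := ENNReal.ofReal ((∑' u : Fin r → Letter d, (∏ i, W (u i)) * t ^ N) ^ 2) with hD
  have hfin : ∑' v : Fin n → Letter d, (∏ j, ENNReal.ofReal (W (v j))) * D ≠ ⊤ := by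
    rw [ENNReal.tsum_mul_right, tsum_prod_pow (fun a => ENNReal.ofReal (W a)) n]
    have := hW.tsum_ofReal_ne_top
    finiteness
  have hs := (summable_prod_fin hW0 hW r).mul_right (t ^ N)
  refine ⟨_, hfin, fun W' h0 hle p => ENNReal.tsum_le_tsum fun v =>
    P.wordAvg_term_le L hW h0 hle p ht v, fun l W' h0 hle hlim p => ?_⟩
  refine tendsto_tsum_of_dominated hfin (fun b v => P.wordAvg_term_le L hW (h0 b) (hle b) p ht v)
    (fun v => P.wordAvg_term_le L hW hW0 (fun _ => le_rfl) p ht v) fun v => ?_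
  have h1 : Tendsto (fun b => ENNReal.ofReal (∏ j, W' b (v j))) l
      (nhds (ENNReal.ofReal (∏ j, W (v j)))) :=
    ENNReal.tendsto_ofReal (tendsto_finsetProd _ fun j _ => hlim (v j))
  have h2 : Tendsto (fun b => ∑' u : Fin r → Letter d, ((∏ i, W' b (u i) : ℝ) : ℂ) *
      S.wordConv L p (P.expand v u) t) l (nhds (∑' u : Fin r → Letter d,
        ((∏ i, W (u i) : ℝ) : ℂ) * S.wordConv L p (P.expand v u) t)) := by
    refine tendsto_tsum_of_dominated_convergence hs (fun u => ?_)
      (Eventually.of_forall fun b u => P.inner_bound L (h0 b) (hle b) p ht v u)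
    refine Tendsto.mul_const _ ((Complex.continuous_ofReal.tendsto _).comp ?_)
    exact tendsto_finsetProd _ fun i _ => hlim (u i)
  have h3 := ENNReal.Tendsto.pow (n := 2) h2.enorm
  exact ENNReal.Tendsto.mul h1 (Or.inr (by finiteness)) h3 (Or.inr ENNReal.ofReal_ne_top)

end Polaron
end

/-! ### Average over the electron state and the limit of large boxes. -/

noncomputable section
set_option linter.unusedSectionVars false
namespace Polaron
variable {d : ℕ}
variable {S : Model d} {C₁ C₂ C₃ C₄ C₆ C₇ : ℝ}

theorem Model.Admissible.exists_Q_le_decay (hd : 3 ≤ d) (hS : S.Admissible C₁ C₂ C₃ C₄ C₆ C₇) :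
    ∃ K : ℝ, 0 ≤ K ∧ ∀ k, |S.Q k| ≤ K * decay k := by
  have := nontrivial_mom hd
  obtain ⟨u, hu⟩ := exists_norm_eq (Mom d) (zero_le_one (α := ℝ))
  refine ⟨|C₇| * 2 ^ (2 * d + 12), by positivity, fun k => ((hS.derivBound_Q hd hu).base.2 k).trans ?_⟩
  have h1 := one_le_jap k
  refine mul_le_mul_of_nonneg_left ?_ (by positivity)
  unfold decay
  exact inv_anti₀ (by positivity) (pow_le_pow_right₀ h1 (by omega))

theorem Model.tsum_eQ (S : Model d) (L : ℝ) :
    ∑' a : Letter d, S.eQ L a = 2 * ∑' m : Mode d, ‖S.Q (mom L m)‖ₑ := by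
  rw [ENNReal.tsum_prod']
  simp only [Model.eQ, tsum_fintype, Finset.sum_const, Finset.card_univ, Fintype.card_units_int,
    nsmul_eq_mul, ENNReal.tsum_mul_left]
  norm_num

theorem Model.Admissible.exists_eQ_bound (hd : 3 ≤ d) (hS : S.Admissible C₁ C₂ C₃ C₄ C₆ C₇) :
    ∃ b : ENNReal, 1 ≤ b ∧ b ≠ ⊤ ∧ (∀ L a, S.eQ L a ≤ b) ∧
      (∀ L : ℝ, 0 < L → ∑' a : Letter d, S.eQ L a ≠ ⊤) ∧
      ∃ c : ℝ, 1 ≤ c ∧ ∀ᶠ L : ℝ in atTop, ∑' a : Letter d, S.eQ L a ≤ ENNReal.ofReal (c * L ^ d) := by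
  obtain ⟨K, hK, hQ⟩ := hS.exists_Q_le_decay hd
  have hle : ∀ L : ℝ, ∀ m : Mode d, ‖S.Q (mom L m)‖ₑ ≤ ENNReal.ofReal (K * decay (mom L m)) :=
    fun L m => by
      rw [← ofReal_norm, Real.norm_eq_abs]
      exact ENNReal.ofReal_le_ofReal (hQ _)
  have hsum : ∀ L : ℝ, 0 < L → ∑' a : Letter d, S.eQ L a ≤
      ENNReal.ofReal (2 * (K * ∑' m : Mode d, decay (mom L m))) := fun L hL => by
    rw [S.tsum_eQ, ENNReal.ofReal_mul zero_le_two, ENNReal.ofReal_ofNat, ← tsum_mul_left,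
      ENNReal.ofReal_tsum_of_nonneg (fun m => mul_nonneg hK (decay_pos _).le)
        ((summable_decay_mom hL).mul_left K)]
    exact mul_le_mul_right (ENNReal.tsum_le_tsum (hle L)) _
  refine ⟨ENNReal.ofReal K + 1, le_add_self, by finiteness, fun L a => ?_, fun L hL =>
    ne_top_of_le_ne_top ENNReal.ofReal_ne_top (hsum L hL), ?_⟩
  · refine (hle L a.1).trans (le_add_right (ENNReal.ofReal_le_ofReal ?_))
    exact mul_le_of_le_one_right hK (decay_le_one _)
  · obtain ⟨L₀, -, K', hK', h⟩ := exists_summable_decay (d := d)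
    refine ⟨2 * (K * K') + 1, by nlinarith [mul_nonneg hK hK'], ?_⟩
    filter_upwards [eventually_ge_atTop L₀, eventually_gt_atTop 0] with L hL hL0
    refine (hsum L hL0).trans (ENNReal.ofReal_le_ofReal ?_)
    have hpos : 0 < L ^ d := by positivity
    have h1 : ∑' m : Mode d, decay (mom L m) ≤ K' * L ^ d := by
      have := (h L hL).2
      rwa [inv_mul_le_iff₀ hpos, mul_comm] at this
    nlinarith [mul_le_mul_of_nonneg_left h1 hK]

/-- The average of the squared word sums over the electron momentum and over the patterns. -/
def Model.stateAvg (S : Model d) (L : ℝ) {n r N : ℕ} (Pf : patterns n N → Pat n r N)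
    (γ : ElSpace d →L[ℂ] ElSpace d) (W : Letter d → ℝ) (t : ℝ) : ENNReal :=
  ∑' p, ENNReal.ofReal (elMat γ p p).re * ∑ m, (Pf m).wordAvg S L W p t

variable {G L T : ℝ} {γ : ElSpace d →L[ℂ] ElSpace d} {n r N : ℕ}

theorem Model.Dispersive.stateAvg_latWeight_le (h : S.Dispersive (latticeMeasure d L) G T)
    (hL : 0 < L) (hω : ∀ k, S.ω (-k) = S.ω k) (hN : N = n + 2 * r)
    (Pf : patterns n N → Pat n r N) (hγ : IsDensity γ) {t : ℝ} (ht : 0 ≤ t) (htT : t ≤ T) :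
    S.stateAvg L Pf γ (S.latWeight L) t ≤
      2 ^ N * ENNReal.ofReal ((4 * G * decayMass) ^ N / ((n + r).factorial : ℝ) * t ^ N) := by
  have := sigmaFinite_latticeMeasure (d := d) hL
  set D := ENNReal.ofReal ((4 * G * decayMass) ^ N / ((n + r).factorial : ℝ) * t ^ N)
  have h1 : ∀ p, ∑ m, (Pf m).wordAvg S L (S.latWeight L) p t ≤ 2 ^ N * D := fun p => by
    refine (Finset.sum_le_card_nsmul _ _ D fun m _ => ?_).trans ?_
    · rw [← h.avg_eq_wordAvg hL hω (Pf m) p ht]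
      exact h.avg_le (Pf m) _ ht htT
    · rw [nsmul_eq_mul]
      refine mul_le_mul_left ?_ _
      rw [Finset.card_univ, Fintype.card_coe]
      exact_mod_cast card_patterns_le hN
  refine (ENNReal.tsum_le_tsum fun p => mul_le_mul_right (h1 p) _).trans ?_
  rw [ENNReal.tsum_mul_right, tsum_ofReal_elMat hγ, one_mul]

theorem Model.stateAvg_tendsto (S : Model d) (L : ℝ) (Pf : patterns n N → Pat n r N)
    (hγ : IsDensity γ) {W : Letter d → ℝ} (hW0 : ∀ a, 0 ≤ W a) (hW : Summable W) {t : ℝ}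
    (ht : 0 ≤ t) {B : Type} (l : Filter B) {W' : B → Letter d → ℝ} (h0 : ∀ b a, 0 ≤ W' b a)
    (hle : ∀ b a, W' b a ≤ W a) (hlim : ∀ a, Tendsto (fun b => W' b a) l (nhds (W a))) :
    (∀ b, S.stateAvg L Pf γ (W' b) t ≠ ⊤) ∧
    Tendsto (fun b => S.stateAvg L Pf γ (W' b) t) l (nhds (S.stateAvg L Pf γ W t)) := by
  choose K hK hb hl using fun m => (Pf m).tendsto_wordAvg S L hW0 hW ht
  have hfin : ∑' p, ENNReal.ofReal (elMat γ p p).re * ∑ m, K m ≠ ⊤ := by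
    rw [ENNReal.tsum_mul_right, tsum_ofReal_elMat hγ, one_mul]
    exact ENNReal.sum_ne_top.2 fun m _ => hK m
  have hbd : ∀ V : Letter d → ℝ, (∀ a, 0 ≤ V a) → (∀ a, V a ≤ W a) → ∀ p,
      ENNReal.ofReal (elMat γ p p).re * ∑ m, (Pf m).wordAvg S L V p t ≤
        ENNReal.ofReal (elMat γ p p).re * ∑ m, K m := fun V hV0 hV p =>
    mul_le_mul_right (Finset.sum_le_sum fun m _ => hb m V hV0 hV p) _
  refine ⟨fun b => ne_top_of_le_ne_top hfin (ENNReal.tsum_le_tsum (hbd _ (h0 b) (hle b))),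
    tendsto_tsum_of_dominated hfin (fun b => hbd _ (h0 b) (hle b))
      (hbd _ hW0 fun _ => le_rfl) fun p => ?_⟩
  refine ENNReal.Tendsto.const_mul (tendsto_finsetSum _ fun m _ => hl m l W' h0 hle hlim p)
    (Or.inr ENNReal.ofReal_ne_top)

/-- The factor `8 = 4 · 2` combines the losses in the mean square with the number of patterns in the
final sum. The error term is of order `L^{-d}`, or zero for `N = 0`, and is independent of the
electron state, which may therefore vary with the box. -/
theorem Model.Admissible.exists_tr_le (hd : 3 ≤ d) (hS : S.Admissible C₁ C₂ C₃ C₄ C₆ C₇)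
    (lam : ℝ) {t : ℝ} (ht : 0 ≤ t) (hG : ∀ᶠ L : ℝ in atTop, S.Dispersive (latticeMeasure d L) G t)
    (hN : N = n + 2 * r) :
    ∃ err : ℝ → ℝ, Tendsto err atTop (nhds 0) ∧ ∀ᶠ L : ℝ in atTop,
      ∀ γ : ElSpace d →L[ℂ] ElSpace d, IsDensity γ →
      (Summable (S.boltz L Set.univ) → S.tr L Set.univ γ lam t n N ≤
        n.factorial * (lam ^ (2 * N) * ((8 * (4 * G * decayMass)) ^ N /
          ((n + r).factorial : ℝ) * t ^ N)) + err L) ∧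
      limsup (fun A : Finset (Mode d) =>
        ((S.tr L (A : Set (Mode d)) γ lam t n N : ℝ) : EReal)) atTop ≤
        ((n.factorial * (lam ^ (2 * N) * ((8 * (4 * G * decayMass)) ^ N /
          ((n + r).factorial : ℝ) * t ^ N)) + err L : ℝ) : EReal) := by
  obtain ⟨b, hb1, hb', hQb, hQfin, c, hc, hQs⟩ := hS.exists_eQ_bound hd
  have hP : ∀ m : patterns n N, ∃ P : Pat n r N, P.toM = m.1 := fun m => exists_pat m.2 r hN
  choose Pf hPf using hP
  obtain ⟨K, hK, hK0, hmean⟩ := hS.exists_meanSq_le_wordAvg lam ht hN hb1 hb' Pf hPf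
  refine ⟨fun L => K.toReal * (c ^ (N - 1) * (L ^ d)⁻¹), ?_, ?_⟩
  · have h1 : Tendsto (fun L : ℝ => (L ^ d)⁻¹) atTop (nhds 0) :=
      tendsto_inv_atTop_zero.comp (tendsto_pow_atTop (by omega))
    simpa using (h1.const_mul (c ^ (N - 1))).const_mul K.toReal
  filter_upwards [hG, hQs, eventually_ge_atTop 1] with L hdisp hs hL1 γ hγ
  have hL : 0 < L := one_pos.trans_le hL1
  have hLd : 1 ≤ L ^ d := one_le_pow₀ hL1
  set E := K * (ENNReal.ofReal ((L ^ d)⁻¹) ^ N * ENNReal.ofReal (c * L ^ d) ^ (N - 1)) with hE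
  have hEfin : E ≠ ⊤ := by finiteness
  -- `L^{-dN} (c L^d)^{N-1} = c^{N-1} L^{-d}` for positive `N`; for `N = 0` the constant `K` is
  -- zero.
  have hEle : E.toReal = K.toReal * (c ^ (N - 1) * (L ^ d)⁻¹) := by
    rw [hE, ENNReal.toReal_mul, ENNReal.toReal_mul, ENNReal.toReal_pow, ENNReal.toReal_pow,
      ENNReal.toReal_ofReal (by positivity), ENNReal.toReal_ofReal (by positivity)]
    rcases Nat.eq_zero_or_pos N with h0 | h0
    · simp [hK0 h0]
    · obtain ⟨k, rfl⟩ := Nat.exists_eq_succ_of_ne_zero h0.ne'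
      simp only [Nat.succ_eq_add_one, Nat.add_sub_cancel]
      have h1 : (L ^ d)⁻¹ * (c * L ^ d) = c := by field_simp
      rw [pow_succ', mul_assoc (L ^ d)⁻¹, ← mul_pow, h1, mul_comm (L ^ d)⁻¹]
  set q : ENNReal := 4 ^ N * (n.factorial * ENNReal.ofReal (lam ^ 2) ^ N) with hq
  have hqfin : q ≠ ⊤ := by finiteness
  have key : ∀ A : Set (Mode d), Summable (S.boltz L A) →
      S.stateAvg L Pf γ (S.meanWeight L A) t ≠ ⊤ → S.tr L A γ lam t n N ≤
        (q * S.stateAvg L Pf γ (S.meanWeight L A) t).toReal + E.toReal := fun A hA hfin => by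
    refine (hS.trace_le hL ht hA (hQfin L hL) hγ n N).2.trans ?_
    rw [← ENNReal.toReal_add (by finiteness) hEfin]
    refine ENNReal.toReal_mono (by finiteness) ?_
    have h1 := hmean L hL A hA (ENNReal.ofReal (c * L ^ d))
      (by rw [← ENNReal.ofReal_one]; exact ENNReal.ofReal_le_ofReal (one_le_mul_of_one_le_of_one_le hc hLd))
      ENNReal.ofReal_ne_top hs (hQb L)
    refine (ENNReal.tsum_le_tsum fun p => mul_le_mul_right (h1 p) _).trans (le_of_eq ?_)
    simp only [mul_add, ENNReal.tsum_add, ENNReal.tsum_mul_right, tsum_ofReal_elMat hγ, one_mul]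
    congr 1
    unfold Model.stateAvg
    rw [← ENNReal.tsum_mul_left]
    exact tsum_congr fun p => mul_left_comm _ _ _
  have hmain := hdisp.stateAvg_latWeight_le hL hS.ω_even hN Pf hγ ht le_rfl
  have hW0 := hdisp.latWeight_nonneg hL
  have hG0 := hdisp.G_nonneg ht
  have hA0 : 0 ≤ 4 * G * decayMass := mul_nonneg (by positivity) decayMass_nonneg
  have hval : (q * S.stateAvg L Pf γ (S.latWeight L) t).toReal ≤
      n.factorial * (lam ^ (2 * N) * ((8 * (4 * G * decayMass)) ^ N /
          ((n + r).factorial : ℝ) * t ^ N)) := by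
    refine (ENNReal.toReal_mono (by finiteness) (mul_le_mul_right hmain q)).trans (le_of_eq ?_)
    have h0 : 0 ≤ (4 * G * decayMass) ^ N / ((n + r).factorial : ℝ) * t ^ N := by positivity
    simp only [hq, ENNReal.toReal_mul, ENNReal.toReal_pow, ENNReal.toReal_natCast,
      ENNReal.toReal_ofNat, ENNReal.toReal_ofReal h0, ENNReal.toReal_ofReal (sq_nonneg lam)]
    rw [mul_pow 8, pow_mul, (by norm_num : (8 : ℝ) = 4 * 2), mul_pow 4 2]
    ring
  have hlatfin : S.stateAvg L Pf γ (S.latWeight L) t ≠ ⊤ := ne_top_of_le_ne_top (by finiteness) hmain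
  have huniv : S.meanWeight L Set.univ = S.latWeight L :=
    funext fun a => Model.meanWeight_univ hS.ω_even L a
  refine ⟨fun hA => ?_, ?_⟩
  · have := key Set.univ hA (by rwa [huniv])
    rw [huniv] at this
    rw [← hEle]
    linarith
  -- The averages contain oscillating sums and are not monotone in the weights. The dispersive bound
  -- is therefore used only in the limit of all modes, where the weights are those of the lattice
  -- measure.
  · obtain ⟨hfin, hl⟩ := S.stateAvg_tendsto L Pf hγ hW0 (hdisp.summable_latWeight hL) ht atTop
      (W' := fun A : Finset (Mode d) => S.meanWeight L (A : Set (Mode d)))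
      (fun A => hS.meanWeight_nonneg hL _) (fun A => hS.meanWeight_le hL _)
      (hS.tendsto_meanWeight L)
    have hl2 : Tendsto (fun A : Finset (Mode d) =>
        ((q * S.stateAvg L Pf γ (S.meanWeight L (A : Set (Mode d))) t).toReal + E.toReal : ℝ))
        atTop (nhds ((q * S.stateAvg L Pf γ (S.latWeight L) t).toReal + E.toReal)) :=
      (((ENNReal.tendsto_toReal (by finiteness)).comp
        (ENNReal.Tendsto.const_mul hl (Or.inr hqfin))).add_const _)
    have hl3 := ((continuous_coe_real_ereal.tendsto _).comp hl2).limsup_eq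
    refine (limsup_le_limsup (Eventually.of_forall fun A => ?_)).trans (hl3.le.trans ?_)
    · exact EReal.coe_le_coe_iff.2 (key _ (hS.summable_boltz L A) (hfin A))
    · rw [← hEle]
      exact EReal.coe_le_coe_iff.2 (by linarith)

theorem limsup_coe_le_of_tendsto {err : ℝ → ℝ} {B : ℝ} (herr : Tendsto err atTop (nhds 0))
    {g : ℝ → EReal} (h : ∀ᶠ L in atTop, g L ≤ ((B + err L : ℝ) : EReal)) :
    limsup g atTop ≤ (B : EReal) := by
  have h1 : Tendsto (fun L => B + err L) atTop (nhds B) := by simpa using herr.const_add B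
  exact (limsup_le_limsup h).trans ((continuous_coe_real_ereal.tendsto _).comp h1).limsup_eq.le

end Polaron
end

/-! ### The main theorem. -/

theorem mainTheorem4 (d : ℕ) (hd : 3 ≤ d) (a : ℝ) (ha0 : 0 ≤ a) (ha1 : a < 1)
    (C₁ C₂ C₃ C₄ C₆ C₇ β : ℝ) :
    ∃ Ca : ℝ, 0 < Ca ∧
      ∀ S : Polaron.Model d, S.β = β → S.Admissible C₁ C₂ C₃ C₄ C₆ C₇ →
      ∀ (lam t : ℝ), 0 ≤ t → ∀ (n N : ℕ), n ≤ N → Even (N - n) →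
        -- bound on each pairing, in infinite volume and in the limit of large boxes
        (∀ m ∈ Polaron.patterns n N, ∀ mt ∈ Polaron.patterns n N, ∀ π : Equiv.Perm (Fin n),
          (∀ ρ : MeasureTheory.Measure (Polaron.Mom d), MeasureTheory.IsProbabilityMeasure ρ →
            ‖S.C (Polaron.fullMeasure d) ρ lam t N m mt π‖
              ≤ Polaron.aprioriBound Ca a lam t n N) ∧
          (∀ γ : ℝ → (Polaron.ElSpace d →L[ℂ] Polaron.ElSpace d),
            (∀ L, Polaron.IsDensity (γ L)) →
            Filter.limsup (fun L : ℝ =>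
                ((‖S.C (Polaron.latticeMeasure d L) (Polaron.momDist L (γ L))
                    lam t N m mt π‖ : ℝ) : EReal)) Filter.atTop
              ≤ ((Polaron.aprioriBound Ca a lam t n N : ℝ) : EReal))) ∧
        (∀ γ : ℝ → (Polaron.ElSpace d →L[ℂ] Polaron.ElSpace d),
          (∀ L, Polaron.IsDensity (γ L)) →
          -- the Gibbs state on the full Fock space, when it is trace class
          (∀ L : ℝ, 0 < L → Summable (S.boltz L Set.univ) →
            Summable (S.trTerm L Set.univ (γ L) lam t n N)) ∧
          ((∀ᶠ L : ℝ in Filter.atTop, Summable (S.boltz L Set.univ)) →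
            Filter.limsup (fun L : ℝ =>
                ((S.tr L Set.univ (γ L) lam t n N : ℝ) : EReal)) Filter.atTop
              ≤ (((n.factorial : ℝ) * Polaron.aprioriBound Ca a lam t n N : ℝ) : EReal)) ∧
          -- the general case: limit of the Gibbs states of finitely many phonon modes
          (∀ (L : ℝ), 0 < L → ∀ A : Finset (Polaron.Mode d),
            Summable (S.trTerm L (A : Set (Polaron.Mode d)) (γ L) lam t n N)) ∧
          Filter.limsup (fun L : ℝ =>
              Filter.limsup (fun A : Finset (Polaron.Mode d) =>
                ((S.tr L (A : Set (Polaron.Mode d)) (γ L) lam t n N : ℝ) : EReal))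
                Filter.atTop) Filter.atTop
            ≤ (((n.factorial : ℝ) * Polaron.aprioriBound Ca a lam t n N : ℝ) : EReal)) := by
  obtain ⟨G, hG, hdisp⟩ := Polaron.exists_dispersive_constant hd C₁ C₂ C₃ C₄ C₆ C₇ β
  have hA : 0 ≤ 4 * G * Polaron.decayMass :=
    mul_nonneg (by positivity) Polaron.decayMass_nonneg
  -- The factor eight is required by the trace and is more than enough for single pairings. The
  -- summand one only secures positivity. The choice does not depend on `a`, since the estimates
  -- give the full factorial.
  refine ⟨8 * (4 * G * Polaron.decayMass) + 1, by positivity,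
    fun S hβ hS lam t ht n N hnN hev => ?_⟩
  obtain ⟨r, hr⟩ : ∃ r, N = n + 2 * r := by
    obtain ⟨r, hr⟩ := hev
    exact ⟨r, by omega⟩
  obtain ⟨hfull, hlat⟩ := hdisp S hβ hS
  refine ⟨fun m hm mt hmt π => ?_, fun γ hγ => ?_⟩
  · obtain ⟨P, rfl⟩ := Polaron.exists_pat hm r hr
    obtain ⟨P', rfl⟩ := Polaron.exists_pat hmt r hr
    have hle := Polaron.pairing_bound_le (lam := lam) hA ht ha1 hr
      (Ca := 8 * (4 * G * Polaron.decayMass) + 1) (by linarith)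
    refine ⟨fun ρ hρ => ((hfull t).norm_C_le P P' π ρ lam ht le_rfl).trans hle, fun γ hγ => ?_⟩
    refine Filter.limsup_le_of_le (h := ?_)
    filter_upwards [hlat t ht, Filter.eventually_gt_atTop 0] with L hL hL0
    have := Polaron.sigmaFinite_latticeMeasure (d := d) hL0
    have := Polaron.isProbabilityMeasure_momDist L (hγ L)
    exact EReal.coe_le_coe_iff.2 ((hL.norm_C_le P P' π _ lam ht le_rfl).trans hle)
  -- Absolute convergence needs summability of the form factor in every box, while the numerical
  -- bound needs only large boxes.
  · obtain ⟨_, -, -, -, hQ, -⟩ := hS.exists_eQ_bound hd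
    obtain ⟨err, herr, htr⟩ := hS.exists_tr_le (n := n) hd lam ht (hlat t ht) hr
    have hle := mul_le_mul_of_nonneg_left (Polaron.pairing_bound_le (lam := lam)
      (A := 8 * (4 * G * Polaron.decayMass)) (by positivity) ht ha1 hr
      (le_add_of_nonneg_right zero_le_one)) (Nat.cast_nonneg (α := ℝ) n.factorial)
    refine ⟨fun L hL hA => (hS.trace_le hL ht hA (hQ L hL) (hγ L) n N).1, fun hsum => ?_,
      fun L hL A => (hS.trace_le hL ht (hS.summable_boltz L A) (hQ L hL) (hγ L) n N).1, ?_⟩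
    · refine Polaron.limsup_coe_le_of_tendsto herr ?_
      filter_upwards [htr, hsum] with L hL hs
      exact EReal.coe_le_coe_iff.2 (((hL _ (hγ L)).1 hs).trans (by linarith))
    · refine Polaron.limsup_coe_le_of_tendsto herr ?_
      filter_upwards [htr] with L hL
      exact (hL _ (hγ L)).2.trans (EReal.coe_le_coe_iff.2 (by linarith))
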